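/- **Energy estimates outside the origin.** Let $p>1$, $M>0$, $0\le q<p$, let $d\ge 1$ be an integer with $p<\frac{d+3}{d-1}$ if $d\ge 2$, and put $\gamma=\min\left(\frac12,\frac{p-q}{p-1}\right)$, $\rho(y)=(1-y^2)^{\frac{2}{p-1}}$. Let $\beta\in C^1((0,\infty))$ be positive, let $f\in C^1(\mathbb R)$, and let $G$ be a continuous real function of $(X,t,v,z)$, $X>0$, with $$|f(u)|\le M(1+|u|^q),\qquad |G(X,t,v,z)|\le M(1+|v|+|z|).$$ Let $T:(0,\infty)\to(0,\infty)$ be $1$-Lipschitz, and let $U$, with $(U,\partial_tU)$ continuous in time with values in $H^1_{loc}\times L^2_{loc}$ on $\{(X,t): X>0,\ 0\le t<T(X)\}$, be a weak solution there of $$\partial_t^2U=\partial_X^2U+\tfrac{d-1}{X}\partial_XU+\beta(X)|U|^{p-1}U+f(U)+G(X,t,\partial_XU,\partial_tU)$$ (for instance, $T$ is the blow-up curve of a maximal solution $U$). For $X_0>0$ set $$w(y,s)=(T(X_0)-t)^{\frac2{p-1}}U(X,t),\qquad y=\frac{X-X_0}{T(X_0)-t},\qquad s=-\log(T(X_0)-t),$$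 and assume that $w$ has finite energy, in the sense that $s\mapsto(w(s),\partial_sw(s))$ is continuous, for $s\ge\max(-\log T(X_0),-\log\frac{X_0}2)$, with values in the space with squared norm $\int_{-1}^1\left(w^2+(1-y^2)(\partial_yw)^2+(\partial_sw)^2\right)\rho\,dy$. With $F(u)=\int_0^uf(v)\,dv$, define $$E_0=\int_{-1}^1\left(\tfrac12(\partial_sw)^2+\tfrac12(\partial_yw)^2(1-y^2)+\tfrac{p+1}{(p-1)^2}w^2-\tfrac{\beta(X_0)}{p+1}|w|^{p+1}\right)\rho\,dy,$$ $$I=-e^{-\frac{2(p+1)s}{p-1}}\int_{-1}^1F\left(e^{\frac{2s}{p-1}}w\right)\rho\,dy,\qquad J=-\tfrac1{p+1}\int_{-1}^1\left(\beta(X_0+ye^{-s})-\beta(X_0)\right)|w|^{p+1}\rho\,dy,$$ $$K=-e^{-\gamma s}\int_{-1}^1w\,\partial_sw\,\rho\,dy,\qquad E=E_0+I+J+K,\qquad H=E\,\exp\left(\tfrac{p+3}{2\gamma}e^{-\gamma s}\right)+\mu e^{-2\gamma s}.$$ There are $C=C(p,M)>0$, $\mu_0=\mu_0(p,q,M)>0$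 and, for all $b_0,B>0$, numbers $S_0,S_1$ depending only on $p,q,d,M,b_0,B$, such that the following holds for all $\beta,f,G,T,U$ as above and all $X_0>0$ as above with $\beta(X_0)\ge b_0$ and $|\beta'(X)|\le B$ whenever $|X-X_0|\le\min(1,\frac{X_0}2)$. (Every $X_0>0$ satisfies the last two conditions for suitable $b_0,B$.) Put $s_i=\max\left(-\log T(X_0),\,S_i,\,-4\log X_0,\,-\log\tfrac{X_0}2\right)$ for $i=0,1$. (i) For $s\ge s_0$ all integrals in $E(w(s),s)$ converge and $s\mapsto E(w(s),s)$ is absolutely continuous on every $[s_0,s_*]$. For almost every $s>s_0$, $\int_{-1}^1(\partial_sw)^2\frac{\rho}{1-y^2}\,dy$ is finite, $E$ is differentiable at $s$, and $$\frac{d}{ds}E(w(s),s)\le\frac{p+3}2e^{-\gamma s}E_0(w(s),\partial_sw(s))-\frac3{p-1}\int_{-1}^1(\partial_sw)^2\frac{\rho}{1-y^2}\,dy+Ce^{-2\gamma s}.$$ (ii) For every $\mu\ge\mu_0$ and all $s\ge s_1$, $E(w(s),s)$ is well defined and $H(w(s),s)\ge0$. Moreover $H$ is a Lyapunov functional: $s\mapsto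 H(w(s),s)$ is nonincreasing on $[s_1,\infty)$ and absolutely continuous on every $[s_1,s_*]$, and for almost every $s>s_1$ it is differentiable at $s$, the integral below is finite, and $$\frac d{ds}H(w(s),s)\le-\frac3{p-1}\int_{-1}^1(\partial_sw)^2\frac\rho{1-y^2}\,dy.$$ -/

import Mathlib

open MeasureTheory Set Filter Topology

noncomputable section

namespace SimilarityEnergy

/-! ## The equation

`∂ₜ² U = ∂_X² U + (d-1)/X ∂_X U + β(X) |U|^(p-1) U + f(U) + G(X, t, ∂_X U, ∂ₜ U)`, for `X > 0`. -/

/-- The conditions on the coefficient `β` and on the perturbations `f` and `G`. -/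
structure AdmissibleCoeffs (q M : ℝ) (β f : ℝ → ℝ) (G : ℝ → ℝ → ℝ → ℝ → ℝ) : Prop where
  beta_contDiffOn : ContDiffOn ℝ 1 β (Ioi 0)
  beta_pos : ∀ X, 0 < X → 0 < β X
  f_contDiff : ContDiff ℝ 1 f
  f_bound : ∀ u, |f u| ≤ M * (1 + |u| ^ q)
  G_continuousOn : ContinuousOn (fun z : ℝ × ℝ × ℝ × ℝ => G z.1 z.2.1 z.2.2.1 z.2.2.2)
    {z | 0 < z.1}
  G_bound : ∀ X t v z, 0 < X → |G X t v z| ≤ M * (1 + |v| + |z|)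

/-- The set `{(X, t) : X > 0, 0 ≤ t < T(X)}` under the curve `t = T(X)`. -/
def underGraph (T : ℝ → ℝ) : Set (ℝ × ℝ) := {z | 0 < z.1 ∧ 0 ≤ z.2 ∧ z.2 < T z.1}

/-- The set `{(X, t) : X > 0, 0 < t < T(X)}`, in which test functions are supported. -/
def openUnderGraph (T : ℝ → ℝ) : Set (ℝ × ℝ) := {z | 0 < z.1 ∧ 0 < z.2 ∧ z.2 < T z.1}

/-- `U`, with space derivative `UX` and time derivative `Ut`, is a weak solution of the equation
under the curve `t = T(X)`, with `(U, ∂ₜ U)` continuous in time with values in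
`H¹_loc × L²_loc` there. -/
structure IsSolution (p : ℝ) (d : ℕ) (β f : ℝ → ℝ) (G : ℝ → ℝ → ℝ → ℝ → ℝ)
    (T : ℝ → ℝ) (U UX Ut : ℝ → ℝ → ℝ) : Prop where
  continuousOn : ContinuousOn (fun z : ℝ × ℝ => U z.1 z.2) (underGraph T)
  measurable_UX : AEStronglyMeasurable (fun z : ℝ × ℝ => UX z.1 z.2)
    (volume.restrict (underGraph T))
  measurable_Ut : AEStronglyMeasurable (fun z : ℝ × ℝ => Ut z.1 z.2)
    (volume.restrict (underGraph T))
  memLp_UX : ∀ a b t, 0 < a → a ≤ b → 0 ≤ t → (∀ X ∈ Icc a b, t < T X) →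
    MemLp (fun X => UX X t) 2 (volume.restrict (Icc a b))
  memLp_Ut : ∀ a b t, 0 < a → a ≤ b → 0 ≤ t → (∀ X ∈ Icc a b, t < T X) →
    MemLp (fun X => Ut X t) 2 (volume.restrict (Icc a b))
  tendsto_UX : ∀ a b t, 0 < a → a ≤ b → 0 ≤ t → (∀ X ∈ Icc a b, t < T X) →
    Tendsto (fun τ => eLpNorm (fun X => UX X τ - UX X t) 2 (volume.restrict (Icc a b)))
      (𝓝[Ici 0] t) (𝓝 0)
  tendsto_Ut : ∀ a b t, 0 < a → a ≤ b → 0 ≤ t → (∀ X ∈ Icc a b, t < T X) →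
    Tendsto (fun τ => eLpNorm (fun X => Ut X τ - Ut X t) 2 (volume.restrict (Icc a b)))
      (𝓝[Ici 0] t) (𝓝 0)
  space_deriv : ∀ a b t, 0 < a → a ≤ b → 0 ≤ t → (∀ X ∈ Icc a b, t < T X) →
    U b t - U a t = ∫ X in a..b, UX X t
  time_deriv : ∀ φ : ℝ × ℝ → ℝ, ContDiff ℝ (⊤ : ℕ∞) φ → HasCompactSupport φ →
    tsupport φ ⊆ openUnderGraph T →
    ∫ z : ℝ × ℝ, U z.1 z.2 * fderiv ℝ φ z (0, 1) = - ∫ z : ℝ × ℝ, Ut z.1 z.2 * φ z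
  equation : ∀ φ : ℝ × ℝ → ℝ, ContDiff ℝ (⊤ : ℕ∞) φ → HasCompactSupport φ →
    tsupport φ ⊆ openUnderGraph T →
    ∫ z : ℝ × ℝ, (Ut z.1 z.2 * fderiv ℝ φ z (0, 1) - UX z.1 z.2 * fderiv ℝ φ z (1, 0)
      + (((d : ℝ) - 1) / z.1 * UX z.1 z.2 + β z.1 * (|U z.1 z.2| ^ (p - 1) * U z.1 z.2)
          + f (U z.1 z.2) + G z.1 z.2 (UX z.1 z.2) (Ut z.1 z.2)) * φ z) = 0

/-! ## Similarity variables -/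

/-- `w(y,s) = (T₀-t)^(2/(p-1)) U(X,t)` with `X = X₀ + y e^(-s)` and `t = T₀ - e^(-s)`. -/
def simW (p X₀ T₀ : ℝ) (U : ℝ → ℝ → ℝ) (s y : ℝ) : ℝ :=
  Real.exp (-(2 / (p - 1)) * s) * U (X₀ + y * Real.exp (-s)) (T₀ - Real.exp (-s))

/-- `∂_y w`, by the chain rule. -/
def simWy (p X₀ T₀ : ℝ) (UX : ℝ → ℝ → ℝ) (s y : ℝ) : ℝ :=
  Real.exp (-((p + 1) / (p - 1)) * s) * UX (X₀ + y * Real.exp (-s)) (T₀ - Real.exp (-s))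

/-- `∂_s w`, by the chain rule. -/
def simWs (p X₀ T₀ : ℝ) (U UX Ut : ℝ → ℝ → ℝ) (s y : ℝ) : ℝ :=
  -(2 / (p - 1)) * simW p X₀ T₀ U s y - y * simWy p X₀ T₀ UX s y
    + Real.exp (-((p + 1) / (p - 1)) * s) * Ut (X₀ + y * Real.exp (-s)) (T₀ - Real.exp (-s))

/-- The weight `ρ(y) = (1-y²)^(2/(p-1))`. -/
def rho (p y : ℝ) : ℝ := (1 - y ^ 2) ^ (2 / (p - 1))

/-- `s ↦ (w(s), ∂_s w(s))` is continuous, for `s ≥ s₀`, with values in the energy space normed by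
`∫_{-1}^{1} (w² + (1-y²) (∂_y w)² + (∂_s w)²) ρ dy`. -/
structure IsEnergyTrajectory (p s₀ : ℝ) (w wy ws : ℝ → ℝ → ℝ) : Prop where
  memLp_w : ∀ s, s₀ ≤ s →
    MemLp (fun y => w s y * √(rho p y)) 2 (volume.restrict (Ioo (-1) 1))
  memLp_wy : ∀ s, s₀ ≤ s →
    MemLp (fun y => wy s y * √((1 - y ^ 2) * rho p y)) 2 (volume.restrict (Ioo (-1) 1))
  memLp_ws : ∀ s, s₀ ≤ s →
    MemLp (fun y => ws s y * √(rho p y)) 2 (volume.restrict (Ioo (-1) 1))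
  tendsto_w : ∀ s, s₀ ≤ s →
    Tendsto (fun σ => eLpNorm (fun y => (w σ y - w s y) * √(rho p y)) 2
      (volume.restrict (Ioo (-1) 1))) (𝓝[Ici s₀] s) (𝓝 0)
  tendsto_wy : ∀ s, s₀ ≤ s →
    Tendsto (fun σ => eLpNorm (fun y => (wy σ y - wy s y) * √((1 - y ^ 2) * rho p y)) 2
      (volume.restrict (Ioo (-1) 1))) (𝓝[Ici s₀] s) (𝓝 0)
  tendsto_ws : ∀ s, s₀ ≤ s →
    Tendsto (fun σ => eLpNorm (fun y => (ws σ y - ws s y) * √(rho p y)) 2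
      (volume.restrict (Ioo (-1) 1))) (𝓝[Ici s₀] s) (𝓝 0)

/-! ## The functionals

In this part `w`, `wy`, `ws` are the functions `w(s)`, `∂_y w(s)`, `∂_s w(s)` of `y` at a fixed
`s`, and `b` stands for `β(X₀)`. -/

/-- `γ = min(1/2, (p-q)/(p-1))`. -/
def gam (p q : ℝ) : ℝ := min (1 / 2) ((p - q) / (p - 1))

/-- The primitive `F(u) = ∫_0^u f`. -/
def primF (f : ℝ → ℝ) (u : ℝ) : ℝ := ∫ v in (0 : ℝ)..u, f v

def densityE₀ (p b : ℝ) (w wy ws : ℝ → ℝ) (y : ℝ) : ℝ :=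
  (1 / 2 * ws y ^ 2 + 1 / 2 * wy y ^ 2 * (1 - y ^ 2) + (p + 1) / (p - 1) ^ 2 * w y ^ 2
    - b / (p + 1) * |w y| ^ (p + 1)) * rho p y

def densityI (p : ℝ) (f : ℝ → ℝ) (w : ℝ → ℝ) (s y : ℝ) : ℝ :=
  primF f (Real.exp (2 / (p - 1) * s) * w y) * rho p y

def densityJ (p X₀ : ℝ) (β : ℝ → ℝ) (w : ℝ → ℝ) (s y : ℝ) : ℝ :=
  (β (X₀ + y * Real.exp (-s)) - β X₀) * |w y| ^ (p + 1) * rho p y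

def densityK (p : ℝ) (w ws : ℝ → ℝ) (y : ℝ) : ℝ := w y * ws y * rho p y

/-- The integrand of the dissipation `∫_{-1}^{1} (∂_s w)² ρ/(1-y²) dy`. -/
def densityD (p : ℝ) (ws : ℝ → ℝ) (y : ℝ) : ℝ := ws y ^ 2 * (rho p y / (1 - y ^ 2))

def funE₀ (p b : ℝ) (w wy ws : ℝ → ℝ) : ℝ := ∫ y in Ioo (-1 : ℝ) 1, densityE₀ p b w wy ws y

def funI (p : ℝ) (f : ℝ → ℝ) (w : ℝ → ℝ) (s : ℝ) : ℝ :=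
  -Real.exp (-(2 * (p + 1) / (p - 1)) * s) * ∫ y in Ioo (-1 : ℝ) 1, densityI p f w s y

def funJ (p X₀ : ℝ) (β : ℝ → ℝ) (w : ℝ → ℝ) (s : ℝ) : ℝ :=
  -(1 / (p + 1)) * ∫ y in Ioo (-1 : ℝ) 1, densityJ p X₀ β w s y

def funK (p q : ℝ) (w ws : ℝ → ℝ) (s : ℝ) : ℝ :=
  -Real.exp (-gam p q * s) * ∫ y in Ioo (-1 : ℝ) 1, densityK p w ws y

def dissip (p : ℝ) (ws : ℝ → ℝ) : ℝ := ∫ y in Ioo (-1 : ℝ) 1, densityD p ws y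

/-- `E = E₀ + I + J + K`. -/
def funE (p q X₀ : ℝ) (β f : ℝ → ℝ) (w wy ws : ℝ → ℝ) (s : ℝ) : ℝ :=
  funE₀ p (β X₀) w wy ws + funI p f w s + funJ p X₀ β w s + funK p q w ws s

/-- `H = E exp((p+3)/(2γ) e^(-γ s)) + μ e^(-2γ s)`. -/
def funH (p q X₀ μ : ℝ) (β f : ℝ → ℝ) (w wy ws : ℝ → ℝ) (s : ℝ) : ℝ :=
  funE p q X₀ β f w wy ws s
      * Real.exp ((p + 3) / (2 * gam p q) * Real.exp (-gam p q * s))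
    + μ * Real.exp (-2 * gam p q * s)

/-! ## The functionals along the trajectory with vertex `(X₀, T(X₀))` -/

/-- `E₀(w(s), ∂_s w(s))`. -/
def pathE₀ (p : ℝ) (β T : ℝ → ℝ) (U UX Ut : ℝ → ℝ → ℝ) (X₀ s : ℝ) : ℝ :=
  funE₀ p (β X₀) (simW p X₀ (T X₀) U s) (simWy p X₀ (T X₀) UX s) (simWs p X₀ (T X₀) U UX Ut s)

/-- `E(w(s), s)`. -/
def pathE (p q : ℝ) (β f T : ℝ → ℝ) (U UX Ut : ℝ → ℝ → ℝ) (X₀ s : ℝ) : ℝ :=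
  funE p q X₀ β f (simW p X₀ (T X₀) U s) (simWy p X₀ (T X₀) UX s)
    (simWs p X₀ (T X₀) U UX Ut s) s

/-- `H(w(s), s)`. -/
def pathH (p q μ : ℝ) (β f T : ℝ → ℝ) (U UX Ut : ℝ → ℝ → ℝ) (X₀ s : ℝ) : ℝ :=
  funH p q X₀ μ β f (simW p X₀ (T X₀) U s) (simWy p X₀ (T X₀) UX s)
    (simWs p X₀ (T X₀) U UX Ut s) s

/-- `∫_{-1}^{1} (∂_s w)² ρ/(1-y²) dy` is finite. -/
def DissipFinite (p : ℝ) (T : ℝ → ℝ) (U UX Ut : ℝ → ℝ → ℝ) (X₀ s : ℝ) : Prop :=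
  IntegrableOn (densityD p (simWs p X₀ (T X₀) U UX Ut s)) (Ioo (-1) 1)

/-- `∫_{-1}^{1} (∂_s w)² ρ/(1-y²) dy`. -/
def pathDissip (p : ℝ) (T : ℝ → ℝ) (U UX Ut : ℝ → ℝ → ℝ) (X₀ s : ℝ) : ℝ :=
  dissip p (simWs p X₀ (T X₀) U UX Ut s)

/-- All the integrals in the definition of `E(w(s), s)` converge. -/
def EnergyConverges (p : ℝ) (β f T : ℝ → ℝ) (U UX Ut : ℝ → ℝ → ℝ) (X₀ s : ℝ) : Prop :=
  IntegrableOn (fun y => |simW p X₀ (T X₀) U s y| ^ (p + 1) * rho p y) (Ioo (-1) 1) ∧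
  IntegrableOn (densityE₀ p (β X₀) (simW p X₀ (T X₀) U s) (simWy p X₀ (T X₀) UX s)
    (simWs p X₀ (T X₀) U UX Ut s)) (Ioo (-1) 1) ∧
  IntegrableOn (densityI p f (simW p X₀ (T X₀) U s) s) (Ioo (-1) 1) ∧
  IntegrableOn (densityJ p X₀ β (simW p X₀ (T X₀) U s) s) (Ioo (-1) 1) ∧
  IntegrableOn (densityK p (simW p X₀ (T X₀) U s) (simWs p X₀ (T X₀) U UX Ut s)) (Ioo (-1) 1)

/-- `max(-log T₀, S, -4 log X₀, -log(X₀/2))`. -/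
def startTime (X₀ T₀ S : ℝ) : ℝ :=
  max (max (-Real.log T₀) S) (max (-4 * Real.log X₀) (-Real.log (X₀ / 2)))

end SimilarityEnergy

end

open MeasureTheory Set Filter Topology

noncomputable section

namespace SimilarityEnergy

/-! ## Test functions and weak derivatives -/

/-! Two difficulties separate the statement from the formal computation of `dE/ds`. The solution has
only weak first derivatives, so the equation cannot be multiplied by `∂_s w` directly; and near `y =
±1` the energy norm controls `∂_y w` only through a degenerate weight, so that neither the
convergence of the dissipation nor the vanishing of boundary terms is given.

Weak form. The second derivatives of `U` are only distributions, but the equation says that `Ut -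
UX` and `Ut + UX` each have an `L²_loc` derivative along one characteristic direction
(`weakDeriv_sub`, `weakDeriv_add`). The product rule `WeakDeriv.mul`, which needs no more than
`L²_loc` factors with an `L²_loc` derivative in one common direction, therefore applies to their
squares and to their products with `U`. It gives the local laws for energy, momentum and `U Ut`
(`fluxLaw_energy_momentum`). These laws and those for `U²` and the potential are carried to
similarity variables by `FluxLaw.comp_simMap`, where suitable combinations are the laws for the
energy density of `w`, for `w ∂_s w` and for the potential.

Boundary. The laws are integrated against `ρ` times a cutoff near `y = ±1`. The derivative of `ρ`
produces the dissipation, while the derivative of the cutoff produces a flux which is bounded above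
by `(1-y²)(∂_y w)²`, uniformly in the cutoff. This bounds the truncated dissipations and proves
`Evolution.integrableOn_dissip`. The Hardy inequality `hardy` makes `w² ρ/(1-y²)` integrable and
bounds `w² ρ` pointwise; hence `|w|^(p-1) (1-y²)` is bounded, and the nonlinear and source terms
become integrable. The cutoff can then be removed without boundary terms
(`Evolution.energy_identity`).

Differential inequality. The correction `K` supplies coercivity: the difference between `(p+3)/2
e^(-γs) E₀` and the derivative of `E` contains a positive multiple of `e^(-γs) ∫ ((1-y²)(∂_y w)² +
w² + |w|^(p+1)) ρ`. For large `s` every perturbation, from `f`, `G`, the variation of `β` or the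
term `(d-1)/X ∂_X U`, is either `O(e^(-2γs))` or a small factor times that integral and the
dissipation, up to the weight `1/(1-y²)` in the term `w²`, which Hardy's inequality removes. Of the
dissipation coefficient `4/(p-1)` a part `1/(p-1)` is spent on this. The pointwise computation is
`rate_le`, its integrated form `FiniteEnergy.integral_rate_le`. The same inequality holds with `E`
in place of `E₀`, and the exponential in `H` is then an integrating factor, while `μ e^(-2γs)` pays
for the remainder (`IsIntegralOf.lyapunov`).

Sign. A vertex `(X₀, T₁)` strictly under the graph sees a bounded solution; in its similarity
variables `w` and the potential tend to zero, so the negative part of `H` does too. As `H` is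
nonincreasing, it is nonnegative for that vertex (`IsSolution.lyapunov_nonneg_of_lt`). At a fixed
physical time, moving the vertex along the axis is a dilation in `y`, and the energy depends
continuously on it (`tendsto_energyAt`); letting the lowered vertex rise gives the sign for the
vertex on the graph. No blow-up argument for negative energy is needed. -/

/-- Smooth functions on the plane with compact support in `Ω`. -/
structure IsTest (Ω : Set (ℝ × ℝ)) (φ : ℝ × ℝ → ℝ) : Prop where
  contDiff : ContDiff ℝ (⊤ : ℕ∞) φ
  compact : HasCompactSupport φ
  subset : tsupport φ ⊆ Ω

namespace IsTest

variable {Ω : Set (ℝ × ℝ)} {φ : ℝ × ℝ → ℝ}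

lemma continuous (h : IsTest Ω φ) : Continuous φ := h.contDiff.continuous

lemma differentiable (h : IsTest Ω φ) : Differentiable ℝ φ :=
  h.contDiff.differentiable (by simp)

lemma eq_zero (h : IsTest Ω φ) {z : ℝ × ℝ} (hz : z ∉ Ω) : φ z = 0 :=
  image_eq_zero_of_notMem_tsupport fun h' => hz (h.subset h')

lemma fderiv_apply (h : IsTest Ω φ) (v : ℝ × ℝ) : IsTest Ω fun z => fderiv ℝ φ z v := by
  refine ⟨?_, h.compact.fderiv_apply ℝ v, (tsupport_fderiv_apply_subset ℝ v).trans h.subset⟩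
  exact (h.contDiff.fderiv_right (m := (⊤ : ℕ∞)) (by simp)).clm_apply contDiff_const

lemma mul_left {m : ℝ × ℝ → ℝ} (h : IsTest Ω φ) (hm : ContDiff ℝ (⊤ : ℕ∞) m) :
    IsTest Ω fun z => m z * φ z :=
  ⟨hm.mul h.contDiff, h.compact.mul_left, (tsupport_mul_subset_right).trans h.subset⟩

end IsTest

/-- Products of locally integrable functions with continuous functions of compact support. -/
lemma integrable_mul_of_tsupport_subset {Ω : Set (ℝ × ℝ)} {f g : ℝ × ℝ → ℝ}
    (hf : LocallyIntegrableOn f Ω) (hg : Continuous g) (hc : HasCompactSupport g)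
    (hs : tsupport g ⊆ Ω) : Integrable fun z => f z * g z := by
  have hK : IsCompact (tsupport g) := hc
  have h1 : IntegrableOn f (tsupport g) := hf.integrableOn_compact_subset hs hK
  have : (tsupport g).indicator (fun z => f z * g z) = fun z => f z * g z := by
    apply indicator_eq_self.2
    apply Function.support_subset_iff'.2
    intro x hx
    simp [image_eq_zero_of_notMem_tsupport hx]
  rw [← this, integrable_indicator_iff hK.measurableSet]
  exact h1.mul_continuousOn hg.continuousOn hK

lemma IsTest.integrable_mul {Ω : Set (ℝ × ℝ)} {f φ : ℝ × ℝ → ℝ} (h : IsTest Ω φ)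
    (hf : LocallyIntegrableOn f Ω) : Integrable fun z => f z * φ z :=
  integrable_mul_of_tsupport_subset hf h.continuous h.compact h.subset

lemma locallyIntegrableOn_of_norm_le {Ω : Set (ℝ × ℝ)} {f g : ℝ × ℝ → ℝ}
    (hg : LocallyIntegrableOn g Ω) (hf : AEStronglyMeasurable f (volume.restrict Ω))
    (hΩ : MeasurableSet Ω) (h : ∀ z ∈ Ω, |f z| ≤ |g z|) : LocallyIntegrableOn f Ω := by
  intro x hx
  obtain ⟨s, hs, hi⟩ := hg x hx
  refine ⟨s ∩ Ω, inter_mem hs self_mem_nhdsWithin, ?_⟩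
  refine Integrable.mono (hi.mono_set inter_subset_left) (hf.mono_set inter_subset_right) ?_
  have : ∀ᵐ z ∂(volume.restrict Ω), ‖f z‖ ≤ ‖g z‖ := by
    filter_upwards [ae_restrict_mem hΩ] with z hz using h z hz
  exact ae_mono (Measure.restrict_mono_set _ inter_subset_right) this

/-- Functions that are square integrable on the compact subsets of `Ω`. -/
structure LocSq (Ω : Set (ℝ × ℝ)) (A : ℝ × ℝ → ℝ) : Prop where
  meas : AEStronglyMeasurable A (volume.restrict Ω)
  sq : LocallyIntegrableOn (fun z => A z ^ 2) Ω

namespace LocSq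

variable {Ω : Set (ℝ × ℝ)} {A B : ℝ × ℝ → ℝ}

lemma mul_locallyIntegrableOn (hA : LocSq Ω A) (hB : LocSq Ω B) (hΩ : IsOpen Ω) :
    LocallyIntegrableOn (fun z => A z * B z) Ω := by
  refine locallyIntegrableOn_of_norm_le (hA.sq.add hB.sq) (hA.meas.mul hB.meas)
    hΩ.measurableSet fun z _ => ?_
  simp only [Pi.add_apply]
  rw [abs_of_nonneg (a := A z ^ 2 + B z ^ 2) (by positivity), abs_le]
  constructor <;> nlinarith [sq_nonneg (A z + B z), sq_nonneg (A z - B z)]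

lemma of_norm_le (hB : LocSq Ω B) (hA : AEStronglyMeasurable A (volume.restrict Ω))
    (h : ∀ z ∈ Ω, |A z| ≤ |B z|) (hΩ : IsOpen Ω) : LocSq Ω A := by
  refine ⟨hA, locallyIntegrableOn_of_norm_le hB.sq (hA.pow 2) hΩ.measurableSet fun z hz => ?_⟩
  simp only [abs_pow]
  exact pow_le_pow_left₀ (abs_nonneg _) (h z hz) 2

lemma of_continuousOn (hA : ContinuousOn A Ω) (hΩ : IsOpen Ω) : LocSq Ω A :=
  ⟨hA.aestronglyMeasurable hΩ.measurableSet,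
    (hA.pow 2).locallyIntegrableOn hΩ.measurableSet⟩

lemma continuousOn_mul (hA : ContinuousOn A Ω) (hB : LocSq Ω B) (hΩ : IsOpen Ω) :
    LocSq Ω fun z => A z * B z := by
  refine ⟨(hA.aestronglyMeasurable hΩ.measurableSet).mul hB.meas, ?_⟩
  have := hB.sq.continuousOn_mul (hA.pow 2) hΩ.isLocallyClosed
  refine this.congr (ae_of_all _ fun z => ?_)
  simp only [Pi.pow_apply]
  ring

lemma add (hA : LocSq Ω A) (hB : LocSq Ω B) (hΩ : IsOpen Ω) : LocSq Ω fun z => A z + B z := by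
  refine ⟨hA.meas.add hB.meas, ?_⟩
  refine locallyIntegrableOn_of_norm_le ((hA.sq.add hB.sq).smul (2 : ℝ))
    ((hA.meas.add hB.meas).pow 2) hΩ.measurableSet fun z _ => ?_
  simp only [Pi.add_apply, Pi.smul_apply, smul_eq_mul]
  rw [abs_of_nonneg (by positivity), abs_of_nonneg (by positivity)]
  nlinarith [sq_nonneg (A z - B z)]

lemma const (c : ℝ) (hΩ : IsOpen Ω) : LocSq Ω fun _ => c :=
  of_continuousOn continuousOn_const hΩ

lemma const_mul (c : ℝ) (hB : LocSq Ω B) (hΩ : IsOpen Ω) : LocSq Ω fun z => c * B z :=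
  continuousOn_mul continuousOn_const hB hΩ

lemma sub (hA : LocSq Ω A) (hB : LocSq Ω B) (hΩ : IsOpen Ω) : LocSq Ω fun z => A z - B z := by
  simpa [sub_eq_add_neg] using hA.add (const_mul (-1) hB hΩ) hΩ

lemma locallyIntegrableOn (hA : LocSq Ω A) (hΩ : IsOpen Ω) : LocallyIntegrableOn A Ω := by
  simpa using hA.mul_locallyIntegrableOn (const 1 hΩ) hΩ

lemma mono {Ω' : Set (ℝ × ℝ)} (hA : LocSq Ω A) (h : Ω' ⊆ Ω) : LocSq Ω' A :=
  ⟨hA.meas.mono_set h, hA.sq.mono_set h⟩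

end LocSq

/-- `A'` is the weak derivative of `A` in the direction `v`. -/
def WeakDeriv (Ω : Set (ℝ × ℝ)) (v : ℝ × ℝ) (A A' : ℝ × ℝ → ℝ) : Prop :=
  ∀ φ, IsTest Ω φ → ∫ z, A z * fderiv ℝ φ z v = - ∫ z, A' z * φ z

/-- `∂₂ A + ∂₁ B = S` in the sense of distributions. -/
structure FluxLaw (Ω : Set (ℝ × ℝ)) (A B S : ℝ × ℝ → ℝ) : Prop where
  locA : LocallyIntegrableOn A Ω
  locB : LocallyIntegrableOn B Ω
  locS : LocallyIntegrableOn S Ω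
  eq : ∀ φ, IsTest Ω φ →
    ∫ z, (A z * fderiv ℝ φ z (0, 1) + B z * fderiv ℝ φ z (1, 0) + S z * φ z) = 0

namespace FluxLaw

variable {Ω : Set (ℝ × ℝ)} {A B S A' B' S' : ℝ × ℝ → ℝ}

lemma integrable (h : FluxLaw Ω A B S) {φ : ℝ × ℝ → ℝ} (hφ : IsTest Ω φ) :
    Integrable fun z => A z * fderiv ℝ φ z (0, 1) + B z * fderiv ℝ φ z (1, 0) + S z * φ z :=
  (((hφ.fderiv_apply (0, 1)).integrable_mul h.locA).add
    ((hφ.fderiv_apply (1, 0)).integrable_mul h.locB)).add (hφ.integrable_mul h.locS)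

lemma add (h : FluxLaw Ω A B S) (h' : FluxLaw Ω A' B' S') :
    FluxLaw Ω (fun z => A z + A' z) (fun z => B z + B' z) (fun z => S z + S' z) := by
  refine ⟨h.locA.add h'.locA, h.locB.add h'.locB, h.locS.add h'.locS, fun φ hφ => ?_⟩
  have := integral_add (h.integrable hφ) (h'.integrable hφ)
  rw [h.eq φ hφ, h'.eq φ hφ, add_zero] at this
  refine Eq.trans ?_ this
  congr 1
  ext z
  ring

/-- If `φ` is a test function then so is `m φ`; the derivatives that fall on `m` move into the
source. The powers of `e^s` and the factors `y` of the similarity variables are introduced in this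
way. -/
lemma mul_smooth (h : FluxLaw Ω A B S) (hΩ : IsOpen Ω) {m : ℝ × ℝ → ℝ}
    (hm : ContDiff ℝ (⊤ : ℕ∞) m) :
    FluxLaw Ω (fun z => m z * A z) (fun z => m z * B z)
      (fun z => m z * S z + fderiv ℝ m z (0, 1) * A z + fderiv ℝ m z (1, 0) * B z) := by
  have hc := hm.continuous
  have hd (v : ℝ × ℝ) : Continuous fun z => fderiv ℝ m z v :=
    ((hm.fderiv_right (m := (⊤ : ℕ∞)) (by simp)).clm_apply contDiff_const).continuous
  have hl {f g : ℝ × ℝ → ℝ} (hf : LocallyIntegrableOn f Ω) (hg : Continuous g) :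
      LocallyIntegrableOn (fun z => g z * f z) Ω :=
    hf.continuousOn_mul hg.continuousOn hΩ.isLocallyClosed
  refine ⟨hl h.locA hc, hl h.locB hc,
    ((hl h.locS hc).add (hl h.locA (hd _))).add (hl h.locB (hd _)), fun φ hφ => ?_⟩
  refine Eq.trans ?_ (h.eq _ (hφ.mul_left hm))
  congr 1
  ext z
  have := fderiv_fun_mul (hm.differentiable (by simp) z) (hφ.differentiable z)
  rw [this]
  simp only [add_apply, smul_apply, smul_eq_mul]
  ring

lemma const_mul (h : FluxLaw Ω A B S) (hΩ : IsOpen Ω) (c : ℝ) :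
    FluxLaw Ω (fun z => c * A z) (fun z => c * B z) (fun z => c * S z) := by
  simpa using h.mul_smooth hΩ (m := fun _ => c) contDiff_const

lemma congr (h : FluxLaw Ω A B S) (hΩ : IsOpen Ω) (hA : ∀ z ∈ Ω, A' z = A z)
    (hB : ∀ z ∈ Ω, B' z = B z) (hS : ∀ z ∈ Ω, S' z = S z) : FluxLaw Ω A' B' S' := by
  have hl {f g : ℝ × ℝ → ℝ} (hf : LocallyIntegrableOn f Ω) (hg : ∀ z ∈ Ω, g z = f z) :
      LocallyIntegrableOn g Ω := by
    refine hf.congr ?_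
    filter_upwards [ae_restrict_mem hΩ.measurableSet] with z hz using (hg z hz).symm
  refine ⟨hl h.locA hA, hl h.locB hB, hl h.locS hS, fun φ hφ => ?_⟩
  refine Eq.trans ?_ (h.eq φ hφ)
  congr 1
  ext z
  by_cases hz : z ∈ Ω
  · rw [hA z hz, hB z hz, hS z hz]
  · rw [hφ.eq_zero hz, (hφ.fderiv_apply _).eq_zero hz, (hφ.fderiv_apply _).eq_zero hz]
    simp

end FluxLaw

/-- A derivative in a constant direction is a conservation law with constant velocity. Product rules
are proved for directional derivatives, linear combinations are formed among laws; this lemma and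
its converse translate between the two. -/
lemma WeakDeriv.fluxLaw {Ω : Set (ℝ × ℝ)} {A A' : ℝ × ℝ → ℝ} {c₁ c₂ : ℝ}
    (h : WeakDeriv Ω (c₁, c₂) A A') (hA : LocallyIntegrableOn A Ω)
    (hA' : LocallyIntegrableOn A' Ω) :
    FluxLaw Ω (fun z => c₂ * A z) (fun z => c₁ * A z) A' := by
  have hc (c : ℝ) : LocallyIntegrableOn (fun z => c * A z) Ω := hA.smul c
  refine ⟨hc _, hc _, hA', fun φ hφ => ?_⟩
  have h1 := h φ hφ
  rw [← add_eq_zero_iff_eq_neg, ← integral_add ((hφ.fderiv_apply _).integrable_mul hA)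
    (hφ.integrable_mul hA')] at h1
  refine Eq.trans ?_ h1
  congr 1
  ext z
  have : ((c₁, c₂) : ℝ × ℝ) = c₁ • (1, 0) + c₂ • (0, 1) := by simp
  rw [this, map_add, map_smul, map_smul]
  simp only [smul_eq_mul]
  ring

lemma FluxLaw.weakDeriv {Ω : Set (ℝ × ℝ)} {A A' : ℝ × ℝ → ℝ} {c₁ c₂ : ℝ}
    (h : FluxLaw Ω (fun z => c₂ * A z) (fun z => c₁ * A z) A')
    (hA : LocallyIntegrableOn A Ω) : WeakDeriv Ω (c₁, c₂) A A' := by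
  intro φ hφ
  rw [← add_eq_zero_iff_eq_neg, ← integral_add ((hφ.fderiv_apply _).integrable_mul hA)
    (hφ.integrable_mul h.locS)]
  refine Eq.trans ?_ (h.eq φ hφ)
  congr 1
  ext z
  have : ((c₁, c₂) : ℝ × ℝ) = c₁ • (1, 0) + c₂ • (0, 1) := by simp
  rw [this, map_add, map_smul, map_smul]
  simp only [smul_eq_mul]
  ring

/-- Weak derivatives commute. -/
lemma WeakDeriv.mixed {Ω : Set (ℝ × ℝ)} {A A₁ A₂ : ℝ × ℝ → ℝ}
    (h₁ : WeakDeriv Ω (1, 0) A A₁) (h₂ : WeakDeriv Ω (0, 1) A A₂)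
    (hA₁ : LocallyIntegrableOn A₁ Ω) (hA₂ : LocallyIntegrableOn A₂ Ω) :
    FluxLaw Ω A₁ (fun z => -A₂ z) (fun _ => 0) := by
  refine ⟨hA₁, hA₂.neg, locallyIntegrableOn_const _, fun φ hφ => ?_⟩
  -- Each weak derivative is tested against the other derivative of `φ`, so that only the symmetry
  -- of the second derivative of the smooth `φ` is used.
  have e1 := h₁ _ (hφ.fderiv_apply (0, 1))
  have e2 := h₂ _ (hφ.fderiv_apply (1, 0))
  have hsym (z : ℝ × ℝ) : fderiv ℝ (fun z => fderiv ℝ φ z (0, 1)) z (1, 0)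
      = fderiv ℝ (fun z => fderiv ℝ φ z (1, 0)) z (0, 1) := by
    have hs : IsSymmSndFDerivAt ℝ φ z := hφ.contDiff.contDiffAt.isSymmSndFDerivAt
      (by simp only [minSmoothness_of_isRCLikeNormedField]; exact WithTop.coe_le_coe.2 (le_top : (2 : ℕ∞) ≤ ⊤))
    have hd : DifferentiableAt ℝ (fderiv ℝ φ) z :=
      (hφ.contDiff.fderiv_right (m := (⊤ : ℕ∞)) (by simp)).differentiable (by simp) z
    rw [fderiv_clm_apply hd (differentiableAt_const _),
      fderiv_clm_apply hd (differentiableAt_const _)]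
    simpa using hs (1, 0) (0, 1)
  simp_rw [hsym] at e1
  rw [e2, neg_inj] at e1
  simp only [zero_mul, add_zero, neg_mul, ← sub_eq_add_neg]
  rw [integral_sub ((hφ.fderiv_apply _).integrable_mul hA₁)
    ((hφ.fderiv_apply _).integrable_mul hA₂), e1, sub_self]

/-! ## Products and compositions of weakly differentiable functions -/

/-- The correlation of two square integrable functions is continuous. -/
lemma continuous_integral_translate_mul {f H : ℝ × ℝ → ℝ} (hf : MemLp f 2) (hH : MemLp H 2) :
    Continuous fun ζ : ℝ × ℝ => ∫ z, f (ζ + z) * H z := by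
  have : Fact ((2 : ENNReal) ≠ ⊤) := ⟨by simp⟩
  -- Translations act strongly continuously on `L²`; the correlation is the inner product of a
  -- translate with a fixed vector.
  have h1 : Continuous fun ζ : ℝ × ℝ => (DomAddAct.mk ζ) +ᵥ hf.toLp f :=
    (continuous_id.vadd continuous_const).comp DomAddAct.continuous_mk
  have h2 : Continuous fun ζ : ℝ × ℝ =>
      inner ℝ (hH.toLp H) ((DomAddAct.mk ζ) +ᵥ hf.toLp f) := continuous_const.inner h1
  refine h2.congr fun ζ => ?_
  rw [L2.inner_def]
  refine integral_congr_ae ?_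
  have h3 : ⇑((DomAddAct.mk ζ) +ᵥ hf.toLp f) =ᵐ[volume] fun z => f (ζ + z) := by
    rw [DomAddAct.mk_vadd_toLp]
    exact MemLp.coeFn_toLp _
  filter_upwards [h3, hH.coeFn_toLp] with z h h'
  rw [h, h']
  simp

/-- A sequence of mollifiers. -/
lemma exists_mollifier (r : ℝ) (hr : 0 < r) : ∃ η : ℕ → ℝ × ℝ → ℝ,
    (∀ n, ContDiff ℝ (⊤ : ℕ∞) (η n)) ∧ (∀ n z, η n z ≠ 0 → ‖z‖ ≤ r) ∧
    ∀ c : ℝ × ℝ → ℝ, Continuous c →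
      Tendsto (fun n => ∫ z, η n z * c z) atTop (𝓝 (c 0)) := by
  let b : ℕ → ContDiffBump (0 : ℝ × ℝ) := fun n =>
    ⟨r / (n + 1) / 2, r / (n + 1), by positivity, half_lt_self (by positivity)⟩
  refine ⟨fun n => (b n).normed volume, fun n => (b n).contDiff_normed, fun n z hz => ?_, ?_⟩
  · have : z ∈ Function.support ((b n).normed volume) := hz
    rw [(b n).support_normed_eq, mem_ball_zero_iff] at this
    refine this.le.trans ?_
    exact div_le_self hr.le (by linarith [n.cast_nonneg (α := ℝ)])
  · intro c hc
    -- The integral against `c` is the convolution with the reflection of `c`, evaluated at the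
    -- origin.
    have h := ContDiffBump.convolution_tendsto_right_of_continuous (μ := volume) (φ := b)
      (l := atTop) (g := fun z => c (-z)) ?_ (by fun_prop) 0
    · simpa [convolution_def] using h
    · have : Tendsto (fun n : ℕ => r * (1 / ((n : ℝ) + 1))) atTop (𝓝 (r * 0)) :=
        tendsto_one_div_add_atTop_nhds_zero_nat.const_mul r
      simpa [b, div_eq_mul_inv] using this

/-- Integrability of the doubled integrands. -/
lemma integrable_mul_mul_sub {g H κ : ℝ × ℝ → ℝ} (hg : Integrable g) (hH : Integrable H)
    (hκ : Continuous κ) (hc : HasCompactSupport κ) :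
    Integrable (fun P : (ℝ × ℝ) × (ℝ × ℝ) => g P.2 * H P.1 * κ (P.2 - P.1))
      (volume.prod volume) := by
  obtain ⟨C, hC⟩ := hκ.bounded_above_of_compact_support hc
  have h1 : Integrable (fun P : (ℝ × ℝ) × (ℝ × ℝ) => H P.1 * g P.2) (volume.prod volume) :=
    hH.mul_prod hg
  have h2 : AEStronglyMeasurable (fun P : (ℝ × ℝ) × (ℝ × ℝ) => κ (P.2 - P.1))
      (volume.prod volume) := (by fun_prop : Continuous _).aestronglyMeasurable
  refine (h1.mul_bdd h2 (ae_of_all _ fun P => hC _)).congr (ae_of_all _ fun P => ?_)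
  simp only []
  ring

/-- The product rule. -/
theorem WeakDeriv.mul {Ω : Set (ℝ × ℝ)} (hΩ : IsOpen Ω) {v : ℝ × ℝ} {A A' B B' : ℝ × ℝ → ℝ}
    (hA : LocSq Ω A) (hA' : LocSq Ω A') (hB : LocSq Ω B) (hB' : LocSq Ω B')
    (h : WeakDeriv Ω v A A') (h' : WeakDeriv Ω v B B') :
    WeakDeriv Ω v (fun z => A z * B z) (fun z => A' z * B z + A z * B' z) := by
  -- Doubling of variables. `A` is taken at `z'` and `B φ` at `z`, joined by a kernel `η n (z' -
  -- z)`. The derivative of the kernel in `z` is minus its derivative in `z'`, so the weak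
  -- derivative of `B` in `z` and that of `A` in `z'` combine to an identity in which the kernel is
  -- not differentiated. The limit uses only the continuity of translations in `L²`.
  intro φ hφ
  obtain ⟨r, hr, hrΩ⟩ := hφ.compact.isCompact.exists_cthickening_subset_open hΩ hφ.subset
  -- The thickening leaves room for the kernel: for `z` in the support of `φ` the ball of radius `r`
  -- about `z` stays inside `Ω`. Cutting `A` and `A'` off outside `K` makes them globally square
  -- integrable.
  set K := Metric.cthickening r (tsupport φ) with hK
  have hKc : IsCompact K := hφ.compact.isCompact.cthickening
  have hKφ : tsupport φ ⊆ K := Metric.self_subset_cthickening _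
  obtain ⟨η, hηs, hηr, hη⟩ := exists_mollifier r hr
  have hηc (n : ℕ) : HasCompactSupport (η n) := by
    refine HasCompactSupport.intro (isCompact_closedBall (0 : ℝ × ℝ) r) fun z hz => ?_
    by_contra hne
    exact hz (mem_closedBall_zero_iff.2 (hηr n z hne))
  have hmem {f : ℝ × ℝ → ℝ} (hf : LocSq Ω f) : MemLp (K.indicator f) 2 := by
    rw [memLp_indicator_iff_restrict hKc.measurableSet,
      memLp_two_iff_integrable_sq (hf.meas.mono_set hrΩ)]
    exact hf.sq.integrableOn_compact_subset hrΩ hKc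
  have hint {f : ℝ × ℝ → ℝ} (hf : LocSq Ω f) : Integrable (K.indicator f) := by
    rw [integrable_indicator_iff hKc.measurableSet]
    exact (hf.locallyIntegrableOn hΩ).integrableOn_compact_subset hrΩ hKc
  have hmul {f g : ℝ × ℝ → ℝ} (hf : LocSq Ω f) (hg : IsTest Ω g) :
      LocSq Ω fun z => f z * g z := by
    simpa only [mul_comm] using LocSq.continuousOn_mul hg.continuous.continuousOn hf hΩ
  have hindic {f g : ℝ × ℝ → ℝ} (hg : tsupport g ⊆ K) :
      K.indicator (fun z => f z * g z) = fun z => f z * g z := by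
    refine indicator_eq_self.2 (Function.support_subset_iff'.2 fun x hx => ?_)
    simp [image_eq_zero_of_notMem_tsupport fun h => hx (hg h)]
  set φ' := fun z => fderiv ℝ φ z v with hφ'
  have hφ't : IsTest Ω φ' := hφ.fderiv_apply v
  have hφ'K : tsupport φ' ⊆ K := (tsupport_fderiv_apply_subset ℝ v).trans hKφ
  set f := K.indicator A with hf
  set f' := K.indicator A' with hf'
  -- the three weights
  set H₁ := fun z => B z * φ' z with hH₁
  set H₂ := fun z => B' z * φ z with hH₂
  set H₃ := fun z => B z * φ z with hH₃
  have m₁ : MemLp H₁ 2 := by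
    have := hmem (hmul hB hφ't)
    rwa [hindic hφ'K] at this
  have m₂ : MemLp H₂ 2 := by
    have := hmem (hmul hB' hφ)
    rwa [hindic hKφ] at this
  have m₃ : MemLp H₃ 2 := by
    have := hmem (hmul hB hφ)
    rwa [hindic hKφ] at this
  have i₁ : Integrable H₁  := by
    have := hint (hmul hB hφ't)
    rwa [hindic hφ'K] at this
  have i₂ : Integrable H₂  := by
    have := hint (hmul hB' hφ)
    rwa [hindic hKφ] at this
  have i₃ : Integrable H₃  := by
    have := hint (hmul hB hφ)
    rwa [hindic hKφ] at this
  -- With `z' = z + ζ` the double integral is `η n` paired with the correlation of `g` and `H`, a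
  -- continuous function of `ζ`, and the mollifier picks out its value at zero.
  have hlim {g H : ℝ × ℝ → ℝ} (hg : MemLp g 2) (hH : MemLp H 2)
      (hgi : Integrable g) (hHi : Integrable H) :
      Tendsto (fun n => ∫ z, ∫ z', g z' * H z * η n (z' - z)) atTop (𝓝 (∫ z, g z * H z)) := by
    have := hη _ (continuous_integral_translate_mul hg hH)
    simp only [zero_add] at this
    refine this.congr fun n => ?_
    have hi := (integrable_mul_mul_sub hgi hHi (hηs n).continuous (hηc n))
    have hi' := (measurePreserving_prod_add (volume : Measure (ℝ × ℝ))
      (volume : Measure (ℝ × ℝ))).integrable_comp_of_integrable hi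
    calc ∫ ζ, η n ζ * ∫ z, g (ζ + z) * H z
        = ∫ ζ, ∫ z, g (z + ζ) * H z * η n (z + ζ - z) := by
          congr 1
          ext ζ
          rw [← integral_const_mul]
          congr 1
          ext z
          rw [add_sub_cancel_left, add_comm ζ z]
          ring
      _ = ∫ z, ∫ ζ, g (z + ζ) * H z * η n (z + ζ - z) := 
          (integral_integral_swap (f := fun z ζ => g (z + ζ) * H z * η n (z + ζ - z)) hi').symm
      _ = _ := by
          congr 1
          ext z
          exact integral_add_left_eq_self (fun z' => g z' * H z * η n (z' - z)) z
  have key (n : ℕ) : (∫ z, ∫ z', f z' * H₁ z * η n (z' - z))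
      + (∫ z, ∫ z', f z' * H₂ z * η n (z' - z)) + ∫ z, ∫ z', f' z' * H₃ z * η n (z' - z) = 0 := by
    have d₁ := (hηs n).continuous
    have hηv : Continuous fun z => fderiv ℝ (η n) z v :=
      (((hηs n).fderiv_right (m := (⊤ : ℕ∞)) (by simp)).clm_apply contDiff_const).continuous
    have hηvc := (hηc n).fderiv_apply ℝ v
    have J₁ := integrable_mul_mul_sub (hint hA) i₁ d₁ (hηc n)
    have J₂ := integrable_mul_mul_sub (hint hA) i₂ d₁ (hηc n)
    have J₃ := integrable_mul_mul_sub (hint hA) i₃ hηv hηvc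
    -- For frozen `z'` this is the weak derivative of `B`, tested against `z ↦ η n (z' - z) φ z`.
    have e₁ (z' : ℝ × ℝ) : (∫ z, f z' * H₁ z * η n (z' - z)) + (∫ z, f z' * H₂ z * η n (z' - z))
        = ∫ z, f z' * H₃ z * fderiv ℝ (η n) (z' - z) v := by
      have ht : IsTest Ω fun z => η n (z' - z) * φ z := hφ.mul_left (by fun_prop)
      have hd (z : ℝ × ℝ) : fderiv ℝ (fun z => η n (z' - z) * φ z) z v
          = η n (z' - z) * φ' z - fderiv ℝ (η n) (z' - z) v * φ z := by
        have h1 : HasFDerivAt (fun z => η n (z' - z))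
            ((fderiv ℝ (η n) (z' - z)).comp (-ContinuousLinearMap.id ℝ (ℝ × ℝ))) z := by
          refine HasFDerivAt.comp z ((hηs n).differentiable (by simp) _).hasFDerivAt ?_
          simpa using (hasFDerivAt_id z).const_sub z'
        rw [(h1.fun_mul (hφ.differentiable z).hasFDerivAt).fderiv]
        simp [hφ']
        ring
      have q₁ : Integrable fun z => B z * (η n (z' - z) * φ' z) :=
        (hφ't.mul_left (by fun_prop)).integrable_mul (hB.locallyIntegrableOn hΩ)
      have q₂ : Integrable fun z => B' z * (η n (z' - z) * φ z) :=
        ht.integrable_mul (hB'.locallyIntegrableOn hΩ)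
      have q₃ : Integrable fun z => B z * (fderiv ℝ (η n) (z' - z) v * φ z) := by
        have : ContDiff ℝ (⊤ : ℕ∞) fun z => fderiv ℝ (η n) (z' - z) v :=
          (((hηs n).fderiv_right (m := (⊤ : ℕ∞)) (by simp)).clm_apply contDiff_const).comp
            (contDiff_const.sub contDiff_id)
        exact (hφ.mul_left this).integrable_mul (hB.locallyIntegrableOn hΩ)
      have e := h' _ ht
      simp_rw [hd, mul_sub] at e
      rw [integral_sub q₁ q₃] at e
      have r₁ : (∫ z, f z' * H₁ z * η n (z' - z)) = f z' * ∫ z, B z * (η n (z' - z) * φ' z) := by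
        rw [← integral_const_mul]; congr 1; ext z; simp only [hH₁]; ring
      have r₂ : (∫ z, f z' * H₂ z * η n (z' - z)) = f z' * ∫ z, B' z * (η n (z' - z) * φ z) := by
        rw [← integral_const_mul]; congr 1; ext z; simp only [hH₂]; ring
      have r₃ : (∫ z, f z' * H₃ z * fderiv ℝ (η n) (z' - z) v)
          = f z' * ∫ z, B z * (fderiv ℝ (η n) (z' - z) v * φ z) := by
        rw [← integral_const_mul]; congr 1; ext z; simp only [hH₃]; ring
      rw [r₁, r₂, r₃, ← mul_add]
      congr 1
      linarith
    -- For frozen `z` this is the weak derivative of `A`, tested against `z' ↦ η n (z' - z)`. That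
    -- function is admissible only for `z` in the support of `φ`; elsewhere the factor `H₃ z`
    -- vanishes.
    have e₂ (z : ℝ × ℝ) : (∫ z', f z' * H₃ z * fderiv ℝ (η n) (z' - z) v)
        = - ∫ z', f' z' * H₃ z * η n (z' - z) := by
      by_cases hz : z ∈ tsupport φ
      swap
      · simp [hH₃, image_eq_zero_of_notMem_tsupport hz]
      have hb : Metric.closedBall z r ⊆ K := Metric.closedBall_subset_cthickening hz r
      have hs : tsupport (fun z' => η n (z' - z)) ⊆ Metric.closedBall z r := by
        refine closure_minimal (fun z' hz' => ?_) Metric.isClosed_closedBall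
        rw [mem_closedBall_iff_norm]
        exact hηr n _ hz'
      have ht : IsTest Ω fun z' => η n (z' - z) :=
        ⟨by fun_prop, HasCompactSupport.of_support_subset_isCompact (isCompact_closedBall z r)
          ((subset_tsupport _).trans hs), hs.trans (hb.trans hrΩ)⟩
      have hd (z' : ℝ × ℝ) : fderiv ℝ (fun z' => η n (z' - z)) z' v
          = fderiv ℝ (η n) (z' - z) v := by
        rw [fderiv_comp_sub]
      have hd' : tsupport (fun z' => fderiv ℝ (η n) (z' - z) v) ⊆ K := by
        simp_rw [← hd]
        exact (tsupport_fderiv_apply_subset ℝ v).trans (hs.trans hb)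
      have e := h _ ht
      simp_rw [hd] at e
      rw [← hindic (f := A) hd', ← hindic (f := A') (hs.trans hb)] at e
      have r₁ : (∫ z', f z' * H₃ z * fderiv ℝ (η n) (z' - z) v)
          = H₃ z * ∫ z', K.indicator (fun z' => A z' * fderiv ℝ (η n) (z' - z) v) z' := by
        rw [← integral_const_mul]; congr 1; ext z'
        by_cases hk : z' ∈ K <;> simp [hf, hk]
        ring
      have r₂ : (∫ z', f' z' * H₃ z * η n (z' - z))
          = H₃ z * ∫ z', K.indicator (fun z' => A' z' * η n (z' - z)) z' := by
        rw [← integral_const_mul]; congr 1; ext z'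
        by_cases hk : z' ∈ K <;> simp [hf', hk]
        ring
      rw [r₁, r₂, e, mul_neg]
    have e₃ : (∫ z, ∫ z', f z' * H₁ z * η n (z' - z)) + (∫ z, ∫ z', f z' * H₂ z * η n (z' - z))
        = ∫ z', ∫ z, f z' * H₃ z * fderiv ℝ (η n) (z' - z) v := by
      rw [integral_integral_swap (f := fun z z' => f z' * H₁ z * η n (z' - z)) J₁,
        integral_integral_swap (f := fun z z' => f z' * H₂ z * η n (z' - z)) J₂,
        ← integral_add J₁.integral_prod_right J₂.integral_prod_right]
      exact integral_congr_ae (ae_of_all _ e₁)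
    rw [e₃]
    rw [← integral_integral_swap
      (f := fun z z' => f z' * H₃ z * fderiv ℝ (η n) (z' - z) v) J₃]
    simp_rw [e₂, integral_neg]
    ring
  have hl := ((hlim (hmem hA) m₁ (hint hA) i₁).add (hlim (hmem hA) m₂ (hint hA) i₂)).add
    (hlim (hmem hA') m₃ (hint hA') i₃)
  have h0 := tendsto_nhds_unique hl (tendsto_const_nhds.congr fun n => (key n).symm)
  have hfA {g H : ℝ × ℝ → ℝ} (hH : ∀ z ∉ K, H z = 0) (z : ℝ × ℝ) :
      K.indicator g z * H z = g z * H z := by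
    by_cases hz : z ∈ K
    · simp [hz]
    · simp [hH z hz]
  have z₁ : ∀ z ∉ K, H₁ z = 0 := fun z hz => by
    simp only [hH₁, image_eq_zero_of_notMem_tsupport fun hh => hz (hφ'K hh), mul_zero]
  have z₂ : ∀ z ∉ K, H₂ z = 0 := fun z hz => by
    simp only [hH₂, image_eq_zero_of_notMem_tsupport fun hh => hz (hKφ hh), mul_zero]
  have z₃ : ∀ z ∉ K, H₃ z = 0 := fun z hz => by
    simp only [hH₃, image_eq_zero_of_notMem_tsupport fun hh => hz (hKφ hh), mul_zero]
  simp only [hfA z₁, hfA z₂, hfA z₃] at h0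
  have s₂ : Integrable fun z => A z * H₂ z := by
    refine (hφ.integrable_mul (hA.mul_locallyIntegrableOn hB' hΩ)).congr (ae_of_all _ fun z => ?_)
    simp only [hH₂]; ring
  have s₃ : Integrable fun z => A' z * H₃ z := by
    refine (hφ.integrable_mul (hA'.mul_locallyIntegrableOn hB hΩ)).congr (ae_of_all _ fun z => ?_)
    simp only [hH₃]; ring
  have t₁ : (∫ z, A z * B z * fderiv ℝ φ z v) = ∫ z, A z * H₁ z := by
    congr 1; ext z; simp only [hH₁, hφ']; ring
  have t₂ : (∫ z, (A' z * B z + A z * B' z) * φ z) = (∫ z, A' z * H₃ z) + ∫ z, A z * H₂ z := by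
    rw [← integral_add s₃ s₂]
    congr 1; ext z; simp only [hH₂, hH₃]; ring
  rw [t₁, t₂]
  linarith

/-- Classical derivatives are weak derivatives. -/
lemma WeakDeriv.of_contDiffOn {Ω : Set (ℝ × ℝ)} (hΩ : IsOpen Ω) {v : ℝ × ℝ} {m : ℝ × ℝ → ℝ}
    (hm : ContDiffOn ℝ 1 m Ω) : WeakDeriv Ω v m fun z => fderiv ℝ m z v := by
  intro φ hφ
  have hc : ContinuousOn (fun z => fderiv ℝ m z v) Ω :=
    (hm.continuousOn_fderiv_of_isOpen hΩ le_rfl).clm_apply continuousOn_const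
  refine integral_mul_fderiv_eq_neg_fderiv_mul_of_integrable ?_ ?_ ?_ (fun z hz => ?_)
    (fun z _ => hφ.differentiable z)
  · exact hφ.integrable_mul (hc.locallyIntegrableOn hΩ.measurableSet)
  · exact (hφ.fderiv_apply v).integrable_mul (hm.continuousOn.locallyIntegrableOn hΩ.measurableSet)
  · exact hφ.integrable_mul (hm.continuousOn.locallyIntegrableOn hΩ.measurableSet)
  · exact (hm.contDiffAt (hΩ.mem_nhds (hφ.subset hz))).differentiableAt (by simp)

lemma WeakDeriv.const {Ω : Set (ℝ × ℝ)} (hΩ : IsOpen Ω) (v : ℝ × ℝ) (c : ℝ) :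
    WeakDeriv Ω v (fun _ => c) fun _ => 0 := by
  simpa using WeakDeriv.of_contDiffOn hΩ (v := v) (m := fun _ => c) contDiffOn_const

lemma WeakDeriv.add {Ω : Set (ℝ × ℝ)} {v : ℝ × ℝ} {A A' B B' : ℝ × ℝ → ℝ}
    (h : WeakDeriv Ω v A A') (h' : WeakDeriv Ω v B B')
    (hA : LocallyIntegrableOn A Ω) (hA' : LocallyIntegrableOn A' Ω)
    (hB : LocallyIntegrableOn B Ω) (hB' : LocallyIntegrableOn B' Ω) :
    WeakDeriv Ω v (fun z => A z + B z) fun z => A' z + B' z := by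
  intro φ hφ
  have hφ' := hφ.fderiv_apply v
  simp_rw [add_mul]
  rw [integral_add (hφ'.integrable_mul hA) (hφ'.integrable_mul hB),
    integral_add (hφ.integrable_mul hA') (hφ.integrable_mul hB'), h φ hφ, h' φ hφ]
  ring

lemma WeakDeriv.congr {Ω : Set (ℝ × ℝ)} {v : ℝ × ℝ} {A A' B B' : ℝ × ℝ → ℝ}
    (h : WeakDeriv Ω v A A') (hA : ∀ z ∈ Ω, B z = A z) (hA' : ∀ z ∈ Ω, B' z = A' z) :
    WeakDeriv Ω v B B' := by
  intro φ hφ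
  have hz {f g ψ : ℝ × ℝ → ℝ} (hψ : IsTest Ω ψ) (hfg : ∀ z ∈ Ω, f z = g z) :
      (fun z => f z * ψ z) = fun z => g z * ψ z := by
    ext z
    by_cases hz : z ∈ Ω
    · rw [hfg z hz]
    · rw [hψ.eq_zero hz, mul_zero, mul_zero]
  rw [hz (hφ.fderiv_apply v) hA, hz hφ hA', h φ hφ]

open Polynomial in
-- Serves the chain rule: a polynomial close to `Φ'` is integrated, with the constant chosen so that
-- the primitive agrees with `Φ` at zero.
lemma exists_derivative_eq (P : ℝ[X]) (c : ℝ) : ∃ Q : ℝ[X], derivative Q = P ∧ Q.eval 0 = c := by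
  suffices ∃ Q : ℝ[X], derivative Q = P by
    obtain ⟨Q, hQ⟩ := this
    exact ⟨Q + C (c - Q.eval 0), by simp [hQ], by simp⟩
  induction P using Polynomial.induction_on' with
  | add p q hp hq =>
    obtain ⟨P, hP⟩ := hp
    obtain ⟨Q, hQ⟩ := hq
    exact ⟨P + Q, by simp [hP, hQ]⟩
  | monomial n a =>
    refine ⟨monomial (n + 1) (a / (n + 1)), ?_⟩
    rw [derivative_monomial]
    congr 1
    push_cast
    field_simp

open Polynomial in
-- Powers follow from the product rule by induction, because a continuous function times an `L²_loc`
-- function is again in `L²_loc`; monomials and sums follow by linearity.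
lemma WeakDeriv.polynomial {Ω : Set (ℝ × ℝ)} (hΩ : IsOpen Ω) {v : ℝ × ℝ} {U U' : ℝ × ℝ → ℝ}
    (hU : ContinuousOn U Ω) (hU' : LocSq Ω U') (h : WeakDeriv Ω v U U') (P : ℝ[X]) :
    WeakDeriv Ω v (fun z => P.eval (U z)) fun z => (derivative P).eval (U z) * U' z := by
  have hc (P : ℝ[X]) : ContinuousOn (fun z => P.eval (U z)) Ω := P.continuous.comp_continuousOn hU
  have hl (P : ℝ[X]) : LocallyIntegrableOn (fun z => P.eval (U z)) Ω :=
    (hc P).locallyIntegrableOn hΩ.measurableSet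
  have hl' (P : ℝ[X]) : LocSq Ω (fun z => P.eval (U z) * U' z) :=
    LocSq.continuousOn_mul (hc P) hU' hΩ
  have hp (n : ℕ) : WeakDeriv Ω v (fun z => (X ^ n : ℝ[X]).eval (U z))
      fun z => (derivative (X ^ n : ℝ[X])).eval (U z) * U' z := by
    induction n with
    | zero => simpa using WeakDeriv.const hΩ v 1
    | succ n ih =>
      refine (WeakDeriv.mul hΩ (LocSq.of_continuousOn (hc (X ^ n)) hΩ)
        (hl' (derivative (X ^ n))) (LocSq.of_continuousOn hU hΩ) hU' ih h).congr
        (fun z _ => by simp [pow_succ]) fun z _ => ?_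
      rw [pow_succ, derivative_mul]
      simp
      ring
  induction P using Polynomial.induction_on' with
  | add P Q hP hQ =>
    refine (hP.add hQ (hl P) ((hl' _).locallyIntegrableOn hΩ) (hl Q)
      ((hl' _).locallyIntegrableOn hΩ)).congr (fun z _ => by simp) fun z _ => ?_
    simp only [derivative_add, eval_add, add_mul]
  | monomial n a =>
    have := WeakDeriv.mul hΩ (LocSq.const a hΩ) (LocSq.const 0 hΩ)
      (LocSq.of_continuousOn (hc (X ^ n)) hΩ) (hl' _) (WeakDeriv.const hΩ v a) (hp n)
    refine this.congr (fun z _ => by simp) fun z _ => ?_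
    simp [derivative_monomial, derivative_X_pow]
    ring

/-- The chain rule. -/
theorem WeakDeriv.comp {Ω : Set (ℝ × ℝ)} (hΩ : IsOpen Ω) {v : ℝ × ℝ} {U U' : ℝ × ℝ → ℝ}
    (hU : ContinuousOn U Ω) (hU' : LocSq Ω U') (h : WeakDeriv Ω v U U') {Φ : ℝ → ℝ}
    (hΦ : ContDiff ℝ 1 Φ) :
    WeakDeriv Ω v (fun z => Φ (U z)) fun z => deriv Φ (U z) * U' z := by
  intro φ hφ
  -- On the support of `φ` the values of `U` lie in a compact interval, and only there does `Φ` have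
  -- to be approximated.
  obtain ⟨R, hR⟩ := hφ.compact.isCompact.exists_bound_of_continuousOn (hU.mono hφ.subset)
  have hR0 : 0 ≤ max R 0 := le_max_right _ _
  have hΦ' : Continuous (deriv Φ) := hΦ.continuous_deriv le_rfl
  have i₁ : Integrable fun z => Φ (U z) * fderiv ℝ φ z v := (hφ.fderiv_apply v).integrable_mul
    ((hΦ.continuous.comp_continuousOn hU).locallyIntegrableOn hΩ.measurableSet)
  have i₂ : Integrable fun z => deriv Φ (U z) * U' z * φ z := hφ.integrable_mul
    ((LocSq.continuousOn_mul (hΦ'.comp_continuousOn hU) hU' hΩ).locallyIntegrableOn hΩ)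
  have i₃ : Integrable fun z => U' z * φ z := hφ.integrable_mul (hU'.locallyIntegrableOn hΩ)
  have i₄ : Integrable fun z => fderiv ℝ φ z v := by
    simpa using (hφ.fderiv_apply v).integrable_mul
      ((LocSq.const 1 hΩ).locallyIntegrableOn hΩ)
  rw [← add_eq_zero_iff_eq_neg]
  set L := (∫ z, Φ (U z) * fderiv ℝ φ z v) + ∫ z, deriv Φ (U z) * U' z * φ z with hL
  set D := (max R 0) * (∫ z, |fderiv ℝ φ z v|) + ∫ z, |U' z * φ z| with hD
  have hD0 : 0 ≤ D := by positivity
  -- Weierstrass approximation is applied to `Φ'`, not to `Φ`: a primitive with the same value at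
  -- zero is then within `ε` times the length of the interval, so function and derivative are
  -- approximated together. The defect of the chain rule vanishes for polynomials.
  have hsmall (ε : ℝ) (hε : 0 < ε) : |L| ≤ ε * D := by
    obtain ⟨P, hP⟩ := exists_polynomial_near_of_continuousOn (-max R 0) (max R 0) (deriv Φ)
      hΦ'.continuousOn ε hε
    obtain ⟨Q, hQP, hQ0⟩ := exists_derivative_eq P (Φ 0)
    have hw := WeakDeriv.polynomial hΩ hU hU' h Q φ hφ
    have j₁ : Integrable fun z => Q.eval (U z) * fderiv ℝ φ z v :=
      (hφ.fderiv_apply v).integrable_mul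
        ((Q.continuous.comp_continuousOn hU).locallyIntegrableOn hΩ.measurableSet)
    have j₂ : Integrable fun z => P.eval (U z) * U' z * φ z := hφ.integrable_mul
      ((LocSq.continuousOn_mul (P.continuous.comp_continuousOn hU) hU' hΩ).locallyIntegrableOn hΩ)
    rw [hQP] at hw
    have hUR (z : ℝ × ℝ) (hz : z ∈ tsupport φ) : U z ∈ Icc (-max R 0) (max R 0) :=
      abs_le.1 ((hR z hz).trans (le_max_left _ _))
    have hdiff (x : ℝ) (hx : x ∈ Icc (-max R 0) (max R 0)) :
        |Φ x - Q.eval x| ≤ ε * max R 0 := by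
      have hd : ∀ y ∈ Icc (-max R 0) (max R 0),
          HasDerivWithinAt (fun x => Φ x - Q.eval x) (deriv Φ y - P.eval y)
            (Icc (-max R 0) (max R 0)) y := fun y _ => by
        have h2 := Q.hasDerivAt y
        rw [hQP] at h2
        exact (((hΦ.differentiable (by simp) y).hasDerivAt).sub h2).hasDerivWithinAt
      have := (convex_Icc (-max R 0) (max R 0)).norm_image_sub_le_of_norm_hasDerivWithin_le
        hd (C := ε) (fun y hy => by
          rw [Real.norm_eq_abs, abs_sub_comm]; exact (hP y hy).le)
        (x := 0) (y := x) ⟨by linarith, hR0⟩ hx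
      simp only [hQ0, sub_self, sub_zero, Real.norm_eq_abs] at this
      exact this.trans (mul_le_mul_of_nonneg_left (abs_le.2 hx) hε.le)
    have hLe : L = (∫ z, (Φ (U z) - Q.eval (U z)) * fderiv ℝ φ z v)
        + ∫ z, (deriv Φ (U z) - P.eval (U z)) * (U' z * φ z) := by
      have e₁ : (fun z => (Φ (U z) - Q.eval (U z)) * fderiv ℝ φ z v)
          = fun z => Φ (U z) * fderiv ℝ φ z v - Q.eval (U z) * fderiv ℝ φ z v := by
        ext z; ring
      have e₂ : (fun z => (deriv Φ (U z) - P.eval (U z)) * (U' z * φ z))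
          = fun z => deriv Φ (U z) * U' z * φ z - P.eval (U z) * U' z * φ z := by
        ext z; ring
      rw [e₁, e₂, integral_sub i₁ j₁, integral_sub i₂ j₂, hw, hL]
      ring
    rw [hLe, hD, mul_add]
    refine (abs_add_le _ _).trans (add_le_add ?_ ?_)
    · rw [← mul_assoc, ← integral_const_mul, ← Real.norm_eq_abs]
      refine norm_integral_le_of_norm_le (i₄.abs.const_mul _) (ae_of_all _ fun z => ?_)
      rw [norm_mul]
      by_cases hz : z ∈ tsupport φ
      · exact mul_le_mul_of_nonneg_right (hdiff _ (hUR z hz)) (abs_nonneg _)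
      · have : fderiv ℝ φ z v = 0 := image_eq_zero_of_notMem_tsupport
          (f := fun z => fderiv ℝ φ z v) fun hh => hz (tsupport_fderiv_apply_subset ℝ v hh)
        simp [this]
    · rw [← integral_const_mul, ← Real.norm_eq_abs]
      refine norm_integral_le_of_norm_le (i₃.abs.const_mul _) (ae_of_all _ fun z => ?_)
      rw [norm_mul]
      by_cases hz : z ∈ tsupport φ
      · refine mul_le_mul_of_nonneg_right ?_ (abs_nonneg _)
        rw [Real.norm_eq_abs, abs_sub_comm]
        exact (hP _ (hUR z hz)).le
      · simp [image_eq_zero_of_notMem_tsupport hz]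
  by_contra hne
  have hpos : 0 < |L| := abs_pos.2 hne
  have := hsmall (|L| / (2 * (D + 1))) (by positivity)
  rw [div_mul_eq_mul_div, le_div_iff₀ (by positivity)] at this
  nlinarith

/-! ## The change of variables -/

/-- `(y, s) ↦ (X, t)`. -/
def simMap (X₀ T₀ : ℝ) (x : ℝ × ℝ) : ℝ × ℝ :=
  (X₀ + x.1 * Real.exp (-x.2), T₀ - Real.exp (-x.2))

/-- `(X, t) ↦ (y, s)`. -/
def simInv (X₀ T₀ : ℝ) (z : ℝ × ℝ) : ℝ × ℝ :=
  ((z.1 - X₀) / (T₀ - z.2), -Real.log (T₀ - z.2))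

/-- The strip `-1 < y < 1`, `s > σ`. -/
def strip (σ : ℝ) : Set (ℝ × ℝ) := Ioo (-1) 1 ×ˢ Ioi σ

/-- The truncated light cone `|X - X₀| < T₀ - t < e^(-σ)`. -/
def cone (X₀ T₀ σ : ℝ) : Set (ℝ × ℝ) :=
  {z | |z.1 - X₀| < T₀ - z.2 ∧ T₀ - z.2 < Real.exp (-σ)}

variable {X₀ T₀ σ : ℝ}

lemma isOpen_strip : IsOpen (strip σ) := isOpen_Ioo.prod isOpen_Ioi

lemma isOpen_cone : IsOpen (cone X₀ T₀ σ) := by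
  have h1 : IsOpen {z : ℝ × ℝ | |z.1 - X₀| < T₀ - z.2} := isOpen_lt (by fun_prop) (by fun_prop)
  have h2 : IsOpen {z : ℝ × ℝ | T₀ - z.2 < Real.exp (-σ)} :=
    isOpen_lt (by fun_prop) (by fun_prop)
  exact h1.inter h2

lemma simInv_simMap (x : ℝ × ℝ) : simInv X₀ T₀ (simMap X₀ T₀ x) = x := by
  have := Real.exp_pos (-x.2)
  ext <;> simp [simInv, simMap]

lemma simMap_simInv {z : ℝ × ℝ} (hz : z.2 < T₀) : simMap X₀ T₀ (simInv X₀ T₀ z) = z := by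
  have h : 0 < T₀ - z.2 := sub_pos.2 hz
  ext
  · simp only [simInv, simMap, neg_neg, Real.exp_log h]
    field_simp
    ring
  · simp [simInv, simMap, Real.exp_log h]

lemma simMap_injective : Function.Injective (simMap X₀ T₀) :=
  Function.LeftInverse.injective simInv_simMap

lemma simMap_mem_cone {x : ℝ × ℝ} : simMap X₀ T₀ x ∈ cone X₀ T₀ σ ↔ x ∈ strip σ := by
  have h := Real.exp_pos (-x.2)
  simp only [simMap, cone, strip, mem_ofPred_eq, add_sub_cancel_left, sub_sub_cancel, abs_mul,
    abs_of_pos h, mem_prod, mem_Ioo, mem_Ioi, Real.exp_lt_exp, neg_lt_neg_iff, ← abs_lt]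
  rw [mul_lt_iff_lt_one_left h]

lemma simMap_image_strip : simMap X₀ T₀ '' strip σ = cone X₀ T₀ σ := by
  ext z
  constructor
  · rintro ⟨x, hx, rfl⟩
    exact simMap_mem_cone.2 hx
  · intro hz
    have h : z.2 < T₀ := sub_pos.1 ((abs_nonneg _).trans_lt hz.1)
    refine ⟨simInv X₀ T₀ z, ?_, simMap_simInv h⟩
    rw [← simMap_mem_cone (X₀ := X₀) (T₀ := T₀), simMap_simInv h]
    exact hz

lemma contDiff_simMap : ContDiff ℝ (⊤ : ℕ∞) (simMap X₀ T₀) := by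
  unfold simMap
  fun_prop

/-- The derivative of `simMap`. -/
def simMapDeriv (x : ℝ × ℝ) : ℝ × ℝ →L[ℝ] ℝ × ℝ :=
  (Matrix.toLin (Module.Basis.finTwoProd ℝ) (Module.Basis.finTwoProd ℝ)
    !![Real.exp (-x.2), -x.1 * Real.exp (-x.2); 0, Real.exp (-x.2)]).toContinuousLinearMap

lemma simMapDeriv_apply (x v : ℝ × ℝ) : simMapDeriv x v
    = (Real.exp (-x.2) * v.1 - x.1 * Real.exp (-x.2) * v.2, Real.exp (-x.2) * v.2) := by
  simp [simMapDeriv, Matrix.toLin_finTwoProd_apply]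
  ring

lemma hasFDerivAt_simMap (x : ℝ × ℝ) : HasFDerivAt (simMap X₀ T₀) (simMapDeriv x) x := by
  have h1 : HasFDerivAt (fun x : ℝ × ℝ => Real.exp (-x.2))
      (Real.exp (-x.2) • -ContinuousLinearMap.snd ℝ ℝ ℝ) x := hasFDerivAt_snd.neg.exp
  have h2 := ((hasFDerivAt_fst (𝕜 := ℝ) (p := x)).fun_mul h1).const_add X₀
  have h3 := h1.const_sub T₀
  have h4 := h2.prodMk h3
  have h5 : simMapDeriv x = (x.1 • Real.exp (-x.2) • -ContinuousLinearMap.snd ℝ ℝ ℝ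
      + Real.exp (-x.2) • ContinuousLinearMap.fst ℝ ℝ ℝ).prod
      (-(Real.exp (-x.2) • -ContinuousLinearMap.snd ℝ ℝ ℝ)) := by
    refine ContinuousLinearMap.ext fun v => ?_
    rw [simMapDeriv_apply]
    ext
    · simp
      ring
    · simp
  rw [h5]
  exact h4

lemma det_simMapDeriv (x : ℝ × ℝ) : (simMapDeriv x).det = Real.exp (-x.2) ^ 2 := by
  simp only [simMapDeriv, LinearMap.det_toContinuousLinearMap, LinearMap.det_toLin,
    Matrix.det_fin_two_of]
  ring

lemma abs_det_simMapDeriv (x : ℝ × ℝ) : |(simMapDeriv x).det| = Real.exp (-x.2) ^ 2 := by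
  rw [det_simMapDeriv, abs_of_nonneg (by positivity)]

lemma setIntegral_cone (F : ℝ × ℝ → ℝ) :
    ∫ z in cone X₀ T₀ σ, F z = ∫ x in strip σ, Real.exp (-x.2) ^ 2 * F (simMap X₀ T₀ x) := by
  rw [← simMap_image_strip, integral_image_eq_integral_abs_det_fderiv_smul volume
    isOpen_strip.measurableSet (fun x _ => (hasFDerivAt_simMap x).hasFDerivWithinAt)
    simMap_injective.injOn]
  simp only [abs_det_simMapDeriv, smul_eq_mul]

lemma locallyIntegrableOn_comp_simMap {A : ℝ × ℝ → ℝ}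
    (hA : LocallyIntegrableOn A (cone X₀ T₀ σ)) :
    LocallyIntegrableOn (fun x => A (simMap X₀ T₀ x)) (strip σ) := by
  rw [locallyIntegrableOn_iff isOpen_strip.isLocallyClosed]
  intro K hK hKc
  have hKi : simMap X₀ T₀ '' K ⊆ cone X₀ T₀ σ := by
    rw [← simMap_image_strip]
    exact image_mono hK
  have h1 : IntegrableOn A (simMap X₀ T₀ '' K) :=
    hA.integrableOn_compact_subset hKi (hKc.image contDiff_simMap.continuous)
  rw [integrableOn_image_iff_integrableOn_abs_det_fderiv_smul volume hKc.measurableSet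
    (fun x _ => (hasFDerivAt_simMap x).hasFDerivWithinAt) simMap_injective.injOn] at h1
  simp only [abs_det_simMapDeriv, smul_eq_mul] at h1
  have h2 := h1.continuousOn_mul (g := fun x : ℝ × ℝ => Real.exp x.2 ^ 2) (by fun_prop) hKc
  refine h2.congr (ae_of_all _ fun x => ?_)
  simp only []
  rw [← mul_assoc, ← mul_pow, ← Real.exp_add]
  simp

/-- Preimages of null sets are null. -/
lemma quasiMeasurePreserving_simMap :
    Measure.QuasiMeasurePreserving (simMap X₀ T₀) volume volume := by
  refine ⟨contDiff_simMap.continuous.measurable, Measure.AbsolutelyContinuous.mk ?_⟩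
  intro N hN h0
  rw [Measure.map_apply contDiff_simMap.continuous.measurable hN]
  have : simMap X₀ T₀ ⁻¹' N ⊆ simInv X₀ T₀ '' (N ∩ {z | z.2 < T₀}) := fun x hx =>
    ⟨simMap X₀ T₀ x, ⟨hx, by simp [simMap, Real.exp_pos]⟩, simInv_simMap x⟩
  refine measure_mono_null this ?_
  refine addHaar_image_eq_zero_of_differentiableOn_of_addHaar_eq_zero volume ?_
    (measure_mono_null inter_subset_left h0)
  rintro z ⟨-, hz⟩
  have h : T₀ - z.2 ≠ 0 := (sub_pos.2 hz).ne'
  unfold simInv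
  exact DifferentiableAt.differentiableWithinAt (by fun_prop (disch := assumption))

lemma LocSq.comp_simMap {A : ℝ × ℝ → ℝ} (hA : LocSq (cone X₀ T₀ σ) A) :
    LocSq (strip σ) fun x => A (simMap X₀ T₀ x) := by
  refine ⟨?_, locallyIntegrableOn_comp_simMap hA.sq⟩
  refine hA.meas.comp_quasiMeasurePreserving ?_
  refine quasiMeasurePreserving_simMap.restrict ?_
  exact fun x hx => simMap_mem_cone.2 hx

/-- The inverse change of variables is meaningful only for `t < T₀`, so the transported function is
set to zero elsewhere. It stays smooth because its support lies in the compact image of the support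
of `φ`, inside the cone. -/
lemma IsTest.exists_comp_simInv {φ : ℝ × ℝ → ℝ} (hφ : IsTest (strip σ) φ) :
    ∃ ψ, IsTest (cone X₀ T₀ σ) ψ ∧ ∀ x, ψ (simMap X₀ T₀ x) = φ x := by
  classical
  set ψ : ℝ × ℝ → ℝ := fun z => if z.2 < T₀ then φ (simInv X₀ T₀ z) else 0 with hψ
  have hval (x : ℝ × ℝ) : ψ (simMap X₀ T₀ x) = φ x := by
    have : (simMap X₀ T₀ x).2 < T₀ := by simp [simMap, Real.exp_pos]
    simp only [hψ, this, if_true, simInv_simMap]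
  have hKc : IsCompact (simMap X₀ T₀ '' tsupport φ) :=
    hφ.compact.isCompact.image contDiff_simMap.continuous
  have hsupp : Function.support ψ ⊆ simMap X₀ T₀ '' tsupport φ := by
    intro z hz
    have h : z.2 < T₀ := by
      by_contra h
      exact hz (by simp [hψ, h])
    refine ⟨simInv X₀ T₀ z, subset_tsupport _ ?_, simMap_simInv h⟩
    have : ψ z = φ (simInv X₀ T₀ z) := by simp [hψ, h]
    rw [Function.mem_support, ← this]
    exact hz
  have hts : tsupport ψ ⊆ simMap X₀ T₀ '' tsupport φ := closure_minimal hsupp hKc.isClosed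
  refine ⟨ψ, ⟨?_, HasCompactSupport.of_support_subset_isCompact hKc hsupp, ?_⟩, hval⟩
  · rw [contDiff_iff_contDiffAt]
    intro z
    by_cases hz : z ∈ simMap X₀ T₀ '' tsupport φ
    · have h : z.2 < T₀ := by
        obtain ⟨x, -, rfl⟩ := hz
        simp [simMap, Real.exp_pos]
      have h' : T₀ - z.2 ≠ 0 := (sub_pos.2 h).ne'
      have hs : ContDiffAt ℝ (⊤ : ℕ∞) (simInv X₀ T₀) z := by
        unfold simInv
        refine ContDiffAt.prodMk ?_ ?_
        · exact ContDiffAt.div (by fun_prop) (by fun_prop) h'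
        · exact (ContDiffAt.log (contDiffAt_const.sub contDiffAt_snd) h').neg
      refine (hφ.contDiff.contDiffAt.comp z hs).congr_of_eventuallyEq ?_
      filter_upwards [(isOpen_lt continuous_snd continuous_const).mem_nhds h] with w hw
      have hw' : w.2 < T₀ := hw
      simp [hψ, hw']
    · have : ψ =ᶠ[𝓝 z] fun _ => 0 := by
        filter_upwards [hKc.isClosed.isOpen_compl.mem_nhds hz] with w hw
        exact Function.notMem_support.1 fun hh => hw (hsupp hh)
      exact contDiffAt_const.congr_of_eventuallyEq this
  · refine hts.trans ?_
    rw [← simMap_image_strip]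
    exact image_mono hφ.subset

/-- Conservation laws in similarity variables. -/
theorem FluxLaw.comp_simMap {A B S : ℝ × ℝ → ℝ} (h : FluxLaw (cone X₀ T₀ σ) A B S) :
    FluxLaw (strip σ) (fun x => Real.exp (-x.2) * A (simMap X₀ T₀ x))
      (fun x => Real.exp (-x.2) * (x.1 * A (simMap X₀ T₀ x) + B (simMap X₀ T₀ x)))
      (fun x => Real.exp (-x.2) ^ 2 * S (simMap X₀ T₀ x)) := by
  have hl {f g : ℝ × ℝ → ℝ} (hf : LocallyIntegrableOn f (strip σ)) (hg : Continuous g) :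
      LocallyIntegrableOn (fun z => g z * f z) (strip σ) :=
    hf.continuousOn_mul hg.continuousOn isOpen_strip.isLocallyClosed
  have hA := locallyIntegrableOn_comp_simMap h.locA
  have hB := locallyIntegrableOn_comp_simMap h.locB
  have hS := locallyIntegrableOn_comp_simMap h.locS
  refine ⟨hl hA (by fun_prop), hl ((hl hA (by fun_prop)).add hB) (by fun_prop),
    hl hS (by fun_prop), fun φ hφ => ?_⟩
  obtain ⟨ψ, hψ, hval⟩ := hφ.exists_comp_simInv (X₀ := X₀) (T₀ := T₀)
  have h0 := h.eq ψ hψ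
  have hd (x v : ℝ × ℝ) :
      fderiv ℝ φ x v = fderiv ℝ ψ (simMap X₀ T₀ x) (simMapDeriv x v) := by
    have h1 := (hψ.differentiable (simMap X₀ T₀ x)).hasFDerivAt.comp x (hasFDerivAt_simMap x)
    have : ψ ∘ simMap X₀ T₀ = φ := funext hval
    rw [this] at h1
    rw [h1.fderiv]
    rfl
  rw [← setIntegral_eq_integral_of_forall_compl_eq_zero (s := cone X₀ T₀ σ), setIntegral_cone,
    setIntegral_eq_integral_of_forall_compl_eq_zero] at h0
  · refine Eq.trans ?_ h0
    congr 1
    ext x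
    -- In terms of `ψ` on the cone, `∂_y φ = e^(-s) ∂_X ψ` and `∂_s φ = e^(-s) (∂_t ψ - y ∂_X ψ)`.
    -- Solving for `∂_t ψ` adds `y A` to the flux; one power of `e^(-s)` remains from the Jacobian
    -- `e^(-2s)`.
    have e1 : simMapDeriv x (1, 0) = Real.exp (-x.2) • (1, 0) := by
      rw [simMapDeriv_apply]; simp
    have e2 : simMapDeriv x (0, 1) = Real.exp (-x.2) • (0, 1)
        - (x.1 * Real.exp (-x.2)) • (1, 0) := by
      rw [simMapDeriv_apply]; simp
    rw [hd, hd, e1, e2, map_sub, map_smul, map_smul, map_smul, hval]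
    simp only [smul_eq_mul]
    ring
  · intro x hx
    have hx' : simMap X₀ T₀ x ∉ cone X₀ T₀ σ := fun hh => hx (simMap_mem_cone.1 hh)
    rw [hψ.eq_zero hx', (hψ.fderiv_apply _).eq_zero hx', (hψ.fderiv_apply _).eq_zero hx']
    simp
  · intro x hx
    rw [hψ.eq_zero hx, (hψ.fderiv_apply _).eq_zero hx, (hψ.fderiv_apply _).eq_zero hx]
    simp

/-! ## Weak derivatives of the solution -/

/-- The product of two primitives is a primitive. -/
lemma integral_primitive_mul {a b : ℝ} (hab : a ≤ b) {u₁ v₁ u₂ v₂ : ℝ → ℝ}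
    (hv₁ : IntervalIntegrable v₁ volume a b) (hv₂ : IntervalIntegrable v₂ volume a b)
    (hu₁ : ∀ x ∈ Icc a b, u₁ x - u₁ a = ∫ y in a..x, v₁ y)
    (hu₂ : ∀ x ∈ Icc a b, u₂ x - u₂ a = ∫ y in a..x, v₂ y) :
    ∫ x in a..b, (v₁ x * u₂ x + u₁ x * v₂ x) = u₁ b * u₂ b - u₁ a * u₂ a := by
  have ha : a ∈ uIcc a b := left_mem_uIcc
  have hac {v : ℝ → ℝ} (hv : IntervalIntegrable v volume a b) (c : ℝ) :
      AbsolutelyContinuousOnInterval (fun x => c + ∫ y in a..x, v y) a b :=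
    (LipschitzOnWith.absolutelyContinuousOnInterval (f := fun _ => c) (K := 0)
      (LipschitzWith.const c).lipschitzOnWith).add
      (hv.absolutelyContinuousOnInterval_intervalIntegral ha)
  have h := (hac hv₁ (u₁ a)).integral_deriv_mul_eq_sub (hac hv₂ (u₂ a))
  have e₁ : ∀ x ∈ Icc a b, u₁ a + ∫ y in a..x, v₁ y = u₁ x := fun x hx => by
    rw [← hu₁ x hx]; ring
  have e₂ : ∀ x ∈ Icc a b, u₂ a + ∫ y in a..x, v₂ y = u₂ x := fun x hx => by
    rw [← hu₂ x hx]; ring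
  rw [e₁ b ⟨hab, le_rfl⟩, e₂ b ⟨hab, le_rfl⟩, e₁ a ⟨le_rfl, hab⟩, e₂ a ⟨le_rfl, hab⟩] at h
  rw [← h]
  refine intervalIntegral.integral_congr_ae ?_
  filter_upwards [hv₁.ae_hasDerivAt_integral, hv₂.ae_hasDerivAt_integral] with x h₁ h₂ hx
  have hx' : x ∈ uIcc a b := uIoc_subset_uIcc hx
  rw [((h₁ hx' a ha).const_add (u₁ a)).deriv, ((h₂ hx' a ha).const_add (u₂ a)).deriv]
  rw [uIcc_of_le hab] at hx'
  rw [e₁ x hx', e₂ x hx']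

/-- Functions that are continuous in time with values in `L²_loc` under the graph of `T`. -/
structure SliceL2 (T : ℝ → ℝ) (V : ℝ → ℝ → ℝ) : Prop where
  meas : AEStronglyMeasurable (fun z : ℝ × ℝ => V z.1 z.2) (volume.restrict (underGraph T))
  memLp : ∀ a b t, 0 < a → a ≤ b → 0 ≤ t → (∀ X ∈ Icc a b, t < T X) →
    MemLp (fun X => V X t) 2 (volume.restrict (Icc a b))
  tendsto : ∀ a b t, 0 < a → a ≤ b → 0 ≤ t → (∀ X ∈ Icc a b, t < T X) →
    Tendsto (fun τ => eLpNorm (fun X => V X τ - V X t) 2 (volume.restrict (Icc a b)))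
      (𝓝[Ici 0] t) (𝓝 0)

lemma IsSolution.sliceL2_UX {p : ℝ} {d : ℕ} {β f : ℝ → ℝ} {G : ℝ → ℝ → ℝ → ℝ → ℝ}
    {T : ℝ → ℝ} {U UX Ut : ℝ → ℝ → ℝ} (h : IsSolution p d β f G T U UX Ut) : SliceL2 T UX :=
  ⟨h.measurable_UX, h.memLp_UX, h.tendsto_UX⟩

lemma IsSolution.sliceL2_Ut {p : ℝ} {d : ℕ} {β f : ℝ → ℝ} {G : ℝ → ℝ → ℝ → ℝ → ℝ}
    {T : ℝ → ℝ} {U UX Ut : ℝ → ℝ → ℝ} (h : IsSolution p d β f G T U UX Ut) : SliceL2 T Ut :=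
  ⟨h.measurable_Ut, h.memLp_Ut, h.tendsto_Ut⟩

lemma openUnderGraph_subset {T : ℝ → ℝ} : openUnderGraph T ⊆ underGraph T :=
  fun _ h => ⟨h.1, h.2.1.le, h.2.2⟩

lemma isOpen_openUnderGraph {T : ℝ → ℝ} (hT : LipschitzOnWith 1 T (Ioi 0)) :
    IsOpen (openUnderGraph T) := by
  have h1 : IsOpen {z : ℝ × ℝ | 0 < z.1} := isOpen_lt continuous_const continuous_fst
  have h2 : ContinuousOn (fun z : ℝ × ℝ => T z.1 - z.2) {z | 0 < z.1} :=
    (hT.continuousOn.comp continuousOn_fst fun z hz => hz).sub continuousOn_snd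
  have h3 := h2.isOpen_inter_preimage h1 (isOpen_Ioi (a := (0 : ℝ)))
  have h4 : IsOpen {z : ℝ × ℝ | 0 < z.2} := isOpen_lt continuous_const continuous_snd
  convert h3.inter h4 using 1
  ext z
  simp only [openUnderGraph, mem_ofPred_eq, mem_inter_iff, mem_preimage, mem_Ioi, sub_pos]
  tauto

/-- By continuity in time the slices near `t₀` have norm at most one more than the slice at `t₀`;
this uniform bound is integrated over a short time interval by Tonelli's theorem. -/
lemma SliceL2.locSq {T : ℝ → ℝ} {V : ℝ → ℝ → ℝ} (hV : SliceL2 T V)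
    (hT : LipschitzOnWith 1 T (Ioi 0)) : LocSq (openUnderGraph T) fun z => V z.1 z.2 := by
  refine ⟨hV.meas.mono_set openUnderGraph_subset, ?_⟩
  rintro ⟨x₀, t₀⟩ ⟨hx₀, ht₀, htT⟩
  simp only at hx₀ ht₀ htT
  obtain ⟨r, hr, hbox⟩ : ∃ r > 0, Icc (x₀ - r) (x₀ + r) ×ˢ Icc (t₀ - r) (t₀ + r)
      ⊆ openUnderGraph T := by
    obtain ⟨r, hr, hb⟩ := Metric.nhds_basis_closedBall.mem_iff.1
      ((isOpen_openUnderGraph hT).mem_nhds (show (x₀, t₀) ∈ openUnderGraph T from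
        ⟨hx₀, ht₀, htT⟩))
    refine ⟨r, hr, fun z hz => hb ?_⟩
    rw [← closedBall_prod_same, Real.closedBall_eq_Icc, Real.closedBall_eq_Icc]
    exact hz
  have hmem (X τ : ℝ) (hX : X ∈ Icc (x₀ - r) (x₀ + r)) (hτ : τ ∈ Icc (t₀ - r) (t₀ + r)) :
      0 < X ∧ 0 < τ ∧ τ < T X := hbox (mk_mem_prod hX hτ)
  have ha : 0 < x₀ - r := (hmem (x₀ - r) t₀ ⟨le_rfl, by linarith⟩ ⟨by linarith, by linarith⟩).1
  have hlp (τ : ℝ) (hτ : τ ∈ Icc (t₀ - r) (t₀ + r)) :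
      MemLp (fun X => V X τ) 2 (volume.restrict (Icc (x₀ - r) (x₀ + r))) :=
    hV.memLp _ _ τ ha (by linarith)
      (hmem x₀ τ ⟨by linarith, by linarith⟩ hτ).2.1.le fun X hX => (hmem X τ hX hτ).2.2
  have ht₀r : t₀ ∈ Icc (t₀ - r) (t₀ + r) := ⟨by linarith, by linarith⟩
  have hlim := hV.tendsto _ _ t₀ ha (by linarith) ht₀.le fun X hX => (hmem X t₀ hX ht₀r).2.2
  rw [nhdsWithin_eq_nhds.2 (Ici_mem_nhds ht₀)] at hlim
  have hev := hlim.eventually_le_const (show (0 : ENNReal) < 1 by simp)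
  obtain ⟨r', hr', hev⟩ := Metric.nhds_basis_closedBall.mem_iff.1
    (inter_mem hev (Icc_mem_nhds (show t₀ - r < t₀ by linarith) (show t₀ < t₀ + r by linarith)))
  rw [Real.closedBall_eq_Icc] at hev
  set I := Icc (x₀ - r) (x₀ + r) with hI
  set J := Icc (t₀ - r') (t₀ + r') with hJ
  have hIJ : I ×ˢ J ⊆ openUnderGraph T := fun z hz => hbox ⟨hz.1, (hev hz.2).2⟩
  refine ⟨I ×ˢ J, mem_nhdsWithin_of_mem_nhds (prod_mem_nhds
    (Icc_mem_nhds (by linarith) (by linarith)) (Icc_mem_nhds (by linarith) (by linarith))), ?_⟩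
  have hm : AEStronglyMeasurable (fun z : ℝ × ℝ => V z.1 z.2)
      ((volume.restrict I).prod (volume.restrict J)) := by
    rw [Measure.prod_restrict]
    exact hV.meas.mono_set (hIJ.trans openUnderGraph_subset)
  have hm2 : AEStronglyMeasurable (fun z : ℝ × ℝ => V z.1 z.2 ^ 2)
      ((volume.restrict I).prod (volume.restrict J)) := hm.pow 2
  rw [IntegrableOn, Measure.volume_eq_prod, ← Measure.prod_restrict]
  refine ⟨hm2, ?_⟩
  set C := 1 + eLpNorm (fun X => V X t₀) 2 (volume.restrict I) with hC
  have hCt : C ≠ ⊤ := by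
    rw [hC]
    exact ENNReal.add_ne_top.2 ⟨by simp, (hlp t₀ ht₀r).eLpNorm_ne_top⟩
  clear_value C
  have hbd (τ : ℝ) (hτ : τ ∈ J) : ∫⁻ X in I, ‖V X τ ^ 2‖ₑ ≤ C ^ 2 := by
    have h1 : eLpNorm (fun X => V X τ) 2 (volume.restrict I) ≤ C := by
      have : (fun X => V X τ) = (fun X => V X τ - V X t₀) + fun X => V X t₀ := by
        ext X; simp
      rw [this]
      rw [hC]
      refine (eLpNorm_add_le ((hlp τ (hev hτ).2).1.sub (hlp t₀ ht₀r).1) (hlp t₀ ht₀r).1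
        (by norm_num)).trans ?_
      exact add_le_add (hev hτ).1 le_rfl
    have h2 : ∫⁻ X in I, ‖V X τ ^ 2‖ₑ = eLpNorm (fun X => V X τ) 2 (volume.restrict I) ^ 2 := by
      have := eLpNorm_nnreal_pow_eq_lintegral (f := fun X => V X τ) (μ := volume.restrict I)
        (p := 2) (by norm_num)
      simp only [NNReal.coe_ofNat, ENNReal.coe_ofNat, ENNReal.rpow_ofNat] at this
      rw [this]
      simp [enorm_pow]
    rw [h2]
    exact pow_le_pow_left₀ (by simp) h1 2
  rw [HasFiniteIntegral, lintegral_prod_symm (fun z : ℝ × ℝ => ‖V z.1 z.2 ^ 2‖ₑ) hm2.enorm]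
  calc ∫⁻ τ in J, ∫⁻ X in I, ‖V X τ ^ 2‖ₑ ≤ ∫⁻ _ in J, C ^ 2 :=
        setLIntegral_mono' measurableSet_Icc hbd
    _ = C ^ 2 * volume J := by simp
    _ < ⊤ := ENNReal.mul_lt_top (ENNReal.pow_lt_top hCt.lt_top) (by simp [hJ])

/-- A vertex `(X₀, T₀)` under the curve, and a time `σ` after which the backward light cone stays
away from `t = 0` and from the origin. -/
structure IsVertex (T : ℝ → ℝ) (X₀ T₀ σ : ℝ) : Prop where
  T_pos : ∀ X, 0 < X → 0 < T X
  lip : LipschitzOnWith 1 T (Ioi 0)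
  X_pos : 0 < X₀
  T₀_le : T₀ ≤ T X₀
  exp_le_T₀ : Real.exp (-σ) ≤ T₀
  exp_le_X₀ : Real.exp (-σ) ≤ X₀ / 2

namespace IsVertex

variable {T : ℝ → ℝ} {X₀ T₀ σ : ℝ}

/-- The Lipschitz constant of `T` equals the speed of propagation, so the backward cone below any
point on or under the graph remains under it. -/
lemma lt_T (h : IsVertex T X₀ T₀ σ) {X t : ℝ} (hX : 0 < X) (ht : |X - X₀| < T₀ - t) :
    t < T X := by
  have := h.lip.dist_le_mul X₀ h.X_pos X hX
  simp only [NNReal.coe_one, one_mul, Real.dist_eq] at this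
  rw [abs_sub_comm X₀ X] at this
  have h2 := (le_abs_self _).trans this
  linarith [h.T₀_le]

lemma half_lt (h : IsVertex T X₀ T₀ σ) {X r : ℝ} (hX : |X - X₀| < r) (hr : r ≤ Real.exp (-σ)) :
    X₀ / 2 < X := by
  have := (neg_abs_le (X - X₀))
  linarith [h.exp_le_X₀]

lemma cone_subset (h : IsVertex T X₀ T₀ σ) : cone X₀ T₀ σ ⊆ openUnderGraph T := by
  rintro z ⟨h1, h2⟩
  have hX : 0 < z.1 := by linarith [h.half_lt h1 h2.le, h.X_pos]
  exact ⟨hX, by linarith [h.exp_le_T₀], h.lt_T hX h1⟩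

end IsVertex

section Laws

variable {p q M : ℝ} {d : ℕ} {β f : ℝ → ℝ} {G : ℝ → ℝ → ℝ → ℝ → ℝ}
  {T : ℝ → ℝ} {U UX Ut : ℝ → ℝ → ℝ} {X₀ T₀ σ : ℝ}

lemma IsSolution.continuousOn_cone (hS : IsSolution p d β f G T U UX Ut)
    (hv : IsVertex T X₀ T₀ σ) : ContinuousOn (fun z : ℝ × ℝ => U z.1 z.2) (cone X₀ T₀ σ) :=
  hS.continuousOn.mono (hv.cone_subset.trans openUnderGraph_subset)

lemma IsSolution.locSq_U (hS : IsSolution p d β f G T U UX Ut)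
    (hv : IsVertex T X₀ T₀ σ) : LocSq (cone X₀ T₀ σ) fun z => U z.1 z.2 :=
  LocSq.of_continuousOn (hS.continuousOn_cone hv) isOpen_cone

lemma IsSolution.locSq_UX (hS : IsSolution p d β f G T U UX Ut)
    (hv : IsVertex T X₀ T₀ σ) : LocSq (cone X₀ T₀ σ) fun z => UX z.1 z.2 :=
  (hS.sliceL2_UX.locSq hv.lip).mono hv.cone_subset

lemma IsSolution.locSq_Ut (hS : IsSolution p d β f G T U UX Ut)
    (hv : IsVertex T X₀ T₀ σ) : LocSq (cone X₀ T₀ σ) fun z => Ut z.1 z.2 :=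
  (hS.sliceL2_Ut.locSq hv.lip).mono hv.cone_subset

lemma IsSolution.weakDeriv_Ut (hS : IsSolution p d β f G T U UX Ut)
    (hv : IsVertex T X₀ T₀ σ) :
    WeakDeriv (cone X₀ T₀ σ) (0, 1) (fun z => U z.1 z.2) fun z => Ut z.1 z.2 := fun φ hφ =>
  hS.time_deriv φ hφ.contDiff hφ.compact (hφ.subset.trans hv.cone_subset)

/-- At each fixed time `U` is a primitive of `UX`, so integration by parts holds slice by slice;
Fubini's theorem assembles the slices. -/
lemma IsSolution.weakDeriv_UX (hS : IsSolution p d β f G T U UX Ut)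
    (hv : IsVertex T X₀ T₀ σ) :
    WeakDeriv (cone X₀ T₀ σ) (1, 0) (fun z => U z.1 z.2) fun z => UX z.1 z.2 := by
  intro φ hφ
  have i₁ := (hφ.fderiv_apply (1, 0)).integrable_mul
    ((hS.locSq_U hv).locallyIntegrableOn isOpen_cone)
  have i₂ := hφ.integrable_mul ((hS.locSq_UX hv).locallyIntegrableOn isOpen_cone)
  rw [Measure.volume_eq_prod] at i₁ i₂ ⊢
  rw [integral_prod_symm _ i₁, integral_prod_symm _ i₂, ← integral_neg]
  congr 1
  ext t
  have hz (X : ℝ) (h : (X, t) ∉ tsupport φ) : φ (X, t) = 0 ∧ fderiv ℝ φ (X, t) (1, 0) = 0 :=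
    ⟨image_eq_zero_of_notMem_tsupport h, image_eq_zero_of_notMem_tsupport
      (f := fun z => fderiv ℝ φ z (1, 0)) fun hh => h (tsupport_fderiv_apply_subset ℝ _ hh)⟩
  by_cases ht : 0 < T₀ - t ∧ T₀ - t < Real.exp (-σ)
  swap
  · have hn (X : ℝ) : (X, t) ∉ tsupport φ := fun hh => by
      have := hφ.subset hh
      exact ht ⟨(abs_nonneg _).trans_lt this.1, this.2⟩
    simp [fun X => hz X (hn X)]
  -- A closed set inside an open ball lies in a smaller open ball. The closed interval of radius `r`
  -- is then still under the graph, and `φ` vanishes at its endpoints.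
  obtain ⟨r, ⟨hr, hrτ⟩, hsub⟩ := exists_pos_lt_subset_ball (x := X₀) ht.1
    (s := {X | (X, t) ∈ tsupport φ})
    ((isClosed_tsupport φ).preimage (by fun_prop : Continuous fun X : ℝ => (X, t)))
    (fun X hX => by
      rw [Metric.mem_ball, Real.dist_eq]
      exact (hφ.subset hX).1)
  rw [Real.ball_eq_Ioo] at hsub
  set a := X₀ - r with ha
  set b := X₀ + r with hb
  have habs (X : ℝ) (hX : X ∈ Icc a b) : |X - X₀| < T₀ - t := by
    rw [abs_lt]
    constructor <;> linarith [hX.1, hX.2]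
  have hpos (X : ℝ) (hX : X ∈ Icc a b) : 0 < X := by
    linarith [hv.half_lt (habs X hX) ht.2.le, hv.X_pos]
  have hab : a ≤ b := by linarith
  have ha0 := hpos a ⟨le_rfl, hab⟩
  have ht0 : 0 ≤ t := by linarith [hv.exp_le_T₀]
  have hlt (X : ℝ) (hX : X ∈ Icc a b) : t < T X := hv.lt_T (hpos X hX) (habs X hX)
  have hUX : IntegrableOn (fun X => UX X t) (Icc a b) :=
    (hS.memLp_UX a b t ha0 hab ht0 hlt).integrable (by norm_num)
  have hUXi : IntervalIntegrable (fun X => UX X t) volume a b :=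
    (intervalIntegrable_iff_integrableOn_Icc_of_le hab).2 hUX
  have hd (X : ℝ) : HasDerivAt (fun X => φ (X, t)) (fderiv ℝ φ (X, t) (1, 0)) X := by
    have h1 : HasDerivAt (fun X : ℝ => (X, t)) ((1, 0) : ℝ × ℝ) X :=
      (hasDerivAt_id X).prodMk (hasDerivAt_const X t)
    exact (hφ.differentiable (X, t)).hasFDerivAt.comp_hasDerivAt X h1
  have hdc : Continuous fun X => fderiv ℝ φ (X, t) (1, 0) :=
    (hφ.fderiv_apply (1, 0)).continuous.comp (by fun_prop)
  have key := integral_primitive_mul hab hUXi (hdc.intervalIntegrable a b)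
    (u₁ := fun X => U X t) (u₂ := fun X => φ (X, t))
    (fun x hx => hS.space_deriv a x t ha0 hx.1 ht0 fun X hX => hlt X ⟨hX.1, hX.2.trans hx.2⟩)
    (fun x _ => (intervalIntegral.integral_eq_sub_of_hasDerivAt (fun X _ => hd X)
      (hdc.intervalIntegrable a x)).symm)
  have hza : φ (a, t) = 0 := (hz a fun hh => by simpa using (hsub hh).1).1
  have hzb : φ (b, t) = 0 := (hz b fun hh => by simpa using (hsub hh).2).1
  have hUc : ContinuousOn (fun X => U X t) (uIcc a b) := by
    rw [uIcc_of_le hab]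
    exact hS.continuousOn.comp (by fun_prop : Continuous fun X : ℝ => (X, t)).continuousOn
      fun X hX => ⟨hpos X hX, ht0, hlt X hX⟩
  have hφc : Continuous fun X => φ (X, t) := hφ.continuous.comp (by fun_prop)
  rw [intervalIntegral.integral_add (hUXi.mul_continuousOn hφc.continuousOn)
    ((hdc.intervalIntegrable a b).continuousOn_mul hUc), hza, hzb] at key
  have e₁ : ∫ X in a..b, UX X t * φ (X, t) = ∫ X, UX X t * φ (X, t) :=
    intervalIntegral.integral_eq_integral_of_support_subset fun X hX => by
      by_contra hn
      exact hX (by simp only [(hz X fun hh => hn (Ioo_subset_Ioc_self (hsub hh))).1, mul_zero])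
  have e₂ : ∫ X in a..b, U X t * fderiv ℝ φ (X, t) (1, 0)
      = ∫ X, U X t * fderiv ℝ φ (X, t) (1, 0) :=
    intervalIntegral.integral_eq_integral_of_support_subset fun X hX => by
      by_contra hn
      exact hX (by simp only [(hz X fun hh => hn (Ioo_subset_Ioc_self (hsub hh))).2, mul_zero])
  simp only []
  rw [← e₁, ← e₂]
  linarith

end Laws

/-! ## Conservation laws for the solution -/

/-- The right-hand side of the equation, apart from `∂_X² U`. -/
def source (p : ℝ) (d : ℕ) (β f : ℝ → ℝ) (G : ℝ → ℝ → ℝ → ℝ → ℝ) (U UX Ut : ℝ → ℝ → ℝ)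
    (z : ℝ × ℝ) : ℝ :=
  ((d : ℝ) - 1) / z.1 * UX z.1 z.2 + β z.1 * (|U z.1 z.2| ^ (p - 1) * U z.1 z.2)
    + f (U z.1 z.2) + G z.1 z.2 (UX z.1 z.2) (Ut z.1 z.2)

/-- A primitive in `u` of `β(X) |u|^(p-1) u + f(u)`. -/
def potential (p : ℝ) (β f : ℝ → ℝ) (X u : ℝ) : ℝ :=
  β X * (|u| ^ (p + 1) / (p + 1)) + primF f u

lemma LocSq.abs {Ω : Set (ℝ × ℝ)} {A : ℝ × ℝ → ℝ} (hA : LocSq Ω A) : LocSq Ω fun z => |A z| :=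
  ⟨by simpa [Real.norm_eq_abs] using hA.meas.norm, by simpa using hA.sq⟩

lemma contDiff_abs_rpow {r : ℝ} (hr : 1 < r) : ContDiff ℝ 1 fun u : ℝ => |u| ^ r := by
  simpa [Real.norm_eq_abs] using contDiff_norm_rpow (E := ℝ) hr

lemma hasDerivAt_abs_rpow_div {p : ℝ} (hp : 0 < p) (u : ℝ) :
    HasDerivAt (fun u : ℝ => |u| ^ (p + 1) / (p + 1)) (|u| ^ (p - 1) * u) u := by
  have h := (hasDerivAt_abs_rpow u (p := p + 1) (by linarith)).div_const (p + 1)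
  have : p + 1 ≠ 0 := by positivity
  rwa [show p + 1 - 2 = p - 1 by ring, mul_assoc, mul_div_cancel_left₀ _ this] at h

lemma hasDerivAt_primF {f : ℝ → ℝ} (hf : Continuous f) (u : ℝ) :
    HasDerivAt (primF f) (f u) u :=
  intervalIntegral.integral_hasDerivAt_right (hf.intervalIntegrable _ _)
    (hf.stronglyMeasurableAtFilter _ _) hf.continuousAt

lemma contDiff_primF {f : ℝ → ℝ} (hf : Continuous f) : ContDiff ℝ 1 (primF f) := by
  rw [contDiff_one_iff_deriv]
  refine ⟨fun u => (hasDerivAt_primF hf u).differentiableAt, ?_⟩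
  rw [show deriv (primF f) = f from funext fun u => (hasDerivAt_primF hf u).deriv]
  exact hf

section Laws

variable {p q M : ℝ} {d : ℕ} {β f : ℝ → ℝ} {G : ℝ → ℝ → ℝ → ℝ → ℝ}
  {T : ℝ → ℝ} {U UX Ut : ℝ → ℝ → ℝ} {X₀ T₀ σ : ℝ}

lemma IsVertex.fst_pos (hv : IsVertex T X₀ T₀ σ) {z : ℝ × ℝ} (hz : z ∈ cone X₀ T₀ σ) : 0 < z.1 :=
  (hv.cone_subset hz).1

lemma continuousOn_beta_cone (hc : AdmissibleCoeffs q M β f G) (hv : IsVertex T X₀ T₀ σ) :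
    ContinuousOn (fun z : ℝ × ℝ => β z.1) (cone X₀ T₀ σ) :=
  hc.beta_contDiffOn.continuousOn.comp continuousOn_fst fun _ hz => hv.fst_pos hz

/-- `G` is continuous only where `X > 0`. Extended by zero it is a Borel function of four variables,
to which composition applies. -/
lemma aestronglyMeasurable_G (hc : AdmissibleCoeffs q M β f G) {Ω : Set (ℝ × ℝ)}
    {A B C D : ℝ × ℝ → ℝ} (hΩ : MeasurableSet Ω) (hpos : ∀ z ∈ Ω, 0 < A z)
    (hA : AEStronglyMeasurable A (volume.restrict Ω))
    (hB : AEStronglyMeasurable B (volume.restrict Ω))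
    (hC : AEStronglyMeasurable C (volume.restrict Ω))
    (hD : AEStronglyMeasurable D (volume.restrict Ω)) :
    AEStronglyMeasurable (fun z => G (A z) (B z) (C z) (D z)) (volume.restrict Ω) := by
  classical
  set P : Set (ℝ × ℝ × ℝ × ℝ) := {z | 0 < z.1}
  have hP : MeasurableSet P := measurableSet_lt measurable_const measurable_fst
  have hm : Measurable (P.piecewise (fun z : ℝ × ℝ × ℝ × ℝ => G z.1 z.2.1 z.2.2.1 z.2.2.2) 0) :=
    hc.G_continuousOn.measurable_piecewise continuousOn_const hP
  have h1 := hm.comp_aemeasurable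
    (hA.aemeasurable.prodMk (hB.aemeasurable.prodMk (hC.aemeasurable.prodMk hD.aemeasurable)))
  refine h1.aestronglyMeasurable.congr ?_
  filter_upwards [ae_restrict_mem hΩ] with z hz
  have : (A z, B z, C z, D z) ∈ P := hpos z hz
  simp [this]

/-- The linear growth of `G` in the derivatives keeps it in `L²_loc`; the other terms are
continuous, or a continuous coefficient times `UX`. -/
lemma locSq_source (hp : 1 < p) (hc : AdmissibleCoeffs q M β f G)
    (hS : IsSolution p d β f G T U UX Ut)
    (hv : IsVertex T X₀ T₀ σ) : LocSq (cone X₀ T₀ σ) (source p d β f G U UX Ut) := by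
  have hΩ : IsOpen (cone X₀ T₀ σ) := isOpen_cone
  have hUc := hS.continuousOn_cone hv
  have hX := hS.locSq_UX hv
  have ht := hS.locSq_Ut hv
  have h1 : ContinuousOn (fun z : ℝ × ℝ => ((d : ℝ) - 1) / z.1) (cone X₀ T₀ σ) :=
    continuousOn_const.div continuousOn_fst fun z hz => (hv.fst_pos hz).ne'
  have h2 : ContinuousOn (fun z : ℝ × ℝ => β z.1 * (|U z.1 z.2| ^ (p - 1) * U z.1 z.2))
      (cone X₀ T₀ σ) :=
    (continuousOn_beta_cone hc hv).mul
      ((hUc.abs.rpow_const fun _ _ => Or.inr (by linarith)).mul hUc)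
  have h3 : ContinuousOn (fun z : ℝ × ℝ => f (U z.1 z.2)) (cone X₀ T₀ σ) :=
    hc.f_contDiff.continuous.comp_continuousOn hUc
  have hG : LocSq (cone X₀ T₀ σ) fun z => G z.1 z.2 (UX z.1 z.2) (Ut z.1 z.2) := by
    refine LocSq.of_norm_le (B := fun z => M * (1 + |UX z.1 z.2| + |Ut z.1 z.2|))
      (((((LocSq.const 1 hΩ).add hX.abs hΩ).add ht.abs hΩ)).const_mul M hΩ)
      (aestronglyMeasurable_G hc hΩ.measurableSet (fun z hz => hv.fst_pos hz)
        continuous_fst.aestronglyMeasurable continuous_snd.aestronglyMeasurable hX.meas ht.meas)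
      (fun z hz => ?_) hΩ
    exact (hc.G_bound _ _ _ _ (hv.fst_pos hz)).trans (le_abs_self _)
  exact (((LocSq.continuousOn_mul h1 hX hΩ).add (LocSq.of_continuousOn h2 hΩ) hΩ).add
    (LocSq.of_continuousOn h3 hΩ) hΩ).add hG hΩ

lemma fluxLaw_equation (hp : 1 < p) (hc : AdmissibleCoeffs q M β f G)
    (hS : IsSolution p d β f G T U UX Ut) (hv : IsVertex T X₀ T₀ σ) :
    FluxLaw (cone X₀ T₀ σ) (fun z => Ut z.1 z.2) (fun z => -UX z.1 z.2)
      (source p d β f G U UX Ut) := by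
  refine ⟨(hS.locSq_Ut hv).locallyIntegrableOn isOpen_cone,
    ((hS.locSq_UX hv).locallyIntegrableOn isOpen_cone).neg,
    (locSq_source hp hc hS hv).locallyIntegrableOn isOpen_cone, fun φ hφ => ?_⟩
  refine Eq.trans ?_
    (hS.equation φ hφ.contDiff hφ.compact (hφ.subset.trans hv.cone_subset))
  congr 1
  ext z
  simp only [source]
  ring

/-- The characteristic derivatives. -/
lemma weakDeriv_sub (hp : 1 < p) (hc : AdmissibleCoeffs q M β f G)
    (hS : IsSolution p d β f G T U UX Ut) (hv : IsVertex T X₀ T₀ σ) :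
    WeakDeriv (cone X₀ T₀ σ) (1, 1) (fun z => Ut z.1 z.2 - UX z.1 z.2)
      (source p d β f G U UX Ut) := by
  -- Formally `(∂_t + ∂_X)(Ut - UX) = U_tt - U_XX`: the mixed derivatives cancel, and that
  -- cancellation is the law `hm`.
  have hm := WeakDeriv.mixed (hS.weakDeriv_UX hv) (hS.weakDeriv_Ut hv)
    ((hS.locSq_UX hv).locallyIntegrableOn isOpen_cone)
    ((hS.locSq_Ut hv).locallyIntegrableOn isOpen_cone)
  have h := (fluxLaw_equation hp hc hS hv).add (hm.const_mul isOpen_cone (-1))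
  refine FluxLaw.weakDeriv ?_
    (((hS.locSq_Ut hv).sub (hS.locSq_UX hv) isOpen_cone).locallyIntegrableOn isOpen_cone)
  exact h.congr isOpen_cone (fun z _ => by ring) (fun z _ => by ring) (fun z _ => by ring)

/-- The other family of characteristics. `U_tt` and `U_XX` are separately only distributions, yet
each Riemann invariant has a derivative in `L²_loc` along its own characteristics, which is all that
the product rule asks for. -/
lemma weakDeriv_add (hp : 1 < p) (hc : AdmissibleCoeffs q M β f G)
    (hS : IsSolution p d β f G T U UX Ut) (hv : IsVertex T X₀ T₀ σ) :
    WeakDeriv (cone X₀ T₀ σ) (-1, 1) (fun z => Ut z.1 z.2 + UX z.1 z.2)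
      (source p d β f G U UX Ut) := by
  have hm := WeakDeriv.mixed (hS.weakDeriv_UX hv) (hS.weakDeriv_Ut hv)
    ((hS.locSq_UX hv).locallyIntegrableOn isOpen_cone)
    ((hS.locSq_Ut hv).locallyIntegrableOn isOpen_cone)
  have h := (fluxLaw_equation hp hc hS hv).add hm
  refine FluxLaw.weakDeriv ?_
    (((hS.locSq_Ut hv).add (hS.locSq_UX hv) isOpen_cone).locallyIntegrableOn isOpen_cone)
  exact h.congr isOpen_cone (fun z _ => by ring) (fun z _ => by ring) (fun z _ => by ring)

/-- To multiply `U` by a Riemann invariant, `U` must be differentiated in the same characteristic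
direction. -/
lemma weakDeriv_U_char (hS : IsSolution p d β f G T U UX Ut) (hv : IsVertex T X₀ T₀ σ) (c : ℝ) :
    WeakDeriv (cone X₀ T₀ σ) (c, 1) (fun z => U z.1 z.2)
      (fun z => Ut z.1 z.2 + c * UX z.1 z.2) := by
  have hU := (hS.locSq_U hv).locallyIntegrableOn isOpen_cone
  have hX := (hS.locSq_UX hv).locallyIntegrableOn isOpen_cone
  have ht := (hS.locSq_Ut hv).locallyIntegrableOn isOpen_cone
  have h := ((hS.weakDeriv_Ut hv).fluxLaw hU ht).add
    (((hS.weakDeriv_UX hv).fluxLaw hU hX).const_mul isOpen_cone c)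
  refine FluxLaw.weakDeriv ?_ hU
  exact h.congr isOpen_cone (fun z _ => by ring) (fun z _ => by ring) (fun z _ => by ring)

/-- The laws for the energy, the momentum and for `U ∂ₜU`. -/
theorem fluxLaw_energy_momentum (hp : 1 < p) (hc : AdmissibleCoeffs q M β f G)
    (hS : IsSolution p d β f G T U UX Ut) (hv : IsVertex T X₀ T₀ σ) :
    FluxLaw (cone X₀ T₀ σ) (fun z => 1 / 2 * (Ut z.1 z.2 ^ 2 + UX z.1 z.2 ^ 2))
        (fun z => -(Ut z.1 z.2 * UX z.1 z.2))
        (fun z => source p d β f G U UX Ut z * Ut z.1 z.2) ∧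
      FluxLaw (cone X₀ T₀ σ) (fun z => Ut z.1 z.2 * UX z.1 z.2)
        (fun z => -(1 / 2 * (Ut z.1 z.2 ^ 2 + UX z.1 z.2 ^ 2)))
        (fun z => source p d β f G U UX Ut z * UX z.1 z.2) ∧
      FluxLaw (cone X₀ T₀ σ) (fun z => U z.1 z.2 * Ut z.1 z.2)
        (fun z => -(U z.1 z.2 * UX z.1 z.2))
        (fun z => Ut z.1 z.2 ^ 2 - UX z.1 z.2 ^ 2
          + source p d β f G U UX Ut z * U z.1 z.2) := by
  have hΩ : IsOpen (cone X₀ T₀ σ) := isOpen_cone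
  have hU := hS.locSq_U hv
  have hX := hS.locSq_UX hv
  have ht := hS.locSq_Ut hv
  have hg := locSq_source hp hc hS hv
  have ha := ht.sub hX hΩ
  have hb := ht.add hX hΩ
  have wa := weakDeriv_sub hp hc hS hv
  have wb := weakDeriv_add hp hc hS hv
  -- With `a = Ut - UX` and `b = Ut + UX`, the energy density is `(a² + b²)/4`, the momentum is `(b²
  -- - a²)/4`, and `U Ut = (U a + U b)/2`. The fluxes come out by themselves, since `a²` and `U a`
  -- travel in direction `(1, 1)` and `b²` and `U b` in direction `(-1, 1)`.
  have laa := (WeakDeriv.mul hΩ ha hg ha hg wa wa).fluxLaw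
    (ha.mul_locallyIntegrableOn ha hΩ)
    ((hg.mul_locallyIntegrableOn ha hΩ).add (ha.mul_locallyIntegrableOn hg hΩ))
  have lbb := (WeakDeriv.mul hΩ hb hg hb hg wb wb).fluxLaw
    (hb.mul_locallyIntegrableOn hb hΩ)
    ((hg.mul_locallyIntegrableOn hb hΩ).add (hb.mul_locallyIntegrableOn hg hΩ))
  have hD (c : ℝ) : LocSq (cone X₀ T₀ σ) fun z => Ut z.1 z.2 + c * UX z.1 z.2 :=
    ht.add (hX.const_mul c hΩ) hΩ
  have lua := (WeakDeriv.mul hΩ hU (hD 1) ha hg (weakDeriv_U_char hS hv 1) wa).fluxLaw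
    (hU.mul_locallyIntegrableOn ha hΩ)
    (((hD 1).mul_locallyIntegrableOn ha hΩ).add (hU.mul_locallyIntegrableOn hg hΩ))
  have lub := (WeakDeriv.mul hΩ hU (hD (-1)) hb hg (weakDeriv_U_char hS hv (-1)) wb).fluxLaw
    (hU.mul_locallyIntegrableOn hb hΩ)
    (((hD (-1)).mul_locallyIntegrableOn hb hΩ).add (hU.mul_locallyIntegrableOn hg hΩ))
  refine ⟨((laa.add lbb).const_mul hΩ (1 / 4)).congr hΩ (fun z _ => ?_) (fun z _ => ?_)
    (fun z _ => ?_), ((lbb.add (laa.const_mul hΩ (-1))).const_mul hΩ (1 / 4)).congr hΩ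
    (fun z _ => ?_) (fun z _ => ?_) (fun z _ => ?_),
    ((lua.add lub).const_mul hΩ (1 / 2)).congr hΩ (fun z _ => ?_) (fun z _ => ?_)
    (fun z _ => ?_)⟩ <;> ring

/-- The laws for `U²`. -/
theorem fluxLaw_sq (hS : IsSolution p d β f G T U UX Ut) (hv : IsVertex T X₀ T₀ σ) :
    FluxLaw (cone X₀ T₀ σ) (fun z => U z.1 z.2 ^ 2) (fun _ => 0)
        (fun z => 2 * (U z.1 z.2 * Ut z.1 z.2)) ∧
      FluxLaw (cone X₀ T₀ σ) (fun _ => 0) (fun z => U z.1 z.2 ^ 2)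
        (fun z => 2 * (U z.1 z.2 * UX z.1 z.2)) ∧
      FluxLaw (cone X₀ T₀ σ) (fun z => U z.1 z.2 * UX z.1 z.2)
        (fun z => -(U z.1 z.2 * Ut z.1 z.2)) (fun _ => 0) := by
  have hΩ : IsOpen (cone X₀ T₀ σ) := isOpen_cone
  have hU := hS.locSq_U hv
  have hX := hS.locSq_UX hv
  have ht := hS.locSq_Ut hv
  have hUU := hU.mul_locallyIntegrableOn hU hΩ
  have iX := (hX.mul_locallyIntegrableOn hU hΩ).add (hU.mul_locallyIntegrableOn hX hΩ)
  have it := (ht.mul_locallyIntegrableOn hU hΩ).add (hU.mul_locallyIntegrableOn ht hΩ)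
  have wt := WeakDeriv.mul hΩ hU ht hU ht (hS.weakDeriv_Ut hv) (hS.weakDeriv_Ut hv)
  have wX := WeakDeriv.mul hΩ hU hX hU hX (hS.weakDeriv_UX hv) (hS.weakDeriv_UX hv)
  refine ⟨(wt.fluxLaw hUU it).congr hΩ (fun z _ => ?_) (fun z _ => ?_) (fun z _ => ?_),
    (wX.fluxLaw hUU iX).congr hΩ (fun z _ => ?_) (fun z _ => ?_) (fun z _ => ?_),
    -- The third law says that the two derivatives of `U²` commute, and needs no equation.
    ((WeakDeriv.mixed wX wt iX it).const_mul hΩ (1 / 2)).congr hΩ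
      (fun z _ => ?_) (fun z _ => ?_) (fun z _ => ?_)⟩ <;> ring

/-- The laws for the potential. -/
theorem fluxLaw_potential (hp : 1 < p) (hc : AdmissibleCoeffs q M β f G)
    (hS : IsSolution p d β f G T U UX Ut) (hv : IsVertex T X₀ T₀ σ) :
    FluxLaw (cone X₀ T₀ σ) (fun z => potential p β f z.1 (U z.1 z.2)) (fun _ => 0)
        (fun z => (β z.1 * (|U z.1 z.2| ^ (p - 1) * U z.1 z.2) + f (U z.1 z.2)) * Ut z.1 z.2) ∧
      FluxLaw (cone X₀ T₀ σ) (fun _ => 0) (fun z => potential p β f z.1 (U z.1 z.2))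
        (fun z => (β z.1 * (|U z.1 z.2| ^ (p - 1) * U z.1 z.2) + f (U z.1 z.2)) * UX z.1 z.2
          + deriv β z.1 * (|U z.1 z.2| ^ (p + 1) / (p + 1))) := by
  have hΩ : IsOpen (cone X₀ T₀ σ) := isOpen_cone
  have hUc := hS.continuousOn_cone hv
  have hβc := continuousOn_beta_cone hc hv
  have hβ'c : ContinuousOn (fun z : ℝ × ℝ => deriv β z.1) (cone X₀ T₀ σ) :=
    (hc.beta_contDiffOn.continuousOn_deriv_of_isOpen isOpen_Ioi le_rfl).comp continuousOn_fst
      fun _ hz => hv.fst_pos hz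
  have hΦ : ContDiff ℝ 1 fun u : ℝ => |u| ^ (p + 1) / (p + 1) :=
    (contDiff_abs_rpow (by linarith)).div_const _
  have hF := contDiff_primF hc.f_contDiff.continuous
  have hβ1 : ContDiffOn ℝ 1 (fun z : ℝ × ℝ => β z.1) (cone X₀ T₀ σ) :=
    hc.beta_contDiffOn.comp contDiffOn_fst fun _ hz => hv.fst_pos hz
  have hΦc : ContinuousOn (fun z : ℝ × ℝ => |U z.1 z.2| ^ (p + 1) / (p + 1)) (cone X₀ T₀ σ) :=
    hΦ.continuous.comp_continuousOn hUc
  have hφc : ContinuousOn (fun z : ℝ × ℝ => |U z.1 z.2| ^ (p - 1) * U z.1 z.2) (cone X₀ T₀ σ) :=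
    (hUc.abs.rpow_const fun _ _ => Or.inr (by linarith)).mul hUc
  have hfc : ContinuousOn (fun z : ℝ × ℝ => f (U z.1 z.2)) (cone X₀ T₀ σ) :=
    hc.f_contDiff.continuous.comp_continuousOn hUc
  have hFc : ContinuousOn (fun z : ℝ × ℝ => primF f (U z.1 z.2)) (cone X₀ T₀ σ) :=
    hF.continuous.comp_continuousOn hUc
  -- The potential is `β(X)` times a `C¹` function of `U`, plus another such function. The factor
  -- `v.1` records that `β` is differentiated only in the direction of `X`.
  have key {v : ℝ × ℝ} {V : ℝ × ℝ → ℝ} (hV : LocSq (cone X₀ T₀ σ) V)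
      (hw : WeakDeriv (cone X₀ T₀ σ) v (fun z => U z.1 z.2) V) :
      WeakDeriv (cone X₀ T₀ σ) v (fun z => potential p β f z.1 (U z.1 z.2))
        (fun z => (β z.1 * (|U z.1 z.2| ^ (p - 1) * U z.1 z.2) + f (U z.1 z.2)) * V z
          + v.1 * deriv β z.1 * (|U z.1 z.2| ^ (p + 1) / (p + 1))) := by
    have hβv : ∀ z ∈ cone X₀ T₀ σ, v.1 * deriv β z.1
        = fderiv ℝ (fun z : ℝ × ℝ => β z.1) z v := fun z hz => by
      have h1 : DifferentiableAt ℝ β z.1 := (hc.beta_contDiffOn.contDiffAt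
        (Ioi_mem_nhds (hv.fst_pos hz))).differentiableAt (by simp)
      have h2 : HasFDerivAt (fun z : ℝ × ℝ => β z.1) _ z :=
        h1.hasDerivAt.hasFDerivAt.comp z hasFDerivAt_fst
      rw [h2.fderiv]
      simp
    have w1 : WeakDeriv (cone X₀ T₀ σ) v (fun z => β z.1) fun z => v.1 * deriv β z.1 :=
      (WeakDeriv.of_contDiffOn hΩ hβ1).congr (fun _ _ => rfl) hβv
    have w2 := WeakDeriv.comp hΩ hUc hV hw hΦ
    have w3 := WeakDeriv.comp hΩ hUc hV hw hF
    have hd2 (u : ℝ) : deriv (fun u : ℝ => |u| ^ (p + 1) / (p + 1)) u = |u| ^ (p - 1) * u :=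
      (hasDerivAt_abs_rpow_div (by linarith) u).deriv
    have hd3 (u : ℝ) : deriv (primF f) u = f u :=
      (hasDerivAt_primF hc.f_contDiff.continuous u).deriv
    simp only [hd2] at w2
    simp only [hd3] at w3
    have q1 := LocSq.continuousOn_mul hφc hV hΩ
    have q2 : LocSq (cone X₀ T₀ σ) fun z => v.1 * deriv β z.1 :=
      LocSq.of_continuousOn (continuousOn_const.mul hβ'c) hΩ
    have qβ := LocSq.of_continuousOn hβc hΩ
    have qΦ := LocSq.of_continuousOn hΦc hΩ
    have w4 := WeakDeriv.mul hΩ qβ q2 qΦ q1 w1 w2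
    refine (w4.add w3 (qβ.mul_locallyIntegrableOn qΦ hΩ)
      ((q2.mul_locallyIntegrableOn qΦ hΩ).add (qβ.mul_locallyIntegrableOn q1 hΩ))
      (hFc.locallyIntegrableOn hΩ.measurableSet)
      ((LocSq.continuousOn_mul hfc hV hΩ).locallyIntegrableOn hΩ)).congr
      (fun z _ => rfl) fun z _ => ?_
    ring
  have hVc : LocallyIntegrableOn (fun z : ℝ × ℝ => potential p β f z.1 (U z.1 z.2))
      (cone X₀ T₀ σ) := ((hβc.mul hΦc).add hFc).locallyIntegrableOn hΩ.measurableSet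
  have hloc {v : ℝ × ℝ} {V : ℝ × ℝ → ℝ} (hV : LocSq (cone X₀ T₀ σ) V) : LocallyIntegrableOn
      (fun z => (β z.1 * (|U z.1 z.2| ^ (p - 1) * U z.1 z.2) + f (U z.1 z.2)) * V z
          + v.1 * deriv β z.1 * (|U z.1 z.2| ^ (p + 1) / (p + 1))) (cone X₀ T₀ σ) :=
    ((LocSq.continuousOn_mul ((hβc.mul hφc).add hfc) hV hΩ).locallyIntegrableOn hΩ).add
      (((continuousOn_const.mul hβ'c).mul hΦc).locallyIntegrableOn hΩ.measurableSet)
  have ht := (key (hS.locSq_Ut hv) (hS.weakDeriv_Ut hv)).fluxLaw hVc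
    (hloc (v := (0, 1)) (hS.locSq_Ut hv))
  have hX := (key (hS.locSq_UX hv) (hS.weakDeriv_UX hv)).fluxLaw hVc
    (hloc (v := (1, 0)) (hS.locSq_UX hv))
  exact ⟨ht.congr hΩ (fun z _ => by ring) (fun z _ => by ring) (fun z _ => by ring),
    hX.congr hΩ (fun z _ => by ring) (fun z _ => by ring) (fun z _ => by ring)⟩

end Laws

/-! ## Conservation laws in similarity variables -/

/-- The exponent `2/(p-1)`. -/
def al (p : ℝ) : ℝ := 2 / (p - 1)

lemma al_pos {p : ℝ} (hp : 1 < p) : 0 < al p := div_pos two_pos (by linarith)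

lemma al_add_one {p : ℝ} (hp : 1 < p) : (p + 1) / (p - 1) = al p + 1 := by
  have : p - 1 ≠ 0 := by linarith
  rw [al]
  field_simp
  ring

lemma FluxLaw.mul_exp {Ω : Set (ℝ × ℝ)} {A B S : ℝ × ℝ → ℝ} (h : FluxLaw Ω A B S)
    (hΩ : IsOpen Ω) (c : ℝ) :
    FluxLaw Ω (fun x => Real.exp (c * x.2) * A x) (fun x => Real.exp (c * x.2) * B x)
      (fun x => Real.exp (c * x.2) * (S x + c * A x)) := by
  have hd (x : ℝ × ℝ) : HasFDerivAt (fun x : ℝ × ℝ => Real.exp (c * x.2))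
      (Real.exp (c * x.2) • c • ContinuousLinearMap.snd ℝ ℝ ℝ) x :=
    (hasFDerivAt_snd.const_mul c).exp
  refine (h.mul_smooth hΩ (m := fun x => Real.exp (c * x.2)) (by fun_prop)).congr hΩ
    (fun x _ => rfl) (fun x _ => rfl) fun x _ => ?_
  rw [(hd x).fderiv]
  simp
  ring

lemma FluxLaw.mul_fst {Ω : Set (ℝ × ℝ)} {A B S : ℝ × ℝ → ℝ} (h : FluxLaw Ω A B S)
    (hΩ : IsOpen Ω) :
    FluxLaw Ω (fun x => x.1 * A x) (fun x => x.1 * B x) (fun x => x.1 * S x + B x) := by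
  refine (h.mul_smooth hΩ (m := fun x => x.1) (by fun_prop)).congr hΩ
    (fun x _ => rfl) (fun x _ => rfl) fun x _ => ?_
  rw [hasFDerivAt_fst.fderiv]
  simp

/-- The source term in similarity variables. -/
def simH (p : ℝ) (d : ℕ) (β f : ℝ → ℝ) (G : ℝ → ℝ → ℝ → ℝ → ℝ) (U UX Ut : ℝ → ℝ → ℝ)
    (X₀ T₀ s y : ℝ) : ℝ :=
  Real.exp (-al p * s) * Real.exp (-s) ^ 2 * source p d β f G U UX Ut (simMap X₀ T₀ (y, s))

/-- `e^(-2(p+1)s/(p-1)) V(X, U)`. -/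
def simV (p : ℝ) (β f : ℝ → ℝ) (U : ℝ → ℝ → ℝ) (X₀ T₀ s y : ℝ) : ℝ :=
  Real.exp (-al p * s) ^ 2 * Real.exp (-s) ^ 2
    * potential p β f (X₀ + y * Real.exp (-s)) (U (X₀ + y * Real.exp (-s)) (T₀ - Real.exp (-s)))

/-- The derivative of the potential, in similarity variables. -/
def simHV (p : ℝ) (β f : ℝ → ℝ) (U : ℝ → ℝ → ℝ) (X₀ T₀ s y : ℝ) : ℝ :=
  Real.exp (-al p * s) * Real.exp (-s) ^ 2
    * (β (X₀ + y * Real.exp (-s))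
        * (|U (X₀ + y * Real.exp (-s)) (T₀ - Real.exp (-s))| ^ (p - 1)
          * U (X₀ + y * Real.exp (-s)) (T₀ - Real.exp (-s)))
      + f (U (X₀ + y * Real.exp (-s)) (T₀ - Real.exp (-s))))

/-- The contribution of `β'`, in similarity variables. -/
def simB (p : ℝ) (β : ℝ → ℝ) (U : ℝ → ℝ → ℝ) (X₀ T₀ s y : ℝ) : ℝ :=
  Real.exp (-al p * s) ^ 2 * Real.exp (-s) ^ 3 * y * deriv β (X₀ + y * Real.exp (-s))
    * (|U (X₀ + y * Real.exp (-s)) (T₀ - Real.exp (-s))| ^ (p + 1) / (p + 1))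

section Laws

variable {p q M : ℝ} {d : ℕ} {β f : ℝ → ℝ} {G : ℝ → ℝ → ℝ → ℝ → ℝ}
  {T : ℝ → ℝ} {U UX Ut : ℝ → ℝ → ℝ} {X₀ T₀ σ : ℝ}

lemma simW_eq (s y : ℝ) : simW p X₀ T₀ U s y
    = Real.exp (-al p * s) * U (simMap X₀ T₀ (y, s)).1 (simMap X₀ T₀ (y, s)).2 := by
  simp [simW, simMap, al]

lemma simWy_eq (hp : 1 < p) (s y : ℝ) : simWy p X₀ T₀ UX s y
    = Real.exp (-al p * s) * Real.exp (-s)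
      * UX (simMap X₀ T₀ (y, s)).1 (simMap X₀ T₀ (y, s)).2 := by
  rw [simWy, al_add_one hp, ← Real.exp_add]
  simp only [simMap]
  congr 2
  ring

lemma simWs_eq (hp : 1 < p) (s y : ℝ) : simWs p X₀ T₀ U UX Ut s y
    = Real.exp (-al p * s) * (Real.exp (-s) * Ut (simMap X₀ T₀ (y, s)).1 (simMap X₀ T₀ (y, s)).2
      - y * Real.exp (-s) * UX (simMap X₀ T₀ (y, s)).1 (simMap X₀ T₀ (y, s)).2
      - al p * U (simMap X₀ T₀ (y, s)).1 (simMap X₀ T₀ (y, s)).2) := by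
  rw [simWs, simW_eq, simWy_eq hp, al_add_one hp]
  have : Real.exp (-(al p + 1) * s) = Real.exp (-al p * s) * Real.exp (-s) := by
    rw [← Real.exp_add]; congr 1; ring
  rw [this]
  simp only [simMap, al]
  ring

lemma exp_mul_two (c s : ℝ) : Real.exp (-(2 * c) * s) = Real.exp (-c * s) ^ 2 := by
  rw [← Real.exp_nat_mul]
  congr 1
  push_cast
  ring

/-- The laws for `U²` on the strip. -/
lemma fluxLaw_strip_sq (hS : IsSolution p d β f G T U UX Ut) (hv : IsVertex T X₀ T₀ σ) :
    FluxLaw (strip σ) (fun x => U (simMap X₀ T₀ x).1 (simMap X₀ T₀ x).2 ^ 2)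
        (fun x => x.1 * U (simMap X₀ T₀ x).1 (simMap X₀ T₀ x).2 ^ 2)
        (fun x => 2 * Real.exp (-x.2) * (U (simMap X₀ T₀ x).1 (simMap X₀ T₀ x).2
          * Ut (simMap X₀ T₀ x).1 (simMap X₀ T₀ x).2)
          + U (simMap X₀ T₀ x).1 (simMap X₀ T₀ x).2 ^ 2) ∧
      FluxLaw (strip σ) (fun _ => 0) (fun x => U (simMap X₀ T₀ x).1 (simMap X₀ T₀ x).2 ^ 2)
        (fun x => 2 * Real.exp (-x.2) * (U (simMap X₀ T₀ x).1 (simMap X₀ T₀ x).2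
          * UX (simMap X₀ T₀ x).1 (simMap X₀ T₀ x).2)) := by
  obtain ⟨ht, hX, -⟩ := fluxLaw_sq hS hv
  have he (x : ℝ × ℝ) : Real.exp (1 * x.2) * Real.exp (-x.2) = 1 := by
    rw [← Real.exp_add]; simp
  refine ⟨(ht.comp_simMap.mul_exp isOpen_strip 1).congr isOpen_strip (fun x _ => ?_)
    (fun x _ => ?_) (fun x _ => ?_), (hX.comp_simMap.mul_exp isOpen_strip 1).congr isOpen_strip
    (fun x _ => ?_) (fun x _ => ?_) (fun x _ => ?_)⟩ <;>
  have := he x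
  · linear_combination -U (simMap X₀ T₀ x).1 (simMap X₀ T₀ x).2 ^ 2 * this
  · linear_combination -x.1 * U (simMap X₀ T₀ x).1 (simMap X₀ T₀ x).2 ^ 2 * this
  · linear_combination -(2 * Real.exp (-x.2) * (U (simMap X₀ T₀ x).1 (simMap X₀ T₀ x).2
          * Ut (simMap X₀ T₀ x).1 (simMap X₀ T₀ x).2)
          + U (simMap X₀ T₀ x).1 (simMap X₀ T₀ x).2 ^ 2) * this
  · ring
  · linear_combination -U (simMap X₀ T₀ x).1 (simMap X₀ T₀ x).2 ^ 2 * this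
  · linear_combination -(2 * Real.exp (-x.2) * (U (simMap X₀ T₀ x).1 (simMap X₀ T₀ x).2
          * UX (simMap X₀ T₀ x).1 (simMap X₀ T₀ x).2)) * this

/-- The energy law. -/
theorem fluxLaw_simE (hp : 1 < p) (hc : AdmissibleCoeffs q M β f G)
    (hS : IsSolution p d β f G T U UX Ut) (hv : IsVertex T X₀ T₀ σ) :
    FluxLaw (strip σ)
      (fun x => 1 / 2 * simWs p X₀ T₀ U UX Ut x.2 x.1 ^ 2
        + 1 / 2 * simWy p X₀ T₀ UX x.2 x.1 ^ 2 * (1 - x.1 ^ 2)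
        + al p * (al p + 1) / 2 * simW p X₀ T₀ U x.2 x.1 ^ 2)
      (fun x => -((1 - x.1 ^ 2) * (simWy p X₀ T₀ UX x.2 x.1 * simWs p X₀ T₀ U UX Ut x.2 x.1))
        + x.1 * simWs p X₀ T₀ U UX Ut x.2 x.1 ^ 2)
      (fun x => -2 * al p * x.1 * (simWy p X₀ T₀ UX x.2 x.1 * simWs p X₀ T₀ U UX Ut x.2 x.1)
        - 2 * al p * simWs p X₀ T₀ U UX Ut x.2 x.1 ^ 2
        + simH p d β f G U UX Ut X₀ T₀ x.2 x.1 * simWs p X₀ T₀ U UX Ut x.2 x.1) := by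
  obtain ⟨l1, l2, l3⟩ := fluxLaw_energy_momentum hp hc hS hv
  obtain ⟨-, -, l6⟩ := fluxLaw_sq hS hv
  obtain ⟨l4, l5⟩ := fluxLaw_strip_sq hS hv
  have hΩ : IsOpen (strip σ) := isOpen_strip
  -- The weights of the six laws are read off by expanding the density of `w`: `1` for the energy,
  -- `-y` for the momentum, `-al p` for `U Ut`, `al p ^ 2 + al p / 2` for `U²` and `al p * y` for `U
  -- UX`. The law in `k5` has no density; it corrects the part of the flux proportional to `y U²`.
  have k1 := (l1.comp_simMap.mul_exp hΩ (-1)).mul_exp hΩ (-(2 * al p))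
  have k2 := (((l2.comp_simMap.mul_fst hΩ).mul_exp hΩ (-1)).mul_exp hΩ (-(2 * al p))).const_mul hΩ
    (-1)
  have k3 := (l3.comp_simMap.mul_exp hΩ (-(2 * al p))).const_mul hΩ (-al p)
  have k4 := (l4.mul_exp hΩ (-(2 * al p))).const_mul hΩ (al p ^ 2 + al p / 2)
  have k5 := ((l5.mul_fst hΩ).mul_exp hΩ (-(2 * al p))).const_mul hΩ (-(al p / 2))
  have k6 := ((l6.comp_simMap.mul_fst hΩ).mul_exp hΩ (-(2 * al p))).const_mul hΩ (al p)
  refine (((((k1.add k2).add k3).add k4).add k5).add k6).congr hΩ (fun x _ => ?_) (fun x _ => ?_)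
    (fun x _ => ?_)
  all_goals
    simp only [simW_eq, simWy_eq hp, simWs_eq hp, simH, exp_mul_two, Prod.mk.eta, neg_one_mul]
    ring

/-- The law for `w ∂ₛw`. -/
theorem fluxLaw_simK (hp : 1 < p) (hc : AdmissibleCoeffs q M β f G)
    (hS : IsSolution p d β f G T U UX Ut) (hv : IsVertex T X₀ T₀ σ) :
    FluxLaw (strip σ)
      (fun x => simW p X₀ T₀ U x.2 x.1 * simWs p X₀ T₀ U UX Ut x.2 x.1)
      (fun x => -((1 - x.1 ^ 2) * (simW p X₀ T₀ U x.2 x.1 * simWy p X₀ T₀ UX x.2 x.1))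
        + 2 * x.1 * (simW p X₀ T₀ U x.2 x.1 * simWs p X₀ T₀ U UX Ut x.2 x.1))
      (fun x => simWs p X₀ T₀ U UX Ut x.2 x.1 ^ 2 - (1 - x.1 ^ 2) * simWy p X₀ T₀ UX x.2 x.1 ^ 2
        - al p * (al p + 1) * simW p X₀ T₀ U x.2 x.1 ^ 2
        + (1 - 2 * al p) * (simW p X₀ T₀ U x.2 x.1 * simWs p X₀ T₀ U UX Ut x.2 x.1)
        + 2 * x.1 * (simWs p X₀ T₀ U UX Ut x.2 x.1 * simWy p X₀ T₀ UX x.2 x.1)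
        - 2 * al p * x.1 * (simW p X₀ T₀ U x.2 x.1 * simWy p X₀ T₀ UX x.2 x.1)
        + simH p d β f G U UX Ut X₀ T₀ x.2 x.1 * simW p X₀ T₀ U x.2 x.1) := by
  obtain ⟨-, -, l3⟩ := fluxLaw_energy_momentum hp hc hS hv
  obtain ⟨-, -, l6⟩ := fluxLaw_sq hS hv
  obtain ⟨l4, l5⟩ := fluxLaw_strip_sq hS hv
  have hΩ : IsOpen (strip σ) := isOpen_strip
  have k3 := l3.comp_simMap.mul_exp hΩ (-(2 * al p))
  have k4 := (l4.mul_exp hΩ (-(2 * al p))).const_mul hΩ (-al p)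
  have k5 := ((l5.mul_fst hΩ).mul_exp hΩ (-(2 * al p))).const_mul hΩ (-al p)
  have k6 := ((l6.comp_simMap.mul_fst hΩ).mul_exp hΩ (-(2 * al p))).const_mul hΩ (-1)
  refine (((k3.add k4).add k5).add k6).congr hΩ (fun x _ => ?_) (fun x _ => ?_) (fun x _ => ?_)
  all_goals
    simp only [simW_eq, simWy_eq hp, simWs_eq hp, simH, exp_mul_two, Prod.mk.eta]
    ring

/-- The law for the potential. -/
theorem fluxLaw_simV (hp : 1 < p) (hc : AdmissibleCoeffs q M β f G)
    (hS : IsSolution p d β f G T U UX Ut) (hv : IsVertex T X₀ T₀ σ) :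
    FluxLaw (strip σ) (fun x => simV p β f U X₀ T₀ x.2 x.1) (fun _ => 0)
      (fun x => simHV p β f U X₀ T₀ x.2 x.1
          * (simWs p X₀ T₀ U UX Ut x.2 x.1 + al p * simW p X₀ T₀ U x.2 x.1)
        - simB p β U X₀ T₀ x.2 x.1 - 2 * (al p + 1) * simV p β f U X₀ T₀ x.2 x.1) := by
  obtain ⟨l7, l8⟩ := fluxLaw_potential hp hc hS hv
  have hΩ : IsOpen (strip σ) := isOpen_strip
  -- Passing to similarity variables gives the potential the flux `y V`. Subtracting `y` times the
  -- law for the `X`-derivative removes it, at the price of a source that contains `β'`.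
  have k7 := (l7.comp_simMap.mul_exp hΩ (-1)).mul_exp hΩ (-(2 * al p))
  have k8 := (((l8.comp_simMap.mul_fst hΩ).mul_exp hΩ (-1)).mul_exp hΩ (-(2 * al p))).const_mul hΩ
    (-1)
  refine (k7.add k8).congr hΩ (fun x _ => ?_) (fun x _ => ?_) (fun x _ => ?_)
  all_goals
    simp only [simW_eq, simWs_eq hp, simV, simHV, simB, exp_mul_two, Prod.mk.eta, neg_one_mul]
    simp only [simMap]
    ring

end Laws

/-! ## Localization in time -/

lemma deriv_smoothTransition_eq_zero {u : ℝ} (hu : u ∉ Icc (0 : ℝ) 1) :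
    deriv Real.smoothTransition u = 0 := by
  rcases lt_or_ge u 0 with h | h
  · have : Real.smoothTransition =ᶠ[𝓝 u] fun _ => 0 := by
      filter_upwards [Iio_mem_nhds h] with v hv
      exact Real.smoothTransition.zero_of_nonpos (le_of_lt hv)
    rw [this.deriv_eq]
    simp
  · have h1 : 1 < u := by
      by_contra h1
      exact hu ⟨h, not_lt.1 h1⟩
    have : Real.smoothTransition =ᶠ[𝓝 u] fun _ => 1 := by
      filter_upwards [Ioi_mem_nhds h1] with v hv
      exact Real.smoothTransition.one_of_one_le (le_of_lt hv)
    rw [this.deriv_eq]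
    simp

lemma continuous_deriv_smoothTransition : Continuous (deriv Real.smoothTransition) :=
  (Real.smoothTransition.contDiff (n := 1)).continuous_deriv le_rfl

lemma hasCompactSupport_deriv_smoothTransition : HasCompactSupport (deriv Real.smoothTransition) :=
  HasCompactSupport.intro isCompact_Icc fun _ => deriv_smoothTransition_eq_zero

lemma integral_deriv_smoothTransition : ∫ u, deriv Real.smoothTransition u = 1 := by
  have h1 : ∫ u in (-1 : ℝ)..2, deriv Real.smoothTransition u = 1 := by
    rw [intervalIntegral.integral_deriv_eq_sub]
    · rw [Real.smoothTransition.one_of_one_le (by norm_num),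
        Real.smoothTransition.zero_of_nonpos (by norm_num), sub_zero]
    · exact fun u _ => (Real.smoothTransition.contDiff (n := 1)).differentiable (by simp) u
    · exact continuous_deriv_smoothTransition.intervalIntegrable _ _
  rw [← h1, intervalIntegral.integral_eq_integral_of_support_subset]
  intro u hu
  by_contra hn
  refine hu (deriv_smoothTransition_eq_zero fun hh => hn ⟨?_, ?_⟩) <;> linarith [hh.1, hh.2]

/-- Derivatives of steep transitions concentrate. -/
lemma tendsto_integral_deriv_transition {N : ℕ → ℝ} (hN : Tendsto N atTop atTop)
    (hN0 : ∀ n, 0 < N n) {P : ℝ → ℝ} (hP : Continuous P) (c k : ℝ) :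
    Tendsto (fun n => ∫ s, deriv (fun s => Real.smoothTransition (N n * (s - c) - k)) s * P s)
      atTop (𝓝 (P c)) := by
  have hd (n : ℕ) (s : ℝ) : deriv (fun s => Real.smoothTransition (N n * (s - c) - k)) s
      = N n * deriv Real.smoothTransition (N n * (s - c) - k) := by
    have h1 : HasDerivAt (fun s => N n * (s - c) - k) (N n) s := by
      simpa using (((hasDerivAt_id s).sub_const c).const_mul (N n)).sub_const k
    have h2 := ((Real.smoothTransition.contDiff (n := 1)).differentiable (by simp)
      (N n * (s - c) - k)).hasDerivAt.comp s h1
    have h3 := h2.deriv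
    rw [Function.comp_def] at h3
    rw [h3, mul_comm]
  -- Substitution `u = N n * (s - c) - k`: the steep ramp becomes a fixed profile of total mass one,
  -- and the steepness moves into the argument of `P`.
  have hsub (n : ℕ) : ∫ s, deriv (fun s => Real.smoothTransition (N n * (s - c) - k)) s * P s
      = ∫ u, deriv Real.smoothTransition u * P (c + (u + k) / N n) := by
    set g := fun u => deriv Real.smoothTransition u * P (c + (u + k) / N n) with hg
    have e1 : (fun s => deriv (fun s => Real.smoothTransition (N n * (s - c) - k)) s * P s)
        = fun s => N n * g (N n * s - (N n * c + k)) := by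
      ext s
      have : c + (N n * s - (N n * c + k) + k) / N n = s := by
        field_simp [(hN0 n).ne']
        ring
      rw [hd, hg]
      simp only []
      rw [this, show N n * (s - c) - k = N n * s - (N n * c + k) by ring, mul_assoc]
    rw [e1, integral_const_mul, Measure.integral_comp_mul_left
      (fun v => g (v - (N n * c + k))), integral_sub_right_eq_self, smul_eq_mul,
      abs_of_pos (inv_pos.2 (hN0 n)), ← mul_assoc, mul_inv_cancel₀ (hN0 n).ne', one_mul]
  simp_rw [hsub]
  have hlim : P c = ∫ u, deriv Real.smoothTransition u * P c := by
    rw [integral_mul_const, integral_deriv_smoothTransition, one_mul]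
  rw [hlim]
  obtain ⟨R, hR⟩ : ∃ R, ∀ n u, u ∈ Icc (0 : ℝ) 1 → N n ≥ 1 → |P (c + (u + k) / N n)| ≤ R := by
    obtain ⟨R, hR⟩ := (isCompact_Icc (a := c - (1 + |k|)) (b := c + (1 + |k|))).exists_bound_of_continuousOn
      hP.continuousOn
    refine ⟨R, fun n u hu hn => hR _ ?_⟩
    have : |(u + k) / N n| ≤ 1 + |k| := by
      rw [abs_div, abs_of_pos (hN0 n)]
      refine (div_le_self (abs_nonneg _) hn).trans ((abs_add_le _ _).trans ?_)
      rw [abs_of_nonneg hu.1]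
      linarith [hu.2]
    constructor <;> linarith [abs_le.1 this]
  refine tendsto_integral_filter_of_dominated_convergence
    (fun u => |deriv Real.smoothTransition u| * R) ?_ ?_ ?_ ?_
  · refine Eventually.of_forall fun n => Continuous.aestronglyMeasurable ?_
    exact continuous_deriv_smoothTransition.mul (hP.comp (by fun_prop))
  · filter_upwards [hN.eventually_ge_atTop 1] with n hn
    refine ae_of_all _ fun u => ?_
    rw [norm_mul]
    by_cases hu : u ∈ Icc (0 : ℝ) 1
    · exact mul_le_mul_of_nonneg_left (hR n u hu hn) (abs_nonneg _)
    · simp [deriv_smoothTransition_eq_zero hu]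
  · exact (continuous_deriv_smoothTransition.integrable_of_hasCompactSupport
      hasCompactSupport_deriv_smoothTransition).abs.mul_const R
  · refine ae_of_all _ fun u => Tendsto.const_mul _ ?_
    refine (hP.tendsto c).comp ?_
    have : Tendsto (fun n => (u + k) / N n) atTop (𝓝 0) := tendsto_const_nhds.div_atTop hN
    simpa using this.const_add c

/-- Smooth approximations from inside of the indicator function of an interval. -/
lemma exists_time_cutoff {a b : ℝ} (hab : a < b) : ∃ θ : ℕ → ℝ → ℝ,
    (∀ n, ContDiff ℝ (⊤ : ℕ∞) (θ n)) ∧ (∀ n, HasCompactSupport (θ n)) ∧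
    (∀ n, tsupport (θ n) ⊆ Ioo a b) ∧ (∀ n s, |θ n s| ≤ 1) ∧
    (∀ s ∈ Ioo a b, Tendsto (fun n => θ n s) atTop (𝓝 1)) ∧
    ∀ P : ℝ → ℝ, Continuous P →
      Tendsto (fun n => ∫ s, deriv (θ n) s * P s) atTop (𝓝 (P a - P b)) := by
  set N : ℕ → ℝ := fun n => ((n : ℝ) + 1) * (4 / (b - a)) with hNdef
  have hba : 0 < b - a := sub_pos.2 hab
  have hN0 (n : ℕ) : 0 < N n := by positivity
  have hN : Tendsto N atTop atTop :=
    (tendsto_atTop_add_const_right _ _ tendsto_natCast_atTop_atTop).atTop_mul_const (by positivity)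
  have hN4 (n : ℕ) : 4 ≤ N n * (b - a) := by
    have : N n * (b - a) = 4 * ((n : ℝ) + 1) := by
      simp only [hNdef]; field_simp
    rw [this]
    linarith [n.cast_nonneg (α := ℝ)]
  -- With `N = N n`, `A n` rises on `[a + 1/N, a + 2/N]` and `C n` on `[b - 2/N, b - 1/N]`. The
  -- factor `4` in the definition of `N` keeps the two ramps from overlapping, and the offsets keep
  -- the support of the difference strictly inside `(a, b)`.
  set A : ℕ → ℝ → ℝ := fun n s => Real.smoothTransition (N n * (s - a) - 1) with hA
  set C : ℕ → ℝ → ℝ := fun n s => Real.smoothTransition (N n * (s - b) - (-2)) with hC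
  have hAs (n : ℕ) : ContDiff ℝ (⊤ : ℕ∞) (A n) := Real.smoothTransition.contDiff.comp (by fun_prop)
  have hCs (n : ℕ) : ContDiff ℝ (⊤ : ℕ∞) (C n) := Real.smoothTransition.contDiff.comp (by fun_prop)
  have hzero (n : ℕ) (s : ℝ) (hs : s ∉ Icc (a + 1 / N n) (b - 1 / N n)) : A n s - C n s = 0 := by
    have hi : N n * (1 / N n) = 1 := mul_one_div_cancel (hN0 n).ne'
    have h4 := hN4 n
    by_cases h : a + 1 / N n ≤ s
    · have h1 : b - 1 / N n < s := by
        by_contra h1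
        exact hs ⟨h, not_lt.1 h1⟩
      have h2 := mul_lt_mul_of_pos_left h1 (hN0 n)
      simp only [hA, hC]
      rw [Real.smoothTransition.one_of_one_le (by nlinarith),
        Real.smoothTransition.one_of_one_le (by nlinarith), sub_self]
    · have h2 := mul_lt_mul_of_pos_left (not_le.1 h) (hN0 n)
      simp only [hA, hC]
      rw [Real.smoothTransition.zero_of_nonpos (by nlinarith),
        Real.smoothTransition.zero_of_nonpos (by nlinarith), sub_self]
  have hts (n : ℕ) : tsupport (fun s => A n s - C n s) ⊆ Icc (a + 1 / N n) (b - 1 / N n) := by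
    refine closure_minimal (fun s hs => ?_) isClosed_Icc
    by_contra hn
    exact hs (hzero n s hn)
  refine ⟨fun n s => A n s - C n s, fun n => (hAs n).sub (hCs n),
    fun n => HasCompactSupport.intro isCompact_Icc (hzero n), fun n => (hts n).trans ?_,
    fun n s => ?_, fun s hs => ?_, fun P hP => ?_⟩
  · have : 0 < 1 / N n := one_div_pos.2 (hN0 n)
    exact Icc_subset_Ioo (by linarith) (by linarith)
  · have h1 := Real.smoothTransition.nonneg (N n * (s - a) - 1)
    have h2 := Real.smoothTransition.le_one (N n * (s - a) - 1)
    have h3 := Real.smoothTransition.nonneg (N n * (s - b) - (-2))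
    have h4 := Real.smoothTransition.le_one (N n * (s - b) - (-2))
    rw [abs_le]
    constructor <;> simp only [hA, hC] <;> linarith
  · have h1 : ∀ᶠ n in atTop, 2 ≤ N n * (s - a) :=
      (hN.atTop_mul_const (sub_pos.2 hs.1)).eventually_ge_atTop 2
    have h2 : ∀ᶠ n in atTop, 2 ≤ N n * (b - s) :=
      (hN.atTop_mul_const (sub_pos.2 hs.2)).eventually_ge_atTop 2
    refine tendsto_const_nhds.congr' ?_
    filter_upwards [h1, h2] with n h1 h2
    simp only [hA, hC]
    rw [Real.smoothTransition.one_of_one_le (by linarith),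
      Real.smoothTransition.zero_of_nonpos (by linarith), sub_zero]
  · have hd (n : ℕ) (s : ℝ) : deriv (fun s => A n s - C n s) s = deriv (A n) s - deriv (C n) s :=
      deriv_fun_sub ((hAs n).differentiable (by simp) s) ((hCs n).differentiable (by simp) s)
    have hint {D : ℕ → ℝ → ℝ} (n : ℕ) (hD : ContDiff ℝ (⊤ : ℕ∞) (D n)) (c k : ℝ)
        (hDe : D n = fun s => Real.smoothTransition (N n * (s - c) - k)) :
        Integrable fun s => deriv (D n) s * P s := by
      have hc : Continuous (deriv (D n)) := (hD.of_le (by simp)).continuous_deriv le_rfl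
      refine (hc.mul hP).integrable_of_hasCompactSupport (HasCompactSupport.mul_right ?_)
      refine HasCompactSupport.intro (isCompact_Icc (a := c + k / N n) (b := c + (k + 1) / N n))
        fun s hs => ?_
      have h1 : HasDerivAt (fun s => N n * (s - c) - k) (N n) s := by
        simpa using (((hasDerivAt_id s).sub_const c).const_mul (N n)).sub_const k
      have h2 := ((Real.smoothTransition.contDiff (n := 1)).differentiable (by simp)
        (N n * (s - c) - k)).hasDerivAt.comp s h1
      have h3 := h2.deriv
      rw [Function.comp_def, ← hDe] at h3
      rw [h3, deriv_smoothTransition_eq_zero, zero_mul]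
      intro hu
      refine hs ⟨?_, ?_⟩
      · have : k / N n ≤ s - c := by
          rw [div_le_iff₀ (hN0 n)]; linarith [hu.1]
        linarith
      · have : s - c ≤ (k + 1) / N n := by
          rw [le_div_iff₀ (hN0 n)]; linarith [hu.2]
        linarith
    have h1 := (tendsto_integral_deriv_transition hN hN0 hP a 1).sub
      (tendsto_integral_deriv_transition hN hN0 hP b (-2))
    refine h1.congr fun n => ?_
    rw [← integral_sub (hint (D := A) n (hAs n) a 1 rfl) (hint (D := C) n (hCs n) b (-2) rfl)]
    congr 1
    ext s
    rw [hd, sub_mul]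

/-- Smooth weights with compact support in `(-1, 1)`. -/
structure IsWeight (ψ : ℝ → ℝ) : Prop where
  contDiff : ContDiff ℝ (⊤ : ℕ∞) ψ
  compact : HasCompactSupport ψ
  subset : tsupport ψ ⊆ Ioo (-1) 1

/-- A conservation law, integrated in space and time. -/
theorem FluxLaw.integral_identity {σ a b : ℝ} {A B S : ℝ × ℝ → ℝ} (h : FluxLaw (strip σ) A B S)
    {ψ : ℝ → ℝ} (hψ : IsWeight ψ) (hσ : σ ≤ a) (hab : a < b)
    (hP : ContinuousOn (fun s => ∫ y, A (y, s) * ψ y) (Icc a b))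
    (hint : IntegrableOn (fun x => B x * deriv ψ x.1 + S x * ψ x.1) (Ioo (-1) 1 ×ˢ Ioo a b)) :
    (∫ y, A (y, b) * ψ y) - ∫ y, A (y, a) * ψ y
      = ∫ x in Ioo (-1) 1 ×ˢ Ioo a b, (B x * deriv ψ x.1 + S x * ψ x.1) := by
  obtain ⟨θ, hθs, hθc, hθt, hθ1, hθl, hθP⟩ := exists_time_cutoff hab
  set P := fun s => ∫ y, A (y, s) * ψ y with hPdef
  set R := Ioo (-1 : ℝ) 1 ×ˢ Ioo a b with hR
  have hRm : MeasurableSet R := measurableSet_Ioo.prod measurableSet_Ioo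
  have htest (n : ℕ) : IsTest (strip σ) fun x => ψ x.1 * θ n x.2 := by
    have hsub : tsupport (fun x : ℝ × ℝ => ψ x.1 * θ n x.2) ⊆ tsupport ψ ×ˢ tsupport (θ n) := by
      refine closure_minimal (fun x hx => ?_) ((isClosed_tsupport _).prod (isClosed_tsupport _))
      have := mul_ne_zero_iff.1 hx
      exact ⟨subset_tsupport _ this.1, subset_tsupport _ this.2⟩
    refine ⟨(hψ.contDiff.comp contDiff_fst).mul ((hθs n).comp contDiff_snd), ?_, ?_⟩
    · exact HasCompactSupport.of_support_subset_isCompact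
        (hψ.compact.isCompact.prod (hθc n).isCompact) ((subset_tsupport _).trans hsub)
    · exact hsub.trans (prod_mono hψ.subset ((hθt n).trans
        (Ioo_subset_Ioi_self.trans (Ioi_subset_Ioi hσ))))
  have hd (n : ℕ) (x v : ℝ × ℝ) : fderiv ℝ (fun x : ℝ × ℝ => ψ x.1 * θ n x.2) x v
      = ψ x.1 * (deriv (θ n) x.2 * v.2) + θ n x.2 * (deriv ψ x.1 * v.1) := by
    have h1 : HasFDerivAt (fun x : ℝ × ℝ => ψ x.1) _ x :=
      ((hψ.contDiff.differentiable (by simp) x.1).hasDerivAt.hasFDerivAt).comp x hasFDerivAt_fst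
    have h2 : HasFDerivAt (fun x : ℝ × ℝ => θ n x.2) _ x :=
      (((hθs n).differentiable (by simp) x.2).hasDerivAt.hasFDerivAt).comp x hasFDerivAt_snd
    rw [(h1.fun_mul h2).fderiv]
    simp
    ring
  -- a continuous extension of `P`
  set P' := fun s => P (projIcc a b hab.le s) with hP'
  have hP'c : Continuous P' :=
    (continuousOn_iff_continuous_domRestrict.1 hP).comp continuous_projIcc
  have hP'e (s : ℝ) (hs : s ∈ Icc a b) : P' s = P s := by
    simp only [hP', projIcc_of_mem hab.le hs]
  -- The law is tested with `ψ(y) θ n (s)`. The time derivative of `θ n` concentrates at the two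
  -- endpoints with opposite signs, while `θ n` itself tends to one inside.
  have key (n : ℕ) : (∫ s, deriv (θ n) s * P' s)
      + ∫ x in R, (B x * deriv ψ x.1 + S x * ψ x.1) * θ n x.2 = 0 := by
    have e := h.eq _ (htest n)
    have i1 : Integrable fun x : ℝ × ℝ => A x * (ψ x.1 * deriv (θ n) x.2) := by
      have := ((htest n).fderiv_apply (0, 1)).integrable_mul h.locA
      simpa only [hd, mul_one, mul_zero, add_zero] using this
    have i2 : Integrable fun x : ℝ × ℝ => B x * (θ n x.2 * deriv ψ x.1) := by
      have := ((htest n).fderiv_apply (1, 0)).integrable_mul h.locB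
      simpa only [hd, mul_one, mul_zero, zero_add] using this
    have i3 := (htest n).integrable_mul h.locS
    have e1 : (fun x : ℝ × ℝ => A x * fderiv ℝ (fun x : ℝ × ℝ => ψ x.1 * θ n x.2) x (0, 1)
        + B x * fderiv ℝ (fun x : ℝ × ℝ => ψ x.1 * θ n x.2) x (1, 0) + S x * (ψ x.1 * θ n x.2))
        = fun x => A x * (ψ x.1 * deriv (θ n) x.2)
          + (B x * (θ n x.2 * deriv ψ x.1) + S x * (ψ x.1 * θ n x.2)) := by
      ext x
      simp only [hd]
      ring
    have i23 : Integrable fun x : ℝ × ℝ => B x * (θ n x.2 * deriv ψ x.1)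
        + S x * (ψ x.1 * θ n x.2) := i2.add i3
    rw [e1, integral_add i1 i23] at e
    refine Eq.trans ?_ e
    congr 1
    · rw [Measure.volume_eq_prod] at i1 ⊢
      rw [integral_prod_symm _ i1]
      congr 1
      ext s
      by_cases hs : s ∈ Icc a b
      · rw [hP'e s hs, hPdef, ← integral_const_mul]
        congr 1
        ext y
        ring
      · have : deriv (θ n) s = 0 := image_eq_zero_of_notMem_tsupport fun hh =>
          hs (Ioo_subset_Icc_self (hθt n (tsupport_deriv_subset hh)))
        simp [this]
    · refine Eq.trans (setIntegral_congr_fun hRm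
        (g := fun x => B x * (θ n x.2 * deriv ψ x.1) + S x * (ψ x.1 * θ n x.2)) fun x _ => ?_)
        (setIntegral_eq_integral_of_forall_compl_eq_zero ?_)
      · simp only []
        ring
      · intro x hx
        have : ψ x.1 = 0 ∧ deriv ψ x.1 = 0 ∨ θ n x.2 = 0 := by
          by_cases h1 : x.1 ∈ Ioo (-1 : ℝ) 1
          · refine Or.inr (image_eq_zero_of_notMem_tsupport fun hh => hx ⟨h1, hθt n hh⟩)
          · exact Or.inl ⟨image_eq_zero_of_notMem_tsupport fun hh => h1 (hψ.subset hh),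
              image_eq_zero_of_notMem_tsupport fun hh =>
                h1 (hψ.subset (tsupport_deriv_subset hh))⟩
        rcases this with ⟨h1, h2⟩ | h1 <;> simp [*]
  have l1 := hθP P' hP'c
  have l2 : Tendsto (fun n => ∫ x in R, (B x * deriv ψ x.1 + S x * ψ x.1) * θ n x.2) atTop
      (𝓝 (∫ x in R, (B x * deriv ψ x.1 + S x * ψ x.1))) := by
    refine tendsto_integral_of_dominated_convergence
      (fun x => |B x * deriv ψ x.1 + S x * ψ x.1|) (fun n => ?_) hint.abs (fun n => ?_) ?_
    · exact hint.1.mul ((hθs n).continuous.comp continuous_snd).aestronglyMeasurable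
    · refine ae_of_all _ fun x => ?_
      rw [norm_mul]
      exact mul_le_of_le_one_right (norm_nonneg _) (hθ1 n x.2)
    · filter_upwards [ae_restrict_mem hRm] with x hx
      simpa using (hθl x.2 hx.2).const_mul (B x * deriv ψ x.1 + S x * ψ x.1)
  have := tendsto_nhds_unique (l1.add l2) (tendsto_const_nhds.congr fun n => (key n).symm)
  rw [hP'e a ⟨le_rfl, hab.le⟩, hP'e b ⟨hab.le, le_rfl⟩] at this
  linarith

/-! ## Continuity in time of weighted integrals -/

section L2

variable {α ι : Type*} {m : MeasurableSpace α} {μ : Measure α} {l : Filter ι}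

/-- `F G - f g = (F - f) G + f (G - g)`, and Hölder's inequality bounds both terms in `L¹`. -/
lemma tendsto_integral_mul_of_tendsto_eLpNorm {F G : ι → α → ℝ} {f g : α → ℝ}
    (hF : ∀ᶠ i in l, MemLp (F i) 2 μ) (hf : MemLp f 2 μ)
    (hFf : Tendsto (fun i => eLpNorm (fun x => F i x - f x) 2 μ) l (𝓝 0))
    (hG : ∀ᶠ i in l, MemLp (G i) 2 μ) (hg : MemLp g 2 μ)
    (hGg : Tendsto (fun i => eLpNorm (fun x => G i x - g x) 2 μ) l (𝓝 0)) :
    Tendsto (fun i => ∫ x, F i x * G i x ∂μ) l (𝓝 (∫ x, f x * g x ∂μ)) := by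
  refine tendsto_integral_of_L1' (fun x => f x * g x) (hf.1.mul hg.1) ?_ ?_
  · filter_upwards [hF, hG] with i h1 h2
    exact h1.integrable_mul h2
  have hz : Tendsto (fun i => eLpNorm (fun x => F i x - f x) 2 μ
      * (eLpNorm (fun x => G i x - g x) 2 μ + eLpNorm g 2 μ)
      + eLpNorm f 2 μ * eLpNorm (fun x => G i x - g x) 2 μ) l (𝓝 0) := by
    have h1 : Tendsto (fun i => eLpNorm (fun x => G i x - g x) 2 μ + eLpNorm g 2 μ) l
        (𝓝 (eLpNorm g 2 μ)) := by simpa using hGg.add_const (eLpNorm g 2 μ)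
    have h2 := ENNReal.Tendsto.mul hFf (Or.inr hg.eLpNorm_ne_top) h1 (Or.inr (by simp))
    have h3 := ENNReal.Tendsto.const_mul (a := eLpNorm f 2 μ) hGg (Or.inr hf.eLpNorm_ne_top)
    simpa using h2.add h3
  refine tendsto_of_tendsto_of_tendsto_of_le_of_le' tendsto_const_nhds hz
    (Eventually.of_forall fun i => zero_le) ?_
  filter_upwards [hF, hG] with i h1 h2
  have e : (fun x => F i x * G i x) - (fun x => f x * g x)
      = (fun x => F i x - f x) • G i + f • (fun x => G i x - g x) := by
    ext x
    simp
    ring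
  rw [e]
  refine (eLpNorm_add_le ((h1.1.sub hf.1).smul h2.1) (hf.1.smul (h2.1.sub hg.1)) le_rfl).trans ?_
  refine add_le_add ((eLpNorm_smul_le_mul_eLpNorm (p := 2) (q := 2) h2.1 (h1.1.sub hf.1)).trans ?_)
    (eLpNorm_smul_le_mul_eLpNorm (p := 2) (q := 2) (h2.1.sub hg.1) hf.1)
  refine mul_le_mul_right ?_ _
  have e2 : G i = (fun x => G i x - g x) + g := by ext x; simp
  conv_lhs => rw [e2]
  exact eLpNorm_add_le (h2.1.sub hg.1) hg.1 (by norm_num)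

/-- Needed for weights that are fixed in `y` and therefore move in `X` as `s` varies. In `(F - f) η
+ f (η - h)` the factor `η` is eventually bounded by `M + 1`, and `η - h` is uniformly small. -/
lemma tendsto_eLpNorm_mul_of_uniform {F η : ι → α → ℝ} {f h : α → ℝ} {M : ℝ}
    (hF : ∀ᶠ i in l, MemLp (F i) 2 μ) (hf : MemLp f 2 μ)
    (hFf : Tendsto (fun i => eLpNorm (fun x => F i x - f x) 2 μ) l (𝓝 0))
    (hη : ∀ i, AEStronglyMeasurable (η i) μ) (hh : AEStronglyMeasurable h μ)
    (hM : ∀ x, |h x| ≤ M)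
    (hu : ∀ ε > 0, ∀ᶠ i in l, ∀ᵐ x ∂μ, |η i x - h x| ≤ ε) :
    Tendsto (fun i => eLpNorm (fun x => F i x * η i x - f x * h x) 2 μ) l (𝓝 0) := by
  refine ENNReal.tendsto_nhds_zero.2 fun ε hε => ?_
  have hε2 : ε / 2 ≠ 0 := (ENNReal.half_pos hε.ne').ne'
  obtain ⟨δ, hδ, hδf⟩ := ENNReal.exists_nnreal_pos_mul_lt hf.eLpNorm_ne_top hε2
  have h1 : Tendsto (fun i => ENNReal.ofReal (M + 1) * eLpNorm (fun x => F i x - f x) 2 μ) l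
      (𝓝 0) := by
    simpa using ENNReal.Tendsto.const_mul (a := ENNReal.ofReal (M + 1)) hFf (Or.inr (by simp))
  filter_upwards [hF, ENNReal.tendsto_nhds_zero.1 h1 _ (ENNReal.half_pos hε.ne'), hu 1 one_pos,
    hu δ hδ] with i hi1 hi2 hi3 hi4
  have e : (fun x => F i x * η i x - f x * h x)
      = (fun x => (F i x - f x) * η i x) + fun x => f x * (η i x - h x) := by
    ext x
    simp
    ring
  rw [e]
  refine (eLpNorm_add_le ((hi1.1.sub hf.1).mul (hη i)) (hf.1.mul ((hη i).sub hh))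
    (by norm_num)).trans ?_
  rw [← ENNReal.add_halves ε]
  refine add_le_add ((eLpNorm_le_mul_eLpNorm_of_ae_le_mul (g := fun x => F i x - f x)
    (c := M + 1) ?_ 2).trans hi2)
    ((eLpNorm_le_mul_eLpNorm_of_ae_le_mul (g := f) (c := δ) ?_ 2).trans ?_)
  · filter_upwards [hi3] with x hx
    simp only [Pi.mul_apply, Pi.sub_apply]
    rw [norm_mul, mul_comm]
    refine mul_le_mul_of_nonneg_right ?_ (norm_nonneg _)
    have : |η i x| ≤ |η i x - h x| + |h x| := by
      have := abs_add_le (η i x - h x) (h x)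
      simpa using this
    rw [Real.norm_eq_abs]
    linarith [hM x]
  · filter_upwards [hi4] with x hx
    simp only [Pi.mul_apply, Pi.sub_apply]
    rw [norm_mul, mul_comm]
    exact mul_le_mul_of_nonneg_right hx (norm_nonneg _)
  · simpa using hδf.le

end L2

/-- Continuity in time with values in `L²_loc` under the graph of `T`. -/
structure ContL2 (T : ℝ → ℝ) (V : ℝ → ℝ → ℝ) : Prop where
  memLp : ∀ a b t, 0 < a → a ≤ b → 0 ≤ t → (∀ X ∈ Icc a b, t < T X) →
    MemLp (fun X => V X t) 2 (volume.restrict (Icc a b))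
  tendsto : ∀ a b t, 0 < a → a ≤ b → 0 ≤ t → (∀ X ∈ Icc a b, t < T X) →
    Tendsto (fun τ => eLpNorm (fun X => V X τ - V X t) 2 (volume.restrict (Icc a b)))
      (𝓝[Ici 0] t) (𝓝 0)

lemma SliceL2.contL2 {T : ℝ → ℝ} {V : ℝ → ℝ → ℝ} (h : SliceL2 T V) : ContL2 T V :=
  ⟨h.memLp, h.tendsto⟩

/-- A time before which a compact interval stays under the curve. -/
lemma exists_gt_forall_lt {T : ℝ → ℝ} (hT : LipschitzOnWith 1 T (Ioi 0)) {a b t : ℝ} (ha : 0 < a)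
    (hab : a ≤ b) (ht : ∀ X ∈ Icc a b, t < T X) : ∃ t' > t, ∀ X ∈ Icc a b, t' < T X := by
  have hc : ContinuousOn T (Icc a b) :=
    hT.continuousOn.mono fun X hX => ha.trans_le hX.1
  obtain ⟨x, hx, hm⟩ := isCompact_Icc.exists_isMinOn ⟨a, le_rfl, hab⟩ hc
  obtain ⟨t', h1, h2⟩ := exists_between (ht x hx)
  exact ⟨t', h1, fun X hX => h2.trans_le (hm hX)⟩

/-- A continuous function is uniformly continuous in time over a compact interval in `X`, as long as
the interval stays under the graph for slightly later times; uniform closeness on a bounded interval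
is `L²` closeness. -/
lemma ContL2.of_continuousOn {T : ℝ → ℝ} {V : ℝ → ℝ → ℝ} (hT : LipschitzOnWith 1 T (Ioi 0))
    (hV : ContinuousOn (fun z : ℝ × ℝ => V z.1 z.2) (underGraph T)) : ContL2 T V := by
  have hslice (a b t : ℝ) (ha : 0 < a) (ht : 0 ≤ t) (hlt : ∀ X ∈ Icc a b, t < T X) :
      ContinuousOn (fun X => V X t) (Icc a b) :=
    hV.comp (by fun_prop : Continuous fun X : ℝ => (X, t)).continuousOn
      fun X hX => ⟨ha.trans_le hX.1, ht, hlt X hX⟩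
  refine ⟨fun a b t ha hab ht hlt => ?_, fun a b t ha hab ht hlt => ?_⟩
  · have hc := hslice a b t ha ht hlt
    obtain ⟨C, hC⟩ := isCompact_Icc.exists_bound_of_continuousOn hc
    refine MemLp.of_bound (hc.aestronglyMeasurable measurableSet_Icc) C ?_
    exact (ae_restrict_iff' measurableSet_Icc).2 (ae_of_all _ hC)
  · obtain ⟨t', htt, ht'⟩ := exists_gt_forall_lt hT ha hab hlt
    refine ENNReal.tendsto_nhds_zero.2 fun ε hε => ?_
    set K := volume.restrict (Icc a b) univ ^ (2 : ENNReal).toReal⁻¹ with hK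
    have hKt : K ≠ ⊤ := by simp [hK]
    clear_value K
    obtain ⟨δ, hδ, hδf⟩ := ENNReal.exists_nnreal_pos_mul_lt hKt hε.ne'
    obtain ⟨v, hv, hvu⟩ := isCompact_Icc.mem_uniformity_of_prod (f := fun τ X => V X τ)
      (s := Ici 0 ∩ Iio t') (k := Icc a b) (q := t) (u := {z | dist z.1 z.2 < δ})
      (hV.comp (by fun_prop : Continuous fun z : ℝ × ℝ => (z.2, z.1)).continuousOn
        fun z hz => ⟨ha.trans_le hz.2.1, hz.1.1, (show z.1 < t' from hz.1.2).trans (ht' _ hz.2)⟩)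
      ⟨ht, htt⟩ (Metric.dist_mem_uniformity (by exact_mod_cast hδ))
    rw [nhdsWithin_inter_of_mem' (mem_nhdsWithin_of_mem_nhds (Iio_mem_nhds htt))] at hv
    filter_upwards [hv] with τ hτ
    refine (eLpNorm_le_of_ae_bound (C := δ) ((ae_restrict_iff' measurableSet_Icc).2
      (ae_of_all _ fun X hX => (hvu τ hτ X hX).le))).trans ?_
    rw [mul_comm, ENNReal.ofReal_coe_nnreal, ← hK]
    exact hδf.le

/-- Integrals over `-1 < y < 1` with continuous compactly supported weights are continuous in
time. -/
def SliceCont (σ : ℝ) (A : ℝ × ℝ → ℝ) : Prop :=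
  ∀ ψ : ℝ → ℝ, Continuous ψ → (∃ c < 1, ∀ y, c < |y| → ψ y = 0) →
    (∀ s, σ ≤ s → Integrable fun y => A (y, s) * ψ y) ∧
    ContinuousOn (fun s => ∫ y, A (y, s) * ψ y) (Ici σ)

namespace SliceCont

variable {σ : ℝ} {A A' : ℝ × ℝ → ℝ}

lemma add (h : SliceCont σ A) (h' : SliceCont σ A') : SliceCont σ fun x => A x + A' x := by
  intro ψ hψ hc
  obtain ⟨h1, h2⟩ := h ψ hψ hc
  obtain ⟨h1', h2'⟩ := h' ψ hψ hc
  refine ⟨fun s hs => ?_, (h2.add h2').congr fun s hs => ?_⟩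
  · simp only [add_mul]
    exact (h1 s hs).add (h1' s hs)
  · simp only [Pi.add_apply, add_mul]
    exact integral_add (h1 s hs) (h1' s hs)

/-- The factor in `y` is absorbed into the weight, the factor in `s` comes out of the integral. -/
lemma coeff_mul (h : SliceCont σ A) {c k : ℝ → ℝ} (hc : Continuous c) (hk : Continuous k) :
    SliceCont σ fun x => c x.2 * k x.1 * A x := by
  intro ψ hψ ⟨r, hr, h0⟩
  obtain ⟨h1, h2⟩ := h (fun y => k y * ψ y) (hk.mul hψ) ⟨r, hr, fun y hy => by simp [h0 y hy]⟩
  have e (s : ℝ) : (fun y => c s * k y * A (y, s) * ψ y)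
      = fun y => c s * (A (y, s) * (k y * ψ y)) := by ext y; ring
  refine ⟨fun s hs => ?_, (hc.continuousOn.mul h2).congr fun s hs => ?_⟩
  · simp only [e]
    exact (h1 s hs).const_mul _
  · simp only [e]
    exact integral_const_mul _ _

lemma congr (h : SliceCont σ A) (he : ∀ x, A' x = A x) : SliceCont σ A' := by
  rwa [funext he]

/-- Functions that are continuous in space and time. -/
lemma of_continuousOn (hA : ContinuousOn A (Ioo (-1) 1 ×ˢ Ici σ)) : SliceCont σ A := by
  intro ψ hψ ⟨r, hr, h0⟩
  have hsub : Icc (-r) r ⊆ Ioo (-1) 1 := fun y hy => ⟨by linarith [hy.1], by linarith [hy.2]⟩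
  have hprod : ContinuousOn (fun x : ℝ × ℝ => A x * ψ x.1) (Icc (-r) r ×ˢ Ici σ) :=
    (hA.mono (prod_mono hsub le_rfl)).mul (hψ.comp continuous_fst).continuousOn
  have hsupp (s : ℝ) : (fun y => A (y, s) * ψ y)
      = (Icc (-r) r).indicator fun y => A (y, s) * ψ y := by
    symm
    rw [indicator_eq_self]
    intro y hy
    by_contra hn
    rw [mem_Icc, ← abs_le] at hn
    exact hy (by simp [h0 y (not_le.1 hn)])
  have hsl (s : ℝ) (hs : σ ≤ s) : ContinuousOn (fun y => A (y, s) * ψ y) (Icc (-r) r) :=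
    hprod.comp (by fun_prop : Continuous fun y : ℝ => (y, s)).continuousOn fun y hy => ⟨hy, hs⟩
  have hint (s : ℝ) (hs : σ ≤ s) : Integrable fun y => A (y, s) * ψ y := by
    rw [hsupp s, integrable_indicator_iff measurableSet_Icc]
    exact (hsl s hs).integrableOn_Icc
  refine ⟨hint, fun s₀ hs₀ => ?_⟩
  have hs₀' : σ ≤ s₀ := hs₀
  obtain ⟨C, hC⟩ := (isCompact_Icc.prod isCompact_Icc).exists_bound_of_continuousOn
    (hprod.mono (prod_mono le_rfl (Icc_subset_Ici_self : Icc σ (s₀ + 1) ⊆ Ici σ)))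
  refine tendsto_integral_filter_of_dominated_convergence
    ((Icc (-r) r).indicator fun _ => C) ?_ ?_ ?_ ?_
  · filter_upwards [self_mem_nhdsWithin] with s hs
    exact (hint s hs).1
  · filter_upwards [self_mem_nhdsWithin, mem_nhdsWithin_of_mem_nhds (Iio_mem_nhds
      (show s₀ < s₀ + 1 by linarith))] with s hs hs'
    refine ae_of_all _ fun y => ?_
    have := congrFun (hsupp s) y
    rw [this, norm_indicator_eq_indicator_norm]
    exact indicator_le_indicator' fun hy => hC (y, s) ⟨hy, hs, (show s < s₀ + 1 from hs').le⟩
  · rw [integrable_indicator_iff measurableSet_Icc]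
    exact integrableOn_const (by simp)
  · refine ae_of_all _ fun y => ?_
    by_cases hy : y ∈ Icc (-r) r
    · exact (hprod (y, s₀) ⟨hy, hs₀'⟩).tendsto.comp (tendsto_nhdsWithin_iff.2
        ⟨((by fun_prop : Continuous fun s : ℝ => (y, s)).tendsto s₀).mono_left nhdsWithin_le_nhds,
          by filter_upwards [self_mem_nhdsWithin] with s hs using ⟨hy, hs⟩⟩)
    · have : ψ y = 0 := by
        rw [mem_Icc, ← abs_le] at hy
        exact h0 y (not_le.1 hy)
      simp only [this, mul_zero]
      exact tendsto_const_nhds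

/-- Products of two functions that are continuous in time with values in `L²_loc`. -/
lemma mul {T : ℝ → ℝ} {X₀ T₀ : ℝ} (hv : IsVertex T X₀ T₀ σ) {V W : ℝ → ℝ → ℝ}
    (hV : ContL2 T V) (hW : ContL2 T W) :
    SliceCont σ fun x => V (simMap X₀ T₀ x).1 (simMap X₀ T₀ x).2
      * W (simMap X₀ T₀ x).1 (simMap X₀ T₀ x).2 := by
  intro ψ hψ ⟨r, hr, h0⟩
  wlog hr0 : 0 < r generalizing r
  · exact this (1 / 2) (by norm_num) (fun y hy => h0 y (by linarith)) (by norm_num)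
  -- Two radii give slack on both sides. For `s` near `s₀` the fixed window `|X - X₀| ≤ r' e^(-s₀)`
  -- contains the support of the moving weight, which has radius `r e^(-s)`, and still lies inside
  -- the section `|X - X₀| < e^(-s)` of the cone.
  obtain ⟨r', hrr', hr'⟩ := exists_between hr
  have hMψ : ∃ M, ∀ y, |ψ y| ≤ M := by
    obtain ⟨M, hM⟩ := isCompact_Icc.exists_bound_of_continuousOn (s := Icc (-r) r) hψ.continuousOn
    refine ⟨max M 0, fun y => ?_⟩
    by_cases hy : |y| ≤ r
    · exact (hM y (abs_le.1 hy)).trans (le_max_left _ _)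
    · rw [h0 y (not_le.1 hy)]; simp
  obtain ⟨M, hM⟩ := hMψ
  set a : ℝ → ℝ := fun s => X₀ - r' * Real.exp (-s) with ha
  set b : ℝ → ℝ := fun s => X₀ + r' * Real.exp (-s) with hb
  set F : ℝ → ℝ → ℝ := fun s X => V X (T₀ - Real.exp (-s)) * W X (T₀ - Real.exp (-s))
    * ψ ((X - X₀) * Real.exp s) with hF
  have hcomp (s y : ℝ) : V (simMap X₀ T₀ (y, s)).1 (simMap X₀ T₀ (y, s)).2
      * W (simMap X₀ T₀ (y, s)).1 (simMap X₀ T₀ (y, s)).2 * ψ y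
      = F s (X₀ + Real.exp (-s) * y) := by
    have : Real.exp (-s) * y * Real.exp s = y := by
      rw [mul_right_comm, ← Real.exp_add]; simp
    simp only [simMap, hF, add_sub_cancel_left, mul_comm y, this]
  have habs (s X : ℝ) (hX : X ∈ Icc (a s) (b s)) : |X - X₀| < Real.exp (-s) := by
    have : |X - X₀| ≤ r' * Real.exp (-s) := by
      rw [abs_le]; constructor <;> [linarith [hX.1]; linarith [hX.2]]
    have h2 := Real.exp_pos (-s)
    nlinarith
  have hab (s : ℝ) : a s ≤ b s := by
    have := Real.exp_pos (-s)
    simp only [ha, hb]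
    nlinarith
  have hexp {s : ℝ} (hs : σ ≤ s) : Real.exp (-s) ≤ Real.exp (-σ) := Real.exp_le_exp.2 (by linarith)
  have hpos {s X : ℝ} (hs : σ ≤ s) (hX : X ∈ Icc (a s) (b s)) : 0 < X := by
    linarith [hv.half_lt (habs s X hX) (hexp hs), hv.X_pos]
  have ha0 {s : ℝ} (hs : σ ≤ s) : 0 < a s := hpos hs ⟨le_rfl, hab s⟩
  have ht0 {s : ℝ} (hs : σ ≤ s) : 0 ≤ T₀ - Real.exp (-s) := by
    linarith [hexp hs, hv.exp_le_T₀]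
  have hlt {s s' X : ℝ} (hs : σ ≤ s) (hX : X ∈ Icc (a s) (b s))
      (hs' : r' * Real.exp (-s) < Real.exp (-s')) : T₀ - Real.exp (-s') < T X := by
    refine hv.lt_T (hpos hs hX) ?_
    rw [sub_sub_cancel]
    refine lt_of_le_of_lt ?_ hs'
    rw [abs_le]; constructor <;> [linarith [hX.1]; linarith [hX.2]]
  have hself (s : ℝ) : r' * Real.exp (-s) < Real.exp (-s) := by
    have h2 := Real.exp_pos (-s)
    nlinarith
  have hψm (s : ℝ) : Continuous fun X => ψ ((X - X₀) * Real.exp s) := by fun_prop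
  have hsupp {s s₀ : ℝ} (hs : r * Real.exp (-s) ≤ r' * Real.exp (-s₀)) :
      F s = (Icc (a s₀) (b s₀)).indicator (F s) := by
    symm
    rw [indicator_eq_self]
    intro X hX
    by_contra hn
    refine hX ?_
    have : ψ ((X - X₀) * Real.exp s) = 0 := by
      refine h0 _ ?_
      have h3 : ¬ |X - X₀| ≤ r' * Real.exp (-s₀) := fun hh => hn (by
        rw [abs_le] at hh; constructor <;> simp only [ha, hb] <;> linarith [hh.1, hh.2])
      rw [abs_mul, abs_of_pos (Real.exp_pos s)]
      have h4 := Real.exp_pos s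
      have h5 : Real.exp (-s) * Real.exp s = 1 := by rw [← Real.exp_add]; simp
      have h6 : r * Real.exp (-s) < |X - X₀| := hs.trans_lt (not_le.1 h3)
      calc r = r * Real.exp (-s) * Real.exp s := by rw [mul_assoc, h5, mul_one]
        _ < _ := mul_lt_mul_of_pos_right h6 h4
    simp only [hF, this, mul_zero]
  have hFi {s : ℝ} (hs : σ ≤ s) : Integrable (F s) := by
    have h2 := Real.exp_pos (-s)
    rw [hsupp (s := s) (s₀ := s) (by nlinarith), integrable_indicator_iff measurableSet_Icc]
    have m1 := hV.memLp _ _ _ (ha0 hs) (hab s) (ht0 hs) fun X hX => hlt hs hX (hself s)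
    have m2 := hW.memLp _ _ _ (ha0 hs) (hab s) (ht0 hs) fun X hX => hlt hs hX (hself s)
    exact (m1.integrable_mul m2).mul_bdd (c := M) (hψm s).aestronglyMeasurable
      (ae_of_all _ fun X => hM _)
  refine ⟨fun s hs => ?_, ?_⟩
  · simp only [hcomp]
    exact ((hFi hs).comp_add_left X₀).comp_mul_left' (Real.exp_pos _).ne'
  have hI (s : ℝ) : ∫ y, V (simMap X₀ T₀ (y, s)).1 (simMap X₀ T₀ (y, s)).2
      * W (simMap X₀ T₀ (y, s)).1 (simMap X₀ T₀ (y, s)).2 * ψ y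
      = Real.exp s * ∫ X, F s X := by
    simp only [hcomp]
    rw [Measure.integral_comp_mul_left (fun X => F s (X₀ + X)), integral_add_left_eq_self,
      ← Real.exp_neg, neg_neg, abs_of_pos (Real.exp_pos s), smul_eq_mul]
  simp only [hI]
  refine Real.continuous_exp.continuousOn.mul fun s₀ hs₀ => ?_
  have hs₀' : σ ≤ s₀ := hs₀
  have hE : Tendsto (fun s : ℝ => Real.exp (-s)) (𝓝[Ici σ] s₀) (𝓝 (Real.exp (-s₀))) :=
    ((by fun_prop : Continuous fun s : ℝ => Real.exp (-s)).tendsto s₀).mono_left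
      nhdsWithin_le_nhds
  have ev1 : ∀ᶠ s in 𝓝[Ici σ] s₀, r' * Real.exp (-s₀) < Real.exp (-s) :=
    hE.eventually (lt_mem_nhds (hself s₀))
  have ev2 : ∀ᶠ s in 𝓝[Ici σ] s₀, r * Real.exp (-s) < r' * Real.exp (-s₀) :=
    (hE.const_mul r).eventually (gt_mem_nhds (by
      have h2 := Real.exp_pos (-s₀)
      nlinarith))
  have hτ : Tendsto (fun s : ℝ => T₀ - Real.exp (-s)) (𝓝[Ici σ] s₀)
      (𝓝[Ici 0] (T₀ - Real.exp (-s₀))) := by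
    refine tendsto_nhdsWithin_iff.2 ⟨hE.const_sub T₀, ?_⟩
    filter_upwards [self_mem_nhdsWithin] with s hs using ht0 hs
  have key : Tendsto (fun s => ∫ X in Icc (a s₀) (b s₀), F s X) (𝓝[Ici σ] s₀)
      (𝓝 (∫ X in Icc (a s₀) (b s₀), F s₀ X)) := by
    have hmem {Z : ℝ → ℝ → ℝ} (hZ : ContL2 T Z) : ∀ᶠ s in 𝓝[Ici σ] s₀,
        MemLp (fun X => Z X (T₀ - Real.exp (-s))) 2 (volume.restrict (Icc (a s₀) (b s₀))) := by
      filter_upwards [self_mem_nhdsWithin, ev1] with s hs h1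
      exact hZ.memLp _ _ _ (ha0 hs₀') (hab s₀) (ht0 hs) fun X hX => hlt hs₀' hX h1
    have hmem₀ {Z : ℝ → ℝ → ℝ} (hZ : ContL2 T Z) :
        MemLp (fun X => Z X (T₀ - Real.exp (-s₀))) 2 (volume.restrict (Icc (a s₀) (b s₀))) :=
      hZ.memLp _ _ _ (ha0 hs₀') (hab s₀) (ht0 hs₀') fun X hX => hlt hs₀' hX (hself s₀)
    have hlim {Z : ℝ → ℝ → ℝ} (hZ : ContL2 T Z) := (hZ.tendsto _ _ _ (ha0 hs₀') (hab s₀)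
      (ht0 hs₀') fun X hX => hlt hs₀' hX (hself s₀)).comp hτ
    have hwη := tendsto_eLpNorm_mul_of_uniform (hmem hW) (hmem₀ hW) (hlim hW)
      (η := fun s X => ψ ((X - X₀) * Real.exp s)) (h := fun X => ψ ((X - X₀) * Real.exp s₀))
      (M := M) (fun s => (hψm s).aestronglyMeasurable) (hψm s₀).aestronglyMeasurable
      (fun X => hM _) (fun ε hε => by
        obtain ⟨v, hv', hvu⟩ := (isCompact_Icc (a := a s₀) (b := b s₀)).mem_uniformity_of_prod
          (f := fun s X => ψ ((X - X₀) * Real.exp s)) (s := Ici σ) (q := s₀)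
          (u := {z | dist z.1 z.2 < ε})
          (by fun_prop : Continuous fun x : ℝ × ℝ => ψ ((x.2 - X₀) * Real.exp x.1)).continuousOn
          hs₀' (Metric.dist_mem_uniformity hε)
        filter_upwards [hv'] with s hs
        exact (ae_restrict_iff' measurableSet_Icc).2 (ae_of_all _ fun X hX => (hvu s hs X hX).le))
    have hmη (s : ℝ) (h : MemLp (fun X => W X (T₀ - Real.exp (-s))) 2
        (volume.restrict (Icc (a s₀) (b s₀)))) :
        MemLp (fun X => W X (T₀ - Real.exp (-s)) * ψ ((X - X₀) * Real.exp s)) 2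
          (volume.restrict (Icc (a s₀) (b s₀))) :=
      MemLp.of_le_mul (c := M) h (h.1.mul (hψm s).aestronglyMeasurable) (ae_of_all _ fun X => by
        rw [norm_mul, mul_comm]
        exact mul_le_mul_of_nonneg_right (hM _) (norm_nonneg _))
    have := tendsto_integral_mul_of_tendsto_eLpNorm (hmem hV) (hmem₀ hV) (hlim hV)
      ((hmem hW).mono fun s => hmη s) (hmη s₀ (hmem₀ hW)) hwη
    simpa only [hF, mul_assoc] using this
  have e₀ : ∫ X, F s₀ X = ∫ X in Icc (a s₀) (b s₀), F s₀ X := by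
    rw [← integral_indicator measurableSet_Icc, ← hsupp]
    have h2 := Real.exp_pos (-s₀)
    nlinarith
  rw [ContinuousWithinAt, e₀]
  refine key.congr' ?_
  filter_upwards [ev2] with s h2
  rw [← integral_indicator measurableSet_Icc, ← hsupp h2.le]

end SliceCont

/-! ## The weight and a Hardy inequality -/

section Weight

variable {p y : ℝ}

lemma one_sub_sq_pos (hy : y ∈ Ioo (-1 : ℝ) 1) : 0 < 1 - y ^ 2 := by
  nlinarith [hy.1, hy.2]

lemma rho_eq : rho p y = (1 - y ^ 2) ^ al p := rfl

lemma rho_pos (hy : y ∈ Ioo (-1 : ℝ) 1) : 0 < rho p y :=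
  Real.rpow_pos_of_pos (one_sub_sq_pos hy) _

lemma rho_le_one (hp : 1 < p) (hy : y ∈ Ioo (-1 : ℝ) 1) : rho p y ≤ 1 :=
  Real.rpow_le_one (one_sub_sq_pos hy).le (by linarith [sq_nonneg y]) (al_pos hp).le

lemma hasDerivAt_rho (hy : y ∈ Ioo (-1 : ℝ) 1) :
    HasDerivAt (rho p) (-(2 * al p * y) * (rho p y / (1 - y ^ 2))) y := by
  have h0 := one_sub_sq_pos hy
  have h1 : HasDerivAt (fun y : ℝ => 1 - y ^ 2) (-(2 * y)) y := by
    simpa using (hasDerivAt_pow 2 y).const_sub 1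
  have h2 := h1.rpow_const (p := al p) (Or.inl h0.ne')
  refine h2.congr_deriv ?_
  rw [Real.rpow_sub_one h0.ne', rho_eq]
  ring

lemma continuousOn_rho : ContinuousOn (rho p) (Ioo (-1) 1) := fun _ hy =>
  (hasDerivAt_rho hy).continuousAt.continuousWithinAt

lemma rho_neg : rho p (-y) = rho p y := by simp [rho]

lemma continuous_rho (hp : 1 < p) : Continuous (rho p) :=
  (by fun_prop : Continuous fun y : ℝ => 1 - y ^ 2).rpow_const fun _ => Or.inr (al_pos hp).le

lemma integrableOn_rho (hp : 1 < p) : IntegrableOn (rho p) (Ioo (-1) 1) :=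
  ((continuous_rho hp).integrableOn_Icc).mono_set Ioo_subset_Icc_self

lemma continuousOn_rho_div : ContinuousOn (fun y => rho p y / (1 - y ^ 2)) (Ioo (-1) 1) :=
  continuousOn_rho.div (by fun_prop) fun _ hy => (one_sub_sq_pos hy).ne'

lemma Icc_neg_subset {c : ℝ} (hc : c < 1) : Icc (-c) c ⊆ Ioo (-1 : ℝ) 1 := fun y hy =>
  ⟨by linarith [hy.1], by linarith [hy.2]⟩

end Weight

/-- `u` is an indefinite integral of `v` on `(-1, 1)`. -/
def IsPrimitive (u v : ℝ → ℝ) : Prop :=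
  ∀ a b, -1 < a → a ≤ b → b < 1 → u b - u a = ∫ y in a..b, v y

/-- On compact subintervals the weight is bounded away from zero. -/
lemma integrableOn_Icc_of_sq {p c : ℝ} (hc : c < 1) {v : ℝ → ℝ}
    (hvm : AEStronglyMeasurable v (volume.restrict (Ioo (-1) 1)))
    (hv : IntegrableOn (fun y => (1 - y ^ 2) * v y ^ 2 * rho p y) (Ioo (-1) 1)) :
    IntegrableOn (fun y => v y ^ 2) (Icc (-c) c) ∧ IntegrableOn v (Icc (-c) c) := by
  have hsub := Icc_neg_subset hc
  have hsq : IntegrableOn (fun y => v y ^ 2) (Icc (-c) c) := by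
    have h1 : ContinuousOn (fun y => ((1 - y ^ 2) * rho p y)⁻¹) (Icc (-c) c) := by
      refine ContinuousOn.inv₀ ((by fun_prop : Continuous fun y : ℝ => 1 - y ^ 2).continuousOn.mul
        (continuousOn_rho.mono hsub)) fun y hy => ?_
      exact (mul_pos (one_sub_sq_pos (hsub hy)) (rho_pos (hsub hy))).ne'
    refine ((hv.mono_set hsub).continuousOn_mul h1 isCompact_Icc).congr_fun (fun y hy => ?_)
      measurableSet_Icc
    have h2 := (one_sub_sq_pos (hsub hy)).ne'
    have h3 := (rho_pos (p := p) (hsub hy)).ne'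
    simp only []
    field_simp
  exact ⟨hsq, (((memLp_two_iff_integrable_sq (hvm.mono_set hsub)).2 hsq).integrable (by norm_num))⟩

/-- A Hardy inequality, with a bound for the boundary terms. -/
theorem hardy {p : ℝ} (hp : 1 < p) {u v : ℝ → ℝ} (huv : IsPrimitive u v)
    (hu : ContinuousOn u (Ioo (-1) 1))
    (hvm : AEStronglyMeasurable v (volume.restrict (Ioo (-1) 1)))
    (i₁ : IntegrableOn (fun y => u y ^ 2 * rho p y) (Ioo (-1) 1))
    (i₂ : IntegrableOn (fun y => (1 - y ^ 2) * v y ^ 2 * rho p y) (Ioo (-1) 1)) :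
    IntegrableOn (fun y => u y ^ 2 * (rho p y / (1 - y ^ 2))) (Ioo (-1) 1) ∧
    al p * ∫ y in Ioo (-1) 1, u y ^ 2 * (rho p y / (1 - y ^ 2))
      ≤ (1 + 2 * al p) * (∫ y in Ioo (-1) 1, u y ^ 2 * rho p y)
        + 1 / al p * ∫ y in Ioo (-1) 1, (1 - y ^ 2) * v y ^ 2 * rho p y ∧
    ∀ y ∈ Ioo (-1 : ℝ) 1, |y| * (u y ^ 2 * rho p y)
      ≤ (1 + 2 * al p) * (∫ y in Ioo (-1) 1, u y ^ 2 * rho p y)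
        + 1 / al p * ∫ y in Ioo (-1) 1, (1 - y ^ 2) * v y ^ 2 * rho p y := by
  have hal := al_pos hp
  set K := (1 + 2 * al p) * (∫ y in Ioo (-1) 1, u y ^ 2 * rho p y)
        + 1 / al p * ∫ y in Ioo (-1) 1, (1 - y ^ 2) * v y ^ 2 * rho p y with hK
  have hint (c : ℝ) (hc : c < 1) :
      IntegrableOn (fun y => u y ^ 2 * (rho p y / (1 - y ^ 2))) (Icc (-c) c) :=
    (((hu.pow 2).mul continuousOn_rho_div).mono (Icc_neg_subset hc)).integrableOn_Icc
  -- The derivative of `y ρ u²` is integrated over `[-c, c]`. Both boundary terms are nonnegative,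
  -- and `(y ρ)' = (1 + 2 al p) ρ - 2 al p ρ/(1-y²)` carries the singular weight with the good sign.
  -- Half of it absorbs the cross term `2 y ρ u v`. Keeping the boundary terms yields the pointwise
  -- bound as well.
  have key (c : ℝ) (hc0 : 0 ≤ c) (hc : c < 1) :
      c * rho p c * (u c ^ 2 + u (-c) ^ 2)
        + al p * ∫ y in Icc (-c) c, u y ^ 2 * (rho p y / (1 - y ^ 2)) ≤ K := by
    have hcc : -c ≤ c := by linarith
    have hsub := Icc_neg_subset hc
    have huc : ContinuousOn u (Icc (-c) c) := hu.mono hsub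
    have hvi : IntervalIntegrable v volume (-c) c :=
      (intervalIntegrable_iff_integrableOn_Icc_of_le hcc).2 (integrableOn_Icc_of_sq hc hvm i₂).2
    have hvi' (x : ℝ) (hx : x ∈ Icc (-c) c) : IntervalIntegrable v volume (-c) x :=
      hvi.mono_set (by
        rw [uIcc_of_le hx.1, uIcc_of_le hcc]; exact Icc_subset_Icc le_rfl hx.2)
    have hp1 (x : ℝ) (hx : x ∈ Icc (-c) c) : u x - u (-c) = ∫ y in (-c)..x, v y :=
      huv _ _ (by linarith) hx.1 (by linarith [hx.2])
    have hvu : IntervalIntegrable (fun y => v y * u y + u y * v y) volume (-c) c := by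
      rw [← uIcc_of_le hcc] at huc
      exact (hvi.mul_continuousOn huc).add (hvi.continuousOn_mul huc)
    set k' : ℝ → ℝ := fun y => rho p y + y * (-(2 * al p * y) * (rho p y / (1 - y ^ 2)))
      with hk'
    have hkd (y : ℝ) (hy : y ∈ Ioo (-1 : ℝ) 1) : HasDerivAt (fun y => y * rho p y) (k' y) y := by
      exact ((hasDerivAt_id y).fun_mul (hasDerivAt_rho (p := p) hy)).congr_deriv (by
        simp only [hk', one_mul, id])
    have hkc : ContinuousOn k' (Icc (-c) c) :=
      ((continuousOn_rho).add (continuousOn_id.mul ((by fun_prop : Continuous fun y : ℝ =>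
        -(2 * al p * y)).continuousOn.mul continuousOn_rho_div))).mono hsub
    have hki : IntervalIntegrable k' volume (-c) c := by
      rw [← uIcc_of_le hcc] at hkc
      exact hkc.intervalIntegrable
    have h := integral_primitive_mul hcc hvu hki (u₁ := fun x => u x * u x)
      (u₂ := fun y => y * rho p y)
      (fun x hx => (integral_primitive_mul hx.1 (hvi' x hx) (hvi' x hx)
        (fun z hz => hp1 z ⟨hz.1, hz.2.trans hx.2⟩)
        (fun z hz => hp1 z ⟨hz.1, hz.2.trans hx.2⟩)).symm)
      (fun x hx => (intervalIntegral.integral_eq_sub_of_hasDerivAt (fun z hz => hkd z (hsub (by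
          rw [uIcc_of_le hx.1] at hz; exact ⟨hz.1, hz.2.trans hx.2⟩)))
        (hki.mono_set (by
          rw [uIcc_of_le hx.1, uIcc_of_le hcc]; exact Icc_subset_Icc le_rfl hx.2))).symm)
    have hbd : c * rho p c * (u c ^ 2 + u (-c) ^ 2)
        = u c * u c * (c * rho p c) - u (-c) * u (-c) * (-c * rho p (-c)) := by
      rw [rho_neg]; ring
    rw [hbd, ← h, intervalIntegral.integral_of_le hcc, ← integral_Icc_eq_integral_Ioc]
    have j₁ := i₁.mono_set hsub
    have j₂ := i₂.mono_set hsub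
    have j₃ := hint c hc
    have j₀ : IntegrableOn (fun y => (v y * u y + u y * v y) * (y * rho p y) + u y * u y * k' y)
        (Icc (-c) c) := by
      rw [← intervalIntegrable_iff_integrableOn_Icc_of_le hcc]
      rw [← uIcc_of_le hcc] at huc hsub
      refine (hvu.mul_continuousOn ?_).add (hki.continuousOn_mul (huc.mul huc))
      exact continuousOn_id.mul (continuousOn_rho.mono hsub)
    have hle : ∫ y in Icc (-c) c, ((v y * u y + u y * v y) * (y * rho p y) + u y * u y * k' y)
        ≤ ∫ y in Icc (-c) c, ((1 + 2 * al p) * (u y ^ 2 * rho p y)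
          + 1 / al p * ((1 - y ^ 2) * v y ^ 2 * rho p y)
          - al p * (u y ^ 2 * (rho p y / (1 - y ^ 2)))) := by
      refine setIntegral_mono_on j₀ (((j₁.const_mul _).add (j₂.const_mul _)).sub
        (j₃.const_mul _)) measurableSet_Icc fun y hy => ?_
      have hm := one_sub_sq_pos (hsub hy)
      have hr := rho_pos (p := p) (hsub hy)
      set m := 1 - y ^ 2 with hmdef
      have hy2 : y ^ 2 = 1 - m := by rw [hmdef]; ring
      -- The gap between the two integrands is a completed square plus a nonnegative remainder, so
      -- Young's inequality appears here as an identity.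
      have e : (1 + 2 * al p) * (u y ^ 2 * rho p y) + 1 / al p * (m * v y ^ 2 * rho p y)
          - al p * (u y ^ 2 * (rho p y / m))
          - ((v y * u y + u y * v y) * (y * rho p y) + u y * u y * k' y)
          = rho p y / (al p * m) * ((al p * u y - y * m * v y) ^ 2
            + m ^ 2 * v y ^ 2 * (1 - y ^ 2)) := by
        simp only [hk', ← hmdef]
        field_simp
        simp only [hy2]
        ring_nf
        simp only [hy2]
        ring
      have : 0 ≤ rho p y / (al p * m) * ((al p * u y - y * m * v y) ^ 2
            + m ^ 2 * v y ^ 2 * (1 - y ^ 2)) := by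
        rw [← hmdef]; positivity
      linarith
    have hsplit : ∫ y in Icc (-c) c, ((1 + 2 * al p) * (u y ^ 2 * rho p y)
          + 1 / al p * ((1 - y ^ 2) * v y ^ 2 * rho p y)
          - al p * (u y ^ 2 * (rho p y / (1 - y ^ 2))))
        = (1 + 2 * al p) * (∫ y in Icc (-c) c, u y ^ 2 * rho p y)
          + 1 / al p * (∫ y in Icc (-c) c, (1 - y ^ 2) * v y ^ 2 * rho p y)
          - al p * ∫ y in Icc (-c) c, u y ^ 2 * (rho p y / (1 - y ^ 2)) := by
      rw [← integral_const_mul, ← integral_const_mul, ← integral_const_mul,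
        ← integral_add (j₁.const_mul _) (j₂.const_mul _)]
      exact integral_sub ((j₁.const_mul _).add (j₂.const_mul _)) (j₃.const_mul _)
    have m₁ : ∫ y in Icc (-c) c, u y ^ 2 * rho p y ≤ ∫ y in Ioo (-1) 1, u y ^ 2 * rho p y := by
      refine setIntegral_mono_set i₁ ?_ hsub.eventuallyLE
      filter_upwards [ae_restrict_mem measurableSet_Ioo] with y hy
      exact mul_nonneg (sq_nonneg _) (rho_pos hy).le
    have m₂ : ∫ y in Icc (-c) c, (1 - y ^ 2) * v y ^ 2 * rho p y
        ≤ ∫ y in Ioo (-1) 1, (1 - y ^ 2) * v y ^ 2 * rho p y := by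
      refine setIntegral_mono_set i₂ ?_ hsub.eventuallyLE
      filter_upwards [ae_restrict_mem measurableSet_Ioo] with y hy
      exact mul_nonneg (mul_nonneg (one_sub_sq_pos hy).le (sq_nonneg _)) (rho_pos hy).le
    have n₁ := mul_le_mul_of_nonneg_left m₁ (show 0 ≤ 1 + 2 * al p by linarith)
    have n₂ := mul_le_mul_of_nonneg_left m₂ (show 0 ≤ 1 / al p by positivity)
    linarith
  have hnn (c : ℝ) (hc : c < 1) :
      0 ≤ ∫ y in Icc (-c) c, u y ^ 2 * (rho p y / (1 - y ^ 2)) :=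
    setIntegral_nonneg measurableSet_Icc fun y hy => mul_nonneg (sq_nonneg _)
      (div_nonneg (rho_pos (Icc_neg_subset hc hy)).le (one_sub_sq_pos (Icc_neg_subset hc hy)).le)
  set c : ℕ → ℝ := fun n => 1 - 1 / ((n : ℝ) + 1) with hcdef
  have hc1 (n : ℕ) : c n < 1 := by
    have : (0 : ℝ) < 1 / ((n : ℝ) + 1) := by positivity
    simp only [hcdef]; linarith
  have hc0 (n : ℕ) : 0 ≤ c n := by
    have : 1 / ((n : ℝ) + 1) ≤ 1 := by
      rw [div_le_one (by positivity)]
      have : (0 : ℝ) ≤ n := n.cast_nonneg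
      linarith
    simp only [hcdef]; linarith
  have hcl : Tendsto c atTop (𝓝 1) := by
    have h := (tendsto_one_div_add_atTop_nhds_zero_nat (𝕜 := ℝ)).const_sub 1
    rwa [sub_zero] at h
  have hcov : AECover (volume.restrict (Ioo (-1 : ℝ) 1)) atTop fun n => Icc (-c n) (c n) :=
    aecover_Ioo_of_Icc hcl.neg hcl
  have hres (n : ℕ) : (volume.restrict (Ioo (-1 : ℝ) 1)).restrict (Icc (-c n) (c n))
      = volume.restrict (Icc (-c n) (c n)) := by
    rw [Measure.restrict_restrict measurableSet_Icc,
      inter_eq_self_of_subset_left (Icc_neg_subset (hc1 n))]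
  have hbdd (n : ℕ) : ∫ y in Icc (-c n) (c n), u y ^ 2 * (rho p y / (1 - y ^ 2)) ≤ K / al p := by
    rw [le_div_iff₀ hal]
    have h1 := key (c n) (hc0 n) (hc1 n)
    have h2 := (rho_pos (p := p) (Icc_neg_subset (hc1 n) ⟨by linarith [hc0 n], le_rfl⟩)).le
    have h3 : 0 ≤ c n * rho p (c n) * (u (c n) ^ 2 + u (-c n) ^ 2) :=
      mul_nonneg (mul_nonneg (hc0 n) h2) (by positivity)
    linarith
  have hI : IntegrableOn (fun y => u y ^ 2 * (rho p y / (1 - y ^ 2))) (Ioo (-1) 1) := by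
    refine hcov.integrable_of_integral_bounded_of_nonneg_ae (K / al p) (fun n => ?_) ?_ ?_
    · rw [IntegrableOn, hres]
      exact hint _ (hc1 n)
    · filter_upwards [ae_restrict_mem measurableSet_Ioo] with y hy
      exact mul_nonneg (sq_nonneg _) (div_nonneg (rho_pos hy).le (one_sub_sq_pos hy).le)
    · refine Eventually.of_forall fun n => ?_
      rw [hres]
      exact hbdd n
  refine ⟨hI, ?_, fun y hy => ?_⟩
  · have hlim := hcov.integral_tendsto_of_countably_generated hI
    have := le_of_tendsto hlim (Eventually.of_forall fun n => by rw [hres]; exact hbdd n)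
    rw [le_div_iff₀ hal] at this
    linarith
  · have hy1 : |y| < 1 := abs_lt.2 hy
    have h1 := key |y| (abs_nonneg y) hy1
    have h2 := mul_nonneg hal.le (hnn |y| hy1)
    have h3 := mul_nonneg (abs_nonneg y) (rho_pos (p := p) hy).le
    have e : rho p |y| = rho p y := by simp [rho]
    -- `y` is one of the two endpoints `±|y|`, so `u y ^ 2` is one of the two boundary terms with `c
    -- = |y|`.
    have h4 : u y ^ 2 ≤ u |y| ^ 2 + u (-|y|) ^ 2 := by
      rcases abs_choice y with hh | hh
      · rw [hh]; exact le_add_of_nonneg_right (sq_nonneg _)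
      · rw [hh, neg_neg]; exact le_add_of_nonneg_left (sq_nonneg _)
    rw [e] at h1
    have h5 := mul_le_mul_of_nonneg_left h4 h3
    linarith

/-! ## Cut-off weights, and conservation laws with the weight `ρ` -/

/-- A cut-off function that vanishes near `y = ±1`. -/
def cut (n : ℕ) (y : ℝ) : ℝ := Real.smoothTransition (n * (1 - y ^ 2) - 1)

/-- The derivative of `cut n`. -/
def cut' (n : ℕ) (y : ℝ) : ℝ :=
  deriv Real.smoothTransition (n * (1 - y ^ 2) - 1) * -(n * (2 * y))

section Cut

variable {n : ℕ} {y : ℝ}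

lemma cut_nonneg : 0 ≤ cut n y := Real.smoothTransition.nonneg _

lemma cut_le_one : cut n y ≤ 1 := Real.smoothTransition.le_one _

lemma cut_eq_one (h : 2 ≤ n * (1 - y ^ 2)) : cut n y = 1 :=
  Real.smoothTransition.one_of_one_le (by linarith)

lemma cut_eq_zero (h : n * (1 - y ^ 2) ≤ 1) : cut n y = 0 :=
  Real.smoothTransition.zero_of_nonpos (by linarith)

lemma contDiff_cut : ContDiff ℝ (⊤ : ℕ∞) (cut n) :=
  Real.smoothTransition.contDiff.comp (by fun_prop)

lemma hasDerivAt_cut : HasDerivAt (cut n) (cut' n y) y := by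
  have h1 : HasDerivAt (fun y : ℝ => n * (1 - y ^ 2) - 1) (-(n * (2 * y))) y := by
    simpa using (((hasDerivAt_pow 2 y).const_sub 1).const_mul (n : ℝ)).sub_const 1
  exact ((Real.smoothTransition.contDiff (n := 1)).differentiable (by simp)
    (n * (1 - y ^ 2) - 1)).hasDerivAt.comp y h1

lemma cut'_eq_zero (h : n * (1 - y ^ 2) ≤ 1 ∨ 2 ≤ n * (1 - y ^ 2)) : cut' n y = 0 := by
  rw [cut']
  rcases eq_or_ne (deriv Real.smoothTransition (n * (1 - y ^ 2) - 1)) 0 with h0 | h0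
  · rw [h0, zero_mul]
  · exfalso
    have hm : n * (1 - y ^ 2) - 1 ∈ Icc (0 : ℝ) 1 := by
      by_contra hn
      exact h0 (deriv_smoothTransition_eq_zero hn)
    rcases h with h | h
    · have e : n * (1 - y ^ 2) - 1 = 0 := le_antisymm (by linarith) hm.1
      rw [e] at h0
      refine h0 ?_
      refine IsLocalMin.deriv_eq_zero (Eventually.of_forall fun x => ?_)
      simpa using Real.smoothTransition.nonneg x
    · have e : n * (1 - y ^ 2) - 1 = 1 := le_antisymm hm.2 (by linarith)
      rw [e] at h0
      refine h0 ?_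
      refine IsLocalMax.deriv_eq_zero (Eventually.of_forall fun x => ?_)
      simpa using Real.smoothTransition.le_one x

/-- A bound for the derivative of `cut n`, in the form `cut' n y = -y μ` with
`0 ≤ μ ≤ L / (1 - y²)`. -/
lemma exists_cut'_bound : ∃ L, 0 < L ∧ ∀ (n : ℕ) (y : ℝ), y ∈ Ioo (-1 : ℝ) 1 →
    ∃ μ, 0 ≤ μ ∧ μ * (1 - y ^ 2) ≤ L ∧ cut' n y = -(y * μ) := by
  obtain ⟨L, hL⟩ := isCompact_Icc.exists_bound_of_continuousOn (s := Icc (0 : ℝ) 1)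
    continuous_deriv_smoothTransition.continuousOn
  refine ⟨4 * max L 1, by positivity, fun n y hy => ?_⟩
  have hd : 0 ≤ deriv Real.smoothTransition (n * (1 - y ^ 2) - 1) :=
    Real.smoothTransition.monotone.deriv_nonneg
  have hm := one_sub_sq_pos hy
  by_cases hn : n * (1 - y ^ 2) - 1 ∈ Icc (0 : ℝ) 1
  · refine ⟨deriv Real.smoothTransition (n * (1 - y ^ 2) - 1) * (2 * n), by positivity, ?_, ?_⟩
    · have h1 := (Real.norm_eq_abs _ ▸ hL _ hn)
      rw [abs_of_nonneg hd] at h1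
      have h2 : (n : ℝ) * (1 - y ^ 2) ≤ 2 := by linarith [hn.2]
      have h3 := le_max_left L 1
      calc deriv Real.smoothTransition (n * (1 - y ^ 2) - 1) * (2 * n) * (1 - y ^ 2)
          = deriv Real.smoothTransition (n * (1 - y ^ 2) - 1) * (2 * (n * (1 - y ^ 2))) := by ring
        _ ≤ max L 1 * (2 * 2) := by
            refine mul_le_mul (h1.trans h3) (by linarith) (by positivity) (by positivity)
        _ = _ := by ring
    · rw [cut']; ring
  · refine ⟨0, le_rfl, by rw [zero_mul]; positivity, ?_⟩
    rw [cut', deriv_smoothTransition_eq_zero hn]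
    simp

lemma eventually_cut (hy : y ∈ Ioo (-1 : ℝ) 1) : ∀ᶠ n : ℕ in atTop, 2 ≤ n * (1 - y ^ 2) :=
  (tendsto_natCast_atTop_atTop.atTop_mul_const (one_sub_sq_pos hy)).eventually_ge_atTop 2

end Cut

/-- The truncated weight `ρ χₙ`. -/
def rhoCut (p : ℝ) (n : ℕ) (y : ℝ) : ℝ := rho p y * cut n y

section RhoCut

variable {p : ℝ} {n : ℕ}

lemma exists_rhoCut_eq_zero : ∃ c < 1, ∀ y, c < |y| → rhoCut p n y = 0 := by
  -- The denominator is `n + 1` so that `n = 0` is included; `n/(n+1) ≤ 1` is all that the cutoff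
  -- requires.
  refine ⟨√(1 - 1 / (n + 1)), ?_, fun y hy => ?_⟩
  · have : (0 : ℝ) < 1 / (n + 1) := by positivity
    rw [Real.sqrt_lt' one_pos]
    linarith
  · rw [rhoCut, cut_eq_zero, mul_zero]
    have h1 := Real.lt_sq_of_sqrt_lt hy
    rw [sq_abs] at h1
    have h2 : 1 - y ^ 2 ≤ 1 / ((n : ℝ) + 1) := by linarith
    have h3 : (0 : ℝ) ≤ n := n.cast_nonneg
    calc (n : ℝ) * (1 - y ^ 2) ≤ n * (1 / ((n : ℝ) + 1)) := mul_le_mul_of_nonneg_left h2 h3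
      _ ≤ 1 := by rw [mul_one_div, div_le_one (by positivity)]; linarith

/-- `ρ` itself need not be smooth at `y = ±1`, but the cutoff vanishes near those points. -/
lemma isWeight_rhoCut : IsWeight (rhoCut p n) := by
  obtain ⟨c, hc, h0⟩ := exists_rhoCut_eq_zero (p := p) (n := n)
  have hsupp : tsupport (rhoCut p n) ⊆ Icc (-c) c := by
    refine closure_minimal (fun y hy => ?_) isClosed_Icc
    by_contra hn
    rw [mem_Icc, ← abs_le] at hn
    exact hy (h0 y (not_le.1 hn))
  refine ⟨contDiff_iff_contDiffAt.2 fun y => ?_, ?_, hsupp.trans (Icc_neg_subset hc)⟩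
  · by_cases hy : y ∈ Ioo (-1 : ℝ) 1
    · have h1 : ContDiffAt ℝ (⊤ : ℕ∞) (fun y : ℝ => 1 - y ^ 2) y := by fun_prop
      have h2 : ContDiffAt ℝ (⊤ : ℕ∞) (rho p) y :=
        h1.rpow_const_of_ne (one_sub_sq_pos hy).ne'
      exact h2.mul contDiff_cut.contDiffAt
    · have : y ∉ tsupport (rhoCut p n) := fun hh => hy (Icc_neg_subset hc (hsupp hh))
      have h3 : rhoCut p n =ᶠ[𝓝 y] fun _ => 0 := notMem_tsupport_iff_eventuallyEq.1 this
      exact contDiffAt_const.congr_of_eventuallyEq h3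
  · exact HasCompactSupport.of_support_subset_isCompact isCompact_Icc
      ((subset_tsupport _).trans hsupp)

lemma deriv_rhoCut {y : ℝ} (hy : y ∈ Ioo (-1 : ℝ) 1) : deriv (rhoCut p n) y
    = -(2 * al p * y) * (rho p y / (1 - y ^ 2)) * cut n y + rho p y * cut' n y :=
  ((hasDerivAt_rho hy).fun_mul hasDerivAt_cut).deriv

end RhoCut

/-- A conservation law, integrated with the weight `ρ`. -/
theorem FluxLaw.integral_identity_rho {p σ a b : ℝ} (hp : 1 < p) {A B S : ℝ × ℝ → ℝ}
    (h : FluxLaw (strip σ) A B S) (hA : SliceCont σ A) (hσ : σ ≤ a) (hab : a < b)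
    (iA : IntegrableOn (fun y => A (y, a) * rho p y) (Ioo (-1) 1))
    (iA' : IntegrableOn (fun y => A (y, b) * rho p y) (Ioo (-1) 1))
    (iB : IntegrableOn (fun x => B x * (rho p x.1 / (1 - x.1 ^ 2))) (Ioo (-1) 1 ×ˢ Ioo a b))
    (iS : IntegrableOn (fun x => S x * rho p x.1) (Ioo (-1) 1 ×ˢ Ioo a b)) :
    (∫ y in Ioo (-1) 1, A (y, b) * rho p y) - ∫ y in Ioo (-1) 1, A (y, a) * rho p y
      = ∫ x in Ioo (-1) 1 ×ˢ Ioo a b, (S x * rho p x.1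
        - 2 * al p * x.1 * (B x * (rho p x.1 / (1 - x.1 ^ 2)))) := by
  obtain ⟨L, hL0, hL⟩ := exists_cut'_bound
  have hal := al_pos hp
  set R := Ioo (-1 : ℝ) 1 ×ˢ Ioo a b with hR
  have hRm : MeasurableSet R := measurableSet_Ioo.prod measurableSet_Ioo
  have hRsub : R ⊆ strip σ := fun x hx => ⟨hx.1, hσ.trans_lt hx.2.1⟩
  have hBm : AEStronglyMeasurable B (volume.restrict R) := h.locB.aestronglyMeasurable.mono_set hRsub
  have hSm : AEStronglyMeasurable S (volume.restrict R) := h.locS.aestronglyMeasurable.mono_set hRsub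
  -- The derivatives of `ρ` and of the cutoff both cost at most a factor `1/(1-y²)`, uniformly in
  -- `n`. Integrability of `B ρ/(1-y²)` thus gives a dominating function; pointwise the derivative
  -- of the cutoff is eventually zero, so the cutoff leaves no boundary term.
  set g : ℝ × ℝ → ℝ := fun x => (2 * al p + L) * |B x * (rho p x.1 / (1 - x.1 ^ 2))|
    + |S x * rho p x.1| with hg
  have hgi : IntegrableOn g R := (iB.abs.const_mul _).add iS.abs
  have hψ (n : ℕ) := isWeight_rhoCut (p := p) (n := n)
  have hψc (n : ℕ) : Continuous (rhoCut p n) := (hψ n).contDiff.continuous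
  have hψc' (n : ℕ) : Continuous (deriv (rhoCut p n)) :=
    (hψ n).contDiff.continuous_deriv (by simp)
  have hm (n : ℕ) : AEStronglyMeasurable (fun x : ℝ × ℝ =>
      B x * deriv (rhoCut p n) x.1 + S x * rhoCut p n x.1) (volume.restrict R) :=
    (hBm.mul ((hψc' n).comp continuous_fst).aestronglyMeasurable).add
      (hSm.mul ((hψc n).comp continuous_fst).aestronglyMeasurable)
  have hdom (n : ℕ) (x : ℝ × ℝ) (hx : x ∈ R) :
      ‖B x * deriv (rhoCut p n) x.1 + S x * rhoCut p n x.1‖ ≤ g x := by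
    have hm := one_sub_sq_pos hx.1
    have hr := rho_pos (p := p) hx.1
    obtain ⟨μ, hμ0, hμ, e⟩ := hL n x.1 hx.1
    have hy : |x.1| ≤ 1 := (abs_lt.2 hx.1).le
    have h1 : |deriv (rhoCut p n) x.1| ≤ (2 * al p + L) * (rho p x.1 / (1 - x.1 ^ 2)) := by
      rw [deriv_rhoCut hx.1, e]
      have e2 : -(2 * al p * x.1) * (rho p x.1 / (1 - x.1 ^ 2)) * cut n x.1
          + rho p x.1 * -(x.1 * μ)
          = -x.1 * ((2 * al p * cut n x.1 + μ * (1 - x.1 ^ 2))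
            * (rho p x.1 / (1 - x.1 ^ 2))) := by
        field_simp
        ring
      have hc := cut_nonneg (n := n) (y := x.1)
      have hc1 := cut_le_one (n := n) (y := x.1)
      have h3 : 0 ≤ rho p x.1 / (1 - x.1 ^ 2) := by positivity
      have h4 : 0 ≤ 2 * al p * cut n x.1 + μ * (1 - x.1 ^ 2) := by positivity
      rw [e2, abs_mul, abs_neg, abs_of_nonneg (mul_nonneg h4 h3)]
      refine (mul_le_of_le_one_left (mul_nonneg h4 h3) hy).trans ?_
      refine mul_le_mul_of_nonneg_right ?_ h3
      nlinarith
    refine (norm_add_le _ _).trans (add_le_add ?_ ?_)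
    · rw [norm_mul, abs_mul, abs_of_nonneg (show 0 ≤ rho p x.1 / (1 - x.1 ^ 2) by positivity)]
      have := mul_le_mul_of_nonneg_left h1 (abs_nonneg (B x))
      simp only [Real.norm_eq_abs]
      linarith
    · rw [norm_mul, abs_mul]
      refine mul_le_mul_of_nonneg_left ?_ (norm_nonneg _)
      rw [Real.norm_eq_abs, rhoCut, abs_mul, abs_of_nonneg (cut_nonneg (n := n))]
      exact mul_le_of_le_one_right (abs_nonneg _) cut_le_one
  have hint (n : ℕ) : IntegrableOn (fun x : ℝ × ℝ =>
      B x * deriv (rhoCut p n) x.1 + S x * rhoCut p n x.1) R :=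
    Integrable.mono' hgi (hm n) ((ae_restrict_iff' hRm).2 (ae_of_all _ (hdom n)))
  have key (n : ℕ) := h.integral_identity (hψ n) hσ hab
    ((hA _ (hψc n) exists_rhoCut_eq_zero).2.mono (Icc_subset_Ici_self.trans (Ici_subset_Ici.2 hσ)))
    (hint n)
  have hlimA (s : ℝ) (hs : σ ≤ s)
      (iA : IntegrableOn (fun y => A (y, s) * rho p y) (Ioo (-1) 1)) :
      Tendsto (fun n => ∫ y, A (y, s) * rhoCut p n y) atTop
        (𝓝 (∫ y in Ioo (-1) 1, A (y, s) * rho p y)) := by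
    have e (n : ℕ) : ∫ y, A (y, s) * rhoCut p n y
        = ∫ y in Ioo (-1) 1, A (y, s) * rhoCut p n y := by
      refine (setIntegral_eq_integral_of_forall_compl_eq_zero fun y hy => ?_).symm
      rw [image_eq_zero_of_notMem_tsupport fun hh => hy ((hψ n).subset hh), mul_zero]
    simp only [e]
    refine tendsto_integral_of_dominated_convergence (fun y => |A (y, s) * rho p y|) (fun n => ?_)
      iA.abs (fun n => ae_of_all _ fun y => ?_) ?_
    · exact ((hA _ (hψc n) exists_rhoCut_eq_zero).1 s hs).1.restrict
    · rw [norm_mul, Real.norm_eq_abs, Real.norm_eq_abs, abs_mul, rhoCut, abs_mul,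
        abs_of_nonneg (cut_nonneg (n := n))]
      exact mul_le_mul_of_nonneg_left (mul_le_of_le_one_right (abs_nonneg _) cut_le_one)
        (abs_nonneg _)
    · filter_upwards [ae_restrict_mem measurableSet_Ioo] with y hy
      refine tendsto_const_nhds.congr' ?_
      filter_upwards [eventually_cut hy] with n hn
      rw [rhoCut, cut_eq_one hn, mul_one]
  have hlimR : Tendsto (fun n => ∫ x in R, (B x * deriv (rhoCut p n) x.1 + S x * rhoCut p n x.1))
      atTop (𝓝 (∫ x in R, (S x * rho p x.1
        - 2 * al p * x.1 * (B x * (rho p x.1 / (1 - x.1 ^ 2)))))) := by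
    refine tendsto_integral_of_dominated_convergence g hm hgi
      (fun n => (ae_restrict_iff' hRm).2 (ae_of_all _ (hdom n))) ?_
    filter_upwards [ae_restrict_mem hRm] with x hx
    refine tendsto_const_nhds.congr' ?_
    filter_upwards [eventually_cut hx.1] with n hn
    rw [deriv_rhoCut hx.1, rhoCut, cut_eq_one hn, cut'_eq_zero (Or.inr hn)]
    ring
  exact tendsto_nhds_unique (((hlimA b (hσ.trans hab.le) iA').sub (hlimA a hσ iA)).congr key) hlimR

/-! ## Trajectories of locally bounded energy -/

/-- Tonelli's theorem: the slice integrals are uniformly bounded and the time interval is finite. -/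
lemma integrableOn_prod_of_slice {a b C : ℝ} {f : ℝ × ℝ → ℝ}
    (hf : AEStronglyMeasurable f (volume.restrict (Ioo (-1) 1 ×ˢ Ioo a b)))
    (h0 : ∀ x ∈ Ioo (-1 : ℝ) 1 ×ˢ Ioo a b, 0 ≤ f x)
    (hi : ∀ s ∈ Ioo a b, IntegrableOn (fun y => f (y, s)) (Ioo (-1) 1))
    (hC : ∀ s ∈ Ioo a b, ∫ y in Ioo (-1) 1, f (y, s) ≤ C) :
    IntegrableOn f (Ioo (-1) 1 ×ˢ Ioo a b) := by
  rw [Measure.volume_eq_prod, ← Measure.prod_restrict] at hf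
  rw [IntegrableOn, Measure.volume_eq_prod, ← Measure.prod_restrict, integrable_prod_iff' hf]
  refine ⟨?_, ?_⟩
  · filter_upwards [ae_restrict_mem measurableSet_Ioo] with s hs using hi s hs
  · refine Integrable.mono' (g := fun _ => C) (integrable_const C)
      hf.norm.prod_swap.integral_prod_right' ?_
    filter_upwards [ae_restrict_mem measurableSet_Ioo] with s hs
    rw [Real.norm_eq_abs, abs_of_nonneg (integral_nonneg fun _ => norm_nonneg _)]
    refine (le_of_eq ?_).trans (hC s hs)
    refine setIntegral_congr_fun measurableSet_Ioo fun y hy => ?_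
    exact Real.norm_of_nonneg (h0 (y, s) ⟨hy, hs⟩)

/-- A trajectory whose energy norm is locally bounded in time. -/
structure FiniteEnergy (p σ : ℝ) (w wy ws : ℝ → ℝ → ℝ) : Prop where
  meas_wy : AEStronglyMeasurable (fun x : ℝ × ℝ => wy x.2 x.1) (volume.restrict (strip σ))
  meas_ws : AEStronglyMeasurable (fun x : ℝ × ℝ => ws x.2 x.1) (volume.restrict (strip σ))
  continuousOn : ContinuousOn (fun x : ℝ × ℝ => w x.2 x.1) (Ioo (-1) 1 ×ˢ Ici σ)
  slice_wy : ∀ s, σ ≤ s → AEStronglyMeasurable (wy s) (volume.restrict (Ioo (-1) 1))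
  slice_ws : ∀ s, σ ≤ s → AEStronglyMeasurable (ws s) (volume.restrict (Ioo (-1) 1))
  prim : ∀ s, σ ≤ s → IsPrimitive (w s) (wy s)
  int_w : ∀ s, σ ≤ s → IntegrableOn (fun y => w s y ^ 2 * rho p y) (Ioo (-1) 1)
  int_wy : ∀ s, σ ≤ s → IntegrableOn (fun y => (1 - y ^ 2) * wy s y ^ 2 * rho p y) (Ioo (-1) 1)
  int_ws : ∀ s, σ ≤ s → IntegrableOn (fun y => ws s y ^ 2 * rho p y) (Ioo (-1) 1)
  bound : ∀ S, ∃ C, ∀ s ∈ Icc σ S, (∫ y in Ioo (-1) 1, w s y ^ 2 * rho p y) ≤ C ∧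
    (∫ y in Ioo (-1) 1, (1 - y ^ 2) * wy s y ^ 2 * rho p y) ≤ C ∧
    (∫ y in Ioo (-1) 1, ws s y ^ 2 * rho p y) ≤ C

lemma measurable_rho {p : ℝ} (hp : 1 < p) : Measurable fun x : ℝ × ℝ => rho p x.1 :=
  (continuous_rho hp).measurable.comp measurable_fst

lemma measurable_rho_div {p : ℝ} (hp : 1 < p) :
    Measurable fun x : ℝ × ℝ => rho p x.1 / (1 - x.1 ^ 2) :=
  (measurable_rho hp).div (by fun_prop : Continuous fun x : ℝ × ℝ => 1 - x.1 ^ 2).measurable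

namespace FiniteEnergy

variable {p σ : ℝ} {w wy ws : ℝ → ℝ → ℝ}

lemma mono (h : FiniteEnergy p σ w wy ws) {σ' : ℝ} (hσ : σ ≤ σ') : FiniteEnergy p σ' w wy ws where
  meas_wy := h.meas_wy.mono_set (prod_mono le_rfl (Ioi_subset_Ioi hσ))
  meas_ws := h.meas_ws.mono_set (prod_mono le_rfl (Ioi_subset_Ioi hσ))
  continuousOn := h.continuousOn.mono (prod_mono le_rfl (Ici_subset_Ici.2 hσ))
  slice_wy s hs := h.slice_wy s (hσ.trans hs)
  slice_ws s hs := h.slice_ws s (hσ.trans hs)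
  prim s hs := h.prim s (hσ.trans hs)
  int_w s hs := h.int_w s (hσ.trans hs)
  int_wy s hs := h.int_wy s (hσ.trans hs)
  int_ws s hs := h.int_ws s (hσ.trans hs)
  bound S := by
    obtain ⟨C, hC⟩ := h.bound S
    exact ⟨C, fun s hs => hC s ⟨hσ.trans hs.1, hs.2⟩⟩

lemma slice_w (h : FiniteEnergy p σ w wy ws) {s : ℝ} (hs : σ ≤ s) :
    ContinuousOn (w s) (Ioo (-1) 1) :=
  h.continuousOn.comp (by fun_prop : Continuous fun y : ℝ => (y, s)).continuousOn
    fun _ hy => ⟨hy, hs⟩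

lemma hardy (h : FiniteEnergy p σ w wy ws) (hp : 1 < p) {s : ℝ} (hs : σ ≤ s) :
    IntegrableOn (fun y => w s y ^ 2 * (rho p y / (1 - y ^ 2))) (Ioo (-1) 1) ∧
    al p * ∫ y in Ioo (-1) 1, w s y ^ 2 * (rho p y / (1 - y ^ 2))
      ≤ (1 + 2 * al p) * (∫ y in Ioo (-1) 1, w s y ^ 2 * rho p y)
        + 1 / al p * ∫ y in Ioo (-1) 1, (1 - y ^ 2) * wy s y ^ 2 * rho p y :=
  have := SimilarityEnergy.hardy hp (h.prim s hs) (h.slice_w hs) (h.slice_wy s hs) (h.int_w s hs)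
    (h.int_wy s hs)
  ⟨this.1, this.2.1⟩

/-- A pointwise bound. -/
lemma sq_mul_rho_le (h : FiniteEnergy p σ w wy ws) (hp : 1 < p) (S : ℝ) :
    ∃ C, 0 < C ∧ ∀ s ∈ Icc σ S, ∀ y ∈ Ioo (-1 : ℝ) 1, w s y ^ 2 * rho p y ≤ C := by
  have hal := al_pos hp
  obtain ⟨C₁, hC₁⟩ := h.bound S
  obtain ⟨C₂, hC₂⟩ := (isCompact_Icc.prod isCompact_Icc).exists_bound_of_continuousOn
    (h.continuousOn.mono (prod_mono (Icc_neg_subset (show (1 / 2 : ℝ) < 1 by norm_num))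
      (Icc_subset_Ici_self : Icc σ S ⊆ Ici σ)))
  set K := (1 + 2 * al p) * C₁ + 1 / al p * C₁ with hK
  refine ⟨max (2 * K) (C₂ ^ 2) + 1, by positivity, fun s hs y hy => ?_⟩
  have hr := rho_pos (p := p) hy
  have hw : 0 ≤ w s y ^ 2 * rho p y := by positivity
  -- The boundary term in Hardy's inequality carries the factor `|y|` and says nothing near `y = 0`;
  -- there the continuity of `w` on a compact set takes over.
  by_cases hy2 : |y| ≤ 1 / 2
  · have h1 := hC₂ (y, s) ⟨abs_le.1 hy2, hs⟩
    have h2 : w s y ^ 2 ≤ C₂ ^ 2 := by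
      rw [← sq_abs]
      exact pow_le_pow_left₀ (abs_nonneg _) h1 2
    have h3 : w s y ^ 2 * rho p y ≤ w s y ^ 2 :=
      mul_le_of_le_one_right (sq_nonneg _) (rho_le_one hp hy)
    linarith [le_max_right (2 * K) (C₂ ^ 2)]
  · have h1 := (SimilarityEnergy.hardy hp (h.prim s hs.1) (h.slice_w hs.1) (h.slice_wy s hs.1)
      (h.int_w s hs.1) (h.int_wy s hs.1)).2.2 y hy
    obtain ⟨k1, k2, -⟩ := hC₁ s hs
    have n₁ := mul_le_mul_of_nonneg_left k1 (show 0 ≤ 1 + 2 * al p by linarith)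
    have n₂ := mul_le_mul_of_nonneg_left k2 (show 0 ≤ 1 / al p by positivity)
    have h2 := mul_le_mul_of_nonneg_right (not_le.1 hy2).le hw
    linarith [le_max_left (2 * K) (C₂ ^ 2)]

/-- The bound for `w² ρ` is raised to the power `(p-1)/2`, which turns `ρ` into exactly `1 - y²`.
Hence `|w|^(p-1)` costs no more than one factor `1/(1-y²)`, precisely what Hardy's inequality
affords; no upper bound on `p` enters, as the problem is one-dimensional. -/
lemma rpow_mul_le (h : FiniteEnergy p σ w wy ws) (hp : 1 < p) (S : ℝ) :
    ∃ C, 0 < C ∧ ∀ s ∈ Icc σ S, ∀ y ∈ Ioo (-1 : ℝ) 1, |w s y| ^ (p - 1) * (1 - y ^ 2) ≤ C := by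
  obtain ⟨C, hC0, hC⟩ := h.sq_mul_rho_le hp S
  refine ⟨C ^ ((p - 1) / 2), by positivity, fun s hs y hy => ?_⟩
  have hr := rho_pos (p := p) hy
  have hm := one_sub_sq_pos hy
  have hp1 : 0 < p - 1 := by linarith
  have h1 := Real.rpow_le_rpow (by positivity) (hC s hs y hy) (show 0 ≤ (p - 1) / 2 by linarith)
  refine (le_of_eq ?_).trans h1
  rw [Real.mul_rpow (sq_nonneg _) hr.le, ← sq_abs (w s y), ← Real.rpow_natCast |w s y|,
    ← Real.rpow_mul (abs_nonneg _), rho_eq, ← Real.rpow_mul hm.le]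
  congr 1
  · congr 1
    push_cast
    ring
  · have : al p * ((p - 1) / 2) = 1 := by rw [al]; field_simp
    rw [this, Real.rpow_one]

variable {a b : ℝ}

lemma meas_w (h : FiniteEnergy p σ w wy ws) :
    AEStronglyMeasurable (fun x : ℝ × ℝ => w x.2 x.1) (volume.restrict (strip σ)) :=
  (h.continuousOn.mono (prod_mono le_rfl Ioi_subset_Ici_self)).aestronglyMeasurable
    isOpen_strip.measurableSet

lemma subset_strip (hσ : σ ≤ a) : Ioo (-1 : ℝ) 1 ×ˢ Ioo a b ⊆ strip σ :=
  fun _ hx => ⟨hx.1, hσ.trans_lt hx.2.1⟩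

lemma integrableOn_w_div (h : FiniteEnergy p σ w wy ws) (hp : 1 < p) (hσ : σ ≤ a) :
    IntegrableOn (fun x : ℝ × ℝ => w x.2 x.1 ^ 2 * (rho p x.1 / (1 - x.1 ^ 2)))
      (Ioo (-1) 1 ×ˢ Ioo a b) := by
  have hal := al_pos hp
  obtain ⟨C, hC⟩ := h.bound b
  refine integrableOn_prod_of_slice (C := ((1 + 2 * al p) * C + 1 / al p * C) / al p)
    (((h.meas_w.mono_set (subset_strip hσ)).pow 2).mul
      (measurable_rho_div hp).aestronglyMeasurable)
    (fun x hx => mul_nonneg (sq_nonneg _) (div_nonneg (rho_pos hx.1).le (one_sub_sq_pos hx.1).le))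
    (fun s hs => (h.hardy hp (hσ.trans hs.1.le)).1) fun s hs => ?_
  have hs' : s ∈ Icc σ b := ⟨hσ.trans hs.1.le, hs.2.le⟩
  rw [le_div_iff₀ hal]
  have h1 := (h.hardy hp hs'.1).2
  obtain ⟨k1, k2, -⟩ := hC s hs'
  have n₁ := mul_le_mul_of_nonneg_left k1 (show 0 ≤ 1 + 2 * al p by linarith)
  have n₂ := mul_le_mul_of_nonneg_left k2 (show 0 ≤ 1 / al p by positivity)
  linarith

lemma integrableOn_wy (h : FiniteEnergy p σ w wy ws) (hp : 1 < p) (hσ : σ ≤ a) :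
    IntegrableOn (fun x : ℝ × ℝ => (1 - x.1 ^ 2) * wy x.2 x.1 ^ 2 * rho p x.1)
      (Ioo (-1) 1 ×ˢ Ioo a b) := by
  obtain ⟨C, hC⟩ := h.bound b
  exact integrableOn_prod_of_slice (C := C)
    (((by fun_prop : Continuous fun x : ℝ × ℝ => 1 - x.1 ^ 2).aestronglyMeasurable.mul
      ((h.meas_wy.mono_set (subset_strip hσ)).pow 2)).mul (measurable_rho hp).aestronglyMeasurable)
    (fun x hx => mul_nonneg (mul_nonneg (one_sub_sq_pos hx.1).le (sq_nonneg _)) (rho_pos hx.1).le)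
    (fun s hs => h.int_wy s (hσ.trans hs.1.le)) fun s hs => (hC s ⟨hσ.trans hs.1.le, hs.2.le⟩).2.1

lemma integrableOn_ws (h : FiniteEnergy p σ w wy ws) (hp : 1 < p) (hσ : σ ≤ a) :
    IntegrableOn (fun x : ℝ × ℝ => ws x.2 x.1 ^ 2 * rho p x.1) (Ioo (-1) 1 ×ˢ Ioo a b) := by
  obtain ⟨C, hC⟩ := h.bound b
  exact integrableOn_prod_of_slice (C := C)
    (((h.meas_ws.mono_set (subset_strip hσ)).pow 2).mul (measurable_rho hp).aestronglyMeasurable)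
    (fun x hx => mul_nonneg (sq_nonneg _) (rho_pos hx.1).le)
    (fun s hs => h.int_ws s (hσ.trans hs.1.le)) fun s hs => (hC s ⟨hσ.trans hs.1.le, hs.2.le⟩).2.2

lemma integrableOn_rho_prod (hp : 1 < p) :
    IntegrableOn (fun x : ℝ × ℝ => rho p x.1) (Ioo (-1) 1 ×ˢ Ioo a b) :=
  integrableOn_prod_of_slice (C := ∫ y in Ioo (-1) 1, rho p y)
    (measurable_rho hp).aestronglyMeasurable (fun _ hx => (rho_pos hx.1).le)
    (fun _ _ => integrableOn_rho hp) fun _ _ => le_rfl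

/-- The integral of `|w|^(p+1) ρ` converges. -/
lemma integrableOn_rpow (h : FiniteEnergy p σ w wy ws) (hp : 1 < p) {s : ℝ} (hs : σ ≤ s) :
    IntegrableOn (fun y => |w s y| ^ (p + 1) * rho p y) (Ioo (-1) 1) := by
  obtain ⟨C, hC0, hC⟩ := h.rpow_mul_le hp s
  refine Integrable.mono' ((h.hardy hp hs).1.const_mul C) ?_ ?_
  · refine ContinuousOn.aestronglyMeasurable ?_ measurableSet_Ioo
    exact ((h.slice_w hs).abs.rpow_const fun _ _ => Or.inr (by linarith)).mul continuousOn_rho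
  · filter_upwards [ae_restrict_mem measurableSet_Ioo] with y hy
    have hr := rho_pos (p := p) hy
    have hm := one_sub_sq_pos hy
    have h1 := hC s ⟨hs, le_rfl⟩ y hy
    have e : |w s y| ^ (p + 1) = |w s y| ^ (p - 1) * w s y ^ 2 := by
      rw [← sq_abs (w s y), ← Real.rpow_two, ← Real.rpow_add_of_nonneg (abs_nonneg _) (by linarith)
        (by norm_num)]
      congr 1
      ring
    rw [Real.norm_of_nonneg (by positivity), e]
    calc |w s y| ^ (p - 1) * w s y ^ 2 * rho p y
        = |w s y| ^ (p - 1) * (1 - y ^ 2) * (w s y ^ 2 * (rho p y / (1 - y ^ 2))) := by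
          field_simp
      _ ≤ C * (w s y ^ 2 * (rho p y / (1 - y ^ 2))) :=
          mul_le_mul_of_nonneg_right h1 (by positivity)

end FiniteEnergy

/-! ## Finiteness of the dissipation -/

/-- A trajectory of locally bounded energy, the source `h`, the potential `v`, its derivative `hv`
with respect to `w`, and a term `bt` from its explicit dependence on `y`, with the conservation
laws for the energy, for `w ∂ₛw` and for the potential. -/
structure Evolution (p σ : ℝ) (w wy ws h v hv bt : ℝ → ℝ → ℝ) : Prop
    extends FiniteEnergy p σ w wy ws where
  meas_h : AEStronglyMeasurable (fun x : ℝ × ℝ => h x.2 x.1) (volume.restrict (strip σ))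
  meas_v : AEStronglyMeasurable (fun x : ℝ × ℝ => v x.2 x.1) (volume.restrict (strip σ))
  meas_hv : AEStronglyMeasurable (fun x : ℝ × ℝ => hv x.2 x.1) (volume.restrict (strip σ))
  meas_bt : AEStronglyMeasurable (fun x : ℝ × ℝ => bt x.2 x.1) (volume.restrict (strip σ))
  slice_v : ∀ s, σ ≤ s → ContinuousOn (v s) (Ioo (-1) 1)
  lawE : FluxLaw (strip σ)
    (fun x => 1 / 2 * ws x.2 x.1 ^ 2 + 1 / 2 * wy x.2 x.1 ^ 2 * (1 - x.1 ^ 2)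
      + al p * (al p + 1) / 2 * w x.2 x.1 ^ 2)
    (fun x => -((1 - x.1 ^ 2) * (wy x.2 x.1 * ws x.2 x.1)) + x.1 * ws x.2 x.1 ^ 2)
    (fun x => -2 * al p * x.1 * (wy x.2 x.1 * ws x.2 x.1) - 2 * al p * ws x.2 x.1 ^ 2
      + h x.2 x.1 * ws x.2 x.1)
  lawK : FluxLaw (strip σ)
    (fun x => w x.2 x.1 * ws x.2 x.1)
    (fun x => -((1 - x.1 ^ 2) * (w x.2 x.1 * wy x.2 x.1))
      + 2 * x.1 * (w x.2 x.1 * ws x.2 x.1))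
    (fun x => ws x.2 x.1 ^ 2 - (1 - x.1 ^ 2) * wy x.2 x.1 ^ 2
      - al p * (al p + 1) * w x.2 x.1 ^ 2
      + (1 - 2 * al p) * (w x.2 x.1 * ws x.2 x.1)
      + 2 * x.1 * (ws x.2 x.1 * wy x.2 x.1)
      - 2 * al p * x.1 * (w x.2 x.1 * wy x.2 x.1)
      + h x.2 x.1 * w x.2 x.1)
  lawV : FluxLaw (strip σ) (fun x => v x.2 x.1) (fun _ => 0)
    (fun x => hv x.2 x.1 * (ws x.2 x.1 + al p * w x.2 x.1) - bt x.2 x.1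
      - 2 * (al p + 1) * v x.2 x.1)
  contE : SliceCont σ fun x => 1 / 2 * ws x.2 x.1 ^ 2 + 1 / 2 * wy x.2 x.1 ^ 2 * (1 - x.1 ^ 2)
    + al p * (al p + 1) / 2 * w x.2 x.1 ^ 2
  contK : SliceCont σ fun x => w x.2 x.1 * ws x.2 x.1
  contV : SliceCont σ fun x => v x.2 x.1
  bound_h : ∀ S, ∃ C, ∀ s ∈ Icc σ S, ∀ y ∈ Ioo (-1 : ℝ) 1,
    |h s y| ≤ C * (1 + |wy s y| + |ws s y| + |w s y| ^ p)
  bound_v : ∀ S, ∃ C, ∀ s ∈ Icc σ S, ∀ y ∈ Ioo (-1 : ℝ) 1,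
    |v s y| ≤ C * (1 + |w s y| ^ (p + 1)) ∧ |hv s y| ≤ C * (1 + |w s y| ^ p) ∧
      |bt s y| ≤ C * (1 + |w s y| ^ (p + 1))

/-- Used with `u = (1-y²) ∂_y w` and `v = y ∂_s w`: the flux created by the cutoff is bounded above
by the gradient alone. -/
lemma mul_sub_sq_le (u v : ℝ) : u * v - v ^ 2 ≤ u ^ 2 := by
  nlinarith [sq_nonneg (u - v), sq_nonneg (u + v)]

lemma abs_rpow_add_one {p : ℝ} (hp : 1 < p) (u : ℝ) : |u| ^ (p + 1) = |u| ^ (p - 1) * u ^ 2 := by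
  rw [← sq_abs u, ← Real.rpow_two, ← Real.rpow_add_of_nonneg (abs_nonneg _) (by linarith)
    (by norm_num)]
  congr 1
  ring

lemma abs_rpow_sq {p : ℝ} (hp : 1 < p) (u : ℝ) : (|u| ^ p) ^ 2 = (|u| ^ (p - 1)) ^ 2 * u ^ 2 := by
  have : |u| ^ p = |u| ^ (p - 1) * |u| := by
    have h := Real.rpow_add_of_nonneg (abs_nonneg u) (show 0 ≤ p - 1 by linarith)
      (show (0 : ℝ) ≤ 1 by norm_num)
    rw [Real.rpow_one] at h
    rw [← h]
    congr 1
    ring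
  rw [this, mul_pow, sq_abs]

namespace Evolution

variable {p σ a b : ℝ} {w wy ws h v hv bt : ℝ → ℝ → ℝ}

/-- Pointwise bounds for the source and the potential. -/
lemma pointwise (E : Evolution p σ w wy ws h v hv bt) (hp : 1 < p) (S : ℝ) :
    ∃ C, 0 < C ∧ ∀ s ∈ Icc σ S, ∀ y ∈ Ioo (-1 : ℝ) 1,
      (1 - y ^ 2) * h s y ^ 2 ≤ C * (1 + w s y ^ 2 / (1 - y ^ 2)
        + (1 - y ^ 2) * wy s y ^ 2 + ws s y ^ 2) ∧
      (1 - y ^ 2) * hv s y ^ 2 ≤ C * (1 + w s y ^ 2 / (1 - y ^ 2)) ∧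
      |v s y| ≤ C * (1 + w s y ^ 2 / (1 - y ^ 2)) ∧
      |bt s y| ≤ C * (1 + w s y ^ 2 / (1 - y ^ 2)) := by
  obtain ⟨C₀, hC₀, h₀⟩ := E.rpow_mul_le hp S
  obtain ⟨C₁, h₁⟩ := E.bound_h S
  obtain ⟨C₂, h₂⟩ := E.bound_v S
  set K := (4 * C₁ ^ 2 + 2 * C₂ ^ 2) * (1 + C₀ ^ 2) + |C₂| * (1 + C₀) + 1 with hK
  have hK1 : 4 * C₁ ^ 2 * (1 + C₀ ^ 2) ≤ K := by
    have : 0 ≤ 2 * C₂ ^ 2 * (1 + C₀ ^ 2) + |C₂| * (1 + C₀) + 1 := by positivity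
    rw [hK]; linarith
  have hK2 : 2 * C₂ ^ 2 * (1 + C₀ ^ 2) ≤ K := by
    have : 0 ≤ 4 * C₁ ^ 2 * (1 + C₀ ^ 2) + |C₂| * (1 + C₀) + 1 := by positivity
    rw [hK]; linarith
  have hK3 : |C₂| * (1 + C₀) ≤ K := by
    have : 0 ≤ (4 * C₁ ^ 2 + 2 * C₂ ^ 2) * (1 + C₀ ^ 2) + 1 := by positivity
    rw [hK]; linarith
  refine ⟨K, by positivity, fun s hs y hy => ?_⟩
  have hm := one_sub_sq_pos hy
  have hm1 : 1 - y ^ 2 ≤ 1 := by linarith [sq_nonneg y]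
  have hP := h₀ s hs y hy
  have hH := h₁ s hs y hy
  obtain ⟨hV, hHV, hBT⟩ := h₂ s hs y hy
  rw [abs_rpow_add_one hp] at hV hBT
  have hsq := abs_rpow_sq hp (w s y)
  have hQ : 0 ≤ |w s y| ^ (p - 1) := by positivity
  have hW : 0 ≤ |w s y| ^ p := by positivity
  set Q := |w s y| ^ (p - 1)
  set W := |w s y| ^ p
  set m := 1 - y ^ 2
  have hz : 0 ≤ w s y ^ 2 / m := by positivity
  have hmQ : 0 ≤ Q * m := by positivity
  -- With `W = |w|^p` and `Q = |w|^(p-1)`, `m W² = (Q m)² w²/m`, so the nonlinearity is measured by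
  -- the Hardy term.
  have e1 : m * W ^ 2 ≤ C₀ ^ 2 * (w s y ^ 2 / m) := by
    have : m * W ^ 2 = (Q * m) ^ 2 * (w s y ^ 2 / m) := by
      rw [hsq]; field_simp
    rw [this]
    exact mul_le_mul_of_nonneg_right (pow_le_pow_left₀ hmQ hP 2) hz
  have e2 : Q * w s y ^ 2 ≤ C₀ * (w s y ^ 2 / m) := by
    have : Q * w s y ^ 2 = Q * m * (w s y ^ 2 / m) := by field_simp
    rw [this]
    exact mul_le_mul_of_nonneg_right hP hz
  have hpot : ∀ z, |z| ≤ C₂ * (1 + Q * w s y ^ 2) → |z| ≤ K * (1 + w s y ^ 2 / m) := by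
    intro z hz'
    have hQw : 0 ≤ Q * w s y ^ 2 := by positivity
    calc |z| ≤ |C₂| * (1 + Q * w s y ^ 2) :=
          hz'.trans (mul_le_mul_of_nonneg_right (le_abs_self _) (by positivity))
      _ ≤ |C₂| * ((1 + C₀) * (1 + w s y ^ 2 / m)) := by
          refine mul_le_mul_of_nonneg_left ?_ (abs_nonneg _)
          have : (1 + C₀) * (1 + w s y ^ 2 / m)
            = 1 + C₀ * (w s y ^ 2 / m) + C₀ + w s y ^ 2 / m := by ring
          linarith
      _ = |C₂| * (1 + C₀) * (1 + w s y ^ 2 / m) := by ring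
      _ ≤ _ := mul_le_mul_of_nonneg_right hK3 (by positivity)
  refine ⟨?_, ?_, hpot _ hV, hpot _ hBT⟩
  · have k1 : h s y ^ 2 ≤ C₁ ^ 2 * (1 + |wy s y| + |ws s y| + W) ^ 2 := by
      rw [← sq_abs, ← mul_pow]
      exact pow_le_pow_left₀ (abs_nonneg _) hH 2
    have k2 : (1 + |wy s y| + |ws s y| + W) ^ 2 ≤ 4 * (1 + wy s y ^ 2 + ws s y ^ 2 + W ^ 2) := by
      rw [← sq_abs (wy s y), ← sq_abs (ws s y)]
      nlinarith [sq_nonneg (1 - |wy s y|), sq_nonneg (1 - |ws s y|), sq_nonneg (1 - W),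
        sq_nonneg (|wy s y| - |ws s y|), sq_nonneg (|wy s y| - W), sq_nonneg (|ws s y| - W)]
    have k3 : m * (1 + wy s y ^ 2 + ws s y ^ 2 + W ^ 2)
        ≤ (1 + C₀ ^ 2) * (1 + w s y ^ 2 / m + m * wy s y ^ 2 + ws s y ^ 2) := by
      have n1 : m * ws s y ^ 2 ≤ ws s y ^ 2 := mul_le_of_le_one_left (sq_nonneg _) hm1
      have n2 : 0 ≤ C₀ ^ 2 * (1 + m * wy s y ^ 2 + ws s y ^ 2) := by positivity
      linarith
    calc m * h s y ^ 2 ≤ m * (C₁ ^ 2 * (4 * (1 + wy s y ^ 2 + ws s y ^ 2 + W ^ 2))) :=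
          mul_le_mul_of_nonneg_left (k1.trans (mul_le_mul_of_nonneg_left k2 (sq_nonneg _))) hm.le
      _ = 4 * C₁ ^ 2 * (m * (1 + wy s y ^ 2 + ws s y ^ 2 + W ^ 2)) := by ring
      _ ≤ 4 * C₁ ^ 2 * ((1 + C₀ ^ 2) * (1 + w s y ^ 2 / m + m * wy s y ^ 2 + ws s y ^ 2)) :=
          mul_le_mul_of_nonneg_left k3 (by positivity)
      _ = 4 * C₁ ^ 2 * (1 + C₀ ^ 2) * (1 + w s y ^ 2 / m + m * wy s y ^ 2 + ws s y ^ 2) := by ring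
      _ ≤ _ := mul_le_mul_of_nonneg_right hK1 (by positivity)
  · have k1 : hv s y ^ 2 ≤ C₂ ^ 2 * (1 + W) ^ 2 := by
      rw [← sq_abs, ← mul_pow]
      exact pow_le_pow_left₀ (abs_nonneg _) hHV 2
    have k2 : (1 + W) ^ 2 ≤ 2 * (1 + W ^ 2) := by nlinarith [sq_nonneg (1 - W)]
    have k3 : m * (1 + W ^ 2) ≤ (1 + C₀ ^ 2) * (1 + w s y ^ 2 / m) := by
      have n2 : 0 ≤ C₀ ^ 2 := by positivity
      linarith
    calc m * hv s y ^ 2 ≤ m * (C₂ ^ 2 * (2 * (1 + W ^ 2))) :=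
          mul_le_mul_of_nonneg_left (k1.trans (mul_le_mul_of_nonneg_left k2 (sq_nonneg _))) hm.le
      _ = 2 * C₂ ^ 2 * (m * (1 + W ^ 2)) := by ring
      _ ≤ 2 * C₂ ^ 2 * ((1 + C₀ ^ 2) * (1 + w s y ^ 2 / m)) :=
          mul_le_mul_of_nonneg_left k3 (by positivity)
      _ = 2 * C₂ ^ 2 * (1 + C₀ ^ 2) * (1 + w s y ^ 2 / m) := by ring
      _ ≤ _ := mul_le_mul_of_nonneg_right hK2 (by positivity)

set_option maxHeartbeats 1000000 in
/-- The dissipation is locally integrable in time. -/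
theorem integrableOn_dissip (E : Evolution p σ w wy ws h v hv bt) (hp : 1 < p) (hσ : σ ≤ a)
    (hab : a < b) : IntegrableOn (fun x : ℝ × ℝ => ws x.2 x.1 ^ 2 * (rho p x.1 / (1 - x.1 ^ 2)))
      (Ioo (-1) 1 ×ˢ Ioo a b) := by
  have hal := al_pos hp
  obtain ⟨L, hL0, hL⟩ := exists_cut'_bound
  obtain ⟨C, hC0, hC⟩ := E.pointwise hp b
  set R := Ioo (-1 : ℝ) 1 ×ˢ Ioo a b with hR
  have hRm : MeasurableSet R := measurableSet_Ioo.prod measurableSet_Ioo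
  have hRsub : R ⊆ strip σ := FiniteEnergy.subset_strip hσ
  have hRs {x : ℝ × ℝ} (hx : x ∈ R) : x.2 ∈ Icc σ b := ⟨hσ.trans hx.2.1.le, hx.2.2.le⟩
  have i₀ : IntegrableOn (fun x : ℝ × ℝ => rho p x.1) R := FiniteEnergy.integrableOn_rho_prod hp
  have i₁ : IntegrableOn _ R := E.integrableOn_w_div hp hσ
  have i₂ : IntegrableOn _ R := E.integrableOn_wy hp hσ
  have i₃ : IntegrableOn _ R := E.integrableOn_ws hp hσ
  have hwsm : AEStronglyMeasurable (fun x : ℝ × ℝ => ws x.2 x.1) (volume.restrict R) :=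
    E.meas_ws.mono_set hRsub
  have hDm : AEStronglyMeasurable (fun x : ℝ × ℝ => ws x.2 x.1 ^ 2 * (rho p x.1 / (1 - x.1 ^ 2)))
      (volume.restrict R) := (hwsm.pow 2).mul (measurable_rho_div hp).aestronglyMeasurable
  -- the integrand with the weight `rhoCut`
  set B : ℝ × ℝ → ℝ := fun x =>
    -((1 - x.1 ^ 2) * (wy x.2 x.1 * ws x.2 x.1)) + x.1 * ws x.2 x.1 ^ 2 with hB
  set S : ℝ × ℝ → ℝ := fun x => -2 * al p * x.1 * (wy x.2 x.1 * ws x.2 x.1)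
    - 2 * al p * ws x.2 x.1 ^ 2 + h x.2 x.1 * ws x.2 x.1 with hS
  set Q : ℕ → ℝ × ℝ → ℝ := fun n x => B x * deriv (rhoCut p n) x.1 + S x * rhoCut p n x.1 with hQ
  have hQe (n : ℕ) {x : ℝ × ℝ} (hx : x ∈ R) {μ : ℝ} (hμ : cut' n x.1 = -(x.1 * μ)) :
      Q n x = rho p x.1 * (cut n x.1 * (-(2 * al p) * (ws x.2 x.1 ^ 2 / (1 - x.1 ^ 2))
        + h x.2 x.1 * ws x.2 x.1)
        + μ * (x.1 * (1 - x.1 ^ 2) * wy x.2 x.1 * ws x.2 x.1 - x.1 ^ 2 * ws x.2 x.1 ^ 2)) := by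
    have hm := one_sub_sq_pos hx.1
    simp only [hQ, deriv_rhoCut hx.1, hμ, rhoCut, hB, hS]
    field_simp
    ring
  have hwe (n : ℕ) := isWeight_rhoCut (p := p) (n := n)
  have hψc (n : ℕ) : Continuous (rhoCut p n) := (hwe n).contDiff.continuous
  have hψc' (n : ℕ) : Continuous (deriv (rhoCut p n)) :=
    (hwe n).contDiff.continuous_deriv (by simp)
  have hQm (n : ℕ) : AEStronglyMeasurable (Q n) (volume.restrict R) :=
    ((E.lawE.locB.aestronglyMeasurable.mono_set hRsub).mul
      ((hψc' n).comp continuous_fst).aestronglyMeasurable).add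
      ((E.lawE.locS.aestronglyMeasurable.mono_set hRsub).mul
      ((hψc n).comp continuous_fst).aestronglyMeasurable)
  -- This bound grows with `n` and serves only to make each truncated identity legitimate. Where the
  -- cutoff is active, `1/(1-y²) ≤ n`.
  have hQdom (n : ℕ) (x : ℝ × ℝ) (hx : x ∈ R) : ‖Q n x‖ ≤
      C * rho p x.1 + C * (w x.2 x.1 ^ 2 * (rho p x.1 / (1 - x.1 ^ 2)))
      + (C + L) * ((1 - x.1 ^ 2) * wy x.2 x.1 ^ 2 * rho p x.1)
      + ((2 * al p + 1 + 2 * L) * n + C) * (ws x.2 x.1 ^ 2 * rho p x.1) := by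
    have hm := one_sub_sq_pos hx.1
    have hr := rho_pos (p := p) hx.1
    have hm1 : 1 - x.1 ^ 2 ≤ 1 := by linarith [sq_nonneg x.1]
    obtain ⟨μ, hμ0, hμ, e⟩ := hL n x.1 hx.1
    obtain ⟨hh, -⟩ := hC x.2 (hRs hx) x.1 hx.1
    have hpos : 0 ≤ C * rho p x.1 + C * (w x.2 x.1 ^ 2 * (rho p x.1 / (1 - x.1 ^ 2)))
      + (C + L) * ((1 - x.1 ^ 2) * wy x.2 x.1 ^ 2 * rho p x.1)
      + ((2 * al p + 1 + 2 * L) * n + C) * (ws x.2 x.1 ^ 2 * rho p x.1) := by positivity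
    by_cases hn : n * (1 - x.1 ^ 2) ≤ 1
    · have : Q n x = 0 := by
        simp only [hQ, deriv_rhoCut hx.1, rhoCut, cut_eq_zero hn, cut'_eq_zero (Or.inl hn)]
        ring
      rw [this, norm_zero]
      exact hpos
    have hn' := (not_le.1 hn).le
    rw [hQe n hx e, norm_mul, Real.norm_of_nonneg hr.le]
    have hc0 := cut_nonneg (n := n) (y := x.1)
    have hc1 := cut_le_one (n := n) (y := x.1)
    set m := 1 - x.1 ^ 2 with hmdef
    set A := ws x.2 x.1 with hA
    set D := wy x.2 x.1 with hD
    set g := h x.2 x.1 with hg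
    have t1 : A ^ 2 / m ≤ n * A ^ 2 := by
      rw [div_le_iff₀ hm]
      nlinarith [sq_nonneg A]
    have t2 : |g * A| ≤ m * g ^ 2 + n * A ^ 2 := by
      have h1 : |g * A| ≤ m * g ^ 2 + A ^ 2 / m := by
        rw [abs_mul, ← sub_nonneg]
        have : m * g ^ 2 + A ^ 2 / m - |g| * |A|
            = ((m * |g| - |A|) ^ 2 + m * |g| * |A|) / m := by
          rw [← sq_abs g, ← sq_abs A]; field_simp; ring
        rw [this]; positivity
      linarith
    have t3 : |D * A| ≤ m * D ^ 2 + n * A ^ 2 := by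
      have h1 : |D * A| ≤ m * D ^ 2 + A ^ 2 / m := by
        rw [abs_mul, ← sub_nonneg]
        have : m * D ^ 2 + A ^ 2 / m - |D| * |A|
            = ((m * |D| - |A|) ^ 2 + m * |D| * |A|) / m := by
          rw [← sq_abs D, ← sq_abs A]; field_simp; ring
        rw [this]; positivity
      linarith
    have hμn : μ ≤ L * n := by
      have : μ ≤ μ * (n * m) := le_mul_of_one_le_right hμ0 hn'
      have h2 := mul_le_mul_of_nonneg_right hμ n.cast_nonneg (α := ℝ)
      linarith
    have hy : |x.1| ≤ 1 := (abs_lt.2 hx.1).le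
    have u1 : ‖cut n x.1 * (-(2 * al p) * (A ^ 2 / m) + g * A)‖
        ≤ 2 * al p * (n * A ^ 2) + (m * g ^ 2 + n * A ^ 2) := by
      rw [norm_mul, Real.norm_of_nonneg hc0]
      refine (mul_le_of_le_one_left (norm_nonneg _) hc1).trans ((norm_add_le _ _).trans
        (add_le_add ?_ t2))
      rw [norm_mul, norm_neg, Real.norm_of_nonneg (by positivity),
        Real.norm_of_nonneg (by positivity)]
      exact mul_le_mul_of_nonneg_left t1 (by positivity)
    have u2 : ‖μ * (x.1 * m * D * A - x.1 ^ 2 * A ^ 2)‖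
        ≤ L * (m * D ^ 2 + n * A ^ 2) + L * n * A ^ 2 := by
      have e3 : μ * (x.1 * m * D * A - x.1 ^ 2 * A ^ 2)
          = x.1 * ((μ * m) * (D * A)) - x.1 ^ 2 * (μ * A ^ 2) := by ring
      rw [e3]
      refine (norm_sub_le _ _).trans (add_le_add ?_ ?_)
      · rw [norm_mul, norm_mul, Real.norm_of_nonneg (by positivity : 0 ≤ μ * m)]
        refine (mul_le_of_le_one_left (by positivity) hy).trans ?_
        exact mul_le_mul hμ t3 (norm_nonneg _) hL0.le
      · rw [norm_mul, Real.norm_of_nonneg (sq_nonneg _), Real.norm_of_nonneg (by positivity)]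
        refine (mul_le_of_le_one_left (by positivity) (by linarith)).trans ?_
        exact mul_le_mul_of_nonneg_right hμn (sq_nonneg _)
    have u3 := (norm_add_le _ _).trans (add_le_add u1 u2)
    refine (mul_le_mul_of_nonneg_left u3 hr.le).trans ?_
    have e4 : C * rho p x.1 + C * (w x.2 x.1 ^ 2 * (rho p x.1 / m))
      + (C + L) * (m * D ^ 2 * rho p x.1)
      + ((2 * al p + 1 + 2 * L) * n + C) * (A ^ 2 * rho p x.1)
      = rho p x.1 * (C * (1 + w x.2 x.1 ^ 2 / m + m * D ^ 2 + A ^ 2)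
        + L * (m * D ^ 2) + (2 * al p + 1 + 2 * L) * n * A ^ 2) := by
      field_simp
      ring
    rw [e4]
    refine mul_le_mul_of_nonneg_left ?_ hr.le
    linarith
  have hQi (n : ℕ) : IntegrableOn (Q n) R :=
    Integrable.mono' ((((i₀.const_mul C).add (i₁.const_mul C)).add (i₂.const_mul (C + L))).add
      (i₃.const_mul ((2 * al p + 1 + 2 * L) * n + C))) (hQm n)
      ((ae_restrict_iff' hRm).2 (ae_of_all _ (hQdom n)))
  -- the energy identity
  set Z : ℝ × ℝ → ℝ := fun x => C / (2 * al p) * rho p x.1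
    + C / (2 * al p) * (w x.2 x.1 ^ 2 * (rho p x.1 / (1 - x.1 ^ 2)))
    + (C / (2 * al p) + L) * ((1 - x.1 ^ 2) * wy x.2 x.1 ^ 2 * rho p x.1)
    + C / (2 * al p) * (ws x.2 x.1 ^ 2 * rho p x.1) with hZ
  have hZi : IntegrableOn Z R :=
    (((i₀.const_mul _).add (i₁.const_mul _)).add (i₂.const_mul _)).add (i₃.const_mul _)
  have hQle (n : ℕ) (x : ℝ × ℝ) (hx : x ∈ R) :
      al p * (cut n x.1 * (ws x.2 x.1 ^ 2 * (rho p x.1 / (1 - x.1 ^ 2)))) ≤ Z x - Q n x := by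
    have hm := one_sub_sq_pos hx.1
    have hr := rho_pos (p := p) hx.1
    have hm1 : 1 - x.1 ^ 2 ≤ 1 := by linarith [sq_nonneg x.1]
    obtain ⟨μ, hμ0, hμ, e⟩ := hL n x.1 hx.1
    obtain ⟨hh, -⟩ := hC x.2 (hRs hx) x.1 hx.1
    have hc0 := cut_nonneg (n := n) (y := x.1)
    have hc1 := cut_le_one (n := n) (y := x.1)
    rw [hQe n hx e]
    simp only [hZ]
    set m := 1 - x.1 ^ 2 with hmdef
    set A := ws x.2 x.1 with hA
    set D := wy x.2 x.1 with hD
    set g := h x.2 x.1 with hg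
    set c := cut n x.1 with hc
    set T := C * (1 + w x.2 x.1 ^ 2 / m + m * D ^ 2 + A ^ 2) with hT
    have hT0 : 0 ≤ T := by positivity
    have e4 : C / (2 * al p) * rho p x.1 + C / (2 * al p) * (w x.2 x.1 ^ 2 * (rho p x.1 / m))
      + (C / (2 * al p) + L) * (m * D ^ 2 * rho p x.1)
      + C / (2 * al p) * (A ^ 2 * rho p x.1)
      - rho p x.1 * (c * (-(2 * al p) * (A ^ 2 / m) + g * A)
        + μ * (x.1 * m * D * A - x.1 ^ 2 * A ^ 2)) - al p * (c * (A ^ 2 * (rho p x.1 / m)))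
      = rho p x.1 * ((T / (2 * al p) - c * (g * A - al p * (A ^ 2 / m)))
        + (L * (m * D ^ 2) - μ * (x.1 * m * D * A - x.1 ^ 2 * A ^ 2))) := by
      rw [hT]
      field_simp
      ring
    -- Half of the dissipation coefficient `2 al p` absorbs the source term by Young's inequality,
    -- leaving `al p`.
    have f1 : g * A - al p * (A ^ 2 / m) ≤ T / (2 * al p) := by
      have h1 : g * A - al p * (A ^ 2 / m) ≤ m * g ^ 2 / (2 * al p) := by
        rw [← sub_nonneg]
        have : m * g ^ 2 / (2 * al p) - (g * A - al p * (A ^ 2 / m))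
            = ((m * g - al p * A) ^ 2 + al p ^ 2 * A ^ 2) / (2 * al p * m) := by
          field_simp; ring
        rw [this]; positivity
      exact h1.trans (div_le_div_of_nonneg_right hh (by positivity))
    have f2 : c * (g * A - al p * (A ^ 2 / m)) ≤ T / (2 * al p) :=
      (mul_le_mul_of_nonneg_left f1 hc0).trans (mul_le_of_le_one_left (by positivity) hc1)
    -- This is the flux through the cutoff layer. Its quadratic term in `∂_s w` has the good sign
    -- and dominates the cross term, which is what makes the estimate independent of `n`.
    have f3 : μ * (x.1 * m * D * A - x.1 ^ 2 * A ^ 2) ≤ L * (m * D ^ 2) := by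
      have g1 : x.1 * m * D * A - x.1 ^ 2 * A ^ 2 ≤ (m * D) ^ 2 := by
        have := mul_sub_sq_le (m * D) (x.1 * A)
        linarith
      calc μ * (x.1 * m * D * A - x.1 ^ 2 * A ^ 2) ≤ μ * (m * D) ^ 2 :=
            mul_le_mul_of_nonneg_left g1 hμ0
        _ = μ * m * (m * D ^ 2) := by ring
        _ ≤ L * (m * D ^ 2) := mul_le_mul_of_nonneg_right hμ (by positivity)
    have : 0 ≤ rho p x.1 * ((T / (2 * al p) - c * (g * A - al p * (A ^ 2 / m)))
        + (L * (m * D ^ 2) - μ * (x.1 * m * D * A - x.1 ^ 2 * A ^ 2))) :=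
      mul_nonneg hr.le (by linarith)
    linarith
  set e₀ : ℝ → ℝ → ℝ := fun s y => 1 / 2 * ws s y ^ 2 + 1 / 2 * wy s y ^ 2 * (1 - y ^ 2)
    + al p * (al p + 1) / 2 * w s y ^ 2 with he₀
  have he₀i (s : ℝ) (hs : σ ≤ s) : IntegrableOn (fun y => e₀ s y * rho p y) (Ioo (-1) 1) := by
    refine ((((E.int_ws s hs).const_mul (1 / 2)).add ((E.int_wy s hs).const_mul (1 / 2))).add
      ((E.int_w s hs).const_mul (al p * (al p + 1) / 2))).congr (ae_of_all _ fun y => ?_)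
    simp only [he₀, Pi.add_apply]
    ring
  have he₀n (s : ℝ) {y : ℝ} (hy : y ∈ Ioo (-1 : ℝ) 1) : 0 ≤ e₀ s y := by
    have hm := one_sub_sq_pos hy
    simp only [he₀]
    positivity
  have hPe (n : ℕ) (s : ℝ) : ∫ y, e₀ s y * rhoCut p n y
      = ∫ y in Ioo (-1) 1, e₀ s y * rhoCut p n y := by
    refine (setIntegral_eq_integral_of_forall_compl_eq_zero fun y hy => ?_).symm
    rw [image_eq_zero_of_notMem_tsupport fun hh => hy ((hwe n).subset hh), mul_zero]
  have hP0 (n : ℕ) (s : ℝ) : 0 ≤ ∫ y, e₀ s y * rhoCut p n y := by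
    rw [hPe]
    exact setIntegral_nonneg measurableSet_Ioo fun y hy =>
      mul_nonneg (he₀n s hy) (mul_nonneg (rho_pos hy).le cut_nonneg)
  have hPle (n : ℕ) (s : ℝ) (hs : σ ≤ s) :
      ∫ y, e₀ s y * rhoCut p n y ≤ ∫ y in Ioo (-1) 1, e₀ s y * rho p y := by
    rw [hPe]
    refine setIntegral_mono_on ((E.contE _ (hψc n) exists_rhoCut_eq_zero).1 s hs).integrableOn
      (he₀i s hs) measurableSet_Ioo fun y hy => ?_
    exact mul_le_mul_of_nonneg_left (mul_le_of_le_one_right (rho_pos hy).le cut_le_one)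
      (he₀n s hy)
  have hid (n : ℕ) := E.lawE.integral_identity (hwe n) hσ hab
    ((E.contE _ (hψc n) exists_rhoCut_eq_zero).2.mono
      (Icc_subset_Ici_self.trans (Ici_subset_Ici.2 hσ))) (hQi n)
  have hcutm (n : ℕ) : Continuous fun x : ℝ × ℝ => cut n x.1 :=
    contDiff_cut.continuous.comp continuous_fst
  have hDn {x : ℝ × ℝ} (hx : x ∈ R) : 0 ≤ ws x.2 x.1 ^ 2 * (rho p x.1 / (1 - x.1 ^ 2)) :=
    mul_nonneg (sq_nonneg _) (div_nonneg (rho_pos hx.1).le (one_sub_sq_pos hx.1).le)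
  have hci (n : ℕ) : IntegrableOn (fun x : ℝ × ℝ =>
      al p * (cut n x.1 * (ws x.2 x.1 ^ 2 * (rho p x.1 / (1 - x.1 ^ 2))))) R := by
    refine Integrable.mono' (hZi.sub (hQi n))
      (((hcutm n).aestronglyMeasurable.mul hDm).const_mul _)
      ((ae_restrict_iff' hRm).2 (ae_of_all _ fun x hx => ?_))
    rw [Real.norm_of_nonneg (mul_nonneg hal.le (mul_nonneg cut_nonneg (hDn hx)))]
    exact hQle n x hx
  -- The truncated quadratic energy is nonnegative at time `b` and at most the full one at time `a`;
  -- the energy here leaves out the potential, which is treated as part of the source.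
  have hcb (n : ℕ) : ∫ x in R, al p * (cut n x.1 * (ws x.2 x.1 ^ 2 * (rho p x.1 / (1 - x.1 ^ 2))))
      ≤ (∫ x in R, Z x) + ∫ y in Ioo (-1) 1, e₀ a y * rho p y := by
    have h1 := setIntegral_mono_on (hci n) (hZi.sub (hQi n)) hRm (hQle n)
    have h2 : ∫ x in R, (Z - Q n) x = (∫ x in R, Z x) - ∫ x in R, Q n x :=
      integral_sub hZi (hQi n)
    rw [h2, ← hid n] at h1
    have h3 := hP0 n b
    have h4 := hPle n a hσ
    simp only [he₀] at h3 h4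
    linarith
  -- exhaustion
  set φ : ℕ → Set (ℝ × ℝ) := fun n => {x | 2 ≤ n * (1 - x.1 ^ 2)} with hφ
  have hφm (n : ℕ) : MeasurableSet (φ n) :=
    measurableSet_le measurable_const
      (by fun_prop : Continuous fun x : ℝ × ℝ => (n : ℝ) * (1 - x.1 ^ 2)).measurable
  have hcov : AECover (volume.restrict R) atTop φ := by
    refine ⟨?_, hφm⟩
    filter_upwards [ae_restrict_mem hRm] with x hx using eventually_cut hx.1
  have hφi (n : ℕ) : IntegrableOn (fun x : ℝ × ℝ =>
      al p * (ws x.2 x.1 ^ 2 * (rho p x.1 / (1 - x.1 ^ 2)))) (φ n) (volume.restrict R) := by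
    refine (IntegrableOn.congr_fun (f := fun x : ℝ × ℝ =>
      al p * (cut n x.1 * (ws x.2 x.1 ^ 2 * (rho p x.1 / (1 - x.1 ^ 2))))) ?_ (fun x hx => ?_)
      (hφm n))
    · exact (hci n).integrableOn
    · simp only [cut_eq_one hx, one_mul]
  have hfin := hcov.integrable_of_integral_bounded_of_nonneg_ae
    ((∫ x in R, Z x) + ∫ y in Ioo (-1) 1, e₀ a y * rho p y) hφi
    (by
      filter_upwards [ae_restrict_mem hRm] with x hx
      exact mul_nonneg hal.le (hDn hx))
    (Eventually.of_forall fun n => by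
      refine le_trans ?_ (hcb n)
      have e1 : ∫ x in φ n, al p * (ws x.2 x.1 ^ 2 * (rho p x.1 / (1 - x.1 ^ 2)))
          ∂(volume.restrict R)
          = ∫ x in φ n, al p * (cut n x.1 * (ws x.2 x.1 ^ 2 * (rho p x.1 / (1 - x.1 ^ 2))))
          ∂(volume.restrict R) :=
        setIntegral_congr_fun (hφm n) fun x hx => by
          simp only [cut_eq_one hx, one_mul]
      rw [e1]
      refine setIntegral_le_integral (hci n) ?_
      filter_upwards [ae_restrict_mem hRm] with x hx
      exact mul_nonneg hal.le (mul_nonneg cut_nonneg (hDn hx)))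
  refine (hfin.const_mul (al p)⁻¹).congr (ae_of_all _ fun x => ?_)
  exact inv_mul_cancel_left₀ hal.ne' _

end Evolution

/-! ## The energy identity -/

lemma IntegrableOn.continuous_mul {a b : ℝ} {f c : ℝ × ℝ → ℝ}
    (hf : IntegrableOn f (Ioo (-1) 1 ×ˢ Ioo a b)) (hc : Continuous c) :
    IntegrableOn (fun x => c x * f x) (Ioo (-1) 1 ×ˢ Ioo a b) := by
  obtain ⟨C, hC⟩ := (isCompact_Icc.prod isCompact_Icc).exists_bound_of_continuousOn
    (s := Icc (-1 : ℝ) 1 ×ˢ Icc a b) hc.continuousOn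
  refine Integrable.bdd_mul (c := C) hf hc.aestronglyMeasurable ?_
  filter_upwards [ae_restrict_mem (measurableSet_Ioo.prod measurableSet_Ioo)] with x hx
  exact hC x (prod_mono Ioo_subset_Icc_self Ioo_subset_Icc_self hx)

lemma abs_mul_le_weighted {m : ℝ} (hm : 0 < m) (x z : ℝ) : |x * z| ≤ m * x ^ 2 + z ^ 2 / m := by
  rw [abs_mul, ← sub_nonneg]
  have : m * x ^ 2 + z ^ 2 / m - |x| * |z| = ((m * |x| - |z|) ^ 2 + m * |x| * |z|) / m := by
    rw [← sq_abs x, ← sq_abs z]; field_simp; ring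
  rw [this]; positivity

/-- The density of the functional `E`. -/
def energyDensity (p γ : ℝ) (w wy ws v : ℝ → ℝ → ℝ) (s y : ℝ) : ℝ :=
  1 / 2 * ws s y ^ 2 + 1 / 2 * wy s y ^ 2 * (1 - y ^ 2) + al p * (al p + 1) / 2 * w s y ^ 2
    - v s y - Real.exp (-γ * s) * (w s y * ws s y)

/-- The density of the derivative of `E`. -/
def rateDensity (p γ : ℝ) (w wy ws h v hv bt : ℝ → ℝ → ℝ) (s y : ℝ) : ℝ :=
  -(2 * al p) * (ws s y ^ 2 / (1 - y ^ 2))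
    + (h s y * ws s y - hv s y * (ws s y + al p * w s y) + bt s y + 2 * (al p + 1) * v s y)
    + γ * Real.exp (-γ * s) * (w s y * ws s y)
    - Real.exp (-γ * s) * (ws s y ^ 2 - (1 - y ^ 2) * wy s y ^ 2 - al p * (al p + 1) * w s y ^ 2
      + (1 + 2 * al p) * (w s y * ws s y) + 2 * y * (ws s y * wy s y) + h s y * w s y
      - 4 * al p * (w s y * ws s y / (1 - y ^ 2)))

namespace Evolution

variable {p σ a b γ : ℝ} {w wy ws h v hv bt : ℝ → ℝ → ℝ}

lemma integrableOn_v (E : Evolution p σ w wy ws h v hv bt) (hp : 1 < p) {s : ℝ} (hs : σ ≤ s) :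
    IntegrableOn (fun y => v s y * rho p y) (Ioo (-1) 1) := by
  obtain ⟨C, hC0, hC⟩ := E.pointwise hp s
  refine Integrable.mono' (((integrableOn_rho hp).const_mul C).add ((E.hardy hp hs).1.const_mul C))
    (((E.slice_v s hs).mul continuousOn_rho).aestronglyMeasurable measurableSet_Ioo) ?_
  filter_upwards [ae_restrict_mem measurableSet_Ioo] with y hy
  have hr := rho_pos (p := p) hy
  have := mul_le_mul_of_nonneg_right (hC s ⟨hs, le_rfl⟩ y hy).2.2.1 hr.le
  rw [norm_mul, Real.norm_eq_abs, Real.norm_of_nonneg hr.le]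
  refine this.trans (le_of_eq ?_)
  simp only [Pi.add_apply]
  ring

lemma _root_.SimilarityEnergy.FiniteEnergy.integrableOn_w_ws (E : FiniteEnergy p σ w wy ws)
    {s : ℝ} (hs : σ ≤ s) :
    IntegrableOn (fun y => w s y * ws s y * rho p y) (Ioo (-1) 1) := by
  refine Integrable.mono' ((E.int_w s hs).add (E.int_ws s hs))
    ((((E.slice_w hs).aestronglyMeasurable measurableSet_Ioo).mul (E.slice_ws s hs)).mul
      (continuousOn_rho.aestronglyMeasurable measurableSet_Ioo)) ?_
  filter_upwards [ae_restrict_mem measurableSet_Ioo] with y hy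
  have hr := rho_pos (p := p) hy
  have h1 := abs_mul_le_weighted one_pos (w s y) (ws s y)
  rw [one_mul, div_one] at h1
  rw [norm_mul, Real.norm_eq_abs, Real.norm_of_nonneg hr.le, Pi.add_apply]
  have := mul_le_mul_of_nonneg_right h1 hr.le
  linarith

lemma integrableOn_energyDensity (E : Evolution p σ w wy ws h v hv bt) (hp : 1 < p) {s : ℝ}
    (hs : σ ≤ s) :
    IntegrableOn (fun y => energyDensity p γ w wy ws v s y * rho p y) (Ioo (-1) 1) := by
  refine (((((E.int_ws s hs).const_mul (1 / 2)).add ((E.int_wy s hs).const_mul (1 / 2))).add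
    ((E.int_w s hs).const_mul (al p * (al p + 1) / 2))).sub (E.integrableOn_v hp hs)).sub
    ((E.integrableOn_w_ws hs).const_mul (Real.exp (-γ * s))) |>.congr (ae_of_all _ fun y => ?_)
  simp only [energyDensity, Pi.add_apply, Pi.sub_apply]
  ring

/-- The integrals in the energy identity converge. -/
lemma integrableOn_of_le (E : Evolution p σ w wy ws h v hv bt) (hp : 1 < p) (hσ : σ ≤ a)
    (hab : a < b) {z : ℝ × ℝ → ℝ} {K : ℝ}
    (hz : AEStronglyMeasurable z (volume.restrict (Ioo (-1) 1 ×ˢ Ioo a b)))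
    (hle : ∀ x ∈ Ioo (-1 : ℝ) 1 ×ˢ Ioo a b, |z x| ≤ K * (1 + w x.2 x.1 ^ 2 / (1 - x.1 ^ 2)
      + (1 - x.1 ^ 2) * wy x.2 x.1 ^ 2 + ws x.2 x.1 ^ 2 / (1 - x.1 ^ 2))) :
    IntegrableOn (fun x => z x * rho p x.1) (Ioo (-1) 1 ×ˢ Ioo a b) := by
  refine Integrable.mono' (((((FiniteEnergy.integrableOn_rho_prod hp).add
    (E.integrableOn_w_div hp hσ)).add (E.integrableOn_wy hp hσ)).add
    (E.integrableOn_dissip hp hσ hab)).const_mul K)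
    (hz.mul (measurable_rho hp).aestronglyMeasurable) ?_
  filter_upwards [ae_restrict_mem (measurableSet_Ioo.prod measurableSet_Ioo)] with x hx
  have hr := rho_pos (p := p) hx.1
  rw [norm_mul, Real.norm_eq_abs, Real.norm_of_nonneg hr.le]
  refine (mul_le_mul_of_nonneg_right (hle x hx) hr.le).trans (le_of_eq ?_)
  simp only [Pi.add_apply]
  ring

/-- The energy identity, for the functional `E`. -/
theorem energy_identity (E : Evolution p σ w wy ws h v hv bt) (hp : 1 < p) (hσ : σ ≤ a)
    (hab : a < b) :
    IntegrableOn (fun x : ℝ × ℝ => rateDensity p γ w wy ws h v hv bt x.2 x.1 * rho p x.1)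
      (Ioo (-1) 1 ×ˢ Ioo a b) ∧
    (∫ y in Ioo (-1) 1, energyDensity p γ w wy ws v b y * rho p y)
      - ∫ y in Ioo (-1) 1, energyDensity p γ w wy ws v a y * rho p y
      = ∫ x in Ioo (-1) 1 ×ˢ Ioo a b,
        rateDensity p γ w wy ws h v hv bt x.2 x.1 * rho p x.1 := by
  obtain ⟨C, hC0, hC⟩ := E.pointwise hp b
  set R := Ioo (-1 : ℝ) 1 ×ˢ Ioo a b with hR
  have hRm : MeasurableSet R := measurableSet_Ioo.prod measurableSet_Ioo
  have hsub : R ⊆ strip σ := FiniteEnergy.subset_strip hσ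
  have mw := E.meas_w.mono_set hsub
  have mwy := E.meas_wy.mono_set hsub
  have mws := E.meas_ws.mono_set hsub
  have mh := E.meas_h.mono_set hsub
  have mhv := E.meas_hv.mono_set hsub
  have mm : AEStronglyMeasurable (fun x : ℝ × ℝ => 1 - x.1 ^ 2) (volume.restrict R) :=
    (by fun_prop : Continuous fun x : ℝ × ℝ => 1 - x.1 ^ 2).aestronglyMeasurable
  have mm' : AEStronglyMeasurable (fun x : ℝ × ℝ => (1 - x.1 ^ 2)⁻¹) (volume.restrict R) :=
    (by fun_prop : Continuous fun x : ℝ × ℝ => 1 - x.1 ^ 2).measurable.inv.aestronglyMeasurable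
  have mr {z : ℝ × ℝ → ℝ} {K : ℝ} := E.integrableOn_of_le (z := z) (K := K) hp hσ hab
  -- pointwise facts
  have pos {x : ℝ × ℝ} (hx : x ∈ R) : 0 ≤ w x.2 x.1 ^ 2 / (1 - x.1 ^ 2) ∧
      0 ≤ (1 - x.1 ^ 2) * wy x.2 x.1 ^ 2 ∧ 0 ≤ ws x.2 x.1 ^ 2 / (1 - x.1 ^ 2) := by
    have := one_sub_sq_pos hx.1
    refine ⟨by positivity, by positivity, by positivity⟩
  have hwsq {x : ℝ × ℝ} (hx : x ∈ R) : ws x.2 x.1 ^ 2 ≤ ws x.2 x.1 ^ 2 / (1 - x.1 ^ 2) := by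
    rw [le_div_iff₀ (one_sub_sq_pos hx.1)]
    nlinarith [sq_nonneg (ws x.2 x.1), sq_nonneg x.1]
  have hCx {x : ℝ × ℝ} (hx : x ∈ R) := hC x.2 ⟨hσ.trans hx.2.1.le, hx.2.2.le⟩ x.1 hx.1
  have bh {x : ℝ × ℝ} (hx : x ∈ R) : (1 - x.1 ^ 2) * h x.2 x.1 ^ 2
      ≤ C * (1 + w x.2 x.1 ^ 2 / (1 - x.1 ^ 2)
        + (1 - x.1 ^ 2) * wy x.2 x.1 ^ 2 + ws x.2 x.1 ^ 2 / (1 - x.1 ^ 2)) :=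
    (hCx hx).1.trans (mul_le_mul_of_nonneg_left (by linarith [hwsq hx]) hC0.le)
  have bV {x : ℝ × ℝ} (hx : x ∈ R) : C * (1 + w x.2 x.1 ^ 2 / (1 - x.1 ^ 2))
      ≤ C * (1 + w x.2 x.1 ^ 2 / (1 - x.1 ^ 2)
        + (1 - x.1 ^ 2) * wy x.2 x.1 ^ 2 + ws x.2 x.1 ^ 2 / (1 - x.1 ^ 2)) :=
    mul_le_mul_of_nonneg_left (by linarith [pos hx]) hC0.le
  have j1 := mr (z := fun x => wy x.2 x.1 * ws x.2 x.1) (K := 1) (mwy.mul mws) fun x hx => by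
    linarith [abs_mul_le_weighted (one_sub_sq_pos hx.1) (wy x.2 x.1) (ws x.2 x.1), pos hx]
  have j2 := mr (z := fun x => w x.2 x.1 * wy x.2 x.1) (K := 1) (mw.mul mwy) fun x hx => by
    rw [mul_comm (w x.2 x.1)]
    linarith [abs_mul_le_weighted (one_sub_sq_pos hx.1) (wy x.2 x.1) (w x.2 x.1), pos hx]
  have j3 := mr (z := fun x => (w x.2 x.1 * ws x.2 x.1) * (1 - x.1 ^ 2)⁻¹) (K := 1)
    ((mw.mul mws).mul mm') fun x hx => by
    have hm := one_sub_sq_pos hx.1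
    have h1 := abs_mul_le_weighted one_pos (w x.2 x.1) (ws x.2 x.1)
    rw [one_mul, div_one] at h1
    rw [abs_mul, abs_of_pos (inv_pos.2 hm)]
    have h2 := mul_le_mul_of_nonneg_right h1 (inv_pos.2 hm).le
    rw [add_mul, ← div_eq_mul_inv (w x.2 x.1 ^ 2), ← div_eq_mul_inv (ws x.2 x.1 ^ 2)] at h2
    linarith [pos hx]
  have j4 := mr (z := fun x => ws x.2 x.1 ^ 2 * (1 - x.1 ^ 2)⁻¹) (K := 1)
    ((mws.pow 2).mul mm') fun x hx => by
    rw [← div_eq_mul_inv, abs_of_nonneg (pos hx).2.2]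
    linarith [pos hx]
  have j5 := mr (z := fun x => w x.2 x.1 ^ 2 * (1 - x.1 ^ 2)⁻¹) (K := 1)
    ((mw.pow 2).mul mm') fun x hx => by
    rw [← div_eq_mul_inv, abs_of_nonneg (pos hx).1]
    linarith [pos hx]
  have j6 := mr (z := fun x => (1 - x.1 ^ 2) * wy x.2 x.1 ^ 2) (K := 1)
    (mm.mul (mwy.pow 2)) fun x hx => by
    rw [abs_of_nonneg (pos hx).2.1]
    linarith [pos hx]
  have j7 := mr (z := fun x => h x.2 x.1 * ws x.2 x.1) (K := C + 1) (mh.mul mws) fun x hx => by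
    linarith [abs_mul_le_weighted (one_sub_sq_pos hx.1) (h x.2 x.1) (ws x.2 x.1), pos hx, bh hx]
  have j8 := mr (z := fun x => h x.2 x.1 * w x.2 x.1) (K := C + 1) (mh.mul mw) fun x hx => by
    linarith [abs_mul_le_weighted (one_sub_sq_pos hx.1) (h x.2 x.1) (w x.2 x.1), pos hx, bh hx]
  have j9 := mr (z := fun x => hv x.2 x.1 * ws x.2 x.1) (K := C + 1) (mhv.mul mws) fun x hx => by
    linarith [abs_mul_le_weighted (one_sub_sq_pos hx.1) (hv x.2 x.1) (ws x.2 x.1), pos hx,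
      (hCx hx).2.1, bV hx]
  have j10 := mr (z := fun x => hv x.2 x.1 * w x.2 x.1) (K := C + 1) (mhv.mul mw) fun x hx => by
    linarith [abs_mul_le_weighted (one_sub_sq_pos hx.1) (hv x.2 x.1) (w x.2 x.1), pos hx,
      (hCx hx).2.1, bV hx]
  have j11 := mr (z := fun x => v x.2 x.1) (K := C) (E.meas_v.mono_set hsub) fun x hx =>
    (hCx hx).2.2.1.trans (bV hx)
  have j12 := mr (z := fun x => bt x.2 x.1) (K := C) (E.meas_bt.mono_set hsub) fun x hx =>
    (hCx hx).2.2.2.trans (bV hx)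
  -- the law
  set Bt : ℝ × ℝ → ℝ := fun x =>
    -((1 - x.1 ^ 2) * (wy x.2 x.1 * ws x.2 x.1)) + x.1 * ws x.2 x.1 ^ 2
      + Real.exp (-γ * x.2) * ((1 - x.1 ^ 2) * (w x.2 x.1 * wy x.2 x.1)
        - 2 * x.1 * (w x.2 x.1 * ws x.2 x.1)) with hBt
  set St : ℝ × ℝ → ℝ := fun x => -2 * al p * x.1 * (wy x.2 x.1 * ws x.2 x.1)
    - 2 * al p * ws x.2 x.1 ^ 2 + h x.2 x.1 * ws x.2 x.1
    - (hv x.2 x.1 * (ws x.2 x.1 + al p * w x.2 x.1) - bt x.2 x.1 - 2 * (al p + 1) * v x.2 x.1)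
    - Real.exp (-γ * x.2) * (ws x.2 x.1 ^ 2 - (1 - x.1 ^ 2) * wy x.2 x.1 ^ 2
      - al p * (al p + 1) * w x.2 x.1 ^ 2
      + (1 - 2 * al p) * (w x.2 x.1 * ws x.2 x.1)
      + 2 * x.1 * (ws x.2 x.1 * wy x.2 x.1)
      - 2 * al p * x.1 * (w x.2 x.1 * wy x.2 x.1)
      + h x.2 x.1 * w x.2 x.1 - γ * (w x.2 x.1 * ws x.2 x.1)) with hSt
  -- The law of `E` is the energy law minus the potential law minus `e^(-γs)` times the law of `w
  -- ∂_s w`.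
  have law : FluxLaw (strip σ) (fun x => energyDensity p γ w wy ws v x.2 x.1) Bt St := by
    have hΩ : IsOpen (strip σ) := isOpen_strip
    refine ((E.lawE.add (E.lawV.const_mul hΩ (-1))).add
      ((E.lawK.mul_exp hΩ (-γ)).const_mul hΩ (-1))).congr hΩ (fun x _ => ?_) (fun x _ => ?_)
      (fun x _ => ?_)
    · simp only [energyDensity]; ring
    · simp only [hBt]; ring
    · simp only [hSt]; ring
  have cont : SliceCont σ fun x => energyDensity p γ w wy ws v x.2 x.1 := by
    refine ((E.contE.add (E.contV.coeff_mul (c := fun _ => -1) (k := fun _ => 1) (by fun_prop)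
      (by fun_prop))).add (E.contK.coeff_mul (c := fun s => -Real.exp (-γ * s)) (k := fun _ => 1)
      (by fun_prop) (by fun_prop))).congr fun x => ?_
    simp only [energyDensity]
    ring
  have iB : IntegrableOn (fun x => Bt x * (rho p x.1 / (1 - x.1 ^ 2))) R := by
    refine IntegrableOn.congr_fun (((j1.neg).add (IntegrableOn.continuous_mul j4
      (c := fun x => x.1) (by fun_prop))).add
      ((IntegrableOn.continuous_mul j2 (c := fun x => Real.exp (-γ * x.2)) (by fun_prop)).sub
      (IntegrableOn.continuous_mul j3 (c := fun x => Real.exp (-γ * x.2) * (2 * x.1))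
        (by fun_prop)))) (fun x hx => ?_) hRm
    have hm := (one_sub_sq_pos hx.1).ne'
    simp only [hBt, Pi.add_apply, Pi.sub_apply, Pi.neg_apply]
    field_simp
  have iS : IntegrableOn (fun x => St x * rho p x.1) R := by
    refine IntegrableOn.congr_fun
      ((((((IntegrableOn.continuous_mul j1 (c := fun x => -2 * al p * x.1
            - Real.exp (-γ * x.2) * (2 * x.1)) (by fun_prop)).add
        (IntegrableOn.continuous_mul j4 (c := fun x => -(2 * al p + Real.exp (-γ * x.2))
            * (1 - x.1 ^ 2)) (by fun_prop))).add
        ((j7.sub j9).sub (j10.const_mul (al p)))).add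
        ((j12.add (j11.const_mul (2 * (al p + 1)))).add
        (IntegrableOn.continuous_mul j6 (c := fun x => Real.exp (-γ * x.2)) (by fun_prop)))).add
        ((IntegrableOn.continuous_mul j5 (c := fun x => Real.exp (-γ * x.2)
            * (al p * (al p + 1)) * (1 - x.1 ^ 2)) (by fun_prop)).add
        (IntegrableOn.continuous_mul j3 (c := fun x => Real.exp (-γ * x.2)
            * (γ - (1 - 2 * al p)) * (1 - x.1 ^ 2)) (by fun_prop)))).add
        ((IntegrableOn.continuous_mul j2 (c := fun x => Real.exp (-γ * x.2)
            * (2 * al p * x.1)) (by fun_prop)).sub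
        (IntegrableOn.continuous_mul j8 (c := fun x => Real.exp (-γ * x.2)) (by fun_prop))))
      (fun x hx => ?_) hRm
    have hm := (one_sub_sq_pos hx.1).ne'
    simp only [hSt, Pi.add_apply, Pi.sub_apply]
    field_simp
    ring
  -- The derivative of the weight acts on the flux. In the energy part the products `∂_y w ∂_s w`
  -- cancel, and `-2 al p (∂_s w)² (1 + y²/(1-y²))` combines to the dissipation. In the part from
  -- `K` the term `w ∂_y w` cancels likewise.
  have hrate {x : ℝ × ℝ} (hx : x ∈ R) : St x * rho p x.1
      - 2 * al p * x.1 * (Bt x * (rho p x.1 / (1 - x.1 ^ 2)))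
      = rateDensity p γ w wy ws h v hv bt x.2 x.1 * rho p x.1 := by
    have hm := (one_sub_sq_pos hx.1).ne'
    simp only [hSt, hBt, rateDensity]
    field_simp
    ring
  refine ⟨IntegrableOn.congr_fun (iS.sub (IntegrableOn.continuous_mul iB
    (c := fun x => 2 * al p * x.1) (by fun_prop))) (fun x hx => hrate hx) hRm, ?_⟩
  rw [law.integral_identity_rho hp cont hσ hab (E.integrableOn_energyDensity hp hσ)
    (E.integrableOn_energyDensity hp (hσ.trans hab.le)) iB iS]
  exact setIntegral_congr_fun hRm fun x hx => hrate hx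

end Evolution

/-! ## The differential inequality -/

/-- The coercivity constant of the differential inequality. -/
def kap (p b₀ : ℝ) : ℝ :=
  min (min ((p - 1) / 4) (al p * (al p + 1) * ((p - 1) / 4)))
    (min (b₀ * ((p - 1) / (2 * (p + 1)))) (al p / 2))

lemma kap_pos {p b₀ : ℝ} (hp : 1 < p) (hb : 0 < b₀) : 0 < kap p b₀ := by
  have hal := al_pos hp
  have h1 : 0 < p - 1 := by linarith
  have h2 : 0 < p + 1 := by linarith
  rw [kap]
  refine lt_min (lt_min ?_ ?_) (lt_min ?_ ?_) <;> positivity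

/-- The constant in the error terms of the differential inequality. -/
def lamErr (p M Λ : ℝ) : ℝ := (1 + (p + 3) / 2) * (2 * M + 2 * Λ + 12 + 6 * al p)

lemma lamErr_pos {p M Λ : ℝ} (hp : 1 < p) (hM : 0 ≤ M) (hΛ : 0 ≤ Λ) : 0 < lamErr p M Λ := by
  have := al_pos hp
  rw [lamErr]
  have : 0 < p := by linarith
  positivity

lemma abs_le_one_add_sq (x : ℝ) : |x| ≤ 1 + x ^ 2 := by
  rw [← sq_abs]; nlinarith [sq_nonneg (|x| - 1)]

set_option maxHeartbeats 1000000 in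
/-- The pointwise form of the differential inequalities. -/
lemma rate_le {p γ M Λ b₀ b δ g m y w wy ws h hv bt v P : ℝ} (hp : 1 < p) (hγ : 0 < γ)
    (hγ1 : γ ≤ 1 / 2) (hM : 0 ≤ M) (hΛ : 0 ≤ Λ) (hb : b₀ ≤ b)
    (hδ : 0 < δ) (hδ1 : δ ≤ 1) (hg : 0 < g) (hgδ : g ≤ δ ^ 2) (hm : 0 < m) (hmy : m = 1 - y ^ 2)
    (hP : 0 ≤ P)
    (h1 : |h - hv| ≤ δ * g * (|wy| + |ws| + |w|) + M * g ^ 2)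
    (h2 : |2 * (al p + 1) * v - al p * (hv * w)| ≤ Λ * (g ^ 2 * (1 + P)))
    (h3 : |hv * w - b * P| ≤ Λ * (g ^ 2 * (1 + P)) + δ * g * P)
    (h4 : |bt| ≤ δ * g * P)
    (h5 : |v - b / (p + 1) * P| ≤ Λ * (g ^ 2 * (1 + P)) + δ * g * P) :
    let e₀ := 1 / 2 * ws ^ 2 + 1 / 2 * wy ^ 2 * m + al p * (al p + 1) / 2 * w ^ 2
      - b / (p + 1) * P
    let e := 1 / 2 * ws ^ 2 + 1 / 2 * wy ^ 2 * m + al p * (al p + 1) / 2 * w ^ 2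
      - v - g * (w * ws)
    let Q := -(2 * al p) * (ws ^ 2 / m)
      + (h * ws - hv * (ws + al p * w) + bt + 2 * (al p + 1) * v)
      + γ * g * (w * ws)
      - g * (ws ^ 2 - m * wy ^ 2 - al p * (al p + 1) * w ^ 2
        + (1 + 2 * al p) * (w * ws) + 2 * y * (ws * wy) + h * w
        - 4 * al p * (w * ws / m))
    let err := lamErr p M Λ * (g ^ 2 + δ * (g * (m * wy ^ 2 + w ^ 2 / m + P) + ws ^ 2 / m))
      - kap p b₀ * (g * (m * wy ^ 2 + w ^ 2 + P) + ws ^ 2 / m)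
    Q ≤ (p + 3) / 2 * g * e₀ - 3 * al p / 2 * (ws ^ 2 / m) + err ∧
    Q ≤ (p + 3) / 2 * g * e - 3 * al p / 2 * (ws ^ 2 / m) + err := by
  intro e₀ e Q err
  have hal := al_pos hp
  have hm1 : m ≤ 1 := by rw [hmy]; linarith [sq_nonneg y]
  have hy : |y| ≤ 1 := by
    rw [← sq_le_one_iff_abs_le_one]; linarith
  have hgd : g ≤ δ := hgδ.trans (pow_le_of_le_one hδ.le hδ1 two_ne_zero)
  have hg1 : g ≤ 1 := hgd.trans hδ1
  have p1 : 0 ≤ w ^ 2 / m := by positivity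
  have p2 : 0 ≤ m * wy ^ 2 := by positivity
  have p3 : 0 ≤ ws ^ 2 / m := by positivity
  have q1 : w ^ 2 ≤ w ^ 2 / m := le_div_self (sq_nonneg _) hm hm1
  have q3 : ws ^ 2 ≤ ws ^ 2 / m := le_div_self (sq_nonneg _) hm hm1
  -- Every error is shown to be at most a constant times `g² + δ Z`.
  set Z := g * (m * wy ^ 2 + w ^ 2 / m + P) + ws ^ 2 / m with hZ
  have gp1 : 0 ≤ g * (w ^ 2 / m) := by positivity
  have gp2 : 0 ≤ g * (m * wy ^ 2) := by positivity
  have gP : 0 ≤ g * P := by positivity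
  have hZe : Z = g * (m * wy ^ 2) + g * (w ^ 2 / m) + g * P + ws ^ 2 / m := by rw [hZ]; ring
  have hZ0 : 0 ≤ Z := by rw [hZe]; linarith
  have gq1 : g * w ^ 2 ≤ g * (w ^ 2 / m) := mul_le_mul_of_nonneg_left q1 hg.le
  have gq3 : g * ws ^ 2 ≤ ws ^ 2 / m := (mul_le_of_le_one_left (sq_nonneg _) hg1).trans q3
  have gq4 : g * (ws ^ 2 / m) ≤ ws ^ 2 / m := mul_le_of_le_one_left p3 hg1
  have hδZe : δ * Z = δ * (g * (m * wy ^ 2)) + δ * (g * (w ^ 2 / m)) + δ * (g * P)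
      + δ * (ws ^ 2 / m) := by rw [hZe]; ring
  have dp1 := mul_nonneg hδ.le gp1
  have dp2 := mul_nonneg hδ.le gp2
  have dp3 := mul_nonneg hδ.le p3
  have dP := mul_nonneg hδ.le gP
  -- products
  have a1 : g * |wy * ws| ≤ Z := by
    have := mul_le_mul_of_nonneg_left (abs_mul_le_weighted hm wy ws) hg.le
    rw [mul_add] at this
    linarith
  have a2 : g * |w * ws| ≤ Z := by
    have := mul_le_mul_of_nonneg_left (abs_mul_le_weighted one_pos w ws) hg.le
    rw [mul_add, one_mul, div_one] at this
    linarith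
  have a3 : g * |wy * w| ≤ Z := by
    have := mul_le_mul_of_nonneg_left (abs_mul_le_weighted hm wy w) hg.le
    rw [mul_add] at this
    linarith
  -- The assumption `g ≤ δ ^ 2` serves this purpose: in Young's inequality with parameter `δ`, the
  -- dissipation receives the coefficient `g/δ`, which must again be small.
  have gδ : g / δ ≤ δ := by rwa [div_le_iff₀ hδ, ← pow_two]
  have s1 : g * |w * ws / m| ≤ δ * Z := by
    have := mul_le_mul_of_nonneg_left (abs_mul_le_weighted hδ w ws) (show 0 ≤ g / m by positivity)
    have e1 : g / m * (δ * w ^ 2 + ws ^ 2 / δ) = δ * (g * (w ^ 2 / m)) + g / δ * (ws ^ 2 / m) := by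
      field_simp
    have e2 : g / m * |w * ws| = g * |w * ws / m| := by
      rw [abs_div, abs_of_pos hm]; ring
    rw [e1, e2] at this
    have k := mul_le_mul_of_nonneg_right gδ p3
    rw [hδZe]
    linarith
  have s2 : g * |w * ws| ≤ δ * Z := by
    refine le_trans (mul_le_mul_of_nonneg_left ?_ hg.le) s1
    rw [abs_div, abs_of_pos hm, le_div_iff₀ hm]
    exact mul_le_of_le_one_right (abs_nonneg _) hm1
  have s3 : g * |ws * wy| ≤ δ * Z := by
    have hmd : 0 < m * δ := by positivity
    have := mul_le_mul_of_nonneg_left (abs_mul_le_weighted hmd wy ws) hg.le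
    have e1 : g * (m * δ * wy ^ 2 + ws ^ 2 / (m * δ))
        = δ * (g * (m * wy ^ 2)) + g / δ * (ws ^ 2 / m) := by
      field_simp
    rw [e1, mul_comm wy] at this
    have k := mul_le_mul_of_nonneg_right gδ p3
    rw [hδZe]
    linarith
  have hδZ : 0 ≤ δ * Z := by positivity
  have c2 : g ^ 2 * (1 + P) ≤ g ^ 2 + δ * Z := by
    have : g * (g * P) ≤ δ * Z := mul_le_mul hgd (by rw [hZe]; linarith) gP hδ.le
    linarith
  have c3 : δ * g * P ≤ δ * Z := by
    rw [mul_assoc]; exact mul_le_mul_of_nonneg_left (by rw [hZe]; linarith) hδ.le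
  -- the error terms
  have b1 : |(h - hv) * ws| ≤ 3 * (δ * Z) + M * (g ^ 2 + δ * Z) := by
    rw [abs_mul]
    refine (mul_le_mul_of_nonneg_right h1 (abs_nonneg _)).trans ?_
    have e1 : (δ * g * (|wy| + |ws| + |w|) + M * g ^ 2) * |ws|
        = δ * (g * |wy * ws|) + δ * (g * ws ^ 2) + δ * (g * |w * ws|) + M * (g ^ 2 * |ws|) := by
      rw [abs_mul, abs_mul, ← sq_abs ws]; ring
    have k1 : g ^ 2 * |ws| ≤ g ^ 2 + δ * Z := by
      have t1 : |ws| ≤ 1 + ws ^ 2 := abs_le_one_add_sq ws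
      have t2 : g * (g * ws ^ 2) ≤ δ * Z :=
        mul_le_mul hgd (by rw [hZe]; linarith) (by positivity) hδ.le
      have t3 := mul_le_mul_of_nonneg_left t1 (sq_nonneg g)
      linarith
    have k2 : g * ws ^ 2 ≤ Z := by rw [hZe]; linarith
    rw [e1]
    have l1 := mul_le_mul_of_nonneg_left a1 hδ.le
    have l2 := mul_le_mul_of_nonneg_left k2 hδ.le
    have l3 := mul_le_mul_of_nonneg_left a2 hδ.le
    have l4 := mul_le_mul_of_nonneg_left k1 hM
    linarith
  have b5 : |g * ((h - hv) * w)| ≤ 3 * (δ * Z) + M * (g ^ 2 + δ * Z) := by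
    rw [abs_mul, abs_mul, abs_of_pos hg]
    refine (mul_le_mul_of_nonneg_left (mul_le_mul_of_nonneg_right h1 (abs_nonneg _)) hg.le).trans ?_
    have e1 : g * ((δ * g * (|wy| + |ws| + |w|) + M * g ^ 2) * |w|)
        = g * (δ * (g * |wy * w|) + δ * (g * |w * ws|) + δ * (g * w ^ 2)
          + M * (g ^ 2 * |w|)) := by
      rw [abs_mul, abs_mul, ← sq_abs w]; ring
    have k1 : g ^ 2 * |w| ≤ g ^ 2 + δ * Z := by
      have t1 : |w| ≤ 1 + w ^ 2 := abs_le_one_add_sq w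
      have t2 : g * (g * w ^ 2) ≤ δ * Z :=
        mul_le_mul hgd (by rw [hZe]; linarith) (by positivity) hδ.le
      have t3 := mul_le_mul_of_nonneg_left t1 (sq_nonneg g)
      linarith
    have k2 : g * w ^ 2 ≤ Z := by rw [hZe]; linarith
    rw [e1]
    have l1 := mul_le_mul_of_nonneg_left a3 hδ.le
    have l2 := mul_le_mul_of_nonneg_left k2 hδ.le
    have l3 := mul_le_mul_of_nonneg_left a2 hδ.le
    have l4 := mul_le_mul_of_nonneg_left k1 hM
    refine (mul_le_of_le_one_left (by positivity) hg1).trans ?_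
    linarith
  have hΛc := mul_le_mul_of_nonneg_left c2 hΛ
  have b6 : |g * (hv * w - b * P)| ≤ Λ * (g ^ 2 + δ * Z) + δ * Z := by
    rw [abs_mul, abs_of_pos hg]
    refine (mul_le_of_le_one_left (abs_nonneg _) hg1).trans (h3.trans ?_)
    linarith
  have b7 : |g * (v - b / (p + 1) * P)| ≤ Λ * (g ^ 2 + δ * Z) + δ * Z := by
    rw [abs_mul, abs_of_pos hg]
    refine (mul_le_of_le_one_left (abs_nonneg _) hg1).trans (h5.trans ?_)
    linarith
  have b8 : |g * (g * (w * ws))| ≤ δ * Z := by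
    rw [abs_mul, abs_mul, abs_of_pos hg]
    exact (mul_le_of_le_one_left (by positivity) hg1).trans s2
  have b9 : |g * (w * ws)| ≤ δ * Z := by rwa [abs_mul, abs_of_pos hg]
  have b10 : |y * (g * (ws * wy))| ≤ δ * Z := by
    rw [abs_mul, abs_mul, abs_of_pos hg]
    exact (mul_le_of_le_one_left (by positivity) hy).trans s3
  have b11 : |g * (w * ws / m)| ≤ δ * Z := by rwa [abs_mul, abs_of_pos hg]
  -- coercivity
  have hp1 : 0 < p - 1 := by linarith
  have hp2 : 0 < p + 1 := by linarith
  have k1 : kap p b₀ ≤ (p - 1) / 4 := (min_le_left _ _).trans (min_le_left _ _)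
  have k2 : kap p b₀ ≤ al p * (al p + 1) * ((p - 1) / 4) :=
    (min_le_left _ _).trans (min_le_right _ _)
  have k3 : kap p b₀ ≤ b * ((p - 1) / (2 * (p + 1))) :=
    ((min_le_right _ _).trans (min_le_left _ _)).trans
      (mul_le_mul_of_nonneg_right hb (by positivity))
  have k4 : kap p b₀ ≤ al p / 2 := (min_le_right _ _).trans (min_le_right _ _)
  have c_wy := mul_le_mul_of_nonneg_right k1 gp2
  have c_w := mul_le_mul_of_nonneg_right k2 (show 0 ≤ g * w ^ 2 by positivity)
  have c_P := mul_le_mul_of_nonneg_right k3 gP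
  have c_ws := mul_le_mul_of_nonneg_right k4 p3
  have hws0 : 0 ≤ g * ws ^ 2 := by positivity
  set L := 2 * M + 2 * Λ + 12 + 6 * al p with hL
  have hL0 : 0 ≤ L := by positivity
  have hY : 0 ≤ g ^ 2 + δ * Z := by positivity
  have main : Q ≤ (p + 3) / 2 * g * e₀ - 3 * al p / 2 * (ws ^ 2 / m) + (L * (g ^ 2 + δ * Z)
      - kap p b₀ * (g * (m * wy ^ 2 + w ^ 2 + P) + ws ^ 2 / m)) := by
    -- The choice of the coefficient `(p+3)/2` leaves four coercive terms: `(p+3)/4 - 1 = (p-1)/4`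
    -- for the gradient, the same factor for `w²`, `b (1 - (p+3)/(2(p+1))) = b (p-1)/(2(p+1))` for
    -- the power, and `al p / 2` from the dissipation. All remaining terms are estimated errors or
    -- nonnegative.
    have id : (p + 3) / 2 * g * e₀ - 3 * al p / 2 * (ws ^ 2 / m) - Q
        = (p - 1) / 4 * (g * (m * wy ^ 2)) + al p * (al p + 1) * ((p - 1) / 4) * (g * w ^ 2)
        + b * ((p - 1) / (2 * (p + 1))) * (g * P) + al p / 2 * (ws ^ 2 / m)
        + ((p + 3) / 4 + 1) * (g * ws ^ 2)
        - (h - hv) * ws - (2 * (al p + 1) * v - al p * (hv * w)) - bt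
        - γ * (g * (w * ws)) + (1 + 2 * al p) * (g * (w * ws)) + 2 * (y * (g * (ws * wy)))
        + g * ((h - hv) * w) - 4 * al p * (g * (w * ws / m)) + g * (hv * w - b * P) := by
      simp only [e₀, Q]
      field_simp
      ring
    have f1 := (abs_le.1 b1).2
    have f2 := (abs_le.1 h2).2
    have f3 := (abs_le.1 h4).2
    have f4 := mul_le_mul_of_nonneg_left (abs_le.1 b9).2 hγ.le
    have f5 := mul_le_mul_of_nonneg_left (abs_le.1 b9).1 (show 0 ≤ 1 + 2 * al p by linarith)
    have f6 := (abs_le.1 b10).1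
    have f7 := (abs_le.1 b5).1
    have f8 := mul_le_mul_of_nonneg_left (abs_le.1 b11).2 (show 0 ≤ 4 * al p by linarith)
    have f9 := (abs_le.1 b6).1
    have f10 : γ * (δ * Z) ≤ 1 / 2 * (δ * Z) := mul_le_mul_of_nonneg_right hγ1 hδZ
    have f11 : 0 ≤ ((p + 3) / 4 + 1) * (g * ws ^ 2) := by
      have : 0 ≤ (p + 3) / 4 + 1 := by linarith
      positivity
    have f12 : 0 ≤ al p * g ^ 2 := by positivity
    have f13 := sq_nonneg g
    have eL : L * (g ^ 2 + δ * Z) = 2 * (M * (g ^ 2 + δ * Z)) + 2 * (Λ * (g ^ 2 + δ * Z))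
        + 12 * g ^ 2 + 12 * (δ * Z) + 6 * (al p * g ^ 2) + 6 * al p * (δ * Z) := by
      rw [hL]; ring
    rw [eL]
    linarith
  have hYL : 0 ≤ L * (g ^ 2 + δ * Z) := by positivity
  have elam : lamErr p M Λ * (g ^ 2 + δ * Z)
      = L * (g ^ 2 + δ * Z) + (p + 3) / 2 * (L * (g ^ 2 + δ * Z)) := by
    rw [lamErr, ← hL]; ring
  have hp3 : 0 < (p + 3) / 2 := by linarith
  -- Replacing `E₀` by `E` on the right costs the density of `I + J + K` times `g`, again an
  -- admissible error; the factor `1 + (p + 3) / 2` in `lamErr` accounts for it.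
  have hee : g * e₀ - g * e ≤ L * (g ^ 2 + δ * Z) := by
    have : g * e₀ - g * e = g * (v - b / (p + 1) * P) + g * (g * (w * ws)) := by
      simp only [e₀, e]; ring
    rw [this]
    have f1 := (abs_le.1 b7).2
    have f2 := (abs_le.1 b8).2
    have f12 : 0 ≤ al p * g ^ 2 := by positivity
    have f14 : 0 ≤ al p * (δ * Z) := by positivity
    have f15 : 0 ≤ M * (g ^ 2 + δ * Z) := by positivity
    have f16 : 0 ≤ Λ * (g ^ 2 + δ * Z) := by positivity
    have f13 := sq_nonneg g
    have eL : L * (g ^ 2 + δ * Z) = 2 * (M * (g ^ 2 + δ * Z)) + 2 * (Λ * (g ^ 2 + δ * Z))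
        + 12 * g ^ 2 + 12 * (δ * Z) + 6 * (al p * g ^ 2) + 6 * (al p * (δ * Z)) := by
      rw [hL]; ring
    rw [eL]
    linarith
  have hee' := mul_le_mul_of_nonneg_left hee hp3.le
  simp only [err]
  rw [elam]
  constructor
  · have : 0 ≤ (p + 3) / 2 * (L * (g ^ 2 + δ * Z)) := by positivity
    linarith
  · linarith

/-! ## The integrated differential inequality -/

/-- The constant in the Hardy inequality. -/
def hardyConst (p : ℝ) : ℝ := 1 + (1 + 2 * al p) / al p + 1 / al p ^ 2

lemma hardyConst_pos {p : ℝ} (hp : 1 < p) : 0 < hardyConst p := by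
  have := al_pos hp
  rw [hardyConst]; positivity

lemma integral_const_mul_add {α : Type*} {m : MeasurableSpace α} {μ : Measure α} {f g : α → ℝ}
    (c : ℝ) (hf : Integrable f μ) (hg : Integrable g μ) :
    Integrable (fun y => c * f y + g y) μ ∧
      ∫ y, (c * f y + g y) ∂μ = c * (∫ y, f y ∂μ) + ∫ y, g y ∂μ :=
  ⟨(hf.const_mul c).add hg, by rw [integral_add (hf.const_mul c) hg, integral_const_mul]⟩

lemma integral_rho_le {p : ℝ} (hp : 1 < p) : ∫ y in Ioo (-1) 1, rho p y ≤ 2 := by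
  have h := setIntegral_mono_on (integrableOn_rho hp) (integrableOn_const (C := (1 : ℝ)) (by simp))
    measurableSet_Ioo fun y hy => rho_le_one hp hy
  refine h.trans (le_of_eq ?_)
  simp
  norm_num

/-- The error contains `w²/(1-y²)` whereas the coercive part contains only `w²`, so absorption fails
pointwise. After integration Hardy's inequality bounds the former by `w²` and `(1-y²)(∂_y w)²`, and
the smallness condition on `δ` closes the estimate. The factor `2` in the remainder bounds the
integral of `ρ`. -/
lemma FiniteEnergy.integral_rate_le {p σ : ℝ} {w wy ws : ℝ → ℝ → ℝ}
    (E : FiniteEnergy p σ w wy ws) (hp : 1 < p) {s : ℝ} (hs : σ ≤ s)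
    (hD : IntegrableOn (fun y => ws s y ^ 2 * (rho p y / (1 - y ^ 2))) (Ioo (-1) 1))
    {Q e : ℝ → ℝ} (hQ : IntegrableOn (fun y => Q y * rho p y) (Ioo (-1) 1))
    (he : IntegrableOn (fun y => e y * rho p y) (Ioo (-1) 1)) {c g δ l κ : ℝ} (hl : 0 ≤ l)
    (hg : 0 ≤ g) (hδ : 0 ≤ δ) (hsmall : l * δ * hardyConst p ≤ κ)
    (hle : ∀ y ∈ Ioo (-1 : ℝ) 1, Q y ≤ c * e y - 3 * al p / 2 * (ws s y ^ 2 / (1 - y ^ 2))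
      + (l * (g ^ 2 + δ * (g * ((1 - y ^ 2) * wy s y ^ 2 + w s y ^ 2 / (1 - y ^ 2)
          + |w s y| ^ (p + 1)) + ws s y ^ 2 / (1 - y ^ 2)))
        - κ * (g * ((1 - y ^ 2) * wy s y ^ 2 + w s y ^ 2 + |w s y| ^ (p + 1))
          + ws s y ^ 2 / (1 - y ^ 2)))) :
    ∫ y in Ioo (-1) 1, Q y * rho p y ≤ c * (∫ y in Ioo (-1) 1, e y * rho p y)
      - 3 * al p / 2 * (∫ y in Ioo (-1) 1, ws s y ^ 2 * (rho p y / (1 - y ^ 2)))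
      + 2 * l * g ^ 2 := by
  have hal := al_pos hp
  obtain ⟨hH, hHle⟩ := E.hardy hp hs
  have hw := E.int_w s hs
  have hy := E.int_wy s hs
  have hP := E.integrableOn_rpow hp hs
  have l6 := integral_const_mul_add (l * δ * g - κ * g) hP (hw.const_mul (-(κ * g)))
  have l5 := integral_const_mul_add (l * δ * g) hH l6.1
  have l4 := integral_const_mul_add (l * δ * g - κ * g) hy l5.1
  have l3 := integral_const_mul_add (l * g ^ 2) (integrableOn_rho hp) l4.1
  have l2 := integral_const_mul_add (-(3 * al p / 2) + l * δ - κ) hD l3.1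
  have l1 := integral_const_mul_add c he l2.1
  have hmono := setIntegral_mono_on hQ l1.1 measurableSet_Ioo fun y hyI => (by
    have hr := rho_pos (p := p) hyI
    have hm := (one_sub_sq_pos hyI).ne'
    refine (mul_le_mul_of_nonneg_right (hle y hyI) hr.le).trans (le_of_eq ?_)
    field_simp
    ring)
  rw [l1.2, l2.2, l3.2, l4.2, l5.2, l6.2, integral_const_mul] at hmono
  have hρ := integral_rho_le hp
  have pos {F : ℝ → ℝ} (hF : ∀ y ∈ Ioo (-1 : ℝ) 1, 0 ≤ F y) : 0 ≤ ∫ y in Ioo (-1) 1, F y :=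
    setIntegral_nonneg measurableSet_Ioo hF
  have dW := pos (F := fun y => w s y ^ 2 * rho p y) fun y hyI =>
    mul_nonneg (sq_nonneg _) (rho_pos hyI).le
  have dY := pos (F := fun y => (1 - y ^ 2) * wy s y ^ 2 * rho p y) fun y hyI =>
    mul_nonneg (mul_nonneg (one_sub_sq_pos hyI).le (sq_nonneg _)) (rho_pos hyI).le
  have dP := pos (F := fun y => |w s y| ^ (p + 1) * rho p y) fun y hyI =>
    mul_nonneg (by positivity) (rho_pos hyI).le
  have dD := pos (F := fun y => ws s y ^ 2 * (rho p y / (1 - y ^ 2))) fun y hyI =>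
    mul_nonneg (sq_nonneg _) (div_nonneg (rho_pos hyI).le (one_sub_sq_pos hyI).le)
  set IW := ∫ y in Ioo (-1) 1, w s y ^ 2 * rho p y
  set IY := ∫ y in Ioo (-1) 1, (1 - y ^ 2) * wy s y ^ 2 * rho p y
  set IP := ∫ y in Ioo (-1) 1, |w s y| ^ (p + 1) * rho p y
  set ID := ∫ y in Ioo (-1) 1, ws s y ^ 2 * (rho p y / (1 - y ^ 2))
  set IH := ∫ y in Ioo (-1) 1, w s y ^ 2 * (rho p y / (1 - y ^ 2))
  set IR := ∫ y in Ioo (-1) 1, rho p y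
  have hIH : IH ≤ (1 + 2 * al p) / al p * IW + 1 / al p ^ 2 * IY := by
    have : IH = al p * IH / al p := by field_simp
    rw [this, div_le_iff₀ hal]
    refine hHle.trans (le_of_eq ?_)
    field_simp
  have hc1 : 1 ≤ hardyConst p := by
    rw [hardyConst]
    have : 0 ≤ (1 + 2 * al p) / al p + 1 / al p ^ 2 := by positivity
    linarith
  have hsum : IY + IH + IP ≤ hardyConst p * (IY + IW + IP) := by
    have e1 : hardyConst p * (IY + IW + IP) = IY + ((1 + 2 * al p) / al p * IW + 1 / al p ^ 2 * IY)
        + IP + (IW + (1 + 2 * al p) / al p * IY + (1 + 2 * al p) / al p * IP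
        + 1 / al p ^ 2 * IW + 1 / al p ^ 2 * IP) := by rw [hardyConst]; ring
    have : 0 ≤ IW + (1 + 2 * al p) / al p * IY + (1 + 2 * al p) / al p * IP
        + 1 / al p ^ 2 * IW + 1 / al p ^ 2 * IP := by positivity
    rw [e1]
    linarith
  have hlδ : 0 ≤ l * δ := by positivity
  have f1 : l * δ * (g * (IY + IH + IP)) ≤ κ * (g * (IY + IW + IP)) := by
    have h1 := mul_le_mul_of_nonneg_left hsum (mul_nonneg hlδ hg)
    have h2 := mul_le_mul_of_nonneg_right hsmall (show 0 ≤ g * (IY + IW + IP) by positivity)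
    linarith
  have f2 : l * δ * ID ≤ κ * ID :=
    mul_le_mul_of_nonneg_right ((le_mul_of_one_le_right hlδ hc1).trans hsmall) dD
  have f3 : l * g ^ 2 * IR ≤ l * g ^ 2 * 2 := mul_le_mul_of_nonneg_left hρ (by positivity)
  linarith

/-- The perturbative terms are small after the time `σ`. -/
structure IsSmall (p γ M Λ b δ σ : ℝ) (w wy ws h v hv bt : ℝ → ℝ → ℝ) : Prop where
  exp_le : ∀ s, σ ≤ s → Real.exp (-γ * s) ≤ δ ^ 2
  h_sub : ∀ s, σ ≤ s → ∀ y ∈ Ioo (-1 : ℝ) 1, |h s y - hv s y|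
    ≤ δ * Real.exp (-γ * s) * (|wy s y| + |ws s y| + |w s y|) + M * Real.exp (-γ * s) ^ 2
  cancel : ∀ s, σ ≤ s → ∀ y ∈ Ioo (-1 : ℝ) 1,
    |2 * (al p + 1) * v s y - al p * (hv s y * w s y)|
      ≤ Λ * (Real.exp (-γ * s) ^ 2 * (1 + |w s y| ^ (p + 1)))
  hv_le : ∀ s, σ ≤ s → ∀ y ∈ Ioo (-1 : ℝ) 1, |hv s y * w s y - b * |w s y| ^ (p + 1)|
    ≤ Λ * (Real.exp (-γ * s) ^ 2 * (1 + |w s y| ^ (p + 1)))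
      + δ * Real.exp (-γ * s) * |w s y| ^ (p + 1)
  bt_le : ∀ s, σ ≤ s → ∀ y ∈ Ioo (-1 : ℝ) 1,
    |bt s y| ≤ δ * Real.exp (-γ * s) * |w s y| ^ (p + 1)
  v_le : ∀ s, σ ≤ s → ∀ y ∈ Ioo (-1 : ℝ) 1, |v s y - b / (p + 1) * |w s y| ^ (p + 1)|
    ≤ Λ * (Real.exp (-γ * s) ^ 2 * (1 + |w s y| ^ (p + 1)))
      + δ * Real.exp (-γ * s) * |w s y| ^ (p + 1)

namespace Evolution

variable {p σ γ M Λ b₀ b δ : ℝ} {w wy ws h v hv bt : ℝ → ℝ → ℝ}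

/-- The density of `E₀` is integrable. -/
lemma integrableOn_unperturbed (E : Evolution p σ w wy ws h v hv bt) (hp : 1 < p) {s : ℝ}
    (hs : σ ≤ s) (b : ℝ) :
    IntegrableOn (fun y => (1 / 2 * ws s y ^ 2 + 1 / 2 * wy s y ^ 2 * (1 - y ^ 2)
      + al p * (al p + 1) / 2 * w s y ^ 2 - b / (p + 1) * |w s y| ^ (p + 1)) * rho p y)
      (Ioo (-1) 1) := by
  refine ((((E.int_ws s hs).const_mul (1 / 2)).add ((E.int_wy s hs).const_mul (1 / 2))).add
    ((E.int_w s hs).const_mul (al p * (al p + 1) / 2))).sub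
    ((E.integrableOn_rpow hp hs).const_mul (b / (p + 1))) |>.congr (ae_of_all _ fun y => ?_)
  simp only [Pi.add_apply, Pi.sub_apply]
  ring

/-- The functional `E` is an indefinite integral, and its derivative satisfies the differential
inequalities. -/
theorem exists_rate (E : Evolution p σ w wy ws h v hv bt) (hp : 1 < p) (hγ : 0 < γ)
    (hγ1 : γ ≤ 1 / 2) (hM : 0 ≤ M) (hΛ : 0 ≤ Λ) (hb : b₀ ≤ b) (hδ : 0 < δ)
    (hδ1 : δ ≤ 1) (hδκ : lamErr p M Λ * δ * hardyConst p ≤ kap p b₀)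
    (hsm : IsSmall p γ M Λ b δ σ w wy ws h v hv bt) :
    ∃ q : ℝ → ℝ, (∀ s, σ ≤ s → IntervalIntegrable q volume σ s) ∧
      (∀ s, σ ≤ s → (∫ y in Ioo (-1) 1, energyDensity p γ w wy ws v s y * rho p y)
        = (∫ y in Ioo (-1) 1, energyDensity p γ w wy ws v σ y * rho p y) + ∫ τ in σ..s, q τ) ∧
      ∀ᵐ s : ℝ, σ < s →
        IntegrableOn (fun y => ws s y ^ 2 * (rho p y / (1 - y ^ 2))) (Ioo (-1) 1) ∧
        q s ≤ (p + 3) / 2 * Real.exp (-γ * s) * (∫ y in Ioo (-1) 1,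
            (1 / 2 * ws s y ^ 2 + 1 / 2 * wy s y ^ 2 * (1 - y ^ 2)
              + al p * (al p + 1) / 2 * w s y ^ 2 - b / (p + 1) * |w s y| ^ (p + 1)) * rho p y)
          - 3 * al p / 2 * (∫ y in Ioo (-1) 1, ws s y ^ 2 * (rho p y / (1 - y ^ 2)))
          + 2 * lamErr p M Λ * Real.exp (-γ * s) ^ 2 ∧
        q s ≤ (p + 3) / 2 * Real.exp (-γ * s)
            * (∫ y in Ioo (-1) 1, energyDensity p γ w wy ws v s y * rho p y)
          - 3 * al p / 2 * (∫ y in Ioo (-1) 1, ws s y ^ 2 * (rho p y / (1 - y ^ 2)))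
          + 2 * lamErr p M Λ * Real.exp (-γ * s) ^ 2 := by
  set q : ℝ → ℝ := fun s => ∫ y in Ioo (-1) 1, rateDensity p γ w wy ws h v hv bt s y * rho p y
    with hq
  have hprod (s : ℝ) (hs : σ < s) : Integrable (fun x : ℝ × ℝ =>
      rateDensity p γ w wy ws h v hv bt x.2 x.1 * rho p x.1)
      ((volume.restrict (Ioo (-1 : ℝ) 1)).prod (volume.restrict (Ioo σ s))) := by
    rw [Measure.prod_restrict]
    exact (E.energy_identity (γ := γ) hp le_rfl hs).1
  have hDprod (s : ℝ) (hs : σ < s) : Integrable (fun x : ℝ × ℝ =>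
      ws x.2 x.1 ^ 2 * (rho p x.1 / (1 - x.1 ^ 2)))
      ((volume.restrict (Ioo (-1 : ℝ) 1)).prod (volume.restrict (Ioo σ s))) := by
    rw [Measure.prod_restrict]
    exact E.integrableOn_dissip hp le_rfl hs
  refine ⟨q, fun s hs => ?_, fun s hs => ?_, ?_⟩
  · rcases hs.eq_or_lt with rfl | hs
    · exact IntervalIntegrable.refl
    · rw [intervalIntegrable_iff_integrableOn_Ioo_of_le hs.le]
      exact (hprod s hs).integral_prod_right
  · rcases hs.eq_or_lt with rfl | hs
    · simp
    · have h1 := (E.energy_identity (γ := γ) hp le_rfl hs).2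
      have h2 : ∫ x in Ioo (-1) 1 ×ˢ Ioo σ s,
          rateDensity p γ w wy ws h v hv bt x.2 x.1 * rho p x.1 = ∫ τ in σ..s, q τ := by
        rw [intervalIntegral.integral_of_le hs.le, integral_Ioc_eq_integral_Ioo,
          Measure.volume_eq_prod, ← Measure.prod_restrict, integral_prod_symm _ (hprod s hs)]
      rw [h2] at h1
      linarith
  -- Fubini's theorem gives convergent slices for almost every time of a bounded interval; countably
  -- many such intervals cover the half line.
  · have hae (n : ℕ) : ∀ᵐ s : ℝ, s ∈ Ioo σ (σ + (n + 1)) →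
        IntegrableOn (fun y => rateDensity p γ w wy ws h v hv bt s y * rho p y) (Ioo (-1) 1) ∧
        IntegrableOn (fun y => ws s y ^ 2 * (rho p y / (1 - y ^ 2))) (Ioo (-1) 1) := by
      have hn : σ < σ + ((n : ℝ) + 1) := by
        have : (0 : ℝ) ≤ n := n.cast_nonneg
        linarith
      rw [← ae_restrict_iff' measurableSet_Ioo]
      filter_upwards [(hprod _ hn).prod_left_ae, (hDprod _ hn).prod_left_ae] with s h1 h2
      exact ⟨h1, h2⟩
    filter_upwards [ae_all_iff.2 hae] with s hs hσs
    obtain ⟨n, hn⟩ := exists_nat_gt (s - σ)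
    obtain ⟨hQ, hD⟩ := hs n ⟨hσs, by linarith⟩
    have hpw (y : ℝ) (hy : y ∈ Ioo (-1 : ℝ) 1) := rate_le (m := 1 - y ^ 2) (y := y)
      (P := |w s y| ^ (p + 1)) (g := Real.exp (-γ * s)) hp hγ hγ1 hM hΛ hb hδ hδ1
      (Real.exp_pos _) (hsm.exp_le s hσs.le) (one_sub_sq_pos hy) rfl (by positivity)
      (hsm.h_sub s hσs.le y hy) (hsm.cancel s hσs.le y hy) (hsm.hv_le s hσs.le y hy)
      (hsm.bt_le s hσs.le y hy) (hsm.v_le s hσs.le y hy)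
    refine ⟨hD, ?_, ?_⟩
    · exact E.integral_rate_le hp hσs.le hD hQ (E.integrableOn_unperturbed hp hσs.le b)
        (lamErr_pos hp hM hΛ).le (Real.exp_pos _).le hδ.le hδκ fun y hy => (hpw y hy).1
    · exact E.integral_rate_le hp hσs.le hD hQ (E.integrableOn_energyDensity hp hσs.le)
        (lamErr_pos hp hM hΛ).le (Real.exp_pos _).le hδ.le hδκ fun y hy => (hpw y hy).2

end Evolution

/-! ## Functions that are indefinite integrals -/

lemma _root_.AbsolutelyContinuousOnInterval.congr {f g : ℝ → ℝ} {a b : ℝ}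
    (hf : AbsolutelyContinuousOnInterval f a b) (h : ∀ x ∈ uIcc a b, g x = f x) :
    AbsolutelyContinuousOnInterval g a b := by
  rw [absolutelyContinuousOnInterval_iff] at hf ⊢
  intro ε hε
  obtain ⟨δ, hδ, H⟩ := hf ε hε
  refine ⟨δ, hδ, fun I hI hlt => ?_⟩
  have h1 := H I hI hlt
  rwa [Finset.sum_congr rfl fun i hi => by
    rw [h _ (hI.left i hi).left, h _ (hI.left i hi).right]]

lemma absolutelyContinuousOnInterval_const (c a b : ℝ) :
    AbsolutelyContinuousOnInterval (fun _ : ℝ => c) a b :=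
  (contDiff_const.contDiffOn).absolutelyContinuousOnInterval

/-- `f` is an indefinite integral of `q` on `[σ, ∞)`. -/
structure IsIntegralOf (σ : ℝ) (f q : ℝ → ℝ) : Prop where
  integrable : ∀ s, σ ≤ s → IntervalIntegrable q volume σ s
  eq : ∀ s, σ ≤ s → f s = f σ + ∫ τ in σ..s, q τ

namespace IsIntegralOf

variable {σ : ℝ} {f q : ℝ → ℝ}

lemma absolutelyContinuous (h : IsIntegralOf σ f q) {s : ℝ} (hs : σ ≤ s) :
    AbsolutelyContinuousOnInterval f σ s :=
  ((absolutelyContinuousOnInterval_const (f σ) σ s).fun_add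
    ((h.integrable s hs).absolutelyContinuousOnInterval_intervalIntegral left_mem_uIcc)).congr
    fun x hx => h.eq x (by rw [uIcc_of_le hs] at hx; exact hx.1)

lemma ae_hasDerivAt (h : IsIntegralOf σ f q) : ∀ᵐ s, σ < s → HasDerivAt f (q s) s := by
  have hae (n : ℕ) := (h.integrable (σ + n) (by simp)).ae_hasDerivAt_integral
  filter_upwards [ae_all_iff.2 hae] with s hs hσ
  obtain ⟨n, hn⟩ := exists_nat_gt (s - σ)
  have h1 := (hs n (by rw [uIcc_of_le (by simp)]; exact ⟨hσ.le, by linarith⟩) σ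
    left_mem_uIcc).const_add (f σ)
  refine h1.congr_of_eventuallyEq ?_
  filter_upwards [Ioi_mem_nhds hσ] with x hx using h.eq x (le_of_lt hx)

end IsIntegralOf

/-- An absolutely continuous function with nonpositive derivative is nonincreasing. -/
lemma antitoneOn_of_absolutelyContinuous {f : ℝ → ℝ} {σ : ℝ}
    (hf : ∀ s, σ ≤ s → AbsolutelyContinuousOnInterval f σ s)
    (h' : ∀ᵐ s, σ < s → deriv f s ≤ 0) : AntitoneOn f (Ici σ) := by
  intro a ha b hb hab
  have h1 : AbsolutelyContinuousOnInterval f a b := (hf b hb).mono (by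
    rw [uIcc_of_le hab, uIcc_of_le hb]
    exact Icc_subset_Icc_left ha)
  have h2 : ∫ x in a..b, deriv f x ≤ 0 := by
    rw [intervalIntegral.integral_of_le hab]
    refine setIntegral_nonpos_of_ae_restrict ?_
    filter_upwards [ae_restrict_of_ae h', ae_restrict_mem measurableSet_Ioc] with x hx hm
      using hx (lt_of_le_of_lt ha hm.1)
  linarith [h1.integral_deriv_eq_sub]

/-- The Lyapunov functional built from an almost nonincreasing one. -/
theorem IsIntegralOf.lyapunov {σ γ A θ μ c k : ℝ} {f q D : ℝ → ℝ} (h : IsIntegralOf σ f q)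
    (hσ : 0 ≤ σ) (hγ : 0 < γ) (hθ : θ * γ = A) (hθ0 : 0 ≤ θ) (hk : 0 ≤ k) (hc : 0 ≤ c)
    (hμ : Real.exp θ * c ≤ 2 * γ * μ) (hD : ∀ s, 0 ≤ D s)
    (hq : ∀ᵐ s, σ < s → q s ≤ A * Real.exp (-γ * s) * f s - k * D s
      + c * Real.exp (-γ * s) ^ 2) :
    (∀ s, σ ≤ s → AbsolutelyContinuousOnInterval
      (fun s => f s * Real.exp (θ * Real.exp (-γ * s)) + μ * Real.exp (-2 * γ * s)) σ s) ∧
    AntitoneOn (fun s => f s * Real.exp (θ * Real.exp (-γ * s)) + μ * Real.exp (-2 * γ * s))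
      (Ici σ) ∧
    ∀ᵐ s, σ < s → ∃ H', HasDerivAt
      (fun s => f s * Real.exp (θ * Real.exp (-γ * s)) + μ * Real.exp (-2 * γ * s)) H' s ∧
      H' ≤ -k * D s := by
  have hac (s : ℝ) (hs : σ ≤ s) : AbsolutelyContinuousOnInterval
      (fun s => f s * Real.exp (θ * Real.exp (-γ * s)) + μ * Real.exp (-2 * γ * s)) σ s := by
    refine ((h.absolutelyContinuous hs).fun_mul ?_).fun_add ?_
    · exact ContDiffOn.absolutelyContinuousOnInterval (by fun_prop)
    · exact ContDiffOn.absolutelyContinuousOnInterval (by fun_prop)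
  have hder : ∀ᵐ s, σ < s → ∃ H', HasDerivAt
      (fun s => f s * Real.exp (θ * Real.exp (-γ * s)) + μ * Real.exp (-2 * γ * s)) H' s ∧
      H' ≤ -k * D s := by
    filter_upwards [h.ae_hasDerivAt, hq] with s h1 h2 hs
    have hlin (a : ℝ) : HasDerivAt (fun s : ℝ => Real.exp (a * s)) (Real.exp (a * s) * a) s := by
      simpa using ((hasDerivAt_id s).const_mul a).exp
    refine ⟨_, ((h1 hs).fun_mul ((hlin (-γ)).const_mul θ).exp).fun_add
      ((hlin (-2 * γ)).const_mul μ), ?_⟩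
    have hg2 : Real.exp (-2 * γ * s) = Real.exp (-γ * s) ^ 2 := by
      rw [← Real.exp_nat_mul]; congr 1; push_cast; ring
    rw [hg2]
    set g := Real.exp (-γ * s)
    have hg0 : 0 < g := Real.exp_pos _
    -- Here `0 ≤ σ` is used: the integrating factor then lies between `1` and `e^θ`. The lower bound
    -- keeps the dissipation, the upper bound controls the remainder.
    have hg1 : g ≤ 1 := Real.exp_le_one_iff.2 (by nlinarith)
    set X := Real.exp (θ * g)
    have hX1 : 1 ≤ X := Real.one_le_exp (by positivity)
    have hX2 : X ≤ Real.exp θ := Real.exp_le_exp.2 (by nlinarith)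
    have h3 : X * q s ≤ X * (A * g * f s - k * D s + c * g ^ 2) :=
      mul_le_mul_of_nonneg_left (h2 hs) (by positivity)
    have h4 : X * (c * g ^ 2) ≤ Real.exp θ * (c * g ^ 2) :=
      mul_le_mul_of_nonneg_right hX2 (by positivity)
    have h5 : Real.exp θ * c * g ^ 2 ≤ 2 * γ * μ * g ^ 2 :=
      mul_le_mul_of_nonneg_right hμ (by positivity)
    have h6 : 1 * (k * D s) ≤ X * (k * D s) :=
      mul_le_mul_of_nonneg_right hX1 (mul_nonneg hk (hD s))
    -- Since `θ γ = A`, the derivative of the integrating factor cancels the term `A g f`; the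
    -- derivative of `μ g²` is left to pay for `c g²`.
    have h7 : q s * X + f s * (X * (θ * (g * -γ))) + μ * (g ^ 2 * (-2 * γ))
        = X * q s - X * (A * g * f s) - 2 * γ * μ * g ^ 2 := by rw [← hθ]; ring
    rw [h7]
    linarith
  refine ⟨hac, antitoneOn_of_absolutelyContinuous hac ?_, hder⟩
  filter_upwards [hder] with s hs h1
  obtain ⟨H', h2, h3⟩ := hs h1
  rw [h2.deriv]
  nlinarith [hD s]

/-! ## Pointwise bounds in similarity variables -/

lemma rpow_le_one_add {r p x : ℝ} (hr : 0 ≤ r) (hrp : r ≤ p) (hx : 0 ≤ x) :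
    x ^ r ≤ 1 + x ^ p := by
  rcases le_total x 1 with h | h
  · have := Real.rpow_le_one hx h hr
    have := Real.rpow_nonneg hx p
    linarith
  · have := Real.rpow_le_rpow_of_exponent_le h hrp
    linarith

lemma al_mul_sub_one {p : ℝ} (hp : 1 < p) : al p * (p - 1) = 2 := by
  have : p - 1 ≠ 0 := by linarith
  rw [al]; field_simp

/-- The scaling identity under which the pure power is invariant in similarity variables. -/
lemma exp_al_rpow {p : ℝ} (hp : 1 < p) (s : ℝ) :
    Real.exp (-al p * s) ^ (p - 1) = Real.exp (-s) ^ 2 := by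
  rw [← Real.exp_mul, ← Real.exp_nat_mul]
  congr 1
  push_cast
  linear_combination -s * al_mul_sub_one hp

lemma abs_primF_le {f : ℝ → ℝ} {q M : ℝ} (hq : 0 ≤ q) (hM : 0 ≤ M)
    (hf : ∀ u, |f u| ≤ M * (1 + |u| ^ q)) (u : ℝ) :
    |primF f u| ≤ M * (1 + |u| ^ q) * |u| := by
  have h := intervalIntegral.norm_integral_le_of_norm_le_const (f := f) (a := 0) (b := u)
    (C := M * (1 + |u| ^ q)) fun x hx => ?_
  · simpa [primF] using h
  · refine (hf x).trans ?_
    have : |x| ≤ |u| := by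
      have hx' := uIoc_subset_uIcc hx
      rw [uIcc_comm] at hx'
      simpa using abs_sub_right_of_mem_uIcc hx'
    gcongr

lemma one_add_rpow_mul_le {q : ℝ} (hq : 0 ≤ q) (u : ℝ) :
    (1 + |u| ^ q) * |u| ≤ 1 + 2 * |u| ^ (q + 1) := by
  have h1 : |u| ^ (q + 1) = |u| ^ q * |u| := by
    rw [Real.rpow_add_of_nonneg (abs_nonneg u) hq zero_le_one, Real.rpow_one]
  have h2 := rpow_le_one_add (r := 1) (p := q + 1) zero_le_one (by linarith) (abs_nonneg u)
  rw [Real.rpow_one] at h2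
  linarith

section Pointwise

variable {p q M : ℝ} {d : ℕ} {β f : ℝ → ℝ} {G : ℝ → ℝ → ℝ → ℝ → ℝ}
  {T : ℝ → ℝ} {U UX Ut : ℝ → ℝ → ℝ} {X₀ T₀ σ : ℝ}

lemma simHV_eq (hp : 1 < p) (s y : ℝ) : simHV p β f U X₀ T₀ s y
    = β (X₀ + y * Real.exp (-s)) * (|simW p X₀ T₀ U s y| ^ (p - 1) * simW p X₀ T₀ U s y)
      + Real.exp (-al p * s) * Real.exp (-s) ^ 2
        * f (U (X₀ + y * Real.exp (-s)) (T₀ - Real.exp (-s))) := by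
  rw [simW_eq, abs_mul, abs_of_pos (Real.exp_pos _), Real.mul_rpow (Real.exp_pos _).le
    (abs_nonneg _), exp_al_rpow hp, simHV]
  simp only [simMap]
  ring

lemma simW_rpow_add_one (hp : 1 < p) (s y : ℝ) : |simW p X₀ T₀ U s y| ^ (p + 1)
    = Real.exp (-al p * s) ^ 2 * Real.exp (-s) ^ 2
      * |U (X₀ + y * Real.exp (-s)) (T₀ - Real.exp (-s))| ^ (p + 1) := by
  rw [abs_rpow_add_one hp, abs_rpow_add_one hp, simW_eq, abs_mul, abs_of_pos (Real.exp_pos _),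
    Real.mul_rpow (Real.exp_pos _).le (abs_nonneg _), exp_al_rpow hp]
  simp only [simMap]
  ring

lemma simV_eq (hp : 1 < p) (s y : ℝ) : simV p β f U X₀ T₀ s y
    = β (X₀ + y * Real.exp (-s)) / (p + 1) * |simW p X₀ T₀ U s y| ^ (p + 1)
      + Real.exp (-al p * s) ^ 2 * Real.exp (-s) ^ 2
        * primF f (U (X₀ + y * Real.exp (-s)) (T₀ - Real.exp (-s))) := by
  rw [simW_rpow_add_one hp, simV, potential]
  ring

lemma simB_eq (hp : 1 < p) (s y : ℝ) : simB p β U X₀ T₀ s y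
    = Real.exp (-s) * y * deriv β (X₀ + y * Real.exp (-s)) / (p + 1)
      * |simW p X₀ T₀ U s y| ^ (p + 1) := by
  rw [simW_rpow_add_one hp, simB]
  ring

lemma IsVertex.exp_le (hv : IsVertex T X₀ T₀ σ) {s : ℝ} (hs : σ ≤ s) :
    Real.exp (-s) ≤ X₀ / 2 :=
  (Real.exp_le_exp.2 (by linarith)).trans hv.exp_le_X₀

lemma IsVertex.mem_Icc (hv : IsVertex T X₀ T₀ σ) {s y : ℝ} (hs : σ ≤ s)
    (hy : y ∈ Ioo (-1 : ℝ) 1) : X₀ + y * Real.exp (-s) ∈ Icc (X₀ / 2) (3 * X₀ / 2) := by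
  have h1 := hv.exp_le hs
  have h2 := Real.exp_pos (-s)
  constructor <;> nlinarith [hy.1, hy.2]

lemma abs_mul_exp_lt {s y : ℝ} (hy : y ∈ Ioo (-1 : ℝ) 1) :
    |y * Real.exp (-s)| < Real.exp (-s) := by
  rw [abs_mul, abs_of_pos (Real.exp_pos _)]
  exact mul_lt_of_lt_one_left (Real.exp_pos _) (abs_lt.2 hy)

lemma IsVertex.simMap_mem (hv : IsVertex T X₀ T₀ σ) {x : ℝ × ℝ}
    (hx : x ∈ Ioo (-1 : ℝ) 1 ×ˢ Ici σ) : simMap X₀ T₀ x ∈ underGraph T := by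
  have h0 : 0 < X₀ + x.1 * Real.exp (-x.2) := by
    linarith [(hv.mem_Icc hx.2 hx.1).1, hv.X_pos]
  refine ⟨h0, ?_, hv.lt_T h0 ?_⟩
  · have : Real.exp (-x.2) ≤ Real.exp (-σ) := Real.exp_le_exp.2 (neg_le_neg hx.2)
    simp only [simMap]
    linarith [hv.exp_le_T₀]
  · simp only [simMap, add_sub_cancel_left, sub_sub_cancel]
    exact abs_mul_exp_lt hx.1

/-- The difference of the source and the derivative of the potential. -/
lemma abs_simH_sub_le (hp : 1 < p) (hM : 0 ≤ M) (hc : AdmissibleCoeffs q M β f G)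
    (hv : IsVertex T X₀ T₀ σ) {s y : ℝ} (hs : σ ≤ s) (hy : y ∈ Ioo (-1 : ℝ) 1) :
    |simH p d β f G U UX Ut X₀ T₀ s y - simHV p β f U X₀ T₀ s y|
      ≤ |(d : ℝ) - 1| * (2 * Real.exp (-s) / X₀) * |simWy p X₀ T₀ UX s y|
        + M * (Real.exp (-al p * s) * Real.exp (-s) ^ 2)
        + M * Real.exp (-s) * (2 * |simWy p X₀ T₀ UX s y| + |simWs p X₀ T₀ U UX Ut s y|
          + al p * |simW p X₀ T₀ U s y|) := by
  set e := Real.exp (-al p * s) with he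
  set E := Real.exp (-s) with hE
  have he0 : 0 < e := Real.exp_pos _
  have hE0 : 0 < E := Real.exp_pos _
  have ha := al_pos hp
  have hX := (hv.mem_Icc hs hy).1
  have hX0 := hv.X_pos
  set X := X₀ + y * E with hXdef
  set t := T₀ - E with ht
  have hXpos : 0 < X := by linarith
  have hw : simW p X₀ T₀ U s y = e * U X t := simW_eq s y
  have hwy : simWy p X₀ T₀ UX s y = e * E * UX X t := simWy_eq hp s y
  have hws : simWs p X₀ T₀ U UX Ut s y = e * (E * Ut X t - y * E * UX X t - al p * U X t) :=
    simWs_eq hp s y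
  have hdiff : simH p d β f G U UX Ut X₀ T₀ s y - simHV p β f U X₀ T₀ s y
      = ((d : ℝ) - 1) * (E / X) * simWy p X₀ T₀ UX s y
        + e * E ^ 2 * G X t (UX X t) (Ut X t) := by
    rw [hwy]
    simp only [simH, simHV, source, simMap]
    ring
  have hG : |e * E ^ 2 * G X t (UX X t) (Ut X t)| ≤ M * (e * E ^ 2)
      + M * E * (|simWy p X₀ T₀ UX s y| + |e * E * Ut X t|) := by
    rw [hwy, abs_mul, abs_of_pos (by positivity : 0 < e * E ^ 2), abs_mul (e * E),
      abs_mul (e * E), abs_of_pos (by positivity : 0 < e * E)]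
    refine (mul_le_mul_of_nonneg_left (hc.G_bound X t _ _ hXpos) (by positivity)).trans
      (le_of_eq ?_)
    ring
  -- `∂_t U` is recovered by solving the chain rule for it: rescaled, it equals `∂_s w + y ∂_y w +
  -- al p w`.
  have hUt : |e * E * Ut X t| ≤ |simWs p X₀ T₀ U UX Ut s y| + |simWy p X₀ T₀ UX s y|
      + al p * |simW p X₀ T₀ U s y| := by
    have h1 : e * E * Ut X t = simWs p X₀ T₀ U UX Ut s y + y * simWy p X₀ T₀ UX s y
        + al p * simW p X₀ T₀ U s y := by rw [hws, hwy, hw]; ring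
    rw [h1]
    refine (abs_add_three _ _ _).trans ?_
    rw [abs_mul, abs_mul, abs_of_pos ha]
    have : |y| * |simWy p X₀ T₀ UX s y| ≤ 1 * |simWy p X₀ T₀ UX s y| :=
      mul_le_mul_of_nonneg_right (abs_lt.2 hy).le (abs_nonneg _)
    linarith
  have hEX : E / X ≤ 2 * E / X₀ := by
    rw [div_le_div_iff₀ hXpos hX0]
    nlinarith
  rw [hdiff]
  refine (abs_add_le _ _).trans ?_
  rw [abs_mul, abs_mul, abs_of_pos (by positivity : 0 < E / X)]
  have h2 : |(d : ℝ) - 1| * (E / X) * |simWy p X₀ T₀ UX s y|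
      ≤ |(d : ℝ) - 1| * (2 * E / X₀) * |simWy p X₀ T₀ UX s y| := by gcongr
  have h3 := mul_le_mul_of_nonneg_left hUt (by positivity : 0 ≤ M * E)
  linarith

/-- The contributions of `f` are of lower order. -/
lemma abs_lower_order_le (hp : 1 < p) (hq : 0 ≤ q) (hqp : q < p) (hM : 0 ≤ M)
    (hc : AdmissibleCoeffs q M β f G) {γ s y : ℝ} (hγ : 2 * γ ≤ al p * (p - q)) (hγ1 : γ ≤ 1 / 2)
    (hs : 0 ≤ s) :
    |Real.exp (-al p * s) ^ 2 * Real.exp (-s) ^ 2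
        * primF f (U (X₀ + y * Real.exp (-s)) (T₀ - Real.exp (-s)))|
      ≤ 3 * M * (Real.exp (-γ * s) ^ 2 * (1 + |simW p X₀ T₀ U s y| ^ (p + 1))) ∧
    |Real.exp (-al p * s) * Real.exp (-s) ^ 2
        * f (U (X₀ + y * Real.exp (-s)) (T₀ - Real.exp (-s))) * simW p X₀ T₀ U s y|
      ≤ 3 * M * (Real.exp (-γ * s) ^ 2 * (1 + |simW p X₀ T₀ U s y| ^ (p + 1))) := by
  have hw : simW p X₀ T₀ U s y
    = Real.exp (-al p * s) * U (X₀ + y * Real.exp (-s)) (T₀ - Real.exp (-s)) := simW_eq s y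
  set u := U (X₀ + y * Real.exp (-s)) (T₀ - Real.exp (-s))
  set w := simW p X₀ T₀ U s y
  have ha := al_pos hp
  have hA : Real.exp (-al p * s) ^ 2 * Real.exp (-s) ^ 2 = Real.exp (-(al p * (p + 1)) * s) := by
    rw [← Real.exp_nat_mul, ← Real.exp_nat_mul, ← Real.exp_add]
    congr 1
    push_cast
    linear_combination s * al_mul_sub_one hp
  have hg : Real.exp (-γ * s) ^ 2 = Real.exp (-2 * γ * s) := by
    rw [← Real.exp_nat_mul]; congr 1; push_cast; ring
  have h1 : Real.exp (-(al p * (p + 1)) * s) ≤ Real.exp (-2 * γ * s) := by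
    rw [Real.exp_le_exp]
    have := al_mul_sub_one hp
    nlinarith
  -- Writing `u = e^(al p s) w` spends `al p (q+1)` of the decay rate `al p (p+1)`; what remains,
  -- `al p (p-q)`, is at least `2 γ`. This is the origin of the second entry in the definition of
  -- `γ`.
  have h2 : Real.exp (-(al p * (p + 1)) * s) * |u| ^ (q + 1)
      ≤ Real.exp (-2 * γ * s) * |w| ^ (q + 1) := by
    rw [hw, abs_mul, abs_of_pos (Real.exp_pos _), Real.mul_rpow (Real.exp_pos _).le (abs_nonneg _),
      ← mul_assoc, ← Real.exp_mul, ← Real.exp_add]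
    refine mul_le_mul_of_nonneg_right (Real.exp_le_exp.2 ?_) (by positivity)
    nlinarith
  have h3 := rpow_le_one_add (r := q + 1) (p := p + 1) (by linarith) (by linarith) (abs_nonneg w)
  have hP : 0 ≤ |w| ^ (p + 1) := by positivity
  have key : Real.exp (-(al p * (p + 1)) * s) * (M * ((1 + |u| ^ q) * |u|))
      ≤ 3 * M * (Real.exp (-2 * γ * s) * (1 + |w| ^ (p + 1))) := by
    have h4 := one_add_rpow_mul_le hq u
    have h5 : Real.exp (-(al p * (p + 1)) * s) * ((1 + |u| ^ q) * |u|)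
        ≤ 3 * (Real.exp (-2 * γ * s) * (1 + |w| ^ (p + 1))) := by
      have h6 := mul_le_mul_of_nonneg_left h4 (Real.exp_pos (-(al p * (p + 1)) * s)).le
      have h7 := mul_le_mul_of_nonneg_left h3 (Real.exp_pos (-2 * γ * s)).le
      have h8 : 0 ≤ Real.exp (-2 * γ * s) * |w| ^ (p + 1) := by positivity
      linarith
    have := mul_le_mul_of_nonneg_left h5 hM
    linarith
  rw [hg]
  constructor
  · rw [hA, abs_mul, abs_of_pos (Real.exp_pos _)]
    refine (mul_le_mul_of_nonneg_left (abs_primF_le hq hM hc.f_bound u)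
      (Real.exp_pos _).le).trans (le_trans (le_of_eq ?_) key)
    ring
  · have : Real.exp (-al p * s) * Real.exp (-s) ^ 2 * f u * w
        = Real.exp (-(al p * (p + 1)) * s) * (f u * u) := by rw [← hA, hw]; ring
    rw [this, abs_mul, abs_of_pos (Real.exp_pos _), abs_mul]
    refine (mul_le_mul_of_nonneg_left (mul_le_mul_of_nonneg_right (hc.f_bound u) (abs_nonneg u))
      (Real.exp_pos _).le).trans (le_trans (le_of_eq ?_) key)
    ring

end Pointwise

/-! ## Solutions in similarity variables -/

section

variable {p q M : ℝ} {d : ℕ} {β f : ℝ → ℝ} {G : ℝ → ℝ → ℝ → ℝ → ℝ}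
  {T : ℝ → ℝ} {U UX Ut : ℝ → ℝ → ℝ} {X₀ T₀ σ : ℝ}

lemma IsVertex.Icc_lt (hv : IsVertex T X₀ T₀ σ) {s : ℝ} (hs : σ ≤ s) {a b : ℝ} (ha : -1 < a)
    (hb : b < 1) : 0 < X₀ + a * Real.exp (-s) ∧
      ∀ X ∈ Icc (X₀ + a * Real.exp (-s)) (X₀ + b * Real.exp (-s)), T₀ - Real.exp (-s) < T X := by
  have he := Real.exp_pos (-s)
  have h1 := hv.exp_le hs
  have h0 : 0 < X₀ + a * Real.exp (-s) := by nlinarith [hv.X_pos]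
  refine ⟨h0, fun X hX => hv.lt_T (h0.trans_le hX.1) ?_⟩
  rw [sub_sub_cancel, abs_lt]
  constructor <;> nlinarith [hX.1, hX.2]

lemma IsVertex.time_nonneg (hv : IsVertex T X₀ T₀ σ) {s : ℝ} (hs : σ ≤ s) :
    0 ≤ T₀ - Real.exp (-s) := by
  have : Real.exp (-s) ≤ Real.exp (-σ) := Real.exp_le_exp.2 (neg_le_neg hs)
  linarith [hv.exp_le_T₀]

/-- Square integrability is known only on compact subintervals of the section of the cone, so `(-1,
1)` is exhausted by countably many of them. -/
lemma ContL2.slice_meas {V : ℝ → ℝ → ℝ} (hV : ContL2 T V) (hv : IsVertex T X₀ T₀ σ) {s : ℝ}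
    (hs : σ ≤ s) : AEStronglyMeasurable
      (fun y => V (X₀ + y * Real.exp (-s)) (T₀ - Real.exp (-s)))
      (volume.restrict (Ioo (-1) 1)) := by
  have he := Real.exp_pos (-s)
  have hsub : Ioo (-1 : ℝ) 1 ⊆ ⋃ n : ℕ, Icc (-(1 - 1 / ((n : ℝ) + 1))) (1 - 1 / ((n : ℝ) + 1)) := by
    intro y hy
    have hy' : 0 < 1 - |y| := sub_pos.2 (abs_lt.2 hy)
    obtain ⟨n, hn⟩ := exists_nat_one_div_lt hy'
    refine mem_iUnion.2 ⟨n, ?_⟩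
    rw [mem_Icc, ← abs_le]
    linarith
  refine AEStronglyMeasurable.mono_set hsub ?_
  rw [aestronglyMeasurable_iUnion_iff]
  intro n
  set c : ℝ := 1 - 1 / ((n : ℝ) + 1) with hc
  have hc1 : c < 1 := by
    have : (0 : ℝ) < 1 / ((n : ℝ) + 1) := by positivity
    linarith
  have hc0 : 0 ≤ c := by
    rw [hc, sub_nonneg, div_le_one (by positivity)]
    linarith [n.cast_nonneg (α := ℝ)]
  obtain ⟨h0, hlt⟩ := hv.Icc_lt hs (show -1 < -c by linarith) hc1
  have hm := hV.memLp _ _ _ h0 (by nlinarith) (hv.time_nonneg hs) hlt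
  have hi := hm.integrable (by norm_num)
  rw [← IntegrableOn, ← integrable_indicator_iff measurableSet_Icc] at hi
  have h2 := ((hi.comp_add_left X₀).comp_mul_left' he.ne').aestronglyMeasurable.restrict
    (s := Icc (-c) c)
  refine h2.congr ?_
  filter_upwards [ae_restrict_mem measurableSet_Icc] with y hy
  rw [indicator_of_mem, mul_comm]
  constructor <;> nlinarith [hy.1, hy.2]

lemma IsSolution.isPrimitive (hp : 1 < p) (hS : IsSolution p d β f G T U UX Ut)
    (hv : IsVertex T X₀ T₀ σ) {s : ℝ} (hs : σ ≤ s) :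
    IsPrimitive (simW p X₀ T₀ U s) (simWy p X₀ T₀ UX s) := by
  intro a b ha hab hb
  have he := Real.exp_pos (-s)
  obtain ⟨h0, hlt⟩ := hv.Icc_lt hs ha hb
  have h := hS.space_deriv _ _ _ h0 (by nlinarith) (hv.time_nonneg hs) hlt
  simp only [simW_eq, simWy_eq hp, simMap, ← mul_sub]
  rw [h, intervalIntegral.integral_const_mul, mul_assoc]
  congr 1
  have h2 := intervalIntegral.mul_integral_comp_add_mul (a := a) (b := b)
    (f := fun X => UX X (T₀ - Real.exp (-s))) (Real.exp (-s)) X₀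
  simp only [mul_comm (Real.exp (-s))] at h2
  rw [← h2, mul_comm]

lemma IsSolution.continuousOn_simW (hS : IsSolution p d β f G T U UX Ut)
    (hv : IsVertex T X₀ T₀ σ) :
    ContinuousOn (fun x : ℝ × ℝ => simW p X₀ T₀ U x.2 x.1) (Ioo (-1) 1 ×ˢ Ici σ) := by
  simp only [simW_eq]
  refine ContinuousOn.mul (by fun_prop) ?_
  exact hS.continuousOn.comp contDiff_simMap.continuous.continuousOn fun x hx => hv.simMap_mem hx

lemma IsSolution.meas_simWy (hp : 1 < p) (hS : IsSolution p d β f G T U UX Ut)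
    (hv : IsVertex T X₀ T₀ σ) : AEStronglyMeasurable
      (fun x : ℝ × ℝ => simWy p X₀ T₀ UX x.2 x.1) (volume.restrict (strip σ)) := by
  simp only [simWy_eq hp]
  exact (by fun_prop : Continuous fun x : ℝ × ℝ =>
    Real.exp (-al p * x.2) * Real.exp (-x.2)).aestronglyMeasurable.mul
    (hS.locSq_UX hv).comp_simMap.meas

lemma strip_subset : strip σ ⊆ Ioo (-1) 1 ×ˢ Ici σ := prod_mono le_rfl Ioi_subset_Ici_self

lemma IsSolution.meas_simW (hS : IsSolution p d β f G T U UX Ut)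
    (hv : IsVertex T X₀ T₀ σ) : AEStronglyMeasurable
      (fun x : ℝ × ℝ => simW p X₀ T₀ U x.2 x.1) (volume.restrict (strip σ)) :=
  ((hS.continuousOn_simW hv).mono strip_subset).aestronglyMeasurable isOpen_strip.measurableSet

lemma IsSolution.meas_simWs (hp : 1 < p) (hS : IsSolution p d β f G T U UX Ut)
    (hv : IsVertex T X₀ T₀ σ) : AEStronglyMeasurable
      (fun x : ℝ × ℝ => simWs p X₀ T₀ U UX Ut x.2 x.1) (volume.restrict (strip σ)) := by
  simp only [simWs]
  refine ((hS.meas_simW hv).const_mul _).sub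
    (continuous_fst.aestronglyMeasurable.mul (hS.meas_simWy hp hv)) |>.add ?_
  exact (by fun_prop : Continuous fun x : ℝ × ℝ =>
    Real.exp (-((p + 1) / (p - 1)) * x.2)).aestronglyMeasurable.mul
    (hS.locSq_Ut hv).comp_simMap.meas

lemma IsSolution.slice_simWs (hS : IsSolution p d β f G T U UX Ut)
    (hv : IsVertex T X₀ T₀ σ) {s : ℝ} (hs : σ ≤ s) :
    AEStronglyMeasurable (simWy p X₀ T₀ UX s) (volume.restrict (Ioo (-1) 1)) ∧
    AEStronglyMeasurable (simWs p X₀ T₀ U UX Ut s) (volume.restrict (Ioo (-1) 1)) := by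
  have h1 : AEStronglyMeasurable (simWy p X₀ T₀ UX s) (volume.restrict (Ioo (-1) 1)) :=
    (hS.sliceL2_UX.contL2.slice_meas hv hs).const_mul _
  refine ⟨h1, ?_⟩
  have h2 := (hS.sliceL2_Ut.contL2.slice_meas hv hs).const_mul (Real.exp (-((p + 1) / (p - 1)) * s))
  have h3 : ContinuousOn (simW p X₀ T₀ U s) (Ioo (-1) 1) :=
    (hS.continuousOn_simW hv).comp (by fun_prop : Continuous fun y : ℝ => (y, s)).continuousOn
      fun y hy => ⟨hy, hs⟩
  exact (((h3.aestronglyMeasurable measurableSet_Ioo).const_mul _).sub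
    (continuous_id.aestronglyMeasurable.mul h1)).add h2

/-- Solutions with locally bounded energy. -/
theorem IsSolution.finiteEnergy (hp : 1 < p) (hS : IsSolution p d β f G T U UX Ut)
    (hv : IsVertex T X₀ T₀ σ)
    (hi : ∀ s, σ ≤ s →
      IntegrableOn (fun y => simW p X₀ T₀ U s y ^ 2 * rho p y) (Ioo (-1) 1) ∧
      IntegrableOn (fun y => (1 - y ^ 2) * simWy p X₀ T₀ UX s y ^ 2 * rho p y) (Ioo (-1) 1) ∧
      IntegrableOn (fun y => simWs p X₀ T₀ U UX Ut s y ^ 2 * rho p y) (Ioo (-1) 1))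
    (hb : ∀ S, ∃ C, ∀ s ∈ Icc σ S,
      (∫ y in Ioo (-1) 1, simW p X₀ T₀ U s y ^ 2 * rho p y) ≤ C ∧
      (∫ y in Ioo (-1) 1, (1 - y ^ 2) * simWy p X₀ T₀ UX s y ^ 2 * rho p y) ≤ C ∧
      (∫ y in Ioo (-1) 1, simWs p X₀ T₀ U UX Ut s y ^ 2 * rho p y) ≤ C) :
    FiniteEnergy p σ (simW p X₀ T₀ U) (simWy p X₀ T₀ UX) (simWs p X₀ T₀ U UX Ut) where
  meas_wy := hS.meas_simWy hp hv
  meas_ws := hS.meas_simWs hp hv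
  continuousOn := hS.continuousOn_simW hv
  slice_wy _ hs := (hS.slice_simWs hv hs).1
  slice_ws _ hs := (hS.slice_simWs hv hs).2
  prim _ hs := hS.isPrimitive hp hv hs
  int_w s hs := (hi s hs).1
  int_wy s hs := (hi s hs).2.1
  int_ws s hs := (hi s hs).2.2
  bound := hb

/-- The density is expanded in products of `U`, `UX`, `Ut` with coefficients continuous in `y` and
`s`, the same expansion as for its conservation law. -/
lemma sliceCont_simE (hp : 1 < p) (hS : IsSolution p d β f G T U UX Ut)
    (hv : IsVertex T X₀ T₀ σ) : SliceCont σ fun x =>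
      1 / 2 * simWs p X₀ T₀ U UX Ut x.2 x.1 ^ 2
        + 1 / 2 * simWy p X₀ T₀ UX x.2 x.1 ^ 2 * (1 - x.1 ^ 2)
        + al p * (al p + 1) / 2 * simW p X₀ T₀ U x.2 x.1 ^ 2 := by
  have hU := ContL2.of_continuousOn hv.lip hS.continuousOn
  have hX := hS.sliceL2_UX.contL2
  have ht := hS.sliceL2_Ut.contL2
  have k1 := (SliceCont.mul hv hU hU).coeff_mul (c := fun s => Real.exp (-al p * s) ^ 2)
    (k := fun _ => al p ^ 2 + al p / 2) (by fun_prop) (by fun_prop)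
  have k2 := (SliceCont.mul hv hX hX).coeff_mul
    (c := fun s => Real.exp (-al p * s) ^ 2 * Real.exp (-s) ^ 2) (k := fun _ => 1 / 2)
    (by fun_prop) (by fun_prop)
  have k3 := (SliceCont.mul hv ht ht).coeff_mul
    (c := fun s => Real.exp (-al p * s) ^ 2 * Real.exp (-s) ^ 2) (k := fun _ => 1 / 2)
    (by fun_prop) (by fun_prop)
  have k4 := (SliceCont.mul hv hU hX).coeff_mul
    (c := fun s => Real.exp (-al p * s) ^ 2 * Real.exp (-s)) (k := fun y => al p * y)
    (by fun_prop) (by fun_prop)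
  have k5 := (SliceCont.mul hv hU ht).coeff_mul
    (c := fun s => Real.exp (-al p * s) ^ 2 * Real.exp (-s)) (k := fun _ => -al p)
    (by fun_prop) (by fun_prop)
  have k6 := (SliceCont.mul hv hX ht).coeff_mul
    (c := fun s => Real.exp (-al p * s) ^ 2 * Real.exp (-s) ^ 2) (k := fun y => -y)
    (by fun_prop) (by fun_prop)
  refine (((((k1.add k2).add k3).add k4).add k5).add k6).congr fun x => ?_
  simp only [simW_eq, simWy_eq hp, simWs_eq hp, Prod.mk.eta]
  ring

lemma sliceCont_simK (hp : 1 < p) (hS : IsSolution p d β f G T U UX Ut)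
    (hv : IsVertex T X₀ T₀ σ) : SliceCont σ fun x =>
      simW p X₀ T₀ U x.2 x.1 * simWs p X₀ T₀ U UX Ut x.2 x.1 := by
  have hU := ContL2.of_continuousOn hv.lip hS.continuousOn
  have hX := hS.sliceL2_UX.contL2
  have ht := hS.sliceL2_Ut.contL2
  have k1 := (SliceCont.mul hv hU hU).coeff_mul (c := fun s => Real.exp (-al p * s) ^ 2)
    (k := fun _ => -al p) (by fun_prop) (by fun_prop)
  have k4 := (SliceCont.mul hv hU hX).coeff_mul
    (c := fun s => Real.exp (-al p * s) ^ 2 * Real.exp (-s)) (k := fun y => -y)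
    (by fun_prop) (by fun_prop)
  have k5 := (SliceCont.mul hv hU ht).coeff_mul
    (c := fun s => Real.exp (-al p * s) ^ 2 * Real.exp (-s)) (k := fun _ => 1)
    (by fun_prop) (by fun_prop)
  refine ((k1.add k4).add k5).congr fun x => ?_
  simp only [simW_eq, simWs_eq hp, Prod.mk.eta]
  ring

lemma continuousOn_beta_sim (hc : AdmissibleCoeffs q M β f G) (hv : IsVertex T X₀ T₀ σ) :
    ContinuousOn (fun x : ℝ × ℝ => β (X₀ + x.1 * Real.exp (-x.2))) (Ioo (-1) 1 ×ˢ Ici σ) ∧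
    ContinuousOn (fun x : ℝ × ℝ => deriv β (X₀ + x.1 * Real.exp (-x.2)))
      (Ioo (-1) 1 ×ˢ Ici σ) := by
  have hm : MapsTo (fun x : ℝ × ℝ => X₀ + x.1 * Real.exp (-x.2)) (Ioo (-1) 1 ×ˢ Ici σ) (Ioi 0) :=
    fun x hx => (hv.simMap_mem hx).1
  exact ⟨hc.beta_contDiffOn.continuousOn.comp (by fun_prop) hm,
    (hc.beta_contDiffOn.continuousOn_deriv_of_isOpen isOpen_Ioi le_rfl).comp (by fun_prop) hm⟩

lemma continuousOn_simV (hp : 1 < p) (hc : AdmissibleCoeffs q M β f G)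
    (hS : IsSolution p d β f G T U UX Ut) (hv : IsVertex T X₀ T₀ σ) :
    ContinuousOn (fun x : ℝ × ℝ => simV p β f U X₀ T₀ x.2 x.1) (Ioo (-1) 1 ×ˢ Ici σ) ∧
    ContinuousOn (fun x : ℝ × ℝ => simHV p β f U X₀ T₀ x.2 x.1) (Ioo (-1) 1 ×ˢ Ici σ) ∧
    ContinuousOn (fun x : ℝ × ℝ => simB p β U X₀ T₀ x.2 x.1) (Ioo (-1) 1 ×ˢ Ici σ) := by
  obtain ⟨hβ, hβ'⟩ := continuousOn_beta_sim (f := f) (G := G) hc hv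
  have hU : ContinuousOn (fun x : ℝ × ℝ => U (X₀ + x.1 * Real.exp (-x.2)) (T₀ - Real.exp (-x.2)))
      (Ioo (-1) 1 ×ˢ Ici σ) :=
    hS.continuousOn.comp (f := simMap X₀ T₀) contDiff_simMap.continuous.continuousOn
      fun x hx => hv.simMap_mem hx
  have hpow {r : ℝ} (hr : 0 ≤ r) := hU.abs.rpow_const (p := r) fun x _ => Or.inr hr
  have hf := hc.f_contDiff.continuous
  have hF : Continuous (primF f) := (contDiff_primF hf).continuous
  have hFU := hF.comp_continuousOn hU
  have hfU := hf.comp_continuousOn hU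
  refine ⟨?_, ?_, ?_⟩
  · exact ContinuousOn.mul (by fun_prop)
      ((hβ.mul ((hpow (by linarith)).div_const _)).add hFU)
  · exact ContinuousOn.mul (by fun_prop)
      ((hβ.mul ((hpow (by linarith)).mul hU)).add hfU)
  · exact (ContinuousOn.mul (by fun_prop) hβ').mul ((hpow (by linarith)).div_const _)

lemma exp_al_le_one (hp : 1 < p) {s : ℝ} (hs : 0 ≤ s) : Real.exp (-al p * s) ≤ 1 :=
  Real.exp_le_one_iff.2 (by have := al_pos hp; nlinarith)

lemma exp_neg_le_one {s : ℝ} (hs : 0 ≤ s) : Real.exp (-s) ≤ 1 :=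
  Real.exp_le_one_iff.2 (by linarith)

/-- Bounds for the potential and its derivatives. -/
lemma exists_potential_bound (hp : 1 < p) (hq : 0 ≤ q) (hqp : q < p) (hM : 0 ≤ M)
    (hc : AdmissibleCoeffs q M β f G) (hv : IsVertex T X₀ T₀ σ) (hσ : 0 ≤ σ) :
    ∃ K, 0 ≤ K ∧ ∀ s, σ ≤ s → ∀ y ∈ Ioo (-1 : ℝ) 1,
      |simV p β f U X₀ T₀ s y| ≤ K * (1 + |simW p X₀ T₀ U s y| ^ (p + 1)) ∧
      |simHV p β f U X₀ T₀ s y| ≤ K * (1 + |simW p X₀ T₀ U s y| ^ p) ∧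
      |simB p β U X₀ T₀ s y| ≤ K * (1 + |simW p X₀ T₀ U s y| ^ (p + 1)) := by
  have ha := al_pos hp
  have hp1 : 0 < p + 1 := by linarith
  have hIcc : Icc (X₀ / 2) (3 * X₀ / 2) ⊆ Ioi 0 := fun x hx =>
    lt_of_lt_of_le (half_pos hv.X_pos) hx.1
  obtain ⟨K₁, hK₁⟩ := isCompact_Icc.exists_bound_of_continuousOn
    (hc.beta_contDiffOn.continuousOn.mono hIcc)
  obtain ⟨K₂, hK₂⟩ := isCompact_Icc.exists_bound_of_continuousOn
    ((hc.beta_contDiffOn.continuousOn_deriv_of_isOpen isOpen_Ioi le_rfl).mono hIcc)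
  -- Only boundedness is needed here, so the estimate of the contributions of `f` is applied with
  -- decay rate zero.
  have hγ0 : 2 * (0 : ℝ) ≤ al p * (p - q) := by
    rw [mul_zero]; exact mul_nonneg ha.le (by linarith)
  have hE1 {s : ℝ} (hs : σ ≤ s) : Real.exp (-s) ≤ 1 := exp_neg_le_one (hσ.trans hs)
  have he1 {s : ℝ} (hs : σ ≤ s) : Real.exp (-al p * s) ≤ 1 := exp_al_le_one hp (hσ.trans hs)
  have hK1 : 0 ≤ K₁ := (norm_nonneg _).trans (hK₁ X₀ ⟨by linarith [hv.X_pos], by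
    linarith [hv.X_pos]⟩)
  have hK2 : 0 ≤ K₂ := (norm_nonneg _).trans (hK₂ X₀ ⟨by linarith [hv.X_pos], by
    linarith [hv.X_pos]⟩)
  refine ⟨K₁ + K₂ + 3 * M, by positivity, fun s hs y hy => ?_⟩
  have hX := hv.mem_Icc hs hy
  have b1 := hK₁ _ hX
  have b2 := hK₂ _ hX
  rw [Real.norm_eq_abs] at b1 b2
  have k1 : 0 ≤ K₁ := (abs_nonneg _).trans b1
  have k2 : 0 ≤ K₂ := (abs_nonneg _).trans b2
  have hP : 0 ≤ |simW p X₀ T₀ U s y| ^ (p + 1) := by positivity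
  have hQ : 0 ≤ |simW p X₀ T₀ U s y| ^ p := by positivity
  refine ⟨?_, ?_, ?_⟩
  · have h := (abs_lower_order_le (U := U) (X₀ := X₀) (T₀ := T₀) (y := y) (γ := 0) hp hq hqp hM hc
      hγ0 (by norm_num) (hσ.trans hs)).1
    simp only [neg_zero, zero_mul, Real.exp_zero, one_pow, one_mul] at h
    rw [simV_eq hp]
    refine (abs_add_le _ _).trans ?_
    rw [abs_mul, abs_of_nonneg hP, abs_div, abs_of_pos hp1]
    have : |β (X₀ + y * Real.exp (-s))| / (p + 1) ≤ K₁ :=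
      (div_le_self (abs_nonneg _) (by linarith)).trans b1
    have h2 := mul_le_mul_of_nonneg_right this hP
    nlinarith
  · rw [simHV_eq hp]
    refine (abs_add_le _ _).trans ?_
    have h1 : |simW p X₀ T₀ U s y| ^ (p - 1) * |simW p X₀ T₀ U s y|
        = |simW p X₀ T₀ U s y| ^ p := by
      have h := Real.rpow_add_of_nonneg (abs_nonneg (simW p X₀ T₀ U s y))
        (show 0 ≤ p - 1 by linarith) zero_le_one
      rw [Real.rpow_one, sub_add_cancel] at h
      exact h.symm
    rw [abs_mul, abs_mul, abs_of_nonneg (by positivity : 0 ≤ |simW p X₀ T₀ U s y| ^ (p - 1)), h1]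
    have h2 := mul_le_mul_of_nonneg_right b1 hQ
    have h3 : |Real.exp (-al p * s) * Real.exp (-s) ^ 2
        * f (U (X₀ + y * Real.exp (-s)) (T₀ - Real.exp (-s)))|
        ≤ M * (2 + |simW p X₀ T₀ U s y| ^ p) := by
      have hw : simW p X₀ T₀ U s y
        = Real.exp (-al p * s) * U (X₀ + y * Real.exp (-s)) (T₀ - Real.exp (-s)) := simW_eq s y
      have h4 := rpow_le_one_add hq hqp.le (abs_nonneg (simW p X₀ T₀ U s y))
      have h5 : Real.exp (-al p * s) * Real.exp (-s) ^ 2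
          * |U (X₀ + y * Real.exp (-s)) (T₀ - Real.exp (-s))| ^ q
          ≤ |simW p X₀ T₀ U s y| ^ q := by
        rw [hw, abs_mul, abs_of_pos (Real.exp_pos _), Real.mul_rpow (Real.exp_pos _).le
          (abs_nonneg _)]
        refine mul_le_mul_of_nonneg_right ?_ (by positivity)
        rw [← Real.exp_mul, ← Real.exp_nat_mul, ← Real.exp_add, Real.exp_le_exp]
        push_cast
        have h0 := al_mul_sub_one hp
        have h00 : 0 ≤ s := hσ.trans hs
        have : 0 ≤ al p * (p - q) * s := mul_nonneg (mul_nonneg ha.le (by linarith)) h00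
        nlinarith
      rw [abs_mul, abs_of_pos (by positivity)]
      have h6 := mul_le_mul_of_nonneg_left (hc.f_bound
        (U (X₀ + y * Real.exp (-s)) (T₀ - Real.exp (-s))))
        (by positivity : 0 ≤ Real.exp (-al p * s) * Real.exp (-s) ^ 2)
      have h7 : Real.exp (-al p * s) * Real.exp (-s) ^ 2 ≤ 1 :=
        mul_le_one₀ (he1 hs) (by positivity) (pow_le_one₀ (by positivity) (hE1 hs))
      have h8 := mul_le_mul_of_nonneg_left (add_le_add h7 (h5.trans h4)) hM
      linarith
    have : 0 ≤ K₂ * (1 + |simW p X₀ T₀ U s y| ^ p) := by positivity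
    have : 0 ≤ M * |simW p X₀ T₀ U s y| ^ p := by positivity
    linarith
  · rw [simB_eq hp, abs_mul, abs_of_nonneg hP]
    have h3 : |Real.exp (-s) * y * deriv β (X₀ + y * Real.exp (-s)) / (p + 1)| ≤ K₂ := by
      rw [abs_div, abs_of_pos hp1, abs_mul, abs_mul, abs_of_pos (Real.exp_pos _)]
      refine (div_le_self (by positivity) (by linarith)).trans ?_
      have h4 : Real.exp (-s) * |y| ≤ 1 :=
        mul_le_one₀ (hE1 hs) (abs_nonneg _) (abs_lt.2 hy).le
      calc _ ≤ 1 * K₂ := mul_le_mul h4 b2 (abs_nonneg _) zero_le_one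
        _ = K₂ := one_mul _
    have := mul_le_mul_of_nonneg_right h3 hP
    have : 0 ≤ (K₁ + 3 * M) * (1 + |simW p X₀ T₀ U s y| ^ (p + 1)) := by positivity
    linarith

/-- Bounds for the source. -/
lemma exists_source_bound (hp : 1 < p) (hq : 0 ≤ q) (hqp : q < p) (hM : 0 ≤ M)
    (hc : AdmissibleCoeffs q M β f G) (hv : IsVertex T X₀ T₀ σ) (hσ : 0 ≤ σ) :
    ∃ C, ∀ s, σ ≤ s → ∀ y ∈ Ioo (-1 : ℝ) 1, |simH p d β f G U UX Ut X₀ T₀ s y|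
      ≤ C * (1 + |simWy p X₀ T₀ UX s y| + |simWs p X₀ T₀ U UX Ut s y|
        + |simW p X₀ T₀ U s y| ^ p) := by
  obtain ⟨K, hK, hV⟩ := exists_potential_bound (U := U) hp hq hqp hM hc hv hσ
  have ha := al_pos hp
  set D := |(d : ℝ) - 1| * (2 / X₀) with hD
  have hD0 : 0 ≤ D := by have := hv.X_pos; positivity
  refine ⟨K + D + M * (4 + al p), fun s hs y hy => ?_⟩
  have h1 := abs_simH_sub_le (d := d) (U := U) (UX := UX) (Ut := Ut) hp hM hc hv hs hy
  have h2 := (hV s hs y hy).2.1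
  have h3 := rpow_le_one_add zero_le_one hp.le (abs_nonneg (simW p X₀ T₀ U s y))
  rw [Real.rpow_one] at h3
  have hX0 := hv.X_pos
  have h4 : |(d : ℝ) - 1| * (2 * Real.exp (-s) / X₀) ≤ D := by
    rw [hD]
    gcongr
    linarith [exp_neg_le_one (hσ.trans hs)]
  have h5 : M * (Real.exp (-al p * s) * Real.exp (-s) ^ 2) ≤ M :=
    mul_le_of_le_one_right hM (mul_le_one₀ (exp_al_le_one hp (hσ.trans hs)) (by positivity)
      (pow_le_one₀ (by positivity) (exp_neg_le_one (hσ.trans hs))))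
  have h6 : M * Real.exp (-s) ≤ M := mul_le_of_le_one_right hM (exp_neg_le_one (hσ.trans hs))
  set a := |simWy p X₀ T₀ UX s y|
  set b := |simWs p X₀ T₀ U UX Ut s y|
  set c := |simW p X₀ T₀ U s y| with hcdef
  have a0 : 0 ≤ a := abs_nonneg _
  have b0 : 0 ≤ b := abs_nonneg _
  have c0 : 0 ≤ c := abs_nonneg _
  have cp0 : 0 ≤ c ^ p := by positivity
  have h7 := mul_le_mul_of_nonneg_right h4 a0
  have h8 := mul_le_mul_of_nonneg_right h6 (by positivity : 0 ≤ 2 * a + b + al p * c)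
  have h9 := mul_le_mul_of_nonneg_left h3 (by positivity : 0 ≤ M * al p)
  have h10 := abs_sub_abs_le_abs_sub (simH p d β f G U UX Ut X₀ T₀ s y)
    (simHV p β f U X₀ T₀ s y)
  have n1 : 0 ≤ (K) * (a + b) := by positivity
  have n2 : 0 ≤ D * (1 + b + c ^ p) := by positivity
  have n3 : 0 ≤ M * (3 + 2 * a + 3 * b + 4 * c ^ p) := by positivity
  have n4 : 0 ≤ M * al p * (a + b) := by positivity
  linarith

/-- Solutions with locally bounded energy satisfy the conservation laws. -/
theorem IsSolution.evolution (hp : 1 < p) (hq : 0 ≤ q) (hqp : q < p) (hM : 0 ≤ M)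
    (hc : AdmissibleCoeffs q M β f G) (hS : IsSolution p d β f G T U UX Ut)
    (hv : IsVertex T X₀ T₀ σ) (hσ : 0 ≤ σ)
    (hE : FiniteEnergy p σ (simW p X₀ T₀ U) (simWy p X₀ T₀ UX) (simWs p X₀ T₀ U UX Ut)) :
    Evolution p σ (simW p X₀ T₀ U) (simWy p X₀ T₀ UX) (simWs p X₀ T₀ U UX Ut)
      (simH p d β f G U UX Ut X₀ T₀) (simV p β f U X₀ T₀) (simHV p β f U X₀ T₀)
      (simB p β U X₀ T₀) := by
  obtain ⟨cV, cHV, cB⟩ := continuousOn_simV hp hc hS hv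
  obtain ⟨K, -, hV⟩ := exists_potential_bound (U := U) hp hq hqp hM hc hv hσ
  obtain ⟨C, hC⟩ := exists_source_bound (d := d) (U := U) (UX := UX) (Ut := Ut) hp hq hqp hM hc
    hv hσ
  have hmeas {A : ℝ × ℝ → ℝ} (hA : ContinuousOn A (Ioo (-1) 1 ×ˢ Ici σ)) :
      AEStronglyMeasurable A (volume.restrict (strip σ)) :=
    (hA.mono strip_subset).aestronglyMeasurable isOpen_strip.measurableSet
  refine
    { hE with
      meas_h := ?_
      meas_v := hmeas cV
      meas_hv := hmeas cHV
      meas_bt := hmeas cB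
      slice_v := fun s hs => cV.comp (by fun_prop : Continuous fun y : ℝ => (y, s)).continuousOn
        fun y hy => ⟨hy, hs⟩
      lawE := fluxLaw_simE hp hc hS hv
      lawK := fluxLaw_simK hp hc hS hv
      lawV := fluxLaw_simV hp hc hS hv
      contE := sliceCont_simE hp hS hv
      contK := sliceCont_simK hp hS hv
      contV := SliceCont.of_continuousOn cV
      bound_h := fun S => ⟨C, fun s hs y hy => hC s hs.1 y hy⟩
      bound_v := fun S => ⟨K, fun s hs y hy => hV s hs.1 y hy⟩ }
  exact (by fun_prop : Continuous fun x : ℝ × ℝ =>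
    Real.exp (-al p * x.2) * Real.exp (-x.2) ^ 2).aestronglyMeasurable.mul
    (locSq_source hp hc hS hv).comp_simMap.meas

end

/-! ## Smallness of the perturbations for large times -/

lemma gam_pos {p q : ℝ} (hp : 1 < p) (hqp : q < p) : 0 < gam p q :=
  lt_min (by norm_num) (div_pos (by linarith) (by linarith))

lemma gam_le_half (p q : ℝ) : gam p q ≤ 1 / 2 := min_le_left _ _

lemma two_mul_gam_le {p q : ℝ} : 2 * gam p q ≤ al p * (p - q) := by
  have h : gam p q ≤ (p - q) / (p - 1) := min_le_right _ _
  have : al p * (p - q) = 2 * ((p - q) / (p - 1)) := by rw [al]; ring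
  linarith

/-- The coefficient of smallness of the perturbations. -/
def perturbSize (p M B : ℝ) (d : ℕ) : ℝ := 2 * ((d : ℝ) + 1) + M * (2 + al p) + B

section

variable {p q M : ℝ} {d : ℕ} {β f : ℝ → ℝ} {G : ℝ → ℝ → ℝ → ℝ → ℝ}
  {T : ℝ → ℝ} {U UX Ut : ℝ → ℝ → ℝ} {X₀ T₀ σ : ℝ}

lemma abs_beta_sub_le (hc : AdmissibleCoeffs q M β f G) (hX₀ : 0 < X₀) {B : ℝ}
    (hB : ∀ X, |X - X₀| ≤ min 1 (X₀ / 2) → |deriv β X| ≤ B) {X : ℝ}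
    (hX : |X - X₀| ≤ min 1 (X₀ / 2)) : |β X - β X₀| ≤ B * |X - X₀| := by
  have h0 : 0 ≤ min 1 (X₀ / 2) := le_min zero_le_one (by linarith)
  have hball {Y : ℝ} (hY : Y ∈ Metric.closedBall X₀ (min 1 (X₀ / 2))) :
      |Y - X₀| ≤ min 1 (X₀ / 2) := by rwa [← Real.dist_eq]
  refine (convex_closedBall X₀ (min 1 (X₀ / 2))).norm_image_sub_le_of_norm_deriv_le
    (f := β) (fun Y hY => ?_) (fun Y hY => hB Y (hball hY)) (Metric.mem_closedBall_self h0)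
    (by rwa [Metric.mem_closedBall, Real.dist_eq])
  have hpos : 0 < Y := by
    have h1 := (hball hY).trans (min_le_right _ _)
    linarith [(abs_le.1 h1).1]
  exact (hc.beta_contDiffOn.differentiableOn one_ne_zero).differentiableAt (Ioi_mem_nhds hpos)

/-- The perturbations are small for large times. -/
theorem isSmall_sim (hp : 1 < p) (hq : 0 ≤ q) (hqp : q < p) (hM : 0 ≤ M)
    (hc : AdmissibleCoeffs q M β f G) (hv : IsVertex T X₀ T₀ σ) {B δ S₀ : ℝ} (hB0 : 0 ≤ B)
    (hB : ∀ X, |X - X₀| ≤ min 1 (X₀ / 2) → |deriv β X| ≤ B)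
    (hS₀ : 0 ≤ S₀) (hσ : S₀ ≤ σ) (hσX : -4 * Real.log X₀ ≤ σ)
    (h1 : Real.exp (-gam p q * S₀) ≤ δ ^ 2)
    (h2 : Real.exp (-S₀ / 4) * perturbSize p M B d ≤ δ) :
    IsSmall p (gam p q) M (3 * M * (3 * al p + 2)) (β X₀) δ σ
      (simW p X₀ T₀ U) (simWy p X₀ T₀ UX) (simWs p X₀ T₀ U UX Ut)
      (simH p d β f G U UX Ut X₀ T₀) (simV p β f U X₀ T₀) (simHV p β f U X₀ T₀)
      (simB p β U X₀ T₀) := by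
  have ha := al_pos hp
  have hp1 : 0 < p + 1 := by linarith
  have hγ := gam_pos hp hqp
  have hγ1 := gam_le_half p q
  set γ := gam p q with hγdef
  have hX₀ := hv.X_pos
  have hL0 : 0 ≤ perturbSize p M B d := by unfold perturbSize; positivity
  -- Because `γ ≤ 1/2`, one power `e^(-s)` pays for `e^(-γs)` and leaves `e^(-s/4)` as the small
  -- factor.
  have hE (s : ℝ) (hs : σ ≤ s) : Real.exp (-s) ≤ Real.exp (-s / 4) * Real.exp (-γ * s) := by
    rw [← Real.exp_add, Real.exp_le_exp]; nlinarith
  -- The term `(d-1)/X` brings the factor `1/X₀`. The condition `s ≥ -4 log X₀` bounds it by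
  -- `e^(s/4)`; after this and the reserve `e^(-s/4)`, exactly `e^(-s/2)` is left for `e^(-γs)`.
  have hEX (s : ℝ) (hs : σ ≤ s) :
      Real.exp (-s) / X₀ ≤ Real.exp (-s / 4) * Real.exp (-γ * s) := by
    have : Real.exp (-s / 4) ≤ X₀ := by
      rw [← Real.le_log_iff_exp_le hX₀]; linarith
    rw [div_le_iff₀ hX₀]
    calc Real.exp (-s) ≤ Real.exp (-s / 4) * Real.exp (-γ * s) * Real.exp (-s / 4) := by
          rw [← Real.exp_add, ← Real.exp_add, Real.exp_le_exp]; nlinarith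
      _ ≤ _ := by gcongr
  have hκ (s : ℝ) (hs : σ ≤ s) : Real.exp (-s / 4) * perturbSize p M B d ≤ δ := by
    refine le_trans ?_ h2
    refine mul_le_mul_of_nonneg_right (Real.exp_le_exp.2 ?_) hL0
    linarith
  have hBE (s : ℝ) (hs : σ ≤ s) : B * Real.exp (-s) ≤ δ * Real.exp (-γ * s) := by
    have hBL : B ≤ perturbSize p M B d := by
      have : 0 ≤ 2 * ((d : ℝ) + 1) + M * (2 + al p) := by positivity
      unfold perturbSize; linarith
    calc B * Real.exp (-s) ≤ perturbSize p M B d * (Real.exp (-s / 4) * Real.exp (-γ * s)) := by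
          gcongr; exact hE s hs
      _ = Real.exp (-s / 4) * perturbSize p M B d * Real.exp (-γ * s) := by ring
      _ ≤ _ := mul_le_mul_of_nonneg_right (hκ s hs) (Real.exp_pos _).le
  have hnear (s : ℝ) (hs : σ ≤ s) (y : ℝ) (hy : y ∈ Ioo (-1 : ℝ) 1) :
      |X₀ + y * Real.exp (-s) - X₀| ≤ min 1 (X₀ / 2) := by
    rw [add_sub_cancel_left]
    refine (abs_mul_exp_lt hy).le.trans (le_min ?_ (hv.exp_le hs))
    exact Real.exp_le_one_iff.2 (by linarith)
  have hβ (s : ℝ) (hs : σ ≤ s) (y : ℝ) (hy : y ∈ Ioo (-1 : ℝ) 1) :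
      |β (X₀ + y * Real.exp (-s)) - β X₀| ≤ δ * Real.exp (-γ * s) := by
    refine ((abs_beta_sub_le hc hX₀ hB (hnear s hs y hy)).trans ?_).trans (hBE s hs)
    rw [add_sub_cancel_left]
    exact mul_le_mul_of_nonneg_left (abs_mul_exp_lt hy).le hB0
  have hlow (s : ℝ) (hs : σ ≤ s) (y : ℝ) := abs_lower_order_le (β := β) (f := f) (G := G) (U := U)
    (X₀ := X₀) (T₀ := T₀) (y := y) hp hq hqp hM hc two_mul_gam_le hγ1 (hS₀.trans (hσ.trans hs))
  rw [← hγdef] at hlow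
  have hΛ {Z : ℝ} (hZ : 0 ≤ Z) : 3 * M * Z ≤ 3 * M * (3 * al p + 2) * Z := by
    have : 0 ≤ M * Z * (3 * al p + 1) := by positivity
    linarith
  refine ⟨fun s hs => ?_, fun s hs y hy => ?_, fun s hs y hy => ?_, fun s hs y hy => ?_,
    fun s hs y hy => ?_, fun s hs y hy => ?_⟩
  · exact le_trans (Real.exp_le_exp.2 (by nlinarith)) h1
  · refine (abs_simH_sub_le (d := d) hp hM hc hv hs hy).trans ?_
    have hsm : Real.exp (-al p * s) * Real.exp (-s) ^ 2 ≤ Real.exp (-γ * s) ^ 2 := by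
      rw [← Real.exp_nat_mul, ← Real.exp_nat_mul, ← Real.exp_add, Real.exp_le_exp]
      push_cast
      have hs0 : 0 ≤ s := hS₀.trans (hσ.trans hs)
      have := mul_nonneg ha.le hs0
      nlinarith
    have hd : |(d : ℝ) - 1| ≤ (d : ℝ) + 1 := by
      have := d.cast_nonneg (α := ℝ)
      rw [abs_le]; constructor <;> linarith
    have hκs := hκ s hs
    have e1 := hE s hs
    have e2 := hEX s hs
    set κ := Real.exp (-s / 4)
    set g := Real.exp (-γ * s)
    have hκ0 : 0 < κ := Real.exp_pos _
    have hg0 : 0 < g := Real.exp_pos _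
    set a := |simWy p X₀ T₀ UX s y|
    set b := |simWs p X₀ T₀ U UX Ut s y|
    set c := |simW p X₀ T₀ U s y|
    have a0 : 0 ≤ a := abs_nonneg _
    have b0 : 0 ≤ b := abs_nonneg _
    have c0 : 0 ≤ c := abs_nonneg _
    have k1 : |(d : ℝ) - 1| * (2 * Real.exp (-s) / X₀) * a ≤ ((d : ℝ) + 1) * (2 * (κ * g)) * a := by
      rw [mul_div_assoc]
      gcongr
    have k2 : M * Real.exp (-s) * (2 * a + b + al p * c)
        ≤ M * (κ * g) * (2 * a + b + al p * c) := by gcongr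
    have k3 := mul_le_mul_of_nonneg_left hsm hM
    have k4 : κ * perturbSize p M B d * (g * (a + b + c)) ≤ δ * (g * (a + b + c)) :=
      mul_le_mul_of_nonneg_right hκs (by positivity)
    have k5 : 0 ≤ κ * g * ((2 * ((d : ℝ) + 1) + B) * (b + c) + B * a
        + M * (al p * a + (1 + al p) * b + 2 * c)) := by positivity
    unfold perturbSize at k4
    linarith
  · obtain ⟨l1, l2⟩ := hlow s hs y
    -- The contributions of `β` cancel since `2 (al p + 1)/(p + 1) = al p`. Only those of `f`
    -- survive, and no condition on `β` enters.
    have hid : 2 * (al p + 1) * simV p β f U X₀ T₀ s y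
        - al p * (simHV p β f U X₀ T₀ s y * simW p X₀ T₀ U s y)
        = 2 * (al p + 1) * (Real.exp (-al p * s) ^ 2 * Real.exp (-s) ^ 2
          * primF f (U (X₀ + y * Real.exp (-s)) (T₀ - Real.exp (-s))))
        - al p * (Real.exp (-al p * s) * Real.exp (-s) ^ 2
          * f (U (X₀ + y * Real.exp (-s)) (T₀ - Real.exp (-s))) * simW p X₀ T₀ U s y) := by
      have h3 : 2 * (al p + 1) / (p + 1) = al p := by
        rw [div_eq_iff hp1.ne']; linarith [al_mul_sub_one hp]
      rw [simV_eq hp, simHV_eq hp, abs_rpow_add_one hp]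
      linear_combination β (X₀ + y * Real.exp (-s)) * (|simW p X₀ T₀ U s y| ^ (p - 1)
        * simW p X₀ T₀ U s y ^ 2) * h3
    rw [hid]
    refine (abs_sub _ _).trans ?_
    rw [abs_mul (2 * (al p + 1)), abs_mul (al p), abs_of_pos ha,
      abs_of_pos (by positivity : 0 < 2 * (al p + 1))]
    have h4 := mul_le_mul_of_nonneg_left l1 (by positivity : 0 ≤ 2 * (al p + 1))
    have h5 := mul_le_mul_of_nonneg_left l2 ha.le
    linarith
  · obtain ⟨-, l2⟩ := hlow s hs y
    have hid : simHV p β f U X₀ T₀ s y * simW p X₀ T₀ U s y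
        - β X₀ * |simW p X₀ T₀ U s y| ^ (p + 1)
        = Real.exp (-al p * s) * Real.exp (-s) ^ 2
          * f (U (X₀ + y * Real.exp (-s)) (T₀ - Real.exp (-s))) * simW p X₀ T₀ U s y
        + (β (X₀ + y * Real.exp (-s)) - β X₀) * |simW p X₀ T₀ U s y| ^ (p + 1) := by
      rw [simHV_eq hp, abs_rpow_add_one hp]; ring
    rw [hid]
    refine (abs_add_le _ _).trans (add_le_add (l2.trans (hΛ (by positivity))) ?_)
    rw [abs_mul, abs_of_nonneg (by positivity : 0 ≤ |simW p X₀ T₀ U s y| ^ (p + 1))]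
    exact mul_le_mul_of_nonneg_right (hβ s hs y hy) (by positivity)
  · rw [simB_eq hp, abs_mul, abs_of_nonneg (by positivity : 0 ≤ |simW p X₀ T₀ U s y| ^ (p + 1))]
    refine mul_le_mul_of_nonneg_right ?_ (by positivity)
    rw [abs_div, abs_of_pos hp1, abs_mul, abs_mul, abs_of_pos (Real.exp_pos _)]
    refine (div_le_self (by positivity) (by linarith)).trans (le_trans ?_ (hBE s hs))
    have h3 : Real.exp (-s) * |y| ≤ Real.exp (-s) :=
      mul_le_of_le_one_right (Real.exp_pos _).le (abs_lt.2 hy).le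
    rw [mul_comm B]
    exact mul_le_mul h3 (hB _ (hnear s hs y hy)) (abs_nonneg _) (Real.exp_pos _).le
  · obtain ⟨l1, -⟩ := hlow s hs y
    have hid : simV p β f U X₀ T₀ s y - β X₀ / (p + 1) * |simW p X₀ T₀ U s y| ^ (p + 1)
        = Real.exp (-al p * s) ^ 2 * Real.exp (-s) ^ 2
          * primF f (U (X₀ + y * Real.exp (-s)) (T₀ - Real.exp (-s)))
        + (β (X₀ + y * Real.exp (-s)) - β X₀) / (p + 1) * |simW p X₀ T₀ U s y| ^ (p + 1) := by
      rw [simV_eq hp]; ring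
    rw [hid]
    refine (abs_add_le _ _).trans (add_le_add (l1.trans (hΛ (by positivity))) ?_)
    rw [abs_mul, abs_of_nonneg (by positivity : 0 ≤ |simW p X₀ T₀ U s y| ^ (p + 1)), abs_div,
      abs_of_pos hp1]
    exact mul_le_mul_of_nonneg_right ((div_le_self (abs_nonneg _) (by linarith)).trans
      (hβ s hs y hy)) (by positivity)

end

/-! ## Trajectories in the energy space -/

/-- Continuity in `L²` makes the square of the norm a continuous function of time, hence bounded on
compact intervals. -/
lemma integrable_sq_and_bound {s₀ : ℝ} {F : ℝ → ℝ → ℝ} {μ : Measure ℝ}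
    (hF : ∀ s, s₀ ≤ s → MemLp (F s) 2 μ)
    (hc : ∀ s, s₀ ≤ s → Tendsto (fun τ => eLpNorm (fun y => F τ y - F s y) 2 μ)
      (𝓝[Ici s₀] s) (𝓝 0)) :
    (∀ s, s₀ ≤ s → Integrable (fun y => F s y * F s y) μ) ∧
      ∀ S, ∃ C, ∀ s ∈ Icc s₀ S, ∫ y, F s y * F s y ∂μ ≤ C := by
  refine ⟨fun s hs => (hF s hs).integrable_mul (hF s hs), fun S => ?_⟩
  have hcont : ContinuousOn (fun s => ∫ y, F s y * F s y ∂μ) (Ici s₀) := fun s hs => by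
    have hmem : ∀ᶠ τ in 𝓝[Ici s₀] s, MemLp (F τ) 2 μ := by
      filter_upwards [self_mem_nhdsWithin] with τ hτ using hF τ hτ
    exact tendsto_integral_mul_of_tendsto_eLpNorm hmem (hF s hs) (hc s hs) hmem (hF s hs) (hc s hs)
  obtain ⟨C, hC⟩ := isCompact_Icc.exists_bound_of_continuousOn
    (hcont.mono (Icc_subset_Ici_self : Icc s₀ S ⊆ Ici s₀))
  exact ⟨C, fun s hs => (le_abs_self _).trans (hC s hs)⟩

lemma IsEnergyTrajectory.integrals {p s₀ : ℝ} {w wy ws : ℝ → ℝ → ℝ}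
    (h : IsEnergyTrajectory p s₀ w wy ws) :
    (∀ s, s₀ ≤ s →
      IntegrableOn (fun y => w s y ^ 2 * rho p y) (Ioo (-1) 1) ∧
      IntegrableOn (fun y => (1 - y ^ 2) * wy s y ^ 2 * rho p y) (Ioo (-1) 1) ∧
      IntegrableOn (fun y => ws s y ^ 2 * rho p y) (Ioo (-1) 1)) ∧
    ∀ S, ∃ C, ∀ s ∈ Icc s₀ S,
      (∫ y in Ioo (-1) 1, w s y ^ 2 * rho p y) ≤ C ∧
      (∫ y in Ioo (-1) 1, (1 - y ^ 2) * wy s y ^ 2 * rho p y) ≤ C ∧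
      (∫ y in Ioo (-1) 1, ws s y ^ 2 * rho p y) ≤ C := by
  have hmul (a b c : ℝ) (hc : 0 ≤ c) : a * √c * (b * √c) = a * b * c := by
    rw [mul_mul_mul_comm, Real.mul_self_sqrt hc]
  have e1 (v : ℝ → ℝ) (y : ℝ) (hy : y ∈ Ioo (-1 : ℝ) 1) :
      v y * √(rho p y) * (v y * √(rho p y)) = v y ^ 2 * rho p y := by
    rw [hmul _ _ _ (rho_pos hy).le, sq]
  have e2 (v : ℝ → ℝ) (y : ℝ) (hy : y ∈ Ioo (-1 : ℝ) 1) :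
      v y * √((1 - y ^ 2) * rho p y) * (v y * √((1 - y ^ 2) * rho p y))
        = (1 - y ^ 2) * v y ^ 2 * rho p y := by
    rw [hmul _ _ _ (mul_pos (one_sub_sq_pos hy) (rho_pos hy)).le]; ring
  obtain ⟨i1, b1⟩ := integrable_sq_and_bound h.memLp_w fun s hs => by
    simpa only [sub_mul] using h.tendsto_w s hs
  obtain ⟨i2, b2⟩ := integrable_sq_and_bound h.memLp_wy fun s hs => by
    simpa only [sub_mul] using h.tendsto_wy s hs
  obtain ⟨i3, b3⟩ := integrable_sq_and_bound h.memLp_ws fun s hs => by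
    simpa only [sub_mul] using h.tendsto_ws s hs
  refine ⟨fun s hs => ⟨?_, ?_, ?_⟩, fun S => ?_⟩
  · exact IntegrableOn.congr_fun (i1 s hs) (fun y hy => e1 (w s) y hy) measurableSet_Ioo
  · exact IntegrableOn.congr_fun (i2 s hs) (fun y hy => e2 (wy s) y hy) measurableSet_Ioo
  · exact IntegrableOn.congr_fun (i3 s hs) (fun y hy => e1 (ws s) y hy) measurableSet_Ioo
  · obtain ⟨C1, h1⟩ := b1 S
    obtain ⟨C2, h2⟩ := b2 S
    obtain ⟨C3, h3⟩ := b3 S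
    refine ⟨max C1 (max C2 C3), fun s hs => ⟨?_, ?_, ?_⟩⟩
    · rw [← setIntegral_congr_fun measurableSet_Ioo fun y hy => e1 (w s) y hy]
      exact (h1 s hs).trans (le_max_left _ _)
    · rw [← setIntegral_congr_fun measurableSet_Ioo fun y hy => e2 (wy s) y hy]
      exact (h2 s hs).trans ((le_max_left _ _).trans (le_max_right _ _))
    · rw [← setIntegral_congr_fun measurableSet_Ioo fun y hy => e1 (ws s) y hy]
      exact (h3 s hs).trans ((le_max_right _ _).trans (le_max_right _ _))

/-! ## Lowering the vertex -/

/-- Lowering the vertex contracts `y` by a factor `κ ≤ 1`. The image of `(-1, 1)` stays inside `(-1,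
1)`, and the change of variables costs `κ⁻¹`. -/
lemma integrableOn_of_le_comp_mul {κ : ℝ} (hκ : 0 < κ) {Φ Ψ : ℝ → ℝ}
    (hm : AEStronglyMeasurable Φ (volume.restrict (Ioo (-1) 1)))
    (hΨ : IntegrableOn Ψ (Ioo (-1) 1)) (h0 : ∀ y ∈ Ioo (-1 : ℝ) 1, 0 ≤ Ψ y)
    (hκ1 : κ ≤ 1) (hle : ∀ y ∈ Ioo (-1 : ℝ) 1, |Φ y| ≤ Ψ (κ * y)) :
    IntegrableOn Φ (Ioo (-1) 1) ∧ ∫ y in Ioo (-1) 1, Φ y ≤ κ⁻¹ * ∫ y in Ioo (-1) 1, Ψ y := by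
  have hi : Integrable ((Ioo (-1 : ℝ) 1).indicator Ψ) :=
    (integrable_indicator_iff measurableSet_Ioo).2 hΨ
  have hi' := hi.comp_mul_left' hκ.ne'
  have hmem {y : ℝ} (hy : y ∈ Ioo (-1 : ℝ) 1) : κ * y ∈ Ioo (-1 : ℝ) 1 := by
    constructor <;> nlinarith [hy.1, hy.2]
  have hle' (y : ℝ) (hy : y ∈ Ioo (-1 : ℝ) 1) :
      |Φ y| ≤ (Ioo (-1 : ℝ) 1).indicator Ψ (κ * y) := by
    rw [indicator_of_mem (hmem hy)]
    exact hle y hy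
  have hΦ : IntegrableOn Φ (Ioo (-1) 1) := by
    refine Integrable.mono' hi'.integrableOn hm ?_
    filter_upwards [ae_restrict_mem measurableSet_Ioo] with y hy using hle' y hy
  refine ⟨hΦ, ?_⟩
  have hnn (y : ℝ) : 0 ≤ (Ioo (-1 : ℝ) 1).indicator Ψ y := indicator_nonneg h0 y
  calc ∫ y in Ioo (-1) 1, Φ y ≤ ∫ y in Ioo (-1) 1, (Ioo (-1 : ℝ) 1).indicator Ψ (κ * y) :=
        setIntegral_mono_on hΦ hi'.integrableOn measurableSet_Ioo
          fun y hy => (le_abs_self _).trans (hle' y hy)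
    _ ≤ ∫ y, (Ioo (-1 : ℝ) 1).indicator Ψ (κ * y) :=
        setIntegral_le_integral hi' (ae_of_all _ fun y => hnn _)
    _ = κ⁻¹ * ∫ y in Ioo (-1) 1, Ψ y := by
        rw [Measure.integral_comp_mul_left, abs_of_pos (inv_pos.2 hκ), smul_eq_mul,
          integral_indicator measurableSet_Ioo]

lemma rho_anti {p : ℝ} (hp : 1 < p) {κ y : ℝ} (hκ : 0 < κ) (hκ1 : κ ≤ 1)
    (hy : y ∈ Ioo (-1 : ℝ) 1) : rho p y ≤ rho p (κ * y) := by
  have h := one_sub_sq_pos hy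
  refine Real.rpow_le_rpow h.le ?_ (al_pos hp).le
  have : κ ^ 2 ≤ 1 := pow_le_one₀ hκ.le hκ1
  nlinarith [sq_nonneg y]

section

variable {p : ℝ} {d : ℕ} {β f : ℝ → ℝ} {G : ℝ → ℝ → ℝ → ℝ → ℝ}
  {T : ℝ → ℝ} {U UX Ut : ℝ → ℝ → ℝ} {X₀ T₀ T₁ s s' σ σ' : ℝ}

/-- The hypothesis says that both similarity times stand for the same physical time. As the vertices
lie on the same axis, the variables `y` differ only by the dilation factor `e^(s-s')`. -/
lemma simMap_shift (h : T₁ - Real.exp (-s') = T₀ - Real.exp (-s)) (y : ℝ) :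
    simMap X₀ T₁ (y, s') = simMap X₀ T₀ (Real.exp (s - s') * y, s) := by
  have : Real.exp (s - s') * y * Real.exp (-s) = y * Real.exp (-s') := by
    rw [mul_right_comm, ← Real.exp_add, mul_comm]
    congr 2
    ring
  simp only [simMap, h, this]

lemma exp_al_shift : Real.exp (-al p * s') = Real.exp (al p * (s - s')) * Real.exp (-al p * s) := by
  rw [← Real.exp_add]; congr 1; ring

lemma exp_shift : Real.exp (-s') = Real.exp (s - s') * Real.exp (-s) := by
  rw [← Real.exp_add]; congr 1; ring

lemma simW_shift (h : T₁ - Real.exp (-s') = T₀ - Real.exp (-s)) (y : ℝ) :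
    simW p X₀ T₁ U s' y
      = Real.exp (al p * (s - s')) * simW p X₀ T₀ U s (Real.exp (s - s') * y) := by
  rw [simW_eq, simW_eq, simMap_shift h, exp_al_shift (s := s), mul_assoc]

lemma simWy_shift (hp : 1 < p) (h : T₁ - Real.exp (-s') = T₀ - Real.exp (-s)) (y : ℝ) :
    simWy p X₀ T₁ UX s' y = Real.exp (al p * (s - s')) * (Real.exp (s - s')
      * simWy p X₀ T₀ UX s (Real.exp (s - s') * y)) := by
  rw [simWy_eq hp, simWy_eq hp, simMap_shift h, exp_al_shift (s := s), exp_shift (s := s)]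
  ring

lemma simWs_shift (hp : 1 < p) (h : T₁ - Real.exp (-s') = T₀ - Real.exp (-s)) (y : ℝ) :
    simWs p X₀ T₁ U UX Ut s' y = Real.exp (al p * (s - s')) *
      (Real.exp (s - s') * simWs p X₀ T₀ U UX Ut s (Real.exp (s - s') * y)
        - (1 - Real.exp (s - s')) * (al p * simW p X₀ T₀ U s (Real.exp (s - s') * y)
          + Real.exp (s - s') * y * simWy p X₀ T₀ UX s (Real.exp (s - s') * y))) := by
  rw [simWs_eq hp, simWs_eq hp, simW_eq, simWy_eq hp, simMap_shift h, exp_al_shift (s := s),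
    exp_shift (s := s)]
  ring

lemma simV_shift (h : T₁ - Real.exp (-s') = T₀ - Real.exp (-s)) (y : ℝ) :
    simV p β f U X₀ T₁ s' y = Real.exp (al p * (s - s')) ^ 2 * Real.exp (s - s') ^ 2
      * simV p β f U X₀ T₀ s (Real.exp (s - s') * y) := by
  have h1 := congrArg Prod.fst (simMap_shift (X₀ := X₀) h y)
  simp only [simMap] at h1
  simp only [simV, h1, h]
  rw [exp_al_shift (s := s), exp_shift (s := s)]
  ring

/-- A weight comparison for the shifted time derivative. -/
lemma shift_sq_le {κ k a x A B D : ℝ} (hκ : 0 < κ) (hκ1 : κ ≤ 1) (hk : 0 ≤ k) (hk1 : k ≤ 1)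
    (hx : |x| ≤ κ) :
    (k * (κ * D - (1 - κ) * (a * A + x * B))) ^ 2
      ≤ 3 * (D ^ 2 + a ^ 2 * A ^ 2 + (1 - x ^ 2) * B ^ 2) := by
  have hx2 : x ^ 2 ≤ κ ^ 2 := sq_le_sq.2 (by rwa [abs_of_pos hκ])
  have hκ2 : κ ^ 2 ≤ 1 := pow_le_one₀ hκ.le hκ1
  have h1 : (κ * D - (1 - κ) * (a * A + x * B)) ^ 2
      ≤ 3 * ((κ * D) ^ 2 + ((1 - κ) * (a * A)) ^ 2 + ((1 - κ) * (x * B)) ^ 2) := by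
    nlinarith [sq_nonneg (κ * D + (1 - κ) * (a * A)), sq_nonneg (κ * D + (1 - κ) * (x * B)),
      sq_nonneg ((1 - κ) * (a * A) - (1 - κ) * (x * B))]
  have h2 : (κ * D) ^ 2 ≤ D ^ 2 := by
    rw [mul_pow]; exact mul_le_of_le_one_left (sq_nonneg _) hκ2
  have h3 : ((1 - κ) * (a * A)) ^ 2 ≤ a ^ 2 * A ^ 2 := by
    rw [mul_pow, mul_pow]
    refine mul_le_of_le_one_left (by positivity) (pow_le_one₀ (by linarith) (by linarith))
  -- `∂_s` depends on the vertex, so lowering it mixes an unweighted `∂_y w` into `∂_s w`. On `|x| ≤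
  -- κ` one has `(1-κ)² ≤ 1 - κ² ≤ 1 - x²`, which restores the weight.
  have h4 : ((1 - κ) * (x * B)) ^ 2 ≤ (1 - x ^ 2) * B ^ 2 := by
    have : ((1 - κ) * (x * B)) ^ 2 = ((1 - κ) ^ 2 * x ^ 2) * B ^ 2 := by ring
    rw [this]
    refine mul_le_mul_of_nonneg_right ?_ (sq_nonneg _)
    have h5 : (1 - κ) ^ 2 * x ^ 2 ≤ (1 - κ) ^ 2 * 1 :=
      mul_le_mul_of_nonneg_left (hx2.trans hκ2) (sq_nonneg _)
    nlinarith
  have h5 : k ^ 2 ≤ 1 := pow_le_one₀ hk hk1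
  rw [mul_pow]
  calc _ ≤ (κ * D - (1 - κ) * (a * A + x * B)) ^ 2 := mul_le_of_le_one_left (sq_nonneg _) h5
    _ ≤ _ := by linarith

/-- The energy stays finite when the vertex is lowered. -/
theorem FiniteEnergy.shift (hp : 1 < p) (hS : IsSolution p d β f G T U UX Ut)
    (hE : FiniteEnergy p σ (simW p X₀ T₀ U) (simWy p X₀ T₀ UX) (simWs p X₀ T₀ U UX Ut))
    (hv : IsVertex T X₀ T₁ σ') (hT : T₁ ≤ T₀)
    (hσ : T₀ - Real.exp (-σ) ≤ T₁ - Real.exp (-σ')) :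
    FiniteEnergy p σ' (simW p X₀ T₁ U) (simWy p X₀ T₁ UX) (simWs p X₀ T₁ U UX Ut) := by
  -- `τ s'` is the similarity time for the upper vertex at the physical time that `s'` has for the
  -- lower one.
  set τ : ℝ → ℝ := fun s' => -Real.log (T₀ - T₁ + Real.exp (-s')) with hτ
  have hpos (s' : ℝ) : 0 < T₀ - T₁ + Real.exp (-s') := by
    have := Real.exp_pos (-s'); linarith
  have hexp (s' : ℝ) : Real.exp (-τ s') = T₀ - T₁ + Real.exp (-s') := by
    simp only [hτ, neg_neg, Real.exp_log (hpos s')]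
  have hrel (s' : ℝ) : T₁ - Real.exp (-s') = T₀ - Real.exp (-τ s') := by rw [hexp]; ring
  have hτσ (s' : ℝ) (hs' : σ' ≤ s') : σ ≤ τ s' := by
    have : Real.exp (-s') ≤ Real.exp (-σ') := Real.exp_le_exp.2 (neg_le_neg hs')
    have h2 : Real.exp (-τ s') ≤ Real.exp (-σ) := by rw [hexp]; linarith
    linarith [Real.exp_le_exp.1 h2]
  have hτs (s' : ℝ) : τ s' ≤ s' := by
    have h2 : Real.exp (-s') ≤ Real.exp (-τ s') := by rw [hexp]; linarith
    linarith [Real.exp_le_exp.1 h2]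
  have ha := al_pos hp
  have key (s' : ℝ) (hs' : σ' ≤ s') :
      (IntegrableOn (fun y => simW p X₀ T₁ U s' y ^ 2 * rho p y) (Ioo (-1) 1) ∧
        (∫ y in Ioo (-1) 1, simW p X₀ T₁ U s' y ^ 2 * rho p y) ≤ (Real.exp (τ s' - s'))⁻¹ *
          ∫ y in Ioo (-1) 1, simW p X₀ T₀ U (τ s') y ^ 2 * rho p y) ∧
      (IntegrableOn (fun y => (1 - y ^ 2) * simWy p X₀ T₁ UX s' y ^ 2 * rho p y) (Ioo (-1) 1) ∧
        (∫ y in Ioo (-1) 1, (1 - y ^ 2) * simWy p X₀ T₁ UX s' y ^ 2 * rho p y)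
          ≤ (Real.exp (τ s' - s'))⁻¹ *
          ∫ y in Ioo (-1) 1, (1 - y ^ 2) * simWy p X₀ T₀ UX (τ s') y ^ 2 * rho p y) ∧
      (IntegrableOn (fun y => simWs p X₀ T₁ U UX Ut s' y ^ 2 * rho p y) (Ioo (-1) 1) ∧
        (∫ y in Ioo (-1) 1, simWs p X₀ T₁ U UX Ut s' y ^ 2 * rho p y)
          ≤ (Real.exp (τ s' - s'))⁻¹ * ∫ y in Ioo (-1) 1,
            3 * (simWs p X₀ T₀ U UX Ut (τ s') y ^ 2 * rho p y
              + al p ^ 2 * (simW p X₀ T₀ U (τ s') y ^ 2 * rho p y)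
              + (1 - y ^ 2) * simWy p X₀ T₀ UX (τ s') y ^ 2 * rho p y)) := by
    have hs := hτσ s' hs'
    have hr := hrel s'
    set κ := Real.exp (τ s' - s') with hκdef
    have hκ : 0 < κ := Real.exp_pos _
    have hκ1 : κ ≤ 1 := Real.exp_le_one_iff.2 (by linarith [hτs s'])
    have hk : 0 < Real.exp (al p * (τ s' - s')) := Real.exp_pos _
    have hk1 : Real.exp (al p * (τ s' - s')) ≤ 1 :=
      Real.exp_le_one_iff.2 (by nlinarith [hτs s'])
    have hmem {y : ℝ} (hy : y ∈ Ioo (-1 : ℝ) 1) : κ * y ∈ Ioo (-1 : ℝ) 1 := by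
      constructor <;> nlinarith [hy.1, hy.2]
    obtain ⟨m2, m3⟩ := hS.slice_simWs hv hs'
    have m1 : AEStronglyMeasurable (simW p X₀ T₁ U s') (volume.restrict (Ioo (-1) 1)) :=
      ((hS.continuousOn_simW hv).comp (by fun_prop : Continuous fun y : ℝ => (y, s')).continuousOn
        fun y hy => ⟨hy, hs'⟩).aestronglyMeasurable measurableSet_Ioo
    have mr : AEStronglyMeasurable (rho p) (volume.restrict (Ioo (-1) 1)) :=
      (continuous_rho hp).aestronglyMeasurable
    have hwt {y : ℝ} : 1 - y ^ 2 ≤ 1 - (κ * y) ^ 2 := by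
      have : κ ^ 2 ≤ 1 := pow_le_one₀ hκ.le hκ1
      nlinarith [sq_nonneg y]
    refine ⟨integrableOn_of_le_comp_mul hκ ((m1.pow 2).mul mr) (hE.int_w _ hs) ?_ hκ1 ?_,
      integrableOn_of_le_comp_mul hκ ?_ (hE.int_wy _ hs) ?_ hκ1 ?_,
      integrableOn_of_le_comp_mul hκ ((m3.pow 2).mul mr) ((((hE.int_ws _ hs).add
        ((hE.int_w _ hs).const_mul (al p ^ 2))).add (hE.int_wy _ hs)).const_mul 3) ?_ hκ1 ?_⟩
    · intro y hy
      have := rho_pos (p := p) hy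
      positivity
    · intro y hy
      have h1 := rho_pos (p := p) hy
      rw [abs_of_nonneg (by positivity), simW_shift hr, mul_pow]
      exact mul_le_mul (mul_le_of_le_one_left (sq_nonneg _) (pow_le_one₀ hk.le hk1))
        (rho_anti hp hκ hκ1 hy) h1.le (sq_nonneg _)
    · exact ((by fun_prop : Continuous fun y : ℝ => 1 - y ^ 2).aestronglyMeasurable.mul
        (m2.pow 2)).mul mr
    · intro y hy
      have := rho_pos (p := p) hy
      have := one_sub_sq_pos hy
      positivity
    · intro y hy
      have h1 := rho_pos (p := p) hy
      have h2 := one_sub_sq_pos hy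
      have h3 := one_sub_sq_pos (hmem hy)
      rw [abs_of_nonneg (by positivity), simWy_shift hp hr]
      refine mul_le_mul (mul_le_mul hwt ?_ (sq_nonneg _) h3.le) (rho_anti hp hκ hκ1 hy) h1.le
        (by positivity)
      rw [← mul_assoc, mul_pow]
      exact mul_le_of_le_one_left (sq_nonneg _) (pow_le_one₀ (by positivity)
        (mul_le_one₀ hk1 hκ.le hκ1))
    · intro y hy
      have := rho_pos (p := p) hy
      have := one_sub_sq_pos hy
      positivity
    · intro y hy
      have h1 := rho_pos (p := p) hy
      have h3 := one_sub_sq_pos (hmem hy)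
      have hxκ : |κ * y| ≤ κ := by
        rw [abs_mul, abs_of_pos hκ]
        exact mul_le_of_le_one_right hκ.le (abs_lt.2 hy).le
      rw [abs_of_nonneg (by positivity), simWs_shift hp hr]
      have h4 := shift_sq_le (a := al p) (A := simW p X₀ T₀ U (τ s') (κ * y))
        (B := simWy p X₀ T₀ UX (τ s') (κ * y)) (D := simWs p X₀ T₀ U UX Ut (τ s') (κ * y))
        hκ hκ1 hk.le hk1 hxκ
      refine (mul_le_mul h4 (rho_anti hp hκ hκ1 hy) h1.le (by positivity)).trans (le_of_eq ?_)
      ring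
  refine hS.finiteEnergy hp hv (fun s' hs' => ?_) fun S => ?_
  · obtain ⟨k1, k2, k3⟩ := key s' hs'
    exact ⟨k1.1, k2.1, k3.1⟩
  · obtain ⟨C, hC⟩ := hE.bound S
    set K := |C| * (3 * (2 + al p ^ 2)) with hK
    have hKC : C ≤ K := by
      have : 0 ≤ |C| * (5 + 3 * al p ^ 2) := by positivity
      linarith [le_abs_self C]
    have hK0 : 0 ≤ K := by positivity
    refine ⟨Real.exp (S - σ) * K, fun s' hs' => ?_⟩
    obtain ⟨k1, k2, k3⟩ := key s' hs'.1
    have hs := hτσ s' hs'.1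
    obtain ⟨c1, c2, c3⟩ := hC (τ s') ⟨hs, (hτs s').trans hs'.2⟩
    have hinv : (Real.exp (τ s' - s'))⁻¹ ≤ Real.exp (S - σ) := by
      rw [← Real.exp_neg, Real.exp_le_exp]; linarith [hs'.2]
    have hfin {I J : ℝ} (hI : I ≤ (Real.exp (τ s' - s'))⁻¹ * J) (hJ : J ≤ K) :
        I ≤ Real.exp (S - σ) * K :=
      hI.trans ((mul_le_mul_of_nonneg_left hJ (by positivity)).trans
        (mul_le_mul_of_nonneg_right hinv hK0))
    refine ⟨hfin k1.2 (c1.trans hKC), hfin k2.2 (c2.trans hKC), hfin k3.2 ?_⟩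
    have hi : IntegrableOn (fun y => simWs p X₀ T₀ U UX Ut (τ s') y ^ 2 * rho p y
        + al p ^ 2 * (simW p X₀ T₀ U (τ s') y ^ 2 * rho p y)) (Ioo (-1) 1) :=
      (hE.int_ws _ hs).add ((hE.int_w _ hs).const_mul (al p ^ 2))
    rw [integral_const_mul, integral_add hi (hE.int_wy _ hs), integral_add (hE.int_ws _ hs)
      ((hE.int_w _ hs).const_mul (al p ^ 2)), integral_const_mul]
    have h1 : al p ^ 2 * (∫ y in Ioo (-1) 1, simW p X₀ T₀ U (τ s') y ^ 2 * rho p y)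
        ≤ al p ^ 2 * C := mul_le_mul_of_nonneg_left c1 (sq_nonneg _)
    have h2 : C * (3 * (2 + al p ^ 2)) ≤ K :=
      mul_le_mul_of_nonneg_right (le_abs_self C) (by positivity)
    linarith

end

/-! ## The energy of a solution and its sign -/

/-- The functional `E` in similarity variables with vertex `(X₀, T₀)`. -/
def energyAt (p γ : ℝ) (β f : ℝ → ℝ) (U UX Ut : ℝ → ℝ → ℝ) (X₀ T₀ s : ℝ) : ℝ :=
  ∫ y in Ioo (-1) 1, energyDensity p γ (simW p X₀ T₀ U) (simWy p X₀ T₀ UX)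
    (simWs p X₀ T₀ U UX Ut) (simV p β f U X₀ T₀) s y * rho p y

/-- The dissipation in similarity variables with vertex `(X₀, T₀)`. -/
def dissipAt (p : ℝ) (U UX Ut : ℝ → ℝ → ℝ) (X₀ T₀ s : ℝ) : ℝ :=
  ∫ y in Ioo (-1) 1, simWs p X₀ T₀ U UX Ut s y ^ 2 * (rho p y / (1 - y ^ 2))

lemma dissipAt_nonneg (p : ℝ) (U UX Ut : ℝ → ℝ → ℝ) (X₀ T₀ s : ℝ) :
    0 ≤ dissipAt p U UX Ut X₀ T₀ s :=
  setIntegral_nonneg measurableSet_Ioo fun _ hy =>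
    mul_nonneg (sq_nonneg _) (div_nonneg (rho_pos hy).le (one_sub_sq_pos hy).le)

/-- The functional `H` in similarity variables with vertex `(X₀, T₀)`. -/
def lyapunovAt (p γ μ : ℝ) (β f : ℝ → ℝ) (U UX Ut : ℝ → ℝ → ℝ) (X₀ T₀ s : ℝ) : ℝ :=
  energyAt p γ β f U UX Ut X₀ T₀ s * Real.exp ((p + 3) / (2 * γ) * Real.exp (-γ * s))
    + μ * Real.exp (-2 * γ * s)

/-- Conditions under which the perturbations are small for `s ≥ σ`. -/
structure IsLate (p q M B δ : ℝ) (d : ℕ) (β : ℝ → ℝ) (X₀ σ : ℝ) : Prop where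
  nonneg : 0 ≤ σ
  log_le : -4 * Real.log X₀ ≤ σ
  exp_gam_le : Real.exp (-gam p q * σ) ≤ δ ^ 2
  exp_mul_le : Real.exp (-σ / 4) * perturbSize p M B d ≤ δ
  bound_nonneg : 0 ≤ B
  deriv_le : ∀ X, |X - X₀| ≤ min 1 (X₀ / 2) → |deriv β X| ≤ B

lemma IsLate.mono {p q M B δ : ℝ} {d : ℕ} {β : ℝ → ℝ} {X₀ σ σ' : ℝ}
    (h : IsLate p q M B δ d β X₀ σ) (hp : 1 < p) (hqp : q < p) (hM : 0 ≤ M) (hσ : σ ≤ σ') :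
    IsLate p q M B δ d β X₀ σ' where
  nonneg := h.nonneg.trans hσ
  log_le := h.log_le.trans hσ
  exp_gam_le := (Real.exp_le_exp.2 (by nlinarith [gam_pos hp hqp])).trans h.exp_gam_le
  exp_mul_le := by
    refine le_trans (mul_le_mul_of_nonneg_right (Real.exp_le_exp.2 (by linarith)) ?_) h.exp_mul_le
    have := al_pos hp
    have := h.bound_nonneg
    unfold perturbSize
    positivity
  bound_nonneg := h.bound_nonneg
  deriv_le := h.deriv_le

/-- The size of the error terms. -/
def errSize (p M : ℝ) : ℝ := lamErr p M (3 * M * (3 * al p + 2))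

section

variable {p q M B δ b₀ : ℝ} {d : ℕ} {β f : ℝ → ℝ} {G : ℝ → ℝ → ℝ → ℝ → ℝ}
  {T : ℝ → ℝ} {U UX Ut : ℝ → ℝ → ℝ} {X₀ T₀ σ : ℝ}

lemma errSize_pos (hp : 1 < p) (hM : 0 ≤ M) : 0 < errSize p M :=
  lamErr_pos hp hM (by have := al_pos hp; positivity)

/-- The differential inequalities for the energy of a solution. -/
theorem IsSolution.exists_rate (hp : 1 < p) (hq : 0 ≤ q) (hqp : q < p) (hM : 0 ≤ M)
    (hc : AdmissibleCoeffs q M β f G) (hS : IsSolution p d β f G T U UX Ut)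
    (hv : IsVertex T X₀ T₀ σ) (hl : IsLate p q M B δ d β X₀ σ)
    (hE : FiniteEnergy p σ (simW p X₀ T₀ U) (simWy p X₀ T₀ UX) (simWs p X₀ T₀ U UX Ut))
    (hb : b₀ ≤ β X₀) (hδ : 0 < δ) (hδ1 : δ ≤ 1)
    (hδκ : errSize p M * δ * hardyConst p ≤ kap p b₀) :
    ∃ Q : ℝ → ℝ, IsIntegralOf σ (energyAt p (gam p q) β f U UX Ut X₀ T₀) Q ∧
      ∀ᵐ s, σ < s →
        IntegrableOn (fun y => simWs p X₀ T₀ U UX Ut s y ^ 2 * (rho p y / (1 - y ^ 2)))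
          (Ioo (-1) 1) ∧
        Q s ≤ (p + 3) / 2 * Real.exp (-gam p q * s)
            * (∫ y in Ioo (-1) 1, (1 / 2 * simWs p X₀ T₀ U UX Ut s y ^ 2
              + 1 / 2 * simWy p X₀ T₀ UX s y ^ 2 * (1 - y ^ 2)
              + al p * (al p + 1) / 2 * simW p X₀ T₀ U s y ^ 2
              - β X₀ / (p + 1) * |simW p X₀ T₀ U s y| ^ (p + 1)) * rho p y)
          - 3 * al p / 2 * dissipAt p U UX Ut X₀ T₀ s
          + 2 * errSize p M * Real.exp (-gam p q * s) ^ 2 ∧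
        Q s ≤ (p + 3) / 2 * Real.exp (-gam p q * s) * energyAt p (gam p q) β f U UX Ut X₀ T₀ s
          - 3 * al p / 2 * dissipAt p U UX Ut X₀ T₀ s
          + 2 * errSize p M * Real.exp (-gam p q * s) ^ 2 := by
  have hev := hS.evolution hp hq hqp hM hc hv hl.nonneg hE
  have hsm := isSmall_sim (d := d) (U := U) (UX := UX) (Ut := Ut) hp hq hqp hM hc hv
    hl.bound_nonneg hl.deriv_le hl.nonneg le_rfl hl.log_le hl.exp_gam_le hl.exp_mul_le
  obtain ⟨Q, h1, h2, h3⟩ := hev.exists_rate hp (gam_pos hp hqp) (gam_le_half p q) hM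
    (by have := al_pos hp; positivity) hb hδ hδ1 hδκ hsm
  exact ⟨Q, ⟨h1, h2⟩, h3⟩

/-- The Lyapunov functional of a solution. -/
theorem IsSolution.lyapunov (hp : 1 < p) (hq : 0 ≤ q) (hqp : q < p) (hM : 0 ≤ M)
    (hc : AdmissibleCoeffs q M β f G) (hS : IsSolution p d β f G T U UX Ut)
    (hv : IsVertex T X₀ T₀ σ) (hl : IsLate p q M B δ d β X₀ σ)
    (hE : FiniteEnergy p σ (simW p X₀ T₀ U) (simWy p X₀ T₀ UX) (simWs p X₀ T₀ U UX Ut))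
    (hb : b₀ ≤ β X₀) (hδ : 0 < δ) (hδ1 : δ ≤ 1)
    (hδκ : errSize p M * δ * hardyConst p ≤ kap p b₀) {μ : ℝ}
    (hμ : Real.exp ((p + 3) / (2 * gam p q)) * errSize p M / gam p q ≤ μ) :
    (∀ s, σ ≤ s → AbsolutelyContinuousOnInterval
      (lyapunovAt p (gam p q) μ β f U UX Ut X₀ T₀) σ s) ∧
    AntitoneOn (lyapunovAt p (gam p q) μ β f U UX Ut X₀ T₀) (Ici σ) ∧
    ∀ᵐ s, σ < s → ∃ H', HasDerivAt (lyapunovAt p (gam p q) μ β f U UX Ut X₀ T₀) H' s ∧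
      H' ≤ -(3 * al p / 2) * dissipAt p U UX Ut X₀ T₀ s := by
  obtain ⟨Q, hQ, hr⟩ := hS.exists_rate hp hq hqp hM hc hv hl hE hb hδ hδ1 hδκ
  have hγ := gam_pos hp hqp
  have hγ' := hγ.ne'
  have herr := errSize_pos hp hM
  refine hQ.lyapunov (A := (p + 3) / 2) (c := 2 * errSize p M) hl.nonneg hγ ?_ ?_ ?_ (by positivity)
    ?_ (fun s => dissipAt_nonneg p U UX Ut X₀ T₀ s) ?_
  · field_simp
  · have : 0 < p + 3 := by linarith
    positivity
  · have := al_pos hp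
    positivity
  · rw [div_le_iff₀ hγ] at hμ
    linarith
  · filter_upwards [hr] with s hs h using (hs h).2.2

/-- Below the graph the solution stays bounded up to the vertex. -/
lemma IsSolution.exists_bound_of_lt (hS : IsSolution p d β f G T U UX Ut) (hp : 1 < p)
    (hc : AdmissibleCoeffs q M β f G) (hv : IsVertex T X₀ T₀ σ) (hT : T₀ < T X₀) :
    ∃ K, 0 ≤ K ∧ ∀ s, σ ≤ s → ∀ y ∈ Ioo (-1 : ℝ) 1,
      |U (X₀ + y * Real.exp (-s)) (T₀ - Real.exp (-s))| ≤ K ∧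
      |potential p β f (X₀ + y * Real.exp (-s))
        (U (X₀ + y * Real.exp (-s)) (T₀ - Real.exp (-s)))| ≤ K := by
  -- `A` parametrizes the closed cone, vertex included. Because `T₀ < T X₀`, its image lies under
  -- the graph, where `U` is continuous, so compactness gives the bound.
  set A : Set (ℝ × ℝ) := Icc (-1 : ℝ) 1 ×ˢ Icc 0 (Real.exp (-σ))
  have hA : IsCompact A := isCompact_Icc.prod isCompact_Icc
  have hv' : IsVertex T X₀ (T X₀) σ := ⟨hv.T_pos, hv.lip, hv.X_pos, le_rfl,
    hv.exp_le_T₀.trans hv.T₀_le, hv.exp_le_X₀⟩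
  have hm : MapsTo (fun x : ℝ × ℝ => (X₀ + x.1 * x.2, T₀ - x.2)) A (underGraph T) := by
    rintro ⟨y, r⟩ ⟨⟨hy1, hy2⟩, hr0, hr1⟩
    simp only at hy1 hy2 hr0 hr1
    have h1 := hv.exp_le_X₀
    have h2 := hv.X_pos
    have h3 := hv.exp_le_T₀
    have h4 : 0 < X₀ + y * r := by nlinarith
    refine ⟨h4, by simp only; linarith, hv'.lt_T h4 ?_⟩
    rw [add_sub_cancel_left, abs_mul, abs_of_nonneg hr0]
    have : |y| * r ≤ 1 * r := mul_le_mul_of_nonneg_right (abs_le.2 ⟨hy1, hy2⟩) hr0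
    linarith
  have hU : ContinuousOn (fun x : ℝ × ℝ => U (X₀ + x.1 * x.2) (T₀ - x.2)) A :=
    hS.continuousOn.comp (f := fun x : ℝ × ℝ => (X₀ + x.1 * x.2, T₀ - x.2))
      (by fun_prop : Continuous fun x : ℝ × ℝ => (X₀ + x.1 * x.2, T₀ - x.2)).continuousOn hm
  have hβ : ContinuousOn (fun x : ℝ × ℝ => β (X₀ + x.1 * x.2)) A :=
    hc.beta_contDiffOn.continuousOn.comp
      (by fun_prop : Continuous fun x : ℝ × ℝ => X₀ + x.1 * x.2).continuousOn
      fun x hx => (hm hx).1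
  have hP : ContinuousOn (fun x : ℝ × ℝ =>
      potential p β f (X₀ + x.1 * x.2) (U (X₀ + x.1 * x.2) (T₀ - x.2))) A :=
    (hβ.mul ((hU.abs.rpow_const fun x _ => Or.inr (by linarith)).div_const _)).add
      ((contDiff_primF hc.f_contDiff.continuous).continuous.comp_continuousOn hU)
  obtain ⟨K₁, h1⟩ := hA.exists_bound_of_continuousOn hU
  obtain ⟨K₂, h2⟩ := hA.exists_bound_of_continuousOn hP
  refine ⟨max (max K₁ K₂) 0, le_max_right _ _, fun s hs y hy => ?_⟩
  have hx : (y, Real.exp (-s)) ∈ A :=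
    ⟨Ioo_subset_Icc_self hy, (Real.exp_pos _).le, Real.exp_le_exp.2 (neg_le_neg hs)⟩
  exact ⟨(h1 _ hx).trans ((le_max_left _ _).trans (le_max_left _ _)),
    (h2 _ hx).trans ((le_max_right _ _).trans (le_max_left _ _))⟩

/-- Below the graph the Lyapunov functional is nonnegative. -/
theorem IsSolution.lyapunov_nonneg_of_lt (hp : 1 < p) (hq : 0 ≤ q) (hqp : q < p) (hM : 0 ≤ M)
    (hc : AdmissibleCoeffs q M β f G) (hS : IsSolution p d β f G T U UX Ut)
    (hv : IsVertex T X₀ T₀ σ) (hT : T₀ < T X₀) (hl : IsLate p q M B δ d β X₀ σ)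
    (hE : FiniteEnergy p σ (simW p X₀ T₀ U) (simWy p X₀ T₀ UX) (simWs p X₀ T₀ U UX Ut))
    (hb : b₀ ≤ β X₀) (hδ : 0 < δ) (hδ1 : δ ≤ 1)
    (hδκ : errSize p M * δ * hardyConst p ≤ kap p b₀) {μ : ℝ}
    (hμ : Real.exp ((p + 3) / (2 * gam p q)) * errSize p M / gam p q ≤ μ) :
    0 ≤ lyapunovAt p (gam p q) μ β f U UX Ut X₀ T₀ σ := by
  obtain ⟨-, hanti, -⟩ := hS.lyapunov hp hq hqp hM hc hv hl hE hb hδ hδ1 hδκ hμ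
  obtain ⟨K, hK0, hK⟩ := hS.exists_bound_of_lt hp hc hv hT
  have hev := hS.evolution hp hq hqp hM hc hv hl.nonneg hE
  have hγ := gam_pos hp hqp
  have ha := al_pos hp
  set θ := (p + 3) / (2 * gam p q) with hθ
  have hθ0 : 0 ≤ θ := by
    have : 0 < p + 3 := by linarith
    positivity
  have hμ0 : 0 ≤ μ := le_trans (by have := errSize_pos hp hM; positivity) hμ
  set R := ∫ y in Ioo (-1) 1, rho p y with hR
  have hR0 : 0 ≤ R := setIntegral_nonneg measurableSet_Ioo fun y hy => (rho_pos hy).le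
  -- Only the potential and `w ∂_s w` can make the energy density negative. The potential is at most
  -- `K e^(-2s)` in absolute value; the product is absorbed by `(∂_s w)²/2` up to `w²`, which is at
  -- most `K² e^(-2 al p s)`. Nothing about the derivatives of `U` is needed.
  set η : ℝ → ℝ := fun s => K * Real.exp (-s) ^ 2 + K ^ 2 * Real.exp (-al p * s) ^ 2 with hη
  have hη0 (s : ℝ) : 0 ≤ η s := by positivity
  have hlow (s : ℝ) (hs : σ ≤ s) : -(η s * R) ≤ energyAt p (gam p q) β f U UX Ut X₀ T₀ s := by
    rw [hR, ← integral_const_mul, ← integral_neg]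
    refine setIntegral_mono_on ((integrableOn_rho hp).const_mul _).neg
      (hev.integrableOn_energyDensity hp hs) measurableSet_Ioo fun y hy => ?_
    have hr := rho_pos (p := p) hy
    have hy2 := one_sub_sq_pos hy
    obtain ⟨k1, k2⟩ := hK s hs y hy
    rw [← neg_mul]
    refine mul_le_mul_of_nonneg_right ?_ hr.le
    have hs0 : 0 ≤ s := hl.nonneg.trans hs
    have hv1 : |simV p β f U X₀ T₀ s y| ≤ K * Real.exp (-s) ^ 2 := by
      rw [simV, abs_mul, abs_of_pos (by positivity), mul_comm K]
      have h1 : Real.exp (-al p * s) ^ 2 ≤ 1 :=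
        pow_le_one₀ (Real.exp_pos _).le (exp_al_le_one hp hs0)
      exact mul_le_mul (mul_le_of_le_one_left (by positivity) h1) k2 (abs_nonneg _) (by positivity)
    have hw1 : simW p X₀ T₀ U s y ^ 2 ≤ K ^ 2 * Real.exp (-al p * s) ^ 2 := by
      rw [simW_eq, mul_pow, mul_comm (K ^ 2)]
      refine mul_le_mul_of_nonneg_left ?_ (sq_nonneg _)
      exact sq_le_sq.2 (by rw [abs_of_nonneg hK0]; exact k1)
    have hg : Real.exp (-gam p q * s) ≤ 1 := Real.exp_le_one_iff.2 (by nlinarith)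
    have hg0 := Real.exp_pos (-gam p q * s)
    simp only [energyDensity, hη]
    set w := simW p X₀ T₀ U s y
    set ws := simWs p X₀ T₀ U UX Ut s y
    set g := Real.exp (-gam p q * s)
    have h2 : g * (w * ws) ≤ 1 / 2 * ws ^ 2 + 1 / 2 * w ^ 2 := by
      have h3 : (g * w) ^ 2 ≤ w ^ 2 := by
        rw [mul_pow]
        exact mul_le_of_le_one_left (sq_nonneg _) (pow_le_one₀ hg0.le hg)
      nlinarith [sq_nonneg (g * w - ws)]
    have h4 : 0 ≤ 1 / 2 * simWy p X₀ T₀ UX s y ^ 2 * (1 - y ^ 2) := by positivity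
    have h5 : 0 ≤ al p * (al p + 1) / 2 * w ^ 2 := by positivity
    have h6 := le_abs_self (simV p β f U X₀ T₀ s y)
    nlinarith [sq_nonneg w]
  -- Monotonicity bounds the value at `σ` from below by the values at later times, whose lower
  -- bounds tend to zero.
  have hlowH (s : ℝ) (hs : σ ≤ s) :
      -(η s * R * Real.exp θ) ≤ lyapunovAt p (gam p q) μ β f U UX Ut X₀ T₀ σ := by
    refine le_trans ?_ (hanti self_mem_Ici hs hs)
    rw [lyapunovAt, ← hθ]
    have h1 : Real.exp (θ * Real.exp (-gam p q * s)) ≤ Real.exp θ := by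
      refine Real.exp_le_exp.2 (mul_le_of_le_one_right hθ0 (Real.exp_le_one_iff.2 ?_))
      have := hl.nonneg.trans hs
      nlinarith
    have h2 := mul_le_mul_of_nonneg_right (hlow s hs)
      (Real.exp_pos (θ * Real.exp (-gam p q * s))).le
    have h3 := mul_le_mul_of_nonneg_left h1 (mul_nonneg (hη0 s) hR0)
    have h4 : 0 ≤ μ * Real.exp (-2 * gam p q * s) := by positivity
    linarith
  have hexp {c : ℝ} (hc : 0 < c) : Tendsto (fun s : ℝ => Real.exp (-c * s)) atTop (𝓝 0) := by
    refine Real.tendsto_exp_atBot.comp ?_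
    exact tendsto_id.const_mul_atTop_of_neg (by linarith)
  have hlim : Tendsto (fun s => -(η s * R * Real.exp θ)) atTop (𝓝 0) := by
    have h1 := ((hexp one_pos).pow 2).const_mul K
    have h2 := ((hexp ha).pow 2).const_mul (K ^ 2)
    have h3 := (((h1.add h2).mul_const R).mul_const (Real.exp θ)).neg
    simpa [hη] using h3
  refine le_of_tendsto hlim ?_
  filter_upwards [eventually_ge_atTop σ] with s hs using hlowH s hs

end

/-! ## Raising the vertex back -/

/-- The energy density for a lowered vertex, in the variable of the original vertex. -/
def shiftDensity (p γ s : ℝ) (w wy ws v : ℝ → ℝ) (l x : ℝ) : ℝ :=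
  (1 / 2 * (Real.exp (al p * l) * (Real.exp l * ws x
      - (1 - Real.exp l) * (al p * w x + x * wy x))) ^ 2
    + 1 / 2 * (Real.exp (al p * l) * (Real.exp l * wy x)) ^ 2 * (1 - (x * Real.exp (-l)) ^ 2)
    + al p * (al p + 1) / 2 * (Real.exp (al p * l) * w x) ^ 2
    - Real.exp (al p * l) ^ 2 * Real.exp l ^ 2 * v x
    - Real.exp (-γ * (s - l)) * ((Real.exp (al p * l) * w x)
      * (Real.exp (al p * l) * (Real.exp l * ws x - (1 - Real.exp l) * (al p * w x + x * wy x)))))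
    * rho p (x * Real.exp (-l))

lemma shiftDensity_zero (p γ s : ℝ) (w wy ws v : ℝ → ℝ) (x : ℝ) :
    shiftDensity p γ s w wy ws v 0 x = (1 / 2 * ws x ^ 2 + 1 / 2 * wy x ^ 2 * (1 - x ^ 2)
      + al p * (al p + 1) / 2 * w x ^ 2 - v x - Real.exp (-γ * s) * (w x * ws x)) * rho p x := by
  simp [shiftDensity]

lemma continuous_shiftDensity {p : ℝ} (hp : 1 < p) (γ s : ℝ) (w wy ws v : ℝ → ℝ) (x : ℝ) :
    Continuous fun l => shiftDensity p γ s w wy ws v l x := by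
  have := continuous_rho hp
  unfold shiftDensity
  fun_prop

/-- A bound independent of the lowering parameter `l`, integrable for a finite-energy trajectory:
the dominating function for the limit `l → 0`. -/
lemma abs_shiftDensity_le {p γ s : ℝ} (hp : 1 < p) (hγ : 0 ≤ γ) (hs : 0 ≤ s) {w wy ws v : ℝ → ℝ}
    {l x : ℝ} (hl : l ≤ 0) (hx : x ∈ Ioo (-Real.exp l) (Real.exp l)) :
    |shiftDensity p γ s w wy ws v l x| ≤ (4 * (ws x ^ 2 + (1 - x ^ 2) * wy x ^ 2)
      + (al p * (al p + 1) / 2 + 3 * al p ^ 2 + 1) * w x ^ 2 + |v x|) * rho p x := by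
  have ha := al_pos hp
  have hxκ : |x| < Real.exp l := abs_lt.2 hx
  have hκ1 : Real.exp l ≤ 1 := Real.exp_le_one_iff.2 hl
  have hk1 : Real.exp (al p * l) ≤ 1 := Real.exp_le_one_iff.2 (by nlinarith)
  have hg1 : Real.exp (-γ * (s - l)) ≤ 1 := Real.exp_le_one_iff.2 (by nlinarith)
  have hinv : Real.exp l * Real.exp (-l) = 1 := by rw [← Real.exp_add]; simp
  have hy : x * Real.exp (-l) ∈ Ioo (-1 : ℝ) 1 := by
    have := Real.exp_pos (-l)
    constructor
    · nlinarith [hx.1]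
    · nlinarith [hx.2]
  have hr := rho_pos (p := p) hy
  have hm := one_sub_sq_pos hy
  have hxy : Real.exp l * (x * Real.exp (-l)) = x := by linear_combination x * hinv
  have hrle : rho p (x * Real.exp (-l)) ≤ rho p x := by
    have := rho_anti hp (Real.exp_pos l) hκ1 hy
    rwa [hxy] at this
  have hmle : 1 - (x * Real.exp (-l)) ^ 2 ≤ 1 - x ^ 2 := by
    have h1 : 1 ≤ Real.exp (-l) := Real.one_le_exp (by linarith)
    have h2 : 1 ≤ Real.exp (-l) ^ 2 := one_le_pow₀ h1
    nlinarith [sq_nonneg x]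
  have hD := shift_sq_le (a := al p) (A := w x) (B := wy x) (D := ws x) (Real.exp_pos l) hκ1
    (Real.exp_pos (al p * l)).le hk1 hxκ.le
  rw [shiftDensity, abs_mul, abs_of_pos hr]
  set D := Real.exp (al p * l) * (Real.exp l * ws x - (1 - Real.exp l) * (al p * w x + x * wy x))
  set k := Real.exp (al p * l)
  set κ := Real.exp l
  set m := 1 - (x * Real.exp (-l)) ^ 2
  set g := Real.exp (-γ * (s - l))
  have hk0 : 0 < k := Real.exp_pos _
  have hκ0 : 0 < κ := Real.exp_pos _
  have hg0 : 0 < g := Real.exp_pos _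
  have hA : (k * w x) ^ 2 ≤ w x ^ 2 := by
    rw [mul_pow]; exact mul_le_of_le_one_left (sq_nonneg _) (pow_le_one₀ hk0.le hk1)
  have hB : (k * (κ * wy x)) ^ 2 * m ≤ (1 - x ^ 2) * wy x ^ 2 := by
    rw [mul_comm (1 - x ^ 2)]
    refine mul_le_mul ?_ hmle hm.le (sq_nonneg _)
    rw [← mul_assoc, mul_pow]
    exact mul_le_of_le_one_left (sq_nonneg _) (pow_le_one₀ (by positivity)
      (mul_le_one₀ hk1 hκ0.le hκ1))
  have hV : |k ^ 2 * κ ^ 2 * v x| ≤ |v x| := by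
    rw [abs_mul, abs_of_pos (by positivity)]
    exact mul_le_of_le_one_left (abs_nonneg _) (mul_le_one₀ (pow_le_one₀ hk0.le hk1)
      (by positivity) (pow_le_one₀ hκ0.le hκ1))
  have hK : |g * ((k * w x) * D)| ≤ 1 / 2 * (k * w x) ^ 2 + 1 / 2 * D ^ 2 := by
    rw [abs_mul, abs_of_pos hg0]
    have h1 : |k * w x * D| ≤ 1 / 2 * (k * w x) ^ 2 + 1 / 2 * D ^ 2 := by
      rw [abs_le]
      constructor <;> nlinarith [sq_nonneg (k * w x - D), sq_nonneg (k * w x + D)]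
    exact (mul_le_of_le_one_left (abs_nonneg _) hg1).trans h1
  have hc : 0 ≤ al p * (al p + 1) / 2 := by positivity
  have hcA := mul_le_mul_of_nonneg_left hA hc
  have hB0 : 0 ≤ (k * (κ * wy x)) ^ 2 * m := by positivity
  have hA0 : 0 ≤ al p * (al p + 1) / 2 * (k * w x) ^ 2 := by positivity
  have hbr : |1 / 2 * D ^ 2 + 1 / 2 * (k * (κ * wy x)) ^ 2 * m
      + al p * (al p + 1) / 2 * (k * w x) ^ 2 - k ^ 2 * κ ^ 2 * v x - g * (k * w x * D)|
      ≤ 4 * (ws x ^ 2 + (1 - x ^ 2) * wy x ^ 2)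
      + (al p * (al p + 1) / 2 + 3 * al p ^ 2 + 1) * w x ^ 2 + |v x| := by
    have h1 := abs_le.1 hV
    have h2 := abs_le.1 hK
    have h3 := sq_nonneg D
    have h4 := sq_nonneg (w x)
    have h5 := sq_nonneg (ws x)
    rw [abs_le]
    constructor <;> linarith
  exact mul_le_mul hbr hrle hr.le ((abs_nonneg _).trans hbr)

section

variable {p q M B δ b₀ : ℝ} {d : ℕ} {β f : ℝ → ℝ} {G : ℝ → ℝ → ℝ → ℝ → ℝ}
  {T : ℝ → ℝ} {U UX Ut : ℝ → ℝ → ℝ} {X₀ T₀ σ : ℝ}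

/-- In the variable `x = e^(s-s') y` of the upper vertex, `w` and its derivatives are evaluated at a
point independent of the lowering. The dependence on it sits in explicit coefficients and in the
interval of integration, which invites dominated convergence. -/
lemma energyAt_shift (hp : 1 < p) {T₁ s s' γ : ℝ} (hss : s ≤ s')
    (h : T₁ - Real.exp (-s') = T₀ - Real.exp (-s)) :
    energyAt p γ β f U UX Ut X₀ T₁ s' = (Real.exp (s - s'))⁻¹ * ∫ x in Ioo (-1) 1,
      (Ioo (-Real.exp (s - s')) (Real.exp (s - s'))).indicator
        (shiftDensity p γ s (simW p X₀ T₀ U s) (simWy p X₀ T₀ UX s) (simWs p X₀ T₀ U UX Ut s)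
          (simV p β f U X₀ T₀ s) (s - s')) x := by
  set κ := Real.exp (s - s') with hκ
  have hκ0 : 0 < κ := Real.exp_pos _
  have hκ1 : κ ≤ 1 := Real.exp_le_one_iff.2 (by linarith)
  have hinv : κ * Real.exp (-(s - s')) = 1 := by rw [hκ, ← Real.exp_add]; simp
  set Φ := shiftDensity p γ s (simW p X₀ T₀ U s) (simWy p X₀ T₀ UX s) (simWs p X₀ T₀ U UX Ut s)
    (simV p β f U X₀ T₀ s) (s - s') with hΦ
  have h1 (y : ℝ) : energyDensity p γ (simW p X₀ T₁ U) (simWy p X₀ T₁ UX)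
      (simWs p X₀ T₁ U UX Ut) (simV p β f U X₀ T₁) s' y * rho p y = Φ (κ * y) := by
    have hy : κ * y * Real.exp (-(s - s')) = y := by linear_combination y * hinv
    simp only [energyDensity, hΦ, shiftDensity, hy, simW_shift h, simWy_shift hp h,
      simWs_shift hp h, simV_shift h, sub_sub_cancel, ← hκ]
  have h2 : (Ioo (-1 : ℝ) 1).indicator (fun y => Φ (κ * y))
      = fun y => (Ioo (-κ) κ).indicator Φ (κ * y) := by
    ext y
    have hiff : y ∈ Ioo (-1 : ℝ) 1 ↔ κ * y ∈ Ioo (-κ) κ := by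
      constructor
      · intro hy; constructor <;> nlinarith [hy.1, hy.2]
      · intro hy; constructor <;> nlinarith [hy.1, hy.2]
    by_cases hy : y ∈ Ioo (-1 : ℝ) 1
    · rw [indicator_of_mem hy, indicator_of_mem (hiff.1 hy)]
    · rw [indicator_of_notMem hy, indicator_of_notMem (fun hh => hy (hiff.2 hh))]
  have h3 : (Ioo (-1 : ℝ) 1).indicator ((Ioo (-κ) κ).indicator Φ) = (Ioo (-κ) κ).indicator Φ := by
    rw [indicator_indicator, inter_eq_right.2]
    exact Ioo_subset_Ioo (by linarith) hκ1
  rw [energyAt]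
  simp only [h1]
  rw [← integral_indicator measurableSet_Ioo, h2, Measure.integral_comp_mul_left,
    abs_of_pos (inv_pos.2 hκ0), smul_eq_mul, ← integral_indicator measurableSet_Ioo, h3]

/-- The energy is continuous with respect to the vertex. -/
lemma tendsto_energyAt (hp : 1 < p) (hq : 0 ≤ q) (hqp : q < p) (hM : 0 ≤ M)
    (hc : AdmissibleCoeffs q M β f G) (hS : IsSolution p d β f G T U UX Ut)
    (hv : IsVertex T X₀ T₀ σ) (hσ : 0 ≤ σ)
    (hE : FiniteEnergy p σ (simW p X₀ T₀ U) (simWy p X₀ T₀ UX) (simWs p X₀ T₀ U UX Ut))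
    {γ s : ℝ} (hγ : 0 ≤ γ) (hs : σ ≤ s) :
    Tendsto (fun l => energyAt p γ β f U UX Ut X₀ (T₀ - Real.exp (-s) + Real.exp (-(s - l)))
      (s - l)) (𝓝[<] 0) (𝓝 (energyAt p γ β f U UX Ut X₀ T₀ s)) := by
  have hev := hS.evolution hp hq hqp hM hc hv hσ hE
  set Φ := shiftDensity p γ s (simW p X₀ T₀ U s) (simWy p X₀ T₀ UX s) (simWs p X₀ T₀ U UX Ut s)
    (simV p β f U X₀ T₀ s) with hΦ
  have h0 : energyAt p γ β f U UX Ut X₀ T₀ s = ∫ x in Ioo (-1) 1, Φ 0 x := by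
    simp only [hΦ, shiftDensity_zero]; rfl
  have key : Tendsto (fun l => ∫ x in Ioo (-1) 1,
      (Ioo (-Real.exp l) (Real.exp l)).indicator (Φ l) x) (𝓝[<] 0)
      (𝓝 (∫ x in Ioo (-1) 1, Φ 0 x)) := by
    refine tendsto_integral_filter_of_dominated_convergence
      (fun x => (4 * (simWs p X₀ T₀ U UX Ut s x ^ 2 + (1 - x ^ 2) * simWy p X₀ T₀ UX s x ^ 2)
        + (al p * (al p + 1) / 2 + 3 * al p ^ 2 + 1) * simW p X₀ T₀ U s x ^ 2
        + |simV p β f U X₀ T₀ s x|) * rho p x) ?_ ?_ ?_ ?_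
    · refine Eventually.of_forall fun l => AEStronglyMeasurable.indicator ?_ measurableSet_Ioo
      obtain ⟨m2, m3⟩ := hS.slice_simWs hv hs
      have m1 := (hE.slice_w hs).aestronglyMeasurable (μ := volume) measurableSet_Ioo
      have m4 := (hev.slice_v s hs).aestronglyMeasurable (μ := volume) measurableSet_Ioo
      have mr : AEStronglyMeasurable (fun x => rho p (x * Real.exp (-l)))
          (volume.restrict (Ioo (-1) 1)) :=
        ((continuous_rho hp).comp (by fun_prop : Continuous fun x : ℝ =>
          x * Real.exp (-l))).aestronglyMeasurable
      have mD : AEStronglyMeasurable (fun x => Real.exp (al p * l) * (Real.exp l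
          * simWs p X₀ T₀ U UX Ut s x - (1 - Real.exp l) * (al p * simW p X₀ T₀ U s x
          + x * simWy p X₀ T₀ UX s x))) (volume.restrict (Ioo (-1) 1)) :=
        ((m3.const_mul _).sub (((m1.const_mul _).add
          (continuous_id.aestronglyMeasurable.mul m2)).const_mul _)).const_mul _
      have mB := (((m2.const_mul (Real.exp l)).const_mul (Real.exp (al p * l))).pow 2).const_mul
        (1 / 2)
      have mm : AEStronglyMeasurable (fun x : ℝ => 1 - (x * Real.exp (-l)) ^ 2)
          (volume.restrict (Ioo (-1) 1)) :=
        (by fun_prop : Continuous fun x : ℝ => 1 - (x * Real.exp (-l)) ^ 2).aestronglyMeasurable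
      have mA := m1.const_mul (Real.exp (al p * l))
      exact ((((((mD.pow 2).const_mul (1 / 2)).add (mB.mul mm)).add
        ((mA.pow 2).const_mul (al p * (al p + 1) / 2))).sub
        (m4.const_mul (Real.exp (al p * l) ^ 2 * Real.exp l ^ 2))).sub
        ((mA.mul mD).const_mul (Real.exp (-γ * (s - l))))).mul mr
    · filter_upwards [self_mem_nhdsWithin] with l hl
      filter_upwards [ae_restrict_mem measurableSet_Ioo] with x hx
      have hr := rho_pos (p := p) hx
      have hm := one_sub_sq_pos hx
      have ha := al_pos hp
      by_cases hxl : x ∈ Ioo (-Real.exp l) (Real.exp l)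
      · rw [indicator_of_mem hxl]
        exact abs_shiftDensity_le hp hγ (hσ.trans hs) (le_of_lt hl) hxl
      · rw [indicator_of_notMem hxl, norm_zero]
        positivity
    · have hV : IntegrableOn (fun y => |simV p β f U X₀ T₀ s y| * rho p y) (Ioo (-1) 1) := by
        refine IntegrableOn.congr_fun (hev.integrableOn_v hp hs).abs (fun y hy => ?_)
          measurableSet_Ioo
        simp only [abs_mul, abs_of_pos (rho_pos (p := p) hy)]
      refine (((((hE.int_ws s hs).add (hE.int_wy s hs)).const_mul 4).add
        ((hE.int_w s hs).const_mul (al p * (al p + 1) / 2 + 3 * al p ^ 2 + 1))).add hV).congr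
        (ae_of_all _ fun x => ?_)
      simp only [Pi.add_apply]
      ring
    · filter_upwards [ae_restrict_mem measurableSet_Ioo] with x hx
      have hΦc : Tendsto (fun l => Φ l x) (𝓝[<] 0) (𝓝 (Φ 0 x)) :=
        ((continuous_shiftDensity hp _ _ _ _ _ _ x).tendsto 0).mono_left nhdsWithin_le_nhds
      refine hΦc.congr' ?_
      have hexp : Tendsto (fun l : ℝ => Real.exp l) (𝓝[<] 0) (𝓝 1) := by
        have := (Real.continuous_exp.tendsto 0).mono_left (nhdsWithin_le_nhds (s := Iio 0))
        rwa [Real.exp_zero] at this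
      filter_upwards [hexp.eventually (lt_mem_nhds (abs_lt.2 hx))] with l hl
      exact (indicator_of_mem (mem_Ioo.2 (abs_lt.1 hl)) _).symm
  have hinv : Tendsto (fun l : ℝ => (Real.exp l)⁻¹) (𝓝[<] 0) (𝓝 1) := by
    have : Continuous fun l : ℝ => (Real.exp l)⁻¹ :=
      Real.continuous_exp.inv₀ fun l => (Real.exp_pos l).ne'
    have := (this.tendsto 0).mono_left (nhdsWithin_le_nhds (s := Iio 0))
    rwa [Real.exp_zero, inv_one] at this
  rw [h0, ← one_mul (∫ x in Ioo (-1) 1, Φ 0 x)]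
  refine (hinv.mul key).congr' ?_
  filter_upwards [self_mem_nhdsWithin] with l hl
  have h := energyAt_shift (β := β) (f := f) (U := U) (UX := UX) (Ut := Ut) (X₀ := X₀) (γ := γ)
    (T₀ := T₀) (T₁ := T₀ - Real.exp (-s) + Real.exp (-(s - l))) (s := s) (s' := s - l) hp
    (by linarith [show l < 0 from hl]) (by ring)
  rw [h, sub_sub_cancel]

/-- The Lyapunov functional is nonnegative. -/
theorem IsSolution.lyapunov_nonneg (hp : 1 < p) (hq : 0 ≤ q) (hqp : q < p) (hM : 0 ≤ M)
    (hc : AdmissibleCoeffs q M β f G) (hS : IsSolution p d β f G T U UX Ut)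
    (hv : IsVertex T X₀ T₀ σ) (hl : IsLate p q M B δ d β X₀ σ)
    (hE : FiniteEnergy p σ (simW p X₀ T₀ U) (simWy p X₀ T₀ UX) (simWs p X₀ T₀ U UX Ut))
    (hb : b₀ ≤ β X₀) (hδ : 0 < δ) (hδ1 : δ ≤ 1)
    (hδκ : errSize p M * δ * hardyConst p ≤ kap p b₀) {μ : ℝ}
    (hμ : Real.exp ((p + 3) / (2 * gam p q)) * errSize p M / gam p q ≤ μ) {s : ℝ} (hs : σ ≤ s) :
    0 ≤ lyapunovAt p (gam p q) μ β f U UX Ut X₀ T₀ s := by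
  have hγ := gam_pos hp hqp
  -- For `l < 0` the vertex with time `T₀ - e^(-s) + e^(-(s-l))` lies strictly below `T₀`, and its
  -- similarity time `s - l` stands for the same physical time as `s`. Nonnegativity passes to the
  -- limit as `l` increases to zero.
  have hlim : Tendsto (fun l => lyapunovAt p (gam p q) μ β f U UX Ut X₀
      (T₀ - Real.exp (-s) + Real.exp (-(s - l))) (s - l)) (𝓝[<] 0)
      (𝓝 (lyapunovAt p (gam p q) μ β f U UX Ut X₀ T₀ s)) := by
    have h1 := tendsto_energyAt hp hq hqp hM hc hS hv hl.nonneg hE hγ.le hs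
    have hcont {F : ℝ → ℝ} (hF : Continuous F) :
        Tendsto (fun l => F (s - l)) (𝓝[<] 0) (𝓝 (F s)) := by
      have hF' : Continuous fun l => F (s - l) := by fun_prop
      have := (hF'.tendsto 0).mono_left (nhdsWithin_le_nhds (s := Iio 0))
      simpa only [sub_zero] using this
    exact (h1.mul (hcont (F := fun s => Real.exp ((p + 3) / (2 * gam p q)
      * Real.exp (-gam p q * s))) (by fun_prop))).add
      (hcont (F := fun s => μ * Real.exp (-2 * gam p q * s)) (by fun_prop))
  refine ge_of_tendsto hlim ?_
  filter_upwards [self_mem_nhdsWithin] with l hl0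
  have hl0' : l < 0 := hl0
  have hlt : Real.exp (-(s - l)) < Real.exp (-s) := Real.exp_lt_exp.2 (by linarith)
  have hse : Real.exp (-s) ≤ Real.exp (-σ) := Real.exp_le_exp.2 (neg_le_neg hs)
  have hv' : IsVertex T X₀ (T₀ - Real.exp (-s) + Real.exp (-(s - l))) (s - l) :=
    ⟨hv.T_pos, hv.lip, hv.X_pos, by linarith [hv.T₀_le], by linarith [hv.exp_le_T₀],
      by linarith [hv.exp_le_X₀]⟩
  exact hS.lyapunov_nonneg_of_lt hp hq hqp hM hc hv' (by linarith [hv.T₀_le])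
    (hl.mono hp hqp hM (by linarith))
    ((hE.mono hs).shift hp hS hv' (by linarith) (by linarith)) hb hδ hδ1 hδκ hμ

end

/-! ## Identification of the functionals -/

lemma startTime_le {X₀ T₀ S : ℝ} : -Real.log T₀ ≤ startTime X₀ T₀ S ∧ S ≤ startTime X₀ T₀ S ∧
    -4 * Real.log X₀ ≤ startTime X₀ T₀ S ∧ -Real.log (X₀ / 2) ≤ startTime X₀ T₀ S :=
  ⟨(le_max_left _ _).trans (le_max_left _ _), (le_max_right _ _).trans (le_max_left _ _),
    (le_max_left _ _).trans (le_max_right _ _), (le_max_right _ _).trans (le_max_right _ _)⟩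

lemma exp_neg_le_of_neg_log_le {a σ : ℝ} (ha : 0 < a) (h : -Real.log a ≤ σ) :
    Real.exp (-σ) ≤ a := by
  rw [← Real.le_log_iff_exp_le ha]; linarith

lemma al_mul_al_add_one {p : ℝ} (hp : 1 < p) : (p + 1) / (p - 1) ^ 2 = al p * (al p + 1) / 2 := by
  have : p - 1 ≠ 0 := by linarith
  rw [← al_add_one hp, al]
  field_simp

lemma densityE₀_eq {p : ℝ} (hp : 1 < p) (b : ℝ) (w wy ws : ℝ → ℝ) :
    densityE₀ p b w wy ws = fun y => (1 / 2 * ws y ^ 2 + 1 / 2 * wy y ^ 2 * (1 - y ^ 2)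
      + al p * (al p + 1) / 2 * w y ^ 2 - b / (p + 1) * |w y| ^ (p + 1)) * rho p y := by
  ext y
  rw [densityE₀, al_mul_al_add_one hp]

section

variable {p q M B δ : ℝ} {d : ℕ} {β f : ℝ → ℝ} {G : ℝ → ℝ → ℝ → ℝ → ℝ}
  {T : ℝ → ℝ} {U UX Ut : ℝ → ℝ → ℝ} {X₀ T₀ σ : ℝ}

/-- The integrals in `E` converge, and `E` is the integral of a single density. -/
theorem energyConverges_and_pathE_eq (hp : 1 < p) (hq : 0 ≤ q) (hqp : q < p) (hM : 0 ≤ M)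
    (hc : AdmissibleCoeffs q M β f G) (hS : IsSolution p d β f G T U UX Ut)
    (hv : IsVertex T X₀ (T X₀) σ) (hl : IsLate p q M B δ d β X₀ σ)
    (hE : FiniteEnergy p σ (simW p X₀ (T X₀) U) (simWy p X₀ (T X₀) UX)
      (simWs p X₀ (T X₀) U UX Ut)) {s : ℝ} (hs : σ ≤ s) :
    EnergyConverges p β f T U UX Ut X₀ s ∧
      pathE p q β f T U UX Ut X₀ s = energyAt p (gam p q) β f U UX Ut X₀ (T X₀) s := by
  have hev := hS.evolution hp hq hqp hM hc hv hl.nonneg hE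
  set w := simW p X₀ (T X₀) U s with hw
  set c := Real.exp (-al p * s) ^ 2 * Real.exp (-s) ^ 2 with hcdef
  have hc0 : 0 < c := by positivity
  have hp1 : p + 1 ≠ 0 := by linarith
  have i1 : IntegrableOn (fun y => |w y| ^ (p + 1) * rho p y) (Ioo (-1) 1) :=
    hE.integrableOn_rpow hp hs
  have i2 : IntegrableOn (densityE₀ p (β X₀) w (simWy p X₀ (T X₀) UX s)
      (simWs p X₀ (T X₀) U UX Ut s)) (Ioo (-1) 1) := by
    rw [densityE₀_eq hp]
    exact hev.integrableOn_unperturbed hp hs (β X₀)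
  have i4 : IntegrableOn (densityJ p X₀ β w s) (Ioo (-1) 1) := by
    have hβ : AEStronglyMeasurable (fun y => β (X₀ + y * Real.exp (-s)) - β X₀)
        (volume.restrict (Ioo (-1) 1)) :=
      (((continuousOn_beta_sim hc hv).1.comp
        (by fun_prop : Continuous fun y : ℝ => (y, s)).continuousOn
        fun y hy => ⟨hy, hs⟩).sub continuousOn_const).aestronglyMeasurable measurableSet_Ioo
    have h := Integrable.bdd_mul (c := B * 1) i1 hβ (by
      filter_upwards [ae_restrict_mem measurableSet_Ioo] with y hy
      have h1 := (abs_mul_exp_lt (s := s) hy).le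
      have h2 : Real.exp (-s) ≤ 1 := exp_neg_le_one (hl.nonneg.trans hs)
      have h3 : |X₀ + y * Real.exp (-s) - X₀| ≤ min 1 (X₀ / 2) := by
        rw [add_sub_cancel_left]
        exact h1.trans (le_min h2 (hv.exp_le hs))
      exact (abs_beta_sub_le hc hv.X_pos hl.deriv_le h3).trans
        (mul_le_mul_of_nonneg_left (h3.trans (min_le_left _ _)) hl.bound_nonneg))
    exact h.congr (ae_of_all _ fun y => by simp only [densityJ, mul_assoc])
  have i5 : IntegrableOn (densityK p w (simWs p X₀ (T X₀) U UX Ut s)) (Ioo (-1) 1) :=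
    hE.integrableOn_w_ws hs
  have hu (y : ℝ) : Real.exp (2 / (p - 1) * s) * w y
      = U (X₀ + y * Real.exp (-s)) (T X₀ - Real.exp (-s)) := by
    rw [hw, simW_eq, ← mul_assoc, ← Real.exp_add, al]
    simp [simMap]
  -- The rescaled potential is the sum of the power term of `E₀` and the densities of `I` and `J`,
  -- up to sign. Hence the integrability of the part with `f` is inherited from the others.
  have hI (y : ℝ) : c * densityI p f w s y = simV p β f U X₀ (T X₀) s y * rho p y
      - β X₀ / (p + 1) * (|w y| ^ (p + 1) * rho p y) - 1 / (p + 1) * densityJ p X₀ β w s y := by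
    rw [densityI, densityJ, hu, simV_eq hp, ← hw, ← hcdef]
    field_simp
    ring
  have i3 : IntegrableOn (densityI p f w s) (Ioo (-1) 1) := by
    have h := ((((hev.integrableOn_v hp hs).sub (i1.const_mul (β X₀ / (p + 1)))).sub
      (i4.const_mul (1 / (p + 1)))).const_mul c⁻¹)
    refine h.congr (ae_of_all _ fun y => ?_)
    simp only [Pi.sub_apply]
    rw [← hI, inv_mul_cancel_left₀ hc0.ne']
  refine ⟨⟨i1, i2, i3, i4, i5⟩, ?_⟩
  have hcexp : Real.exp (-(2 * (p + 1) / (p - 1)) * s) = c := by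
    rw [hcdef, mul_div_assoc, al_add_one hp, exp_mul_two, ← mul_pow, ← Real.exp_add]
    congr 2
    ring
  have hsum (y : ℝ) : energyDensity p (gam p q) (simW p X₀ (T X₀) U) (simWy p X₀ (T X₀) UX)
      (simWs p X₀ (T X₀) U UX Ut) (simV p β f U X₀ (T X₀)) s y * rho p y
      = densityE₀ p (β X₀) w (simWy p X₀ (T X₀) UX s) (simWs p X₀ (T X₀) U UX Ut s) y
        + -c * densityI p f w s y + -(1 / (p + 1)) * densityJ p X₀ β w s y
        + -Real.exp (-gam p q * s) * densityK p w (simWs p X₀ (T X₀) U UX Ut s) y := by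
    rw [neg_mul c, hI, densityE₀_eq hp, energyDensity, densityK]
    ring
  have i23 : IntegrableOn (fun y => densityE₀ p (β X₀) w (simWy p X₀ (T X₀) UX s)
      (simWs p X₀ (T X₀) U UX Ut s) y + -c * densityI p f w s y) (Ioo (-1) 1) :=
    i2.add (i3.const_mul _)
  have i234 : IntegrableOn (fun y => densityE₀ p (β X₀) w (simWy p X₀ (T X₀) UX s)
      (simWs p X₀ (T X₀) U UX Ut s) y + -c * densityI p f w s y
      + -(1 / (p + 1)) * densityJ p X₀ β w s y) (Ioo (-1) 1) :=
    i23.add (i4.const_mul _)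
  rw [pathE, funE, funE₀, funI, funJ, funK, energyAt, hcexp]
  simp only [hsum]
  rw [integral_add i234 (i5.const_mul _), integral_add i23 (i4.const_mul _),
    integral_add i2 (i3.const_mul _), integral_const_mul, integral_const_mul, integral_const_mul]

lemma exists_small (p M b₀ : ℝ) (hp : 1 < p) (hM : 0 ≤ M) (hb : 0 < b₀) :
    ∃ δ, 0 < δ ∧ δ ≤ 1 ∧ errSize p M * δ * hardyConst p ≤ kap p b₀ := by
  have h1 := errSize_pos hp hM
  have h2 := hardyConst_pos hp
  refine ⟨min 1 (kap p b₀ / (errSize p M * hardyConst p)), lt_min one_pos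
    (div_pos (kap_pos hp hb) (by positivity)), min_le_left _ _, ?_⟩
  have h3 : min 1 (kap p b₀ / (errSize p M * hardyConst p))
      ≤ kap p b₀ / (errSize p M * hardyConst p) := min_le_right _ _
  rw [le_div_iff₀ (by positivity)] at h3
  linarith

lemma exists_time {γ δ : ℝ} (hγ : 0 < γ) (hδ : 0 < δ) (L : ℝ) :
    ∃ S, 0 ≤ S ∧ Real.exp (-γ * S) ≤ δ ^ 2 ∧ Real.exp (-S / 4) * L ≤ δ := by
  have h1 : Tendsto (fun S : ℝ => Real.exp (-γ * S)) atTop (𝓝 0) :=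
    Real.tendsto_exp_atBot.comp (tendsto_id.const_mul_atTop_of_neg (by linarith))
  have h2 : Tendsto (fun S : ℝ => Real.exp (-S / 4) * L) atTop (𝓝 0) := by
    have h3 : Tendsto (fun S : ℝ => Real.exp (-(1 / 4) * S)) atTop (𝓝 0) :=
      Real.tendsto_exp_atBot.comp (tendsto_id.const_mul_atTop_of_neg (by norm_num))
    have h4 := h3.mul_const L
    rw [zero_mul] at h4
    refine h4.congr fun S => ?_
    congr 2
    ring
  obtain ⟨S, hS0, hS1, hS2⟩ := ((eventually_ge_atTop (0 : ℝ)).and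
    ((h1.eventually (ge_mem_nhds (by positivity : 0 < δ ^ 2))).and
      (h2.eventually (ge_mem_nhds hδ)))).exists
  exact ⟨S, hS0, hS1, hS2⟩

end

end SimilarityEnergy

end

open SimilarityEnergy MeasureTheory Set in
theorem mainTheorem6 (p M : ℝ) (hp : 1 < p) (hM : 0 < M) :
    ∃ C : ℝ, 0 < C ∧ ∀ q : ℝ, 0 ≤ q → q < p →
    ∃ μ₀ : ℝ, 0 < μ₀ ∧
    ∀ d : ℕ, 1 ≤ d → (2 ≤ d → p < ((d : ℝ) + 3) / ((d : ℝ) - 1)) →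
    ∀ b₀ B : ℝ, 0 < b₀ → 0 < B →
    ∃ S₀ S₁ : ℝ,
    ∀ (β f : ℝ → ℝ) (G : ℝ → ℝ → ℝ → ℝ → ℝ) (T : ℝ → ℝ) (U UX Ut : ℝ → ℝ → ℝ) (X₀ : ℝ),
      AdmissibleCoeffs q M β f G →
      (∀ X, 0 < X → 0 < T X) → LipschitzOnWith 1 T (Ioi 0) →
      IsSolution p d β f G T U UX Ut →
      0 < X₀ → b₀ ≤ β X₀ → (∀ X, |X - X₀| ≤ min 1 (X₀ / 2) → |deriv β X| ≤ B) →
      IsEnergyTrajectory p (max (-Real.log (T X₀)) (-Real.log (X₀ / 2)))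
        (simW p X₀ (T X₀) U) (simWy p X₀ (T X₀) UX) (simWs p X₀ (T X₀) U UX Ut) →
      ((∀ s, startTime X₀ (T X₀) S₀ ≤ s →
          EnergyConverges p β f T U UX Ut X₀ s ∧
          AbsolutelyContinuousOnInterval (pathE p q β f T U UX Ut X₀)
            (startTime X₀ (T X₀) S₀) s) ∧
        (∀ᵐ s : ℝ, startTime X₀ (T X₀) S₀ < s →
          DissipFinite p T U UX Ut X₀ s ∧
          ∃ E' : ℝ, HasDerivAt (pathE p q β f T U UX Ut X₀) E' s ∧
            E' ≤ (p + 3) / 2 * Real.exp (-gam p q * s) * pathE₀ p β T U UX Ut X₀ s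
              - 3 / (p - 1) * pathDissip p T U UX Ut X₀ s
              + C * Real.exp (-2 * gam p q * s))) ∧
      (∀ μ, μ₀ ≤ μ →
        (∀ s, startTime X₀ (T X₀) S₁ ≤ s →
          EnergyConverges p β f T U UX Ut X₀ s ∧
          0 ≤ pathH p q μ β f T U UX Ut X₀ s ∧
          AbsolutelyContinuousOnInterval (pathH p q μ β f T U UX Ut X₀)
            (startTime X₀ (T X₀) S₁) s) ∧
        AntitoneOn (pathH p q μ β f T U UX Ut X₀) (Ici (startTime X₀ (T X₀) S₁)) ∧
        (∀ᵐ s : ℝ, startTime X₀ (T X₀) S₁ < s →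
          DissipFinite p T U UX Ut X₀ s ∧
          ∃ H' : ℝ, HasDerivAt (pathH p q μ β f T U UX Ut X₀) H' s ∧
            H' ≤ -(3 / (p - 1)) * pathDissip p T U UX Ut X₀ s)) := by
  have herr := errSize_pos hp hM.le
  -- The constant must be fixed before `q` and `d`: their influence is confined to `γ`, to `μ₀` and
  -- to the time after which the perturbations are small.
  refine ⟨2 * errSize p M, by positivity, fun q hq hqp => ?_⟩
  have hγ := gam_pos hp hqp
  refine ⟨Real.exp ((p + 3) / (2 * gam p q)) * errSize p M / gam p q, by positivity,
    fun d _ _ b₀ B hb₀ hB => ?_⟩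
  obtain ⟨δ, hδ, hδ1, hδκ⟩ := exists_small p M b₀ hp hM.le hb₀
  obtain ⟨S, hS0, hS1, hS2⟩ := exists_time hγ hδ (perturbSize p M B d)
  -- A single time serves both parts: the inequality with `E₀` and the one with `E` hold under the
  -- same smallness conditions, and the sign of `H` requires no later time.
  refine ⟨S, S, fun β f G T U UX Ut X₀ hc hTpos hTlip hS hX₀ hb hβ' htr => ?_⟩
  obtain ⟨t1, t2, t3, t4⟩ := startTime_le (X₀ := X₀) (T₀ := T X₀) (S := S)
  set σ := startTime X₀ (T X₀) S
  have hv : IsVertex T X₀ (T X₀) σ := ⟨hTpos, hTlip, hX₀, le_rfl,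
    exp_neg_le_of_neg_log_le (hTpos X₀ hX₀) t1, exp_neg_le_of_neg_log_le (half_pos hX₀) t4⟩
  have hl : IsLate p q M B δ d β X₀ σ :=
    { nonneg := hS0.trans t2
      log_le := t3
      exp_gam_le := (Real.exp_le_exp.2 (by nlinarith)).trans hS1
      exp_mul_le := by
        refine le_trans (mul_le_mul_of_nonneg_right (Real.exp_le_exp.2 (by linarith)) ?_) hS2
        have := al_pos hp
        unfold perturbSize
        positivity
      bound_nonneg := hB.le
      deriv_le := hβ' }
  obtain ⟨hint, hbd⟩ := htr.integrals
  have hσ : max (-Real.log (T X₀)) (-Real.log (X₀ / 2)) ≤ σ := max_le t1 t4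
  have hE : FiniteEnergy p σ (simW p X₀ (T X₀) U) (simWy p X₀ (T X₀) UX)
      (simWs p X₀ (T X₀) U UX Ut) :=
    hS.finiteEnergy hp hv (fun s hs => hint s (hσ.trans hs)) fun R => by
      obtain ⟨K, hK⟩ := hbd R
      exact ⟨K, fun s hs => hK s ⟨hσ.trans hs.1, hs.2⟩⟩
  have hEC (s : ℝ) (hs : σ ≤ s) :=
    energyConverges_and_pathE_eq hp hq hqp hM.le hc hS hv hl hE hs
  have hH (μ s : ℝ) (hs : σ ≤ s) : pathH p q μ β f T U UX Ut X₀ s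
      = lyapunovAt p (gam p q) μ β f U UX Ut X₀ (T X₀) s := by
    rw [pathH, funH, lyapunovAt, ← (hEC s hs).2, pathE]
  have hk : 3 / (p - 1) = 3 * al p / 2 := by rw [al]; ring
  obtain ⟨Q, hQ, hrate⟩ := hS.exists_rate hp hq hqp hM.le hc hv hl hE hb hδ hδ1 hδκ
  have hac {F F' : ℝ → ℝ} (hF : ∀ s, σ ≤ s → F' s = F s) {s : ℝ} (hs : σ ≤ s)
      (h : AbsolutelyContinuousOnInterval F σ s) : AbsolutelyContinuousOnInterval F' σ s :=
    h.congr fun x hx => hF x (by rw [uIcc_of_le hs] at hx; exact hx.1)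
  have hder {F F' : ℝ → ℝ} (hF : ∀ s, σ ≤ s → F' s = F s) {s D : ℝ} (hs : σ < s)
      (h : HasDerivAt F D s) : HasDerivAt F' D s :=
    h.congr_of_eventuallyEq (Filter.eventuallyEq_of_mem (Ioi_mem_nhds hs) fun x hx =>
      hF x (le_of_lt hx))
  have hg2 (s : ℝ) : Real.exp (-2 * gam p q * s) = Real.exp (-gam p q * s) ^ 2 := by
    rw [← Real.exp_nat_mul]; congr 1; push_cast; ring
  refine ⟨⟨fun s hs => ⟨(hEC s hs).1, hac (fun s hs => (hEC s hs).2) hs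
    (hQ.absolutelyContinuous hs)⟩, ?_⟩, fun μ hμ => ?_⟩
  · filter_upwards [hrate, hQ.ae_hasDerivAt] with s h1 h2 hs
    obtain ⟨k1, k2, -⟩ := h1 hs
    refine ⟨k1, Q s, hder (fun s hs => (hEC s hs).2) hs (h2 hs), ?_⟩
    rw [hg2, hk, pathE₀, funE₀, densityE₀_eq hp]
    exact k2
  · obtain ⟨l1, l2, l3⟩ := hS.lyapunov hp hq hqp hM.le hc hv hl hE hb hδ hδ1 hδκ hμ
    refine ⟨fun s hs => ⟨(hEC s hs).1, ?_, hac (hH μ) hs (l1 s hs)⟩, fun a ha b hb' hab => ?_, ?_⟩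
    · rw [hH μ s hs]
      exact hS.lyapunov_nonneg hp hq hqp hM.le hc hv hl hE hb hδ hδ1 hδκ hμ hs
    · rw [hH μ a ha, hH μ b hb']
      exact l2 ha hb' hab
    · filter_upwards [hrate, l3] with s h1 h2 hs
      obtain ⟨H', k1, k2⟩ := h2 hs
      refine ⟨(h1 hs).1, H', hder (hH μ) hs k1, ?_⟩
      rw [hk]
      exact k2
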